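/- Let $d\ge 2$ and let $\Sigma\subset\mathbb R^d$ be a connected embedded $C^2$ hypersurface, compact or non-compact and not necessarily closed; put $\partial\Sigma:=\overline\Sigma\setminus\Sigma$. Let $\Sigma$ be oriented by a unit normal field $N$ that is continuous up to $\overline\Sigma$, and let $\kappa_1,\dots,\kappa_{d-1}$ be its principal curvatures, i.e. the eigenvalues (with multiplicity) of the Weingarten map $-dN$ on the tangent spaces. Assume that they are bounded, $|\kappa_i|\le K$, and that for some $\varepsilon_0>0$ the map $(x,t)\mapsto x+\varepsilon_0 t\,N(x)$ is injective on $\overline\Sigma\times[0,1]$. For $0<\varepsilon\le\varepsilon_0$ let $$\Omega_\varepsilon=\{x+\varepsilon t\,N(x) : x\in\Sigma,\ 0<t<1\},\qquad \Sigma_\varepsilon=\{x+\varepsilon N(x): x\in\Sigma\}.$$ Let $-\Delta_{DN}^{\Omega_\varepsilon}$ be the Laplacian on $L^2(\Omega_\varepsilon)$ with Neumann conditions on $\Sigma_\varepsilon$ and Dirichlet conditions on $\partial\Omega_\varepsilon\setminus\Sigma_\varepsilon$ (that is, on $\Sigma$ and, if $\partial\Sigma\neq\emptyset$, on the remaining part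 of the boundary): the self-adjoint operator of the quadratic form $\int_{\Omega_\varepsilon}|\nabla\psi|^2$ whose domain is the closure in $W^{1,2}(\Omega_\varepsilon)$ of the restrictions of compactly supported $C^1$ functions on $\mathbb R^d$ with support disjoint from $\partial\Omega_\varepsilon\setminus\Sigma_\varepsilon$. Let $$H_\varepsilon=-\Delta_g+\frac{\kappa}{\varepsilon}\quad\text{on } L^2(\Sigma),\qquad \kappa=\kappa_1+\dots+\kappa_{d-1},$$ where $-\Delta_g$ is the Laplace–Beltrami operator of $\Sigma$ for the metric $g$ induced from $\mathbb R^d$, with Dirichlet conditions on $\partial\Sigma$ (form domain $W^{1,2}_0(\Sigma)$, the closure of the $C^1$ functions with compact support in $\Sigma$). For a self-adjoint operator, the $n$-th spectral number is the $n$-th eigenvalue below the essential spectrum, in increasing order and repeated according to multiplicity, if there are at least $n$ such eigenvalues, and the infimum of the essential spectrum otherwise. Let $\lambda_n(\varepsilon)$ and $\mu_n(\varepsilon)$ be the $n$-th spectral numbers of $-\Delta_{DN}^{\Omega_\varepsilon}$ and of $H_\varepsilon$. Then for every $n\ge1$ the numbers $\lambda_n(\varepsilon)$ and $\mu_n(\varepsilon)$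 are finite for all sufficiently small $\varepsilon>0$, and $$\lambda_n(\varepsilon)=\Big(\frac{\pi}{2\varepsilon}\Big)^2+\mu_n(\varepsilon)+\mathcal O(1)\qquad\text{as }\varepsilon\to0,$$ where the constant in $\mathcal O(1)$ depends only on $d$ and $K$: there is $C=C(d,K)$ such that, for every such oriented hypersurface $\Sigma$ and every index $n\ge1$, there is $\varepsilon_1>0$ (which may depend on $\Sigma$, its orientation and $n$) with $\big|\lambda_n(\varepsilon)-(\pi/(2\varepsilon))^2-\mu_n(\varepsilon)\big|\le C$ for all $0<\varepsilon<\varepsilon_1$. -/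

import Mathlib

open MeasureTheory Set
open scoped InnerProductSpace

noncomputable section

/-! ### Spectral numbers of an operator

An (unbounded) operator on a complex Hilbert space `H` is represented by its graph, a linear
subspace of `H × H`: the pair `(ψ, f)` belongs to it iff `ψ` is in the domain and is mapped
to `f`. -/

namespace OperatorGraph

variable {H : Type*} [NormedAddCommGroup H] [InnerProductSpace ℂ H]

/-- The real spectrum: all `z` for which `A - z` is not a bijection from the domain of `A` onto
`H`. (For a closed operator the inverse of such a bijection is automatically bounded, and the
spectrum of a self-adjoint operator is real.) -/
def spectrum (A : Submodule ℂ (H × H)) : Set ℝ :=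
  {z | ¬ ∀ g : H, ∃! ψ : H, (ψ, g + (z : ℂ) • ψ) ∈ A}

/-- The kernel of `A - z`. -/
def eigenspace (A : Submodule ℂ (H × H)) (z : ℝ) : Submodule ℂ H where
  carrier := {ψ | (ψ, (z : ℂ) • ψ) ∈ A}
  add_mem' := by
    intro a b ha hb
    have h := A.add_mem ha hb
    simpa [smul_add] using h
  zero_mem' := by
    have h := A.zero_mem
    simp only [Set.mem_ofPred_eq, smul_zero]
    exact h
  smul_mem' := by
    intro c x hx
    have h := A.smul_mem c hx
    simp only [Set.mem_ofPred_eq, smul_comm (z : ℂ) c x]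
    exact h

/-- The discrete spectrum: eigenvalues of finite multiplicity that are isolated points of the
spectrum. -/
def discreteSpectrum (A : Submodule ℂ (H × H)) : Set ℝ :=
  {z | eigenspace A z ≠ ⊥ ∧ FiniteDimensional ℂ (eigenspace A z) ∧
    ∃ r > 0, ∀ w ∈ spectrum A, |w - z| < r → w = z}

/-- The essential spectrum: the complement of the discrete spectrum in the spectrum. -/
def essentialSpectrum (A : Submodule ℂ (H × H)) : Set ℝ :=
  spectrum A \ discreteSpectrum A

/-- The reals `E` below the essential spectrum for which there are, counted with multiplicity,
at least `n` eigenvalues `≤ E`. -/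
def levels (A : Submodule ℂ (H × H)) (n : ℕ) : Set ℝ :=
  {E | (∀ s ∈ essentialSpectrum A, E < s) ∧
    (n : Cardinal) ≤ Module.rank ℂ (⨆ z : ℝ, ⨆ _ : z ≤ E, eigenspace A z : Submodule ℂ H)}

open Classical in
/-- The `n`-th spectral number (`n = 1, 2, …`): the `n`-th eigenvalue below the essential
spectrum, in increasing order and repeated according to multiplicity, if there are at least `n` of
them, and the infimum of the essential spectrum otherwise. It is an extended real number so that
no junk value can arise (`inf ∅ = ⊤`, and `⊥` if the set is not bounded below). -/
def spectralNumber (A : Submodule ℂ (H × H)) (n : ℕ) : EReal :=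
  if (levels A n).Nonempty then sInf ((fun E : ℝ => (E : EReal)) '' levels A n)
  else sInf ((fun E : ℝ => (E : EReal)) '' essentialSpectrum A)

/-- Let `D` be the graph of a closed operator `∇ : H ⊇ dom ∇ → L`. This is the graph of `∇* ∇`,
the operator associated with the quadratic form `‖∇ψ‖²` on `dom ∇`: `ψ ∈ dom ∇` is mapped to `f`
iff `⟪∇φ, ∇ψ⟫ = ⟪φ, f⟫` for all `φ ∈ dom ∇`. -/
def ofGradient {L : Type*} [NormedAddCommGroup L] [InnerProductSpace ℂ L]
    (D : Submodule ℂ (H × L)) : Submodule ℂ (H × H) where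
  carrier := {p | ∃ F : L, (p.1, F) ∈ D ∧ ∀ q ∈ D, ⟪q.2, F⟫_ℂ = ⟪q.1, p.2⟫_ℂ}
  add_mem' := by
    rintro a b ⟨F, hF, hF'⟩ ⟨G, hG, hG'⟩
    refine ⟨F + G, D.add_mem hF hG, fun q hq => ?_⟩
    rw [inner_add_right, hF' q hq, hG' q hq, Prod.snd_add, inner_add_right]
  zero_mem' := ⟨0, D.zero_mem, fun q _ => by simp⟩
  smul_mem' := by
    rintro c a ⟨F, hF, hF'⟩
    refine ⟨c • F, D.smul_mem c hF, fun q hq => ?_⟩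
    rw [inner_smul_right, hF' q hq, Prod.smul_snd, inner_smul_right]

/-- The graph of `A + V`, where `A` is an operator on `L²(μ)` and `V` is the operator of
multiplication by a bounded real function. -/
def addPotential {X : Type*} [MeasurableSpace X] {μ : Measure X}
    (A : Submodule ℂ (Lp ℂ 2 μ × Lp ℂ 2 μ)) (V : X → ℝ) :
    Submodule ℂ (Lp ℂ 2 μ × Lp ℂ 2 μ) where
  carrier := {p | ∃ g : Lp ℂ 2 μ, (p.1, g) ∈ A ∧ p.2 =ᵐ[μ] fun x => g x + (V x : ℂ) * p.1 x}
  add_mem' := by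
    rintro a b ⟨g, hg, hg'⟩ ⟨k, hk, hk'⟩
    refine ⟨g + k, A.add_mem hg hk, ?_⟩
    filter_upwards [hg', hk', Lp.coeFn_add g k, Lp.coeFn_add a.1 b.1, Lp.coeFn_add a.2 b.2]
      with x h1 h2 h3 h4 h5
    simp only [Prod.fst_add, Prod.snd_add, h3, h4, h5, Pi.add_apply, h1, h2]
    ring
  zero_mem' := by
    refine ⟨0, A.zero_mem, ?_⟩
    filter_upwards [Lp.coeFn_zero ℂ 2 μ] with x h
    simp only [Prod.fst_zero, Prod.snd_zero, h]
    simp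
  smul_mem' := by
    rintro c a ⟨g, hg, hg'⟩
    refine ⟨c • g, A.smul_mem c hg, ?_⟩
    filter_upwards [hg', Lp.coeFn_smul c g, Lp.coeFn_smul c a.1, Lp.coeFn_smul c a.2]
      with x h1 h2 h3 h4
    simp only [Prod.smul_fst, Prod.smul_snd, h2, h3, h4, Pi.smul_apply, h1, smul_eq_mul]
    ring

end OperatorGraph

namespace Tube

variable {d : ℕ}

/-! ### Hypersurfaces and their curvature -/

/-- `S` is an embedded `C²` hypersurface of `ℝ^d` (not necessarily closed): near each of its points
it is the zero set of a `C²` function without critical points. -/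
def IsC2Hypersurface (S : Set (EuclideanSpace ℝ (Fin d))) : Prop :=
  ∀ x ∈ S, ∃ (U : Set (EuclideanSpace ℝ (Fin d))) (f : EuclideanSpace ℝ (Fin d) → ℝ),
    IsOpen U ∧ x ∈ U ∧ ContDiffOn ℝ 2 f U ∧ (∀ y ∈ U, fderiv ℝ f y ≠ 0) ∧
      S ∩ U = {y ∈ U | f y = 0}

/-- `N` restricts to a unit normal vector field on `S`, continuous up to the closure of `S`.
(At a point of a `C¹` hypersurface the tangent cone is the tangent space.) -/
def IsUnitNormalField (S : Set (EuclideanSpace ℝ (Fin d)))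
    (N : EuclideanSpace ℝ (Fin d) → EuclideanSpace ℝ (Fin d)) : Prop :=
  ContinuousOn N (closure S) ∧ (∀ x ∈ S, ‖N x‖ = 1) ∧
    ∀ x ∈ S, ∀ v ∈ tangentConeAt ℝ S x, ⟪v, N x⟫_ℝ = 0

/-- The tangent space of `S` at `x`, the orthogonal complement of the normal `N x`. -/
def tangentSpace (N : EuclideanSpace ℝ (Fin d) → EuclideanSpace ℝ (Fin d))
    (x : EuclideanSpace ℝ (Fin d)) : Submodule ℝ (EuclideanSpace ℝ (Fin d)) :=
  (ℝ ∙ N x)ᗮ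

/-- The Weingarten map `v ↦ -dN(v)` of `S` at `x`, an endomorphism of the tangent space. Although
the derivative of `N` within `S` is not unique as a linear map on `ℝ^d`, its values on tangent
vectors are, and these are tangent (so that the projection only serves to record this). -/
def weingarten (S : Set (EuclideanSpace ℝ (Fin d)))
    (N : EuclideanSpace ℝ (Fin d) → EuclideanSpace ℝ (Fin d)) (x : EuclideanSpace ℝ (Fin d)) :
    tangentSpace N x →ₗ[ℝ] tangentSpace N x :=
  -((tangentSpace N x).orthogonalProjectionOnto.toLinearMap ∘ₗ
    (fderivWithin ℝ N S x).toLinearMap ∘ₗ (tangentSpace N x).subtype)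

/-- The principal curvatures of `S` at `x` with respect to `N`: the eigenvalues of the Weingarten
map, with multiplicity. The sign is such that the sphere has positive principal curvatures
for the inward normal. -/
def principalCurvatures (S : Set (EuclideanSpace ℝ (Fin d)))
    (N : EuclideanSpace ℝ (Fin d) → EuclideanSpace ℝ (Fin d)) (x : EuclideanSpace ℝ (Fin d)) :
    Multiset ℝ :=
  (weingarten S N x).charpoly.roots

/-- The sum of the principal curvatures. -/
def totalCurvature (S : Set (EuclideanSpace ℝ (Fin d)))
    (N : EuclideanSpace ℝ (Fin d) → EuclideanSpace ℝ (Fin d)) (x : EuclideanSpace ℝ (Fin d)) : ℝ :=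
  (principalCurvatures S N x).sum

/-! ### Tubular neighbourhoods -/

/-- The map `(x, t) ↦ x + ε t N(x)`. -/
def tubeMap (N : EuclideanSpace ℝ (Fin d) → EuclideanSpace ℝ (Fin d)) (ε : ℝ)
    (p : EuclideanSpace ℝ (Fin d) × ℝ) : EuclideanSpace ℝ (Fin d) :=
  p.1 + (ε * p.2) • N p.1

/-- The tubular neighbourhood `Ω_ε`, the image of `S × (0, 1)`. -/
def tube (S : Set (EuclideanSpace ℝ (Fin d)))
    (N : EuclideanSpace ℝ (Fin d) → EuclideanSpace ℝ (Fin d)) (ε : ℝ) :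
    Set (EuclideanSpace ℝ (Fin d)) :=
  tubeMap N ε '' (S ×ˢ Ioo 0 1)

/-- The parallel hypersurface `S_ε = S + ε N(S)`. -/
def parallelSurface (S : Set (EuclideanSpace ℝ (Fin d)))
    (N : EuclideanSpace ℝ (Fin d) → EuclideanSpace ℝ (Fin d)) (ε : ℝ) :
    Set (EuclideanSpace ℝ (Fin d)) :=
  (fun x => x + ε • N x) '' S

/-! ### Sobolev spaces and Laplacians -/

/-- The gradient of `u : ℝ^d → ℂ`, projected onto the (complexified) linear subspace `T`: its
`i`-th component is `⟨P_T ∇u(x), e_i⟩ = du(x)(P_T e_i)`. For `T = ℝ^d` it is the gradient, for `T`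
the tangent space of a hypersurface it is the Riemannian gradient for the induced metric. -/
def gradientAlong (T : Submodule ℝ (EuclideanSpace ℝ (Fin d)))
    (u : EuclideanSpace ℝ (Fin d) → ℂ) (x : EuclideanSpace ℝ (Fin d)) :
    EuclideanSpace ℂ (Fin d) :=
  WithLp.toLp 2 fun i => fderiv ℝ u x (T.starProjection (EuclideanSpace.single i 1))

lemma gradientAlong_add (T : Submodule ℝ (EuclideanSpace ℝ (Fin d)))
    {u v : EuclideanSpace ℝ (Fin d) → ℂ} (hu : ContDiff ℝ 1 u) (hv : ContDiff ℝ 1 v)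
    (x : EuclideanSpace ℝ (Fin d)) :
    gradientAlong T (u + v) x = gradientAlong T u x + gradientAlong T v x := by
  ext i
  simp [gradientAlong, fderiv_add (hu.differentiable one_ne_zero x)
    (hv.differentiable one_ne_zero x)]

lemma gradientAlong_smul (T : Submodule ℝ (EuclideanSpace ℝ (Fin d)))
    {u : EuclideanSpace ℝ (Fin d) → ℂ} (c : ℂ) (hu : ContDiff ℝ 1 u)
    (x : EuclideanSpace ℝ (Fin d)) :
    gradientAlong T (c • u) x = c • gradientAlong T u x := by
  ext i
  simp [gradientAlong, fderiv_const_smul (hu.differentiable one_ne_zero x) c]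

/-- The graph of the gradient on test functions: the pairs `(u, ∇u)` as elements of `L²(μ)`, where
`u` runs over the compactly supported `C¹` functions on `ℝ^d` whose support does not meet
the set `Z`, and `∇u(x)` is the gradient along the subspace `T x`. -/
def testGraph (μ : Measure (EuclideanSpace ℝ (Fin d)))
    (T : EuclideanSpace ℝ (Fin d) → Submodule ℝ (EuclideanSpace ℝ (Fin d)))
    (Z : Set (EuclideanSpace ℝ (Fin d))) :
    Submodule ℂ (Lp ℂ 2 μ × Lp (EuclideanSpace ℂ (Fin d)) 2 μ) where
  carrier := {p | ∃ u : EuclideanSpace ℝ (Fin d) → ℂ,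
    ContDiff ℝ 1 u ∧ HasCompactSupport u ∧ Disjoint (tsupport u) Z ∧
      p.1 =ᵐ[μ] u ∧ p.2 =ᵐ[μ] fun x => gradientAlong (T x) u x}
  add_mem' := by
    rintro a b ⟨u, hu, hu2, hu3, hu4, hu5⟩ ⟨v, hv, hv2, hv3, hv4, hv5⟩
    refine ⟨u + v, hu.add hv, hu2.add hv2,
      (disjoint_union_left.2 ⟨hu3, hv3⟩).mono_left (tsupport_add u v), ?_, ?_⟩
    · exact (Lp.coeFn_add a.1 b.1).trans (hu4.add hv4)
    · filter_upwards [hu5, hv5, Lp.coeFn_add a.2 b.2] with x h1 h2 h3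
      rw [Prod.snd_add, h3, Pi.add_apply, h1, h2, gradientAlong_add _ hu hv]
  zero_mem' := by
    refine ⟨0, contDiff_const, HasCompactSupport.zero, by simp [tsupport], ?_, ?_⟩
    · exact Lp.coeFn_zero ℂ 2 μ
    · filter_upwards [Lp.coeFn_zero (EuclideanSpace ℂ (Fin d)) 2 μ] with x h
      rw [Prod.snd_zero, h]
      ext i
      simp [gradientAlong]
  smul_mem' := by
    rintro c a ⟨u, hu, hu2, hu3, hu4, hu5⟩
    have hs : tsupport (c • u) ⊆ tsupport u :=
      closure_mono (Function.support_const_smul_subset c u)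
    refine ⟨c • u, hu.const_smul c, hu2.mono' (subset_closure.trans hs), hu3.mono_left hs,
      ?_, ?_⟩
    · exact (Lp.coeFn_smul c a.1).trans (hu4.const_smul c)
    · filter_upwards [hu5, Lp.coeFn_smul c a.2] with x h1 h2
      rw [Prod.smul_snd, h2, Pi.smul_apply, h1, gradientAlong_smul _ c hu]

/-- The graph of the weak gradient on the Sobolev space that is the closure, in the `W^{1,2}`-norm,
of the test functions whose support does not meet `Z`. -/
def sobolevGraph (μ : Measure (EuclideanSpace ℝ (Fin d)))
    (T : EuclideanSpace ℝ (Fin d) → Submodule ℝ (EuclideanSpace ℝ (Fin d)))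
    (Z : Set (EuclideanSpace ℝ (Fin d))) :
    Submodule ℂ (Lp ℂ 2 μ × Lp (EuclideanSpace ℂ (Fin d)) 2 μ) :=
  (testGraph μ T Z).topologicalClosure

/-- The Laplacian `-Δ_DN` on `L²(Ω_ε)`, with Neumann conditions on the parallel surface `S_ε` and
Dirichlet conditions on the rest `∂Ω_ε \ S_ε` of the boundary: the operator of the form
`∫ |∇ψ|²` on the functions in `W^{1,2}(Ω_ε)` that vanish on `∂Ω_ε \ S_ε`. -/
def laplacianDN (S : Set (EuclideanSpace ℝ (Fin d)))
    (N : EuclideanSpace ℝ (Fin d) → EuclideanSpace ℝ (Fin d)) (ε : ℝ) :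
    Submodule ℂ (Lp ℂ 2 (volume.restrict (tube S N ε)) ×
      Lp ℂ 2 (volume.restrict (tube S N ε))) :=
  OperatorGraph.ofGradient (sobolevGraph (volume.restrict (tube S N ε)) (fun _ => ⊤)
    (frontier (tube S N ε) \ parallelSurface S N ε))

/-- The surface measure of `S`. -/
def surfaceMeasure (S : Set (EuclideanSpace ℝ (Fin d))) : Measure (EuclideanSpace ℝ (Fin d)) :=
  (Measure.euclideanHausdorffMeasure (d - 1)).restrict S

/-- The Laplace–Beltrami operator `-Δ_g` on `L²(S)` with Dirichlet conditions on
`∂S = closure S \ S`: the operator of the form `∫ |∇_g φ|²` on `W₀^{1,2}(S)`, the closure of the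
`C¹` functions with compact support in `S`. -/
def laplaceBeltrami (S : Set (EuclideanSpace ℝ (Fin d)))
    (N : EuclideanSpace ℝ (Fin d) → EuclideanSpace ℝ (Fin d)) :
    Submodule ℂ (Lp ℂ 2 (surfaceMeasure S) × Lp ℂ 2 (surfaceMeasure S)) :=
  OperatorGraph.ofGradient (sobolevGraph (surfaceMeasure S) (tangentSpace N) (closure S \ S))

/-- The operator `H_ε = -Δ_g + κ / ε` on `L²(S)`. -/
def effectiveOperator (S : Set (EuclideanSpace ℝ (Fin d)))
    (N : EuclideanSpace ℝ (Fin d) → EuclideanSpace ℝ (Fin d)) (ε : ℝ) :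
    Submodule ℂ (Lp ℂ 2 (surfaceMeasure S) × Lp ℂ 2 (surfaceMeasure S)) :=
  OperatorGraph.addPotential (laplaceBeltrami S N) fun x => totalCurvature S N x / ε

end Tube

end

/-! In the coordinates z = x + ε t N(x) Lebesgue measure becomes ε ρ dσ dt, where ρ(t) = ∏ (1 - ε t
κ_i) = 1 - ε κ t + O(ε²). The transverse Dirichlet-Neumann problem on (0, 1) has ground state χ(t) =
√2 sin(π t / 2) and lowest eigenvalue (π/2)². Writing ψ = χ f along a normal line and integrating by
parts, with no boundary terms because χ(0) = 0 = χ'(1), turns ε⁻² ∫ (|ψ'|² - (π/2)² |ψ|²) ρ into ε⁻²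
∫ χ² |f'|² ρ - ε⁻² ∫ χ χ' ρ' |f|². Since ρ' = -ε κ + O(ε²) and ∫ χ χ' = χ(1)²/2 = 1, the last term
is κ/ε times |f|² to leading order: this is the effective potential. The first term controls the
oscillation of f with a factor ε⁻², while replacing f by its mean only costs ε⁻¹ times that
oscillation, so the error is O(1).

The tangential gradient on the parallel surface at distance ε t differs from that on Σ by a factor 1
+ O(ε). Since μ_n = O(1/ε), the relevant trial functions have kinetic energy O(1/ε), and this
relative error is again O(1). All these constants depend on d and K only; Σ and n enter only through
the admissible ε, namely through the width of the tube and through an upper bound μ_n ≤ a/ε + M.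

Both inequalities transplant n-dimensional spaces of test functions. From Σ to the tube: φ(x) g(t),
with g a cut-off of χ vanishing near t = 0 (`Transverse.exists_trial_profile`,
`Tube.exists_energy_upper_bound`, `Tube.exists_laplacianDN_le`). From the tube to Σ: the average
φ(x) = ∫ χ(t) u(x + ε t N(x)) dt (`Tube.IsTube.exists_average`), whose energy is estimated on each
normal line (`Transverse.exists_energy_lower_bound`, `Tube.exists_pointwise_lower_bound`,
`Tube.exists_effective_le`).

Two tools support this. Min-max is proved for operators given by graphs: ∇*∇ + V + c is the inverse
of R = J J*, where J embeds the form domain, and the continuous functional calculus of the bounded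
positive operator R gives both halves (`OperatorGraph.spectralNumber_le_of_form`,
`OperatorGraph.exists_trial_of_form`). No eigenfunctions are needed, so the essential spectrum plays
no special role later. The volume formula for Hausdorff measure on a C² hypersurface
(`Tube.volume_normalMap_image`) follows by comparing measures locally up to a factor close to one.
-/

noncomputable section

/-! ### Bounded positive operators and their functional calculus -/

namespace OperatorGraph

section Bounded

variable {H : Type*} [NormedAddCommGroup H] [InnerProductSpace ℂ H] [CompleteSpace H]

lemma cfc_apply_cfc (R : H →L[ℂ] H) (f g : ℝ → ℝ) (hf : Continuous f) (hg : Continuous g)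
    (v : H) : cfc f R (cfc g R v) = cfc (fun s => f s * g s) R v := by
  rw [cfc_mul f g R hf.continuousOn hg.continuousOn]; rfl

lemma cfc_sub_const_apply {R : H →L[ℂ] H} (hR : IsSelfAdjoint R) (r : ℝ) (v : H) :
    cfc (fun s => s - r) R v = R v - (r : ℂ) • v := by
  rw [cfc_sub (fun s : ℝ => s) (fun _ => r) R continuous_id.continuousOn
    continuous_const.continuousOn, cfc_id' ℝ R, cfc_const r R]
  simp [Algebra.algebraMap_eq_smul_one]

/-- If `r` is an isolated point of the spectrum of `R` (or not in the spectrum), then `R - r` is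
bounded below on the orthogonal complement of its kernel. -/
lemma exists_norm_le_of_isolated {R : H →L[ℂ] H} (hR : IsSelfAdjoint R) {r δ : ℝ} (hδ : 0 < δ)
    (h : ∀ s ∈ _root_.spectrum ℝ R, |s - r| < δ → s = r) :
    ∃ k : ℝ, ∀ f : H, (∀ v : H, R v = (r : ℂ) • v → ⟪v, f⟫_ℂ = 0) →
      ‖f‖ ≤ k * ‖R f - (r : ℂ) • f‖ := by
  -- On the spectrum p is the indicator function of r, and k is 1/(s - r) away from r. Hence 1 = p +
  -- k (s - r) there. The gap δ is what allows both to be continuous.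
  set p : ℝ → ℝ := fun s => max 0 (1 - |s - r| / δ) with hp
  set k : ℝ → ℝ := fun s => (s - r) / (max δ |s - r|) ^ 2 with hk
  have hpc : Continuous p := by fun_prop
  have hkc : Continuous k := by
    apply Continuous.div (by fun_prop) (by fun_prop)
    intro s
    have : 0 < max δ |s - r| := lt_max_of_lt_left hδ
    positivity
  have hp1 : ∀ s ∈ _root_.spectrum ℝ R, s ≠ r → p s = 0 := by
    intro s hs hsr
    have h1 : δ ≤ |s - r| := by
      by_contra hlt
      exact hsr (h s hs (not_le.1 hlt))
    apply max_eq_left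
    have : 1 ≤ |s - r| / δ := by rwa [one_le_div hδ]
    linarith
  have hpr : p r = 1 := by simp [hp]
  have e1 : ∀ f : H, f = cfc p R f + cfc k R (R f - (r : ℂ) • f) := by
    intro f
    rw [← cfc_sub_const_apply hR, cfc_apply_cfc R k _ hkc (by fun_prop), ← add_apply,
      ← cfc_add R p _ hpc.continuousOn (by fun_prop)]
    have : cfc (fun s => p s + k s * (s - r)) R = cfc (fun _ : ℝ => (1 : ℝ)) R := by
      apply cfc_congr
      intro s hs
      by_cases hsr : s = r
      · simp [hsr, hpr]
      · simp only [hp1 s hs hsr, hk]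
        have h1 : δ ≤ |s - r| := by
          by_contra hlt
          exact hsr (h s hs (not_le.1 hlt))
        have h2 : s - r ≠ 0 := sub_ne_zero.2 hsr
        rw [max_eq_right h1, sq_abs]
        field_simp
        simp
    rw [this, cfc_const_one ℝ R]
    rfl
  have e2 : ∀ f : H, R (cfc p R f) = (r : ℂ) • cfc p R f := by
    intro f
    rw [← sub_eq_zero, ← cfc_sub_const_apply hR, cfc_apply_cfc R _ _ (by fun_prop) hpc]
    have : cfc (fun s => (s - r) * p s) R = cfc (fun _ : ℝ => (0 : ℝ)) R := by
      apply cfc_congr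
      intro s hs
      by_cases hsr : s = r
      · simp [hsr]
      · simp [hp1 s hs hsr]
    rw [this, cfc_const_zero ℝ R]
    rfl
  have hsa : IsSelfAdjoint (cfc p R) := cfc_predicate p R
  refine ⟨‖cfc k R‖, fun f hf => ?_⟩
  have h0 : cfc p R f = 0 := by
    rw [← inner_self_eq_zero (𝕜 := ℂ)]
    have := hsa.isSymmetric f (cfc p R f)
    simp only [ContinuousLinearMap.coe_coe] at this
    rw [this, ← inner_conj_symm, hf _ (e2 _)]
    simp
  calc ‖f‖ = ‖cfc k R (R f - (r : ℂ) • f)‖ := by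
        conv_lhs => rw [e1 f, h0, zero_add]
    _ ≤ _ := ContinuousLinearMap.le_opNorm _ _

/-- A bounded symmetric operator maps a subspace invariant under it and its complement. -/
lemma map_orthogonal_of_map {R : H →L[ℂ] H} (hR : IsSelfAdjoint R) {M : Submodule ℂ H}
    (hM : ∀ v ∈ M, R v ∈ M) {f : H} (hf : f ∈ Mᗮ) : R f ∈ Mᗮ := by
  intro v hv
  have := hR.isSymmetric v f
  simp only [ContinuousLinearMap.coe_coe] at this
  rw [← this]
  exact hf _ (hM v hv)

/-- On an invariant subspace of a positive operator, the norm of the restriction is attained by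
approximate eigenvectors. -/
lemma exists_approx_eigenvector {R : H →L[ℂ] H} (hR : R.IsPositive) {M : Submodule ℂ H}
    (hM : ∀ v ∈ M, R v ∈ M) {f₀ : H} (hf₀ : f₀ ∈ M) (hne : f₀ ≠ 0) {t : ℝ} (ht : 0 < t)
    (h : t * ‖f₀‖ ≤ ‖R f₀‖) :
    ∃ s : ℝ, t ≤ s ∧ ∀ δ > 0, ∃ f ∈ M, ‖f‖ = 1 ∧ ‖R f - (s : ℂ) • f‖ ≤ δ := by
  -- The candidate s is the norm of the restriction to M, which may be smaller than the norm of R.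
  set R' : M →L[ℂ] H := R ∘L M.subtypeL with hR'
  set s : ℝ := ‖R'‖ with hs
  have hsb : ∀ f ∈ M, ‖R f‖ ≤ s * ‖f‖ := fun f hf => R'.le_opNorm ⟨f, hf⟩
  have hts : t ≤ s := by
    have h1 := hsb f₀ hf₀
    have h2 : 0 < ‖f₀‖ := norm_pos_iff.2 hne
    exact le_of_mul_le_mul_right (h.trans h1) h2
  have hs0 : 0 < s := ht.trans_le hts
  refine ⟨s, hts, fun δ hδ => ?_⟩
  -- choose a vector nearly attaining the norm
  set η : ℝ := min (s / 2) (δ ^ 2 / (2 * s)) with hη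
  have hη0 : 0 < η := by positivity
  obtain ⟨g, hg⟩ : ∃ g : M, (s - η) * ‖g‖ < ‖R' g‖ := by
    by_contra hcon
    push Not at hcon
    have : ‖R'‖ ≤ s - η := ContinuousLinearMap.opNorm_le_bound _
      (by have := min_le_left (s / 2) (δ ^ 2 / (2 * s)); linarith) hcon
    linarith
  have hg0 : 0 < ‖g‖ := by
    rcases eq_or_ne g 0 with h0 | h0
    · simp [h0] at hg
    · exact norm_pos_iff.2 h0
  set f : H := ((‖g‖⁻¹ : ℝ) : ℂ) • (g : H) with hf
  have hfM : f ∈ M := M.smul_mem _ g.2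
  have hf1 : ‖f‖ = 1 := by
    have h2 : ‖(g : H)‖ = ‖g‖ := rfl
    rw [hf, norm_smul, Complex.norm_real, norm_inv, norm_norm, h2, inv_mul_cancel₀ hg0.ne']
  have hRf : s - η ≤ ‖R f‖ := by
    have h2 : R' g = R g := rfl
    rw [h2] at hg
    rw [hf, map_smul, norm_smul, Complex.norm_real, norm_inv, norm_norm, inv_mul_eq_div,
      le_div_iff₀ hg0]
    exact hg.le
  refine ⟨f, hfM, hf1, ?_⟩
  have hsym : ∀ a b : H, ⟪R a, b⟫_ℂ = ⟪a, R b⟫_ℂ := fun a b => hR.isSelfAdjoint.isSymmetric a b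
  -- As R ≥ 0, the factor R + s is bounded below by s. So u = (R - s) f is small once (R + s) u =
  -- (R² - s²) f is, and the square of the norm of the latter is at most s² (s² - ‖R f‖²) because R
  -- f stays in M.
  set u : H := R f - (s : ℂ) • f with hu
  have key1 : s * ‖u‖ ≤ ‖R u + (s : ℂ) • u‖ := by
    rcases eq_or_ne u 0 with h0 | h0
    · simp [h0]
    have hu0 : 0 < ‖u‖ := norm_pos_iff.2 h0
    have h1 : s * ‖u‖ ^ 2 ≤ ‖R u + (s : ℂ) • u‖ * ‖u‖ := by
      calc s * ‖u‖ ^ 2 ≤ RCLike.re ⟪R u, u⟫_ℂ + s * ‖u‖ ^ 2 := by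
            have := hR.re_inner_nonneg_left u
            linarith
        _ = RCLike.re ⟪R u + (s : ℂ) • u, u⟫_ℂ := by
            rw [inner_add_left, inner_smul_left, map_add, inner_self_eq_norm_sq_to_K]
            simp [← Complex.ofReal_pow]
        _ ≤ _ := re_inner_le_norm _ _
    have h3 : s * ‖u‖ * ‖u‖ ≤ ‖R u + (s : ℂ) • u‖ * ‖u‖ := by nlinarith
    exact le_of_mul_le_mul_right h3 hu0
  clear_value f u
  have key2 : R u + (s : ℂ) • u = R (R f) - ((s ^ 2 : ℝ) : ℂ) • f := by
    rw [hu, map_sub, map_smul, smul_sub, smul_smul]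
    push_cast
    rw [sq]
    abel
  have key3 : ‖R (R f) - ((s ^ 2 : ℝ) : ℂ) • f‖ ^ 2 ≤ s ^ 2 * (s ^ 2 - ‖R f‖ ^ 2) := by
    rw [@norm_sub_sq ℂ, inner_smul_right, hsym, inner_self_eq_norm_sq_to_K, norm_smul,
      Complex.norm_real, Real.norm_of_nonneg (by positivity), hf1]
    have h1 : ‖R (R f)‖ ≤ s * ‖R f‖ := hsb _ (hM f hfM)
    have h2 : ‖R (R f)‖ ^ 2 ≤ (s * ‖R f‖) ^ 2 := by gcongr
    have h3 : RCLike.re (((s ^ 2 : ℝ) : ℂ) * ((‖R f‖ : ℝ) : ℂ) ^ 2) = s ^ 2 * ‖R f‖ ^ 2 := by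
      rw [← Complex.ofReal_pow, ← Complex.ofReal_mul]
      exact Complex.ofReal_re _
    have h4 : RCLike.re (((s ^ 2 : ℝ) : ℂ) * ((RCLike.ofReal ‖R f‖ : ℂ)) ^ 2) = s ^ 2 * ‖R f‖ ^ 2 := h3
    rw [h4]
    nlinarith
  have key4 : s ^ 2 - ‖R f‖ ^ 2 ≤ δ ^ 2 := by
    have h1 : ‖R f‖ ≤ s := by simpa [hf1] using hsb f hfM
    have h2 : η ≤ δ ^ 2 / (2 * s) := min_le_right _ _
    have h3 : η * (2 * s) ≤ δ ^ 2 := by rwa [le_div_iff₀ (by positivity)] at h2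
    nlinarith [norm_nonneg (R f)]
  have key5 : (s * ‖u‖) ^ 2 ≤ (s * δ) ^ 2 := by
    calc (s * ‖u‖) ^ 2 ≤ ‖R u + (s : ℂ) • u‖ ^ 2 := by gcongr
      _ ≤ s ^ 2 * (s ^ 2 - ‖R f‖ ^ 2) := by rw [key2]; exact key3
      _ ≤ s ^ 2 * δ ^ 2 := by gcongr
      _ = _ := by ring
  have key6 := abs_le_of_sq_le_sq' key5 (by positivity)
  exact le_of_mul_le_mul_left key6.2 hs0

end Bounded

/-! ### Passing between an operator and its shifted inverse -/

section Inverse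

variable {H X : Type*} [NormedAddCommGroup H] [InnerProductSpace ℂ H] [CompleteSpace H]
  {A : Submodule ℂ (H × H)} {R : H →L[ℂ] H} {c : ℝ}

/-- `A + c` is the inverse of the bounded positive operator `R`. -/
structure IsShiftedInverse (A : Submodule ℂ (H × H)) (R : H →L[ℂ] H) (c : ℝ) : Prop where
  pos : R.IsPositive
  mem_iff : ∀ ψ f : H, (ψ, f) ∈ A ↔ R (f + (c : ℂ) • ψ) = ψ

namespace IsShiftedInverse

lemma mem_eigenspace_iff (h : IsShiftedInverse A R c) {z : ℝ} {ψ : H} :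
    ψ ∈ eigenspace A z ↔ ((z + c : ℝ) : ℂ) • R ψ = ψ := by
  change (ψ, (z : ℂ) • ψ) ∈ A ↔ _
  rw [h.mem_iff, ← add_smul, map_smul]
  push_cast
  rfl

/-- Pairing (z + c) R ψ = ψ with ψ gives (z + c) ⟪ψ, R ψ⟫ = ‖ψ‖² > 0, while ⟪ψ, R ψ⟫ ≥ 0. -/
lemma pos_of_mem_eigenspace (h : IsShiftedInverse A R c) {z : ℝ} {ψ : H}
    (hψ : ψ ∈ eigenspace A z) (h0 : ψ ≠ 0) : 0 < z + c := by
  rw [h.mem_eigenspace_iff] at hψ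
  by_contra hle
  have h1 := h.pos.re_inner_nonneg_right ψ
  have h2 : RCLike.re ⟪ψ, ((z + c : ℝ) : ℂ) • R ψ⟫_ℂ = ‖ψ‖ ^ 2 := by
    rw [hψ, inner_self_eq_norm_sq_to_K, ← RCLike.ofReal_pow, RCLike.ofReal_re]
  rw [inner_smul_right] at h2
  have h3 : RCLike.re (((z + c : ℝ) : ℂ) * ⟪ψ, R ψ⟫_ℂ) = (z + c) * RCLike.re ⟪ψ, R ψ⟫_ℂ :=
    Complex.re_ofReal_mul _ _
  rw [h3] at h2
  have h4 : 0 < ‖ψ‖ ^ 2 := by have := norm_pos_iff.2 h0; positivity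
  push Not at hle
  nlinarith

lemma mem_eigenspace_iff_of_pos (h : IsShiftedInverse A R c) {z : ℝ} (hz : 0 < z + c) {ψ : H} :
    ψ ∈ eigenspace A z ↔ R ψ = (((z + c)⁻¹ : ℝ) : ℂ) • ψ := by
  rw [h.mem_eigenspace_iff]
  have h1 : ((z + c : ℝ) : ℂ) ≠ 0 := by exact_mod_cast hz.ne'
  rw [Complex.ofReal_inv]
  constructor
  · intro h2
    rw [eq_inv_smul_iff₀ h1, h2]
  · intro h2
    rw [h2, smul_inv_smul₀ h1]

/-- The substitution f = g + (z + c) ψ, with inverse ψ = R f, replaces the unbounded equation by one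
for the bounded operator 1 - (z + c) R. -/
lemma existsUnique_iff (h : IsShiftedInverse A R c) (z : ℝ) (g : H) :
    (∃! ψ : H, (ψ, g + (z : ℂ) • ψ) ∈ A) ↔ ∃! f : H, f - ((z + c : ℝ) : ℂ) • R f = g := by
  have key : ∀ ψ : H, (ψ, g + (z : ℂ) • ψ) ∈ A ↔ R (g + ((z + c : ℝ) : ℂ) • ψ) = ψ := by
    intro ψ
    rw [h.mem_iff, add_assoc, ← add_smul]
    push_cast
    rfl
  simp_rw [key]
  constructor
  · rintro ⟨ψ, hψ, hu⟩
    refine ⟨g + ((z + c : ℝ) : ℂ) • ψ, ?_, fun f hf => ?_⟩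
    · simp only [hψ]; abel
    · have h1 : f = g + ((z + c : ℝ) : ℂ) • R f := by rw [← hf]; abel
      rw [← hu (R f) (by simp only; rw [← h1])]
      exact h1
  · rintro ⟨f, hf, hu⟩
    have h1 : g + ((z + c : ℝ) : ℂ) • R f = f := by rw [← hf]; abel
    refine ⟨R f, by simp only [h1], fun ψ hψ => ?_⟩
    rw [← hu (g + ((z + c : ℝ) : ℂ) • ψ) (by simp only [hψ]; abel), hψ]

/-- Spectral mapping for z ↦ (z + c)⁻¹. For z + c < 0 positivity of R excludes spectrum, and for z +
c = 0 the operator 1 - (z + c) R is the identity. -/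
lemma mem_spectrum_iff (h : IsShiftedInverse A R c) {z : ℝ} :
    z ∈ spectrum A ↔ 0 < z + c ∧ (z + c)⁻¹ ∈ _root_.spectrum ℝ R := by
  have e1 : z ∈ spectrum A ↔
      ¬ Function.Bijective (fun f : H => f - ((z + c : ℝ) : ℂ) • R f) := by
    rw [Function.bijective_iff_existsUnique]
    change (¬ ∀ g : H, _) ↔ _
    simp_rw [h.existsUnique_iff]
  have e2 : z + c ≠ 0 → (z ∈ spectrum A ↔ (z + c)⁻¹ ∈ _root_.spectrum ℝ R) := by
    intro hz
    have hz' : ((z + c : ℝ) : ℂ) ≠ 0 := by exact_mod_cast hz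
    rw [e1, _root_.spectrum.mem_iff, not_iff_not, ContinuousLinearMap.isUnit_iff_bijective]
    have : (fun f : H => f - ((z + c : ℝ) : ℂ) • R f) =
        (fun f : H => ((z + c : ℝ) : ℂ) • f) ∘
          ⇑(algebraMap ℝ (H →L[ℂ] H) (z + c)⁻¹ - R) := by
      ext f
      simp only [Function.comp, sub_apply, Algebra.algebraMap_eq_smul_one,
        smul_apply, one_apply_eq_self, smul_sub]
      congr 1
      rw [← Complex.coe_smul, Complex.ofReal_inv, smul_inv_smul₀ hz']
    rw [this]
    have hb : Function.Bijective (fun f : H => ((z + c : ℝ) : ℂ) • f) :=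
      MulAction.bijective₀ hz'
    exact hb.of_comp_iff' _
  rcases lt_trichotomy (z + c) 0 with hz | hz | hz
  · refine (e2 hz.ne).trans ⟨fun hs => ?_, fun hs => absurd hs.1 (not_lt.2 hz.le)⟩
    have h1 : 0 ≤ R := (ContinuousLinearMap.nonneg_iff_isPositive R).2 h.pos
    have h2 := spectrum_nonneg_of_nonneg h1 hs
    exact absurd h2 (not_le.2 (inv_lt_zero.2 hz))
  · rw [e1, hz]
    simp only [Complex.ofReal_zero, zero_smul, sub_zero, lt_irrefl, false_and, iff_false, not_not]
    exact Function.bijective_id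
  · rw [e2 hz.ne']
    simp [hz]

end IsShiftedInverse

end Inverse

end OperatorGraph

/-! ### The min-max principle -/

namespace OperatorGraph

/-- Both branches of the definition are covered: a level lies by definition below every point of the
essential spectrum. -/
lemma spectralNumber_le_of_mem_essentialSpectrum {H : Type*} [NormedAddCommGroup H]
    [InnerProductSpace ℂ H] {A : Submodule ℂ (H × H)} {s : ℝ} (hs : s ∈ essentialSpectrum A)
    (n : ℕ) : spectralNumber A n ≤ (s : EReal) := by
  unfold spectralNumber
  split_ifs with h
  · obtain ⟨E, hE⟩ := h
    exact (sInf_le (mem_image_of_mem _ hE)).trans (EReal.coe_le_coe_iff.2 (hE.1 s hs).le)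
  · exact sInf_le (mem_image_of_mem _ hs)

lemma spectralNumber_le_of_mem_levels {H : Type*} [NormedAddCommGroup H]
    [InnerProductSpace ℂ H] {A : Submodule ℂ (H × H)} {n : ℕ} {E : ℝ} (hE : E ∈ levels A n) :
    spectralNumber A n ≤ (E : EReal) := by
  unfold spectralNumber
  rw [if_pos ⟨E, hE⟩]
  exact sInf_le (mem_image_of_mem _ hE)

namespace IsShiftedInverse

variable {H X : Type*} [NormedAddCommGroup H] [InnerProductSpace ℂ H] [CompleteSpace H]
  [NormedAddCommGroup X] [InnerProductSpace ℂ X] [CompleteSpace X]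
  {A : Submodule ℂ (H × H)} {c : ℝ}

/-- R acts as the scalar (z + c)⁻¹ on each eigenspace. The invariance passes to the orthogonal
complement, where the min-max argument takes place. -/
lemma map_iSup_eigenspace {R : H →L[ℂ] H} (h : IsShiftedInverse A R c) (E : ℝ) :
    ∀ v ∈ (⨆ z : ℝ, ⨆ _ : z ≤ E, eigenspace A z : Submodule ℂ H),
      R v ∈ (⨆ z : ℝ, ⨆ _ : z ≤ E, eigenspace A z : Submodule ℂ H) := by
  set M : Submodule ℂ H := ⨆ z : ℝ, ⨆ _ : z ≤ E, eigenspace A z with hM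
  suffices M ≤ M.comap (R : H →ₗ[ℂ] H) from this
  conv_lhs => rw [hM]
  refine iSup₂_le fun z hz v hv => ?_
  change R v ∈ M
  by_cases h0 : v = 0
  · rw [h0, map_zero]; exact M.zero_mem
  have hpos := h.pos_of_mem_eigenspace hv h0
  rw [(h.mem_eigenspace_iff_of_pos hpos).1 hv]
  exact M.smul_mem _ ((le_iSup₂ (f := fun (z : ℝ) (_ : z ≤ E) => eigenspace A z) z hz) hv)

/-- Points of the spectrum of the resolvent near a nonzero one correspond to nearby points of the
spectrum of the operator. -/
lemma isolated_of_isolated {R : H →L[ℂ] H} (h : IsShiftedInverse A R c) {s r : ℝ} (hs : 0 < s)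
    (hr : 0 < r) (hiso : ∀ w ∈ spectrum A, |w - (s⁻¹ - c)| < r → w = s⁻¹ - c) :
    ∃ δ > 0, ∀ s' ∈ _root_.spectrum ℝ R, |s' - s| < δ → s' = s := by
  have hc : ContinuousAt (fun x : ℝ => x⁻¹) s := continuousAt_inv₀ hs.ne'
  obtain ⟨δ, hδ, hδ'⟩ := Metric.continuousAt_iff.1 hc r hr
  refine ⟨min δ s, by positivity, fun s' hs' hlt => ?_⟩
  have h1 : |s' - s| < δ := hlt.trans_le (min_le_left _ _)
  have h2 : |s' - s| < s := hlt.trans_le (min_le_right _ _)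
  have h3 : 0 < s' := by have := (abs_lt.1 h2).1; linarith
  have h4 : s'⁻¹ - c ∈ spectrum A := by
    rw [h.mem_spectrum_iff]
    simp [h3, hs']
  have h5 := hδ' (x := s') (by rwa [Real.dist_eq])
  rw [Real.dist_eq] at h5
  have h6 := hiso _ h4 (by rwa [sub_sub_sub_cancel_right])
  exact inv_injective (by linarith)

/-- Upper bound in the min-max principle. -/
theorem spectralNumber_le {J : X →L[ℂ] H} (h : IsShiftedInverse A (J ∘L J.adjoint) c)
    {n : ℕ} (hn : 1 ≤ n) {E : ℝ} (B : (Fin n → ℂ) →ₗ[ℂ] X)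
    (hB : ∀ x, x ≠ 0 → J (B x) ≠ 0 ∧ ‖B x‖ ^ 2 ≤ (E + c) * ‖J (B x)‖ ^ 2) :
    spectralNumber A n ≤ (E : EReal) := by
  set R : H →L[ℂ] H := J ∘L J.adjoint with hR
  have he : 0 < E + c := by
    have : Nonempty (Fin n) := ⟨⟨0, hn⟩⟩
    obtain ⟨h1, h2⟩ := hB (fun _ => 1) (by
      intro h0
      exact one_ne_zero (congrFun h0 ⟨0, hn⟩))
    have h3 : 0 < ‖J (B fun _ => 1)‖ ^ 2 := by have := norm_pos_iff.2 h1; positivity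
    have h4 : 0 < ‖B fun _ => 1‖ ^ 2 := by
      have : B (fun _ => 1) ≠ 0 := fun h0 => h1 (by rw [h0, map_zero])
      have := norm_pos_iff.2 this
      positivity
    by_contra hle
    push Not at hle
    nlinarith
  -- If the spectral number exceeds E, the essential spectrum lies above E and the eigenvectors up
  -- to E span a space M of dimension less than n. Some trial vector is mapped into Mᗮ, where R then
  -- still has norm at least (E + c)⁻¹. This produces approximate eigenvectors in Mᗮ for some s ≥ (E
  -- + c)⁻¹, that is at s⁻¹ - c ≤ E. There the spectrum is at most an isolated eigenvalue, whose
  -- eigenvectors belong to M, and R - s is bounded below on Mᗮ: a contradiction.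
  by_contra hlt
  have h1 : ∀ s ∈ essentialSpectrum A, E < s := by
    intro s hs
    by_contra hle
    exact hlt ((spectralNumber_le_of_mem_essentialSpectrum hs n).trans
      (EReal.coe_le_coe_iff.2 (not_lt.1 hle)))
  set M : Submodule ℂ H := ⨆ z : ℝ, ⨆ _ : z ≤ E, eigenspace A z with hM
  have h2 : Module.rank ℂ M < n := by
    by_contra hle
    exact hlt (spectralNumber_le_of_mem_levels ⟨h1, not_lt.1 hle⟩)
  have : FiniteDimensional ℂ M :=
    Module.rank_lt_aleph0_iff.1 (h2.trans Cardinal.natCast_lt_aleph0)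
  have h3 : Module.finrank ℂ M < n := by
    have := Module.finrank_eq_rank ℂ M
    rw [← this] at h2
    exact_mod_cast h2
  obtain ⟨x, hx, hx0⟩ : ∃ x : Fin n → ℂ, x ≠ 0 ∧ J (B x) ∈ Mᗮ := by
    set T : (Fin n → ℂ) →ₗ[ℂ] M :=
      (M.orthogonalProjectionOnto : H →ₗ[ℂ] M) ∘ₗ (J : X →ₗ[ℂ] H) ∘ₗ B
    have hT := LinearMap.ker_ne_bot_of_finrank_lt (f := T) (by simpa using h3)
    obtain ⟨x, hx, hx0⟩ := T.ker.exists_mem_ne_zero_of_ne_bot hT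
    exact ⟨x, hx0, Submodule.orthogonalProjectionOnto_eq_zero_iff.1 hx⟩
  set f₀ := J (B x) with hf₀
  obtain ⟨hf₀n, hxe⟩ := hB x hx
  -- Cauchy-Schwarz twice, in the form domain for ‖f₀‖² = ⟪B x, J* f₀⟫ and in H for ‖J* f₀‖² = ⟪f₀,
  -- R f₀⟫.
  have hRf₀ : (E + c)⁻¹ * ‖f₀‖ ≤ ‖R f₀‖ := by
    have e1 : ‖f₀‖ ^ 2 ≤ ‖B x‖ * ‖J.adjoint f₀‖ := by
      rw [← @inner_self_eq_norm_sq ℂ]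
      conv_lhs => rw [hf₀]
      rw [← ContinuousLinearMap.adjoint_inner_right]
      exact re_inner_le_norm _ _
    have e2 : ‖J.adjoint f₀‖ ^ 2 ≤ ‖f₀‖ * ‖R f₀‖ := by
      rw [← @inner_self_eq_norm_sq ℂ, ContinuousLinearMap.adjoint_inner_left]
      exact re_inner_le_norm _ _
    have e0 : 0 < ‖f₀‖ := norm_pos_iff.2 hf₀n
    have e3 : (‖f₀‖ ^ 2) ^ 2 ≤ ((E + c) * ‖f₀‖ ^ 2) * (‖f₀‖ * ‖R f₀‖) := by
      calc (‖f₀‖ ^ 2) ^ 2 ≤ (‖B x‖ * ‖J.adjoint f₀‖) ^ 2 := by gcongr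
        _ = ‖B x‖ ^ 2 * ‖J.adjoint f₀‖ ^ 2 := by ring
        _ ≤ _ := by gcongr
    rw [inv_mul_le_iff₀ he]
    have e4 : 0 < ‖f₀‖ ^ 3 := by positivity
    refine le_of_mul_le_mul_left ?_ e4
    linarith
  have hMR : ∀ v ∈ Mᗮ, R v ∈ Mᗮ := fun v hv =>
    map_orthogonal_of_map h.pos.isSelfAdjoint (h.map_iSup_eigenspace E) hv
  obtain ⟨s, hts, happ⟩ := exists_approx_eigenvector h.pos hMR hx0 hf₀n (inv_pos.2 he) hRf₀
  have hs0 : 0 < s := (inv_pos.2 he).trans_le hts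
  have hsE : s⁻¹ - c ≤ E := by
    have := inv_anti₀ (inv_pos.2 he) hts
    rw [inv_inv] at this
    linarith
  have hiso : ∃ δ > 0, ∀ s' ∈ _root_.spectrum ℝ R, |s' - s| < δ → s' = s := by
    by_cases hsp : s ∈ _root_.spectrum ℝ R
    · have hz : s⁻¹ - c ∈ spectrum A := by
        rw [h.mem_spectrum_iff]
        simp [hs0, hsp]
      have hd : s⁻¹ - c ∈ discreteSpectrum A := by
        by_contra hnd
        exact absurd hsE (not_le.2 (h1 _ ⟨hz, hnd⟩))
      obtain ⟨-, -, r, hr, hrs⟩ := hd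
      exact h.isolated_of_isolated hs0 hr hrs
    · have hcl : IsClosed (_root_.spectrum ℝ R) := _root_.spectrum.isClosed R
      obtain ⟨δ, hδ, hδ'⟩ := Metric.isOpen_iff.1 hcl.isOpen_compl s hsp
      refine ⟨δ, hδ, fun s' hs' hlt => absurd hs' (hδ' ?_)⟩
      rwa [Metric.mem_ball, Real.dist_eq]
  obtain ⟨δ, hδ, hδ'⟩ := hiso
  obtain ⟨k, hk⟩ := exists_norm_le_of_isolated h.pos.isSelfAdjoint hδ hδ'
  -- The tolerance is so small that k ‖R f - s f‖ < 1 = ‖f‖, against the lower bound `hk`.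
  obtain ⟨f, hfM, hf1, hfs⟩ := happ (1 / (2 * (|k| + 1))) (by positivity)
  have hfk := hk f (fun v hv => by
    refine hfM v ((le_iSup₂ (f := fun (z : ℝ) (_ : z ≤ E) => eigenspace A z) (s⁻¹ - c) hsE) ?_)
    rw [h.mem_eigenspace_iff_of_pos (by simpa using hs0)]
    simpa using hv)
  rw [hf1] at hfk
  have : k * ‖R f - (s : ℂ) • f‖ ≤ |k| * (1 / (2 * (|k| + 1))) := by
    calc k * ‖R f - (s : ℂ) • f‖ ≤ |k| * ‖R f - (s : ℂ) • f‖ := by gcongr; exact le_abs_self k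
      _ ≤ _ := by gcongr
  have h5 : |k| * (1 / (2 * (|k| + 1))) < 1 := by
    rw [mul_one_div, div_lt_one (by positivity)]
    have := abs_nonneg k
    linarith
  linarith

/-- The spectral subspace `ran (R - t)₊` of a positive operator. -/
lemma exists_upper_subspace {R : H →L[ℂ] H} (hR : R.IsPositive) {t : ℝ} (ht : 0 < t) :
    ∃ Y : Submodule ℂ H,
      (∀ f ∈ Y, t * ‖f‖ ^ 2 ≤ RCLike.re ⟪f, R f⟫_ℂ ∧ t * RCLike.re ⟪f, R f⟫_ℂ ≤ ‖R f‖ ^ 2) ∧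
      (∀ r : ℝ, t < r → ∀ v, R v = (r : ℂ) • v → v ∈ Y) ∧
      (∀ v ∈ Y, R v ∈ Y) ∧
      (∀ r : ℝ, t < r → ∀ w ∈ Yᗮ, ∃ f ∈ Yᗮ, (r : ℂ) • f - R f = w) := by
  -- Y is the range of G = (R - t)₊, which need not be closed. It suffices that (R - t) G = G², so
  -- that R ≥ t and R² ≥ t R on Y, and that Yᗮ is the kernel of G, where R ≤ t.
  set g : ℝ → ℝ := fun s => max (s - t) 0 with hg
  have hgc : Continuous g := by fun_prop
  have hRs := hR.isSelfAdjoint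
  set G : H →L[ℂ] H := cfc g R with hG
  have hGs : IsSelfAdjoint G := cfc_predicate g R
  have hGsym : ∀ a b : H, ⟪G a, b⟫_ℂ = ⟪a, G b⟫_ℂ := fun a b => hGs.isSymmetric a b
  have hRsym : ∀ a b : H, ⟪R a, b⟫_ℂ = ⟪a, R b⟫_ℂ := fun a b => hRs.isSymmetric a b
  have hspec : ∀ s ∈ _root_.spectrum ℝ R, 0 ≤ s := fun s hs =>
    spectrum_nonneg_of_nonneg ((ContinuousLinearMap.nonneg_iff_isPositive R).2 hR) hs
  have hcomm : ∀ v, R (G v) = G (R v) := by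
    intro v
    have h1 := cfc_commute_cfc (fun s : ℝ => s) g R
    rw [cfc_id' ℝ R] at h1
    exact congrArg (fun T : H →L[ℂ] H => T v) h1.eq
  have hpos : ∀ (k : ℝ → ℝ), (∀ s ∈ _root_.spectrum ℝ R, 0 ≤ k s) → ∀ v,
      0 ≤ RCLike.re ⟪v, cfc k R v⟫_ℂ := by
    intro k hk v
    exact ((ContinuousLinearMap.nonneg_iff_isPositive _).1 (cfc_nonneg hk)).re_inner_nonneg_right v
  have hsub : ∀ v, R v - (t : ℂ) • v = G v - cfc (fun s => max (t - s) 0) R v := by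
    intro v
    rw [← cfc_sub_const_apply hRs, hG, ← sub_apply, ← cfc_sub g _ R hgc.continuousOn
      (by fun_prop)]
    congr 2
    ext s
    simp only [hg]
    rcases le_total s t with h | h
    · rw [max_eq_right (by linarith), max_eq_left (by linarith)]; ring
    · rw [max_eq_left (by linarith), max_eq_right (by linarith)]; ring
  have hGG : ∀ v, R (G v) - (t : ℂ) • G v = G (G v) := by
    intro v
    rw [← cfc_sub_const_apply hRs, hG, cfc_apply_cfc R _ _ (by fun_prop) hgc,
      cfc_apply_cfc R _ _ hgc hgc]
    congr 2
    ext s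
    simp only [hg]
    rcases le_total s t with h | h
    · rw [max_eq_right (by linarith)]; ring
    · rw [max_eq_left (by linarith)]
  have hker : ∀ w, w ∈ (LinearMap.range (G : H →ₗ[ℂ] H))ᗮ ↔ G w = 0 := by
    intro w
    rw [Submodule.mem_orthogonal]
    constructor
    · intro h1
      have := h1 (G (G w)) ⟨G w, rfl⟩
      rw [hGsym, inner_self_eq_zero] at this
      exact this
    · rintro h1 _ ⟨u, rfl⟩
      change ⟪G u, w⟫_ℂ = 0
      rw [hGsym, h1, inner_zero_right]
  have hneg : ∀ w, G w = 0 → RCLike.re ⟪w, R w⟫_ℂ ≤ t * ‖w‖ ^ 2 := by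
    intro w hw
    have h1 := hsub w
    rw [hw, zero_sub] at h1
    have h2 := hpos (fun s => max (t - s) 0) (fun s _ => le_max_right _ _) w
    have h3 : cfc (fun s => max (t - s) 0) R w = (t : ℂ) • w - R w := by
      rw [← neg_sub (R w), h1, neg_neg]
    rw [h3, inner_sub_right, inner_smul_right, inner_self_eq_norm_sq_to_K, map_sub] at h2
    have h4 : RCLike.re ((t : ℂ) * ((‖w‖ : ℝ) : ℂ) ^ 2) = t * ‖w‖ ^ 2 := by
      rw [← Complex.ofReal_pow, ← Complex.ofReal_mul]
      exact Complex.ofReal_re _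
    have h5 : RCLike.re ((t : ℂ) * ((RCLike.ofReal ‖w‖ : ℂ)) ^ 2) = t * ‖w‖ ^ 2 := h4
    linarith
  refine ⟨LinearMap.range (G : H →ₗ[ℂ] H), ?_, ?_, ?_, ?_⟩
  · rintro _ ⟨u, rfl⟩
    change t * ‖G u‖ ^ 2 ≤ RCLike.re ⟪G u, R (G u)⟫_ℂ ∧
      t * RCLike.re ⟪G u, R (G u)⟫_ℂ ≤ ‖R (G u)‖ ^ 2
    have h1 : ∀ w : H, RCLike.re ⟪w, (t : ℂ) • G u⟫_ℂ = t * RCLike.re ⟪w, G u⟫_ℂ := by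
      intro w
      rw [inner_smul_right]
      exact Complex.re_ofReal_mul _ _
    constructor
    · have h2 := hpos g (fun s _ => le_max_right _ _) (G u)
      rw [← hG, ← hGG, inner_sub_right, map_sub, h1, inner_self_eq_norm_sq] at h2
      linarith
    · have h2 := hpos (fun s => s * g s) (fun s hs => mul_nonneg (hspec s hs) (le_max_right _ _))
        (G u)
      have h3 : cfc (fun s => s * g s) R (G u) = R (G (G u)) := by
        rw [← cfc_apply_cfc R (fun s => s) g continuous_id hgc, cfc_id' ℝ R]
      rw [h3, ← hRsym, ← hGG, inner_sub_right, map_sub, h1, inner_self_eq_norm_sq, hRsym] at h2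
      linarith
  · intro r hr v hv
    have hrt : ((r - t : ℝ) : ℂ) ≠ 0 := by exact_mod_cast (sub_pos.2 hr).ne'
    have h1 : G (G v) = ((r - t : ℝ) : ℂ) • G v := by
      rw [← hGG, hcomm, hv, map_smul, ← sub_smul]
      push_cast
      rfl
    set u := v - ((r - t : ℝ) : ℂ)⁻¹ • G v with hu
    have h2 : G u = 0 := by
      rw [hu, map_sub, map_smul, h1, inv_smul_smul₀ hrt, sub_self]
    have h3 : R u = (r : ℂ) • u := by
      rw [hu, map_sub, map_smul, hcomm, hv, map_smul, smul_sub, smul_comm]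
    have h4 := hneg u h2
    rw [h3, inner_smul_right, inner_self_eq_norm_sq_to_K] at h4
    have h5 : RCLike.re ((r : ℂ) * ((RCLike.ofReal ‖u‖ : ℂ)) ^ 2) = r * ‖u‖ ^ 2 := by
      have : ((r : ℂ) * ((RCLike.ofReal ‖u‖ : ℂ)) ^ 2) = ((r * ‖u‖ ^ 2 : ℝ) : ℂ) := by
        push_cast; rfl
      rw [this]
      exact Complex.ofReal_re _
    rw [h5] at h4
    have h6 : ‖u‖ ^ 2 = 0 := by nlinarith [sq_nonneg ‖u‖]
    have h7 : u = 0 := by simpa using h6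
    rw [hu, sub_eq_zero] at h7
    rw [h7, ← map_smul]
    exact ⟨_, rfl⟩
  · rintro _ ⟨u, rfl⟩
    exact ⟨R u, (hcomm u).symm⟩
  · intro r hr w hw
    rw [hker] at hw
    -- On the kernel of G the operator r - R coincides with r - R + G, whose symbol is at least r -
    -- t > 0. The latter is therefore invertible on the whole space, and commutation with G keeps
    -- the solution in the kernel.
    have hqc : Continuous fun s => (r - s) + g s := by fun_prop
    have hQ : IsUnit (cfc (fun s => (r - s) + g s) R) := by
      refine isUnit_cfc _ R hqc.continuousOn hRs fun s _ => ?_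
      have : 0 < (r - s) + g s := by
        have := le_max_left (s - t) 0
        simp only [hg]
        linarith
      exact this.ne'
    have hQ' : ∀ v, cfc (fun s => (r - s) + g s) R v = (r : ℂ) • v - R v + G v := by
      intro v
      have e1 : cfc (fun s => (r - s) + g s) R = cfc (fun s => g s - (s - r)) R := by
        congr 1; ext s; ring
      rw [e1, cfc_sub g _ R hgc.continuousOn (by fun_prop), sub_apply, cfc_sub_const_apply hRs]
      abel
    obtain ⟨f, hf⟩ := (ContinuousLinearMap.isUnit_iff_bijective.1 hQ).2 w
    have hGf : G f = 0 := by
      have e2 : cfc (fun s => (r - s) + g s) R (G f) = 0 := by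
        rw [hG, cfc_apply_cfc R _ _ hqc hgc]
        have : (fun s => (r - s + g s) * g s) = fun s => g s * (r - s + g s) := by
          ext s; ring
        rw [this, ← cfc_apply_cfc R _ _ hgc hqc, hf, ← hG, hw]
      exact (ContinuousLinearMap.isUnit_iff_bijective.1 hQ).1 (by rw [e2, map_zero])
    refine ⟨f, (hker f).2 hGf, ?_⟩
    rw [hQ', hGf, add_zero] at hf
    exact hf

/-- The spectral subspace of the resolvent above `t` has dimension at least `n` if the
spectral number is below `t⁻¹ - c`. -/
lemma le_rank_upper_subspace {R : H →L[ℂ] H} (h : IsShiftedInverse A R c) {t : ℝ} (ht : 0 < t)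
    {Y : Submodule ℂ H}
    (hY2 : ∀ r : ℝ, t < r → ∀ v, R v = (r : ℂ) • v → v ∈ Y)
    (hY3 : ∀ v ∈ Y, R v ∈ Y)
    (hY4 : ∀ r : ℝ, t < r → ∀ w ∈ Yᗮ, ∃ f ∈ Yᗮ, (r : ℂ) • f - R f = w)
    {n : ℕ} (hlt : spectralNumber A n < ((t⁻¹ - c : ℝ) : EReal)) :
    (n : Cardinal) ≤ Module.rank ℂ Y := by
  have hE : ∀ z : ℝ, 0 < z + c → z < t⁻¹ - c → t < (z + c)⁻¹ := by
    intro z hz hzt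
    rw [lt_inv_comm₀ ht hz]
    linarith
  have heig : ∀ z : ℝ, z < t⁻¹ - c → eigenspace A z ≤ Y := by
    intro z hz v hv
    by_cases h0 : v = 0
    · rw [h0]; exact Y.zero_mem
    have hp := h.pos_of_mem_eigenspace hv h0
    exact hY2 _ (hE z hp hz) v ((h.mem_eigenspace_iff_of_pos hp).1 hv)
  -- Were dim Y < n, then Y would be finite-dimensional, and since r - R is onto on Yᗮ for r > t,
  -- the spectrum of A below t⁻¹ - c would consist of finitely many eigenvalues with eigenvectors in
  -- Y. The essential spectrum then starts at t⁻¹ - c or later, and fewer than n eigenvalues lie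
  -- below: neither branch of the definition allows the assumed inequality.
  by_contra hcon
  have hrk := not_le.1 hcon
  have : FiniteDimensional ℂ Y :=
    Module.rank_lt_aleph0_iff.1 (hrk.trans Cardinal.natCast_lt_aleph0)
  -- spectral points below the threshold are eigenvalues
  have hev : ∀ z ∈ spectrum A, z < t⁻¹ - c → eigenspace A z ≠ ⊥ := by
    intro z hz hzt hbot
    obtain ⟨hp, hsp⟩ := h.mem_spectrum_iff.1 hz
    set r := (z + c)⁻¹ with hr
    have htr : t < r := hE z hp hzt
    apply (_root_.spectrum.mem_iff.1 hsp)
    rw [ContinuousLinearMap.isUnit_iff_bijective]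
    have happ : ∀ v, (algebraMap ℝ (H →L[ℂ] H) r - R) v = (r : ℂ) • v - R v := by
      intro v
      simp [Algebra.algebraMap_eq_smul_one]
    have hinj : ∀ v, (r : ℂ) • v - R v = 0 → v = 0 := by
      intro v hv
      have : v ∈ eigenspace A z := by
        rw [h.mem_eigenspace_iff_of_pos hp]
        exact (sub_eq_zero.1 hv).symm
      rw [hbot] at this
      simpa using this
    constructor
    · rw [injective_iff_map_eq_zero]
      intro v hv
      exact hinj v (by rw [← happ, hv])
    · intro w
      set T : Y →ₗ[ℂ] Y := (r : ℂ) • LinearMap.id - (R : H →ₗ[ℂ] H).restrict hY3 with hT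
      have hTi : Function.Injective T := by
        rw [injective_iff_map_eq_zero]
        intro v hv
        have := congrArg (Subtype.val) hv
        exact Subtype.ext (hinj v this)
      have hTs := LinearMap.surjective_of_injective hTi
      obtain ⟨y, hy⟩ := hTs (Y.orthogonalProjectionOnto w)
      obtain ⟨f, -, hf⟩ := hY4 r htr (w - Y.orthogonalProjectionOnto w)
        (Submodule.sub_starProjection_mem_orthogonal w)
      refine ⟨y + f, ?_⟩
      rw [happ, smul_add, map_add]
      have hy' : (r : ℂ) • (y : H) - R y = Y.orthogonalProjectionOnto w :=
        congrArg Subtype.val hy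
      calc (r : ℂ) • (y : H) + (r : ℂ) • f - (R y + R f)
          = ((r : ℂ) • (y : H) - R y) + ((r : ℂ) • f - R f) := by abel
        _ = w := by rw [hy', hf]; abel
  -- there are finitely many of them
  have hfin : {z | z ∈ spectrum A ∧ z < t⁻¹ - c}.Finite := by
    set T : Module.End ℂ Y := (R : H →ₗ[ℂ] H).restrict hY3 with hT
    have hTfin := Module.End.finite_hasEigenvalue T
    refine Set.Finite.of_finite_image (f := fun z : ℝ => (((z + c)⁻¹ : ℝ) : ℂ))
      (hTfin.subset ?_) ?_
    · rintro _ ⟨z, ⟨hz, hzt⟩, rfl⟩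
      obtain ⟨v, hv, hv0⟩ := (Submodule.ne_bot_iff _).1 (hev z hz hzt)
      have hp := h.pos_of_mem_eigenspace hv hv0
      have hvY := heig z hzt hv
      refine Module.End.hasEigenvalue_of_hasEigenvector (x := (⟨v, hvY⟩ : Y)) ⟨?_, ?_⟩
      · rw [Module.End.mem_eigenspace_iff]
        exact Subtype.ext ((h.mem_eigenspace_iff_of_pos hp).1 hv)
      · exact fun h0 => hv0 (congrArg Subtype.val h0)
    · intro z _ w _ hzw
      have := Complex.ofReal_injective hzw
      have := inv_injective this
      linarith
  have hess : ∀ s ∈ essentialSpectrum A, t⁻¹ - c ≤ s := by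
    rintro s ⟨hs, hnd⟩
    by_contra hlt'
    push Not at hlt'
    apply hnd
    refine ⟨hev s hs hlt', Submodule.finiteDimensional_of_le (heig s hlt'), ?_⟩
    have hcl : IsClosed ({z | z ∈ spectrum A ∧ z < t⁻¹ - c} \ {s}) := (hfin.sdiff).isClosed
    have ho : IsOpen (({z | z ∈ spectrum A ∧ z < t⁻¹ - c} \ {s})ᶜ ∩ Iio (t⁻¹ - c)) :=
      hcl.isOpen_compl.inter isOpen_Iio
    obtain ⟨r, hr, hr'⟩ := Metric.isOpen_iff.1 ho s ⟨by simp, hlt'⟩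
    refine ⟨r, hr, fun w hw hws => ?_⟩
    have h1 := hr' (by rwa [Metric.mem_ball, Real.dist_eq] : w ∈ Metric.ball s r)
    by_contra hne
    exact h1.1 ⟨⟨hw, h1.2⟩, hne⟩
  unfold spectralNumber at hlt
  split_ifs at hlt with hlev
  · obtain ⟨_, ⟨E, hE1, rfl⟩, hE2⟩ := sInf_lt_iff.1 hlt
    have hE3 : E < t⁻¹ - c := EReal.coe_lt_coe_iff.1 hE2
    refine hcon (hE1.2.trans (Submodule.rank_mono ?_))
    exact iSup₂_le fun z hz => heig z (hz.trans_lt hE3)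
  · obtain ⟨_, ⟨s, hs, rfl⟩, hs2⟩ := sInf_lt_iff.1 hlt
    exact absurd (hess s hs) (not_le.2 (EReal.coe_lt_coe_iff.1 hs2))

/-- The trial vectors are J* f with f in the spectral subspace of R above t = (E + c)⁻¹. Since ‖J*
f‖² = ⟪f, R f⟫ and ‖J J* f‖² = ‖R f‖², the inequality R² ≥ t R on that subspace is exactly the bound
on the quotient. -/
lemma exists_trial_of_pos {J : X →L[ℂ] H} (h : IsShiftedInverse A (J ∘L J.adjoint) c)
    {n : ℕ} {E : ℝ} (hE : 0 < E + c) (hlt : spectralNumber A n < (E : EReal)) :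
    ∃ B : (Fin n → ℂ) →ₗ[ℂ] X, ∀ x, x ≠ 0 →
      J (B x) ≠ 0 ∧ ‖B x‖ ^ 2 ≤ (E + c) * ‖J (B x)‖ ^ 2 := by
  set R : H →L[ℂ] H := J ∘L J.adjoint with hR
  set t := (E + c)⁻¹ with ht
  have ht0 : 0 < t := inv_pos.2 hE
  obtain ⟨Y, hY1, hY2, hY3, hY4⟩ := exists_upper_subspace h.pos ht0
  have hrk := h.le_rank_upper_subspace ht0 hY2 hY3 hY4 (n := n) (by rw [ht]; simpa using hlt)
  obtain ⟨s, hs, hli⟩ := le_rank_iff_exists_linearIndependent_finset.1 hrk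
  set e : Fin n ≃ s := (finCongr hs.symm).trans s.equivFin.symm
  have hli' : LinearIndependent ℂ (fun i : Fin n => ((e i : Y))) := hli.comp _ e.injective
  set C : (Fin n → ℂ) →ₗ[ℂ] Y := Fintype.linearCombination ℂ (fun i : Fin n => ((e i : Y)))
  have hCi : Function.Injective C := hli'.fintypeLinearCombination_injective
  refine ⟨(J.adjoint : H →ₗ[ℂ] X) ∘ₗ Y.subtype ∘ₗ C, fun x hx => ?_⟩
  have hCx : C x ≠ 0 := fun h0 => hx (hCi (by rw [h0, map_zero]))
  set f : H := ((C x : Y) : H) with hf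
  have hf0 : 0 < ‖f‖ := norm_pos_iff.2 (fun h0 => hCx (Subtype.ext h0))
  obtain ⟨h1, h2⟩ := hY1 f (C x).2
  change J (J.adjoint f) ≠ 0 ∧ ‖J.adjoint f‖ ^ 2 ≤ (E + c) * ‖J (J.adjoint f)‖ ^ 2
  have h3 : J (J.adjoint f) = R f := rfl
  have h4 : ‖J.adjoint f‖ ^ 2 = RCLike.re ⟪f, R f⟫_ℂ := by
    rw [← @inner_self_eq_norm_sq ℂ, ContinuousLinearMap.adjoint_inner_left]
    rfl
  rw [h3, h4]
  constructor
  · intro h0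
    rw [h0, inner_zero_right, map_zero] at h1
    have : 0 < t * ‖f‖ ^ 2 := by positivity
    linarith
  · rw [ht, inv_mul_le_iff₀ hE] at h2
    exact h2

/-- Lower bound in the min-max principle, with trial vectors in a form core. -/
theorem exists_trial {J : X →L[ℂ] H} (h : IsShiftedInverse A (J ∘L J.adjoint) c)
    {X₀ : Submodule ℂ X} (hX₀ : Dense (X₀ : Set X))
    {n : ℕ} (hn : 1 ≤ n) {E : ℝ} (hlt : spectralNumber A n < (E : EReal)) :
    ∃ B : (Fin n → ℂ) →ₗ[ℂ] X, (∀ x, B x ∈ X₀) ∧ ∀ x, x ≠ 0 →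
      J (B x) ≠ 0 ∧ ‖B x‖ ^ 2 ≤ (E + c) * ‖J (B x)‖ ^ 2 := by
  -- The slack E - E' turns the bounds into strict ones, which survive a perturbation into the dense
  -- subspace.
  obtain ⟨E', hE1, hE2⟩ := EReal.lt_iff_exists_real_btwn.1 hlt
  have hE2' : E' < E := EReal.coe_lt_coe_iff.1 hE2
  have hone : (fun _ : Fin n => (1 : ℂ)) ≠ 0 := fun h0 => one_ne_zero (congrFun h0 ⟨0, hn⟩)
  have hpos : 0 < E' + c := by
    by_contra hle
    push Not at hle
    -- otherwise there are trial vectors with arbitrarily small quotient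
    set e := (‖J‖ ^ 2 + 1)⁻¹ with he
    have he0 : 0 < e := by positivity
    obtain ⟨B, hB⟩ := h.exists_trial_of_pos (n := n) (E := e - c) (by simpa using he0)
      (hE1.trans_le (EReal.coe_le_coe_iff.2 (by linarith)))
    obtain ⟨h1, h2⟩ := hB _ hone
    set p := B (fun _ : Fin n => (1 : ℂ))
    -- The bound ‖p‖² ≤ e ‖J p‖² is impossible for p ≠ 0, because e ‖J‖² < 1.
    have h3 : ‖J p‖ ^ 2 ≤ ‖J‖ ^ 2 * ‖p‖ ^ 2 := by
      rw [← mul_pow]; gcongr; exact J.le_opNorm p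
    have h4 : 0 < ‖p‖ ^ 2 := by
      have : p ≠ 0 := fun h0 => h1 (by rw [h0, map_zero])
      have := norm_pos_iff.2 this
      positivity
    rw [sub_add_cancel, he, le_inv_mul_iff₀ (by positivity)] at h2
    nlinarith
  obtain ⟨B', hB'⟩ := h.exists_trial_of_pos hpos hE1
  -- perturb into the core
  set F : (Fin n → X) → (Fin n → ℂ) → ℝ := fun p x =>
    (E + c) * ‖J (∑ i, x i • p i)‖ ^ 2 - ‖∑ i, x i • p i‖ ^ 2 with hF
  have hFc : Continuous fun q : (Fin n → X) × (Fin n → ℂ) => F q.1 q.2 := by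
    simp only [hF]
    fun_prop
  set p₀ : Fin n → X := fun i => B' (Pi.single i 1) with hp₀
  have hsum : ∀ x, ∑ i, x i • p₀ i = B' x := by
    intro x
    simp only [hp₀, ← map_smul, ← map_sum]
    congr 1
    ext j
    simp [Finset.sum_apply, Pi.single_apply]
  have hp₀F : ∀ x ∈ Metric.sphere (0 : Fin n → ℂ) 1, 0 < F p₀ x := by
    intro x hx
    have hx0 : x ≠ 0 := by
      rintro rfl
      simp at hx
    obtain ⟨h1, h2⟩ := hB' x hx0
    have h3 : 0 < ‖J (B' x)‖ ^ 2 := by have := norm_pos_iff.2 h1; positivity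
    simp only [hF, hsum]
    nlinarith
  -- Compactness of the unit sphere of coefficients makes the strict inequality stable under small
  -- changes of all n basis vectors at once; homogeneity then gives every x ≠ 0.
  have hev : ∀ᶠ p in nhds p₀, ∀ x ∈ Metric.sphere (0 : Fin n → ℂ) 1, 0 < F p x := by
    apply (isCompact_sphere _ _).eventually_forall_of_forall_eventually
    intro x hx
    exact (hFc.continuousAt (x := (p₀, x))).eventually (lt_mem_nhds (hp₀F x hx))
  have hd : Dense (Set.pi univ fun _ : Fin n => (X₀ : Set X)) :=
    dense_pi univ fun _ _ => hX₀
  obtain ⟨p, hp, hpX⟩ := (hd.inter_nhds_nonempty hev)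
  refine ⟨Fintype.linearCombination ℂ p, fun x => ?_, fun x hx => ?_⟩
  · rw [Fintype.linearCombination_apply]
    exact X₀.sum_mem fun i _ => X₀.smul_mem _ (hp i (mem_univ i))
  · rw [Fintype.linearCombination_apply]
    have hx0 : 0 < ‖x‖ := norm_pos_iff.2 hx
    have h1 := hpX (((‖x‖⁻¹ : ℝ) : ℂ) • x) (by
      simp [norm_smul, hx0.ne'])
    have h2 : ∑ i, (((‖x‖⁻¹ : ℝ) : ℂ) • x) i • p i = ((‖x‖⁻¹ : ℝ) : ℂ) • ∑ i, x i • p i := by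
      rw [Finset.smul_sum]
      simp [smul_smul]
    simp only [hF, h2, map_smul, norm_smul, mul_pow] at h1
    have h3 : 0 < ‖((‖x‖⁻¹ : ℝ) : ℂ)‖ ^ 2 := by
      rw [Complex.norm_real]
      have : 0 < ‖‖x‖⁻¹‖ := by simpa using hx
      positivity
    have h4 : 0 < (E + c) * ‖J (∑ i, x i • p i)‖ ^ 2 - ‖∑ i, x i • p i‖ ^ 2 := by
      refine (mul_pos_iff_of_pos_left h3).1 ?_
      linarith
    constructor
    · intro h0
      rw [h0, norm_zero] at h4
      have := sq_nonneg ‖∑ i, x i • p i‖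
      linarith
    · linarith

end IsShiftedInverse

end OperatorGraph

/-! ### Operators of closed forms as shifted inverses -/

namespace OperatorGraph

section FormSpace

variable {H L : Type*} [NormedAddCommGroup H] [InnerProductSpace ℂ H] [CompleteSpace H]
  [NormedAddCommGroup L] [InnerProductSpace ℂ L] [CompleteSpace L]

/-- The pair `(h, F)` is mapped to `(M⁻¹ h, F)`. -/
def formEquiv (L : Type*) [NormedAddCommGroup L] [InnerProductSpace ℂ L] (M : H ≃L[ℂ] H) :
    WithLp 2 (H × L) ≃L[ℂ] H × L :=
  (WithLp.prodContinuousLinearEquiv 2 ℂ H L).trans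
    (M.symm.prodCongr (ContinuousLinearEquiv.refl ℂ L))

lemma formEquiv_apply (M : H ≃L[ℂ] H) (p : WithLp 2 (H × L)) :
    formEquiv L M p = (M.symm p.fst, p.snd) := rfl

/-- The form domain with the inner product `⟪Mψ, Mφ⟫ + ⟪∇ψ, ∇φ⟫`. -/
def formSpace (M : H ≃L[ℂ] H) (D : Submodule ℂ (H × L)) : Submodule ℂ (WithLp 2 (H × L)) :=
  D.comap ((formEquiv L M : WithLp 2 (H × L) →L[ℂ] H × L) : WithLp 2 (H × L) →ₗ[ℂ] H × L)

lemma mem_formSpace {M : H ≃L[ℂ] H} {D : Submodule ℂ (H × L)} {p : WithLp 2 (H × L)} :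
    p ∈ formSpace M D ↔ (M.symm p.fst, p.snd) ∈ D := Iff.rfl

lemma isClosed_formSpace (M : H ≃L[ℂ] H) {D : Submodule ℂ (H × L)}
    (hD : IsClosed (D : Set (H × L))) : IsClosed (formSpace M D : Set (WithLp 2 (H × L))) :=
  hD.preimage (formEquiv L M).continuous

/-- The embedding of the form domain. -/
def formEmbedding (M : H ≃L[ℂ] H) (D : Submodule ℂ (H × L)) : formSpace M D →L[ℂ] H :=
  (ContinuousLinearMap.fst ℂ H L ∘L (formEquiv L M : WithLp 2 (H × L) →L[ℂ] H × L)) ∘L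
    (formSpace M D).subtypeL

lemma formEmbedding_apply (M : H ≃L[ℂ] H) (D : Submodule ℂ (H × L)) (p : formSpace M D) :
    formEmbedding M D p = M.symm (p : WithLp 2 (H × L)).fst := rfl

instance (M : H ≃L[ℂ] H) (D : Submodule ℂ (H × L)) :
    CompleteSpace (formSpace M D.topologicalClosure) :=
  (isClosed_formSpace M D.isClosed_topologicalClosure).completeSpace_coe

/-- M is a square root of V + c, so the inner product of the form space is the form of A + c. By
definition J* h represents the functional q ↦ ⟪J q, h⟫ in this inner product, hence J J* (f + c ψ) =
ψ is the weak equation for A ψ = f. The gradient F is recovered as the second component of J* (f + c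
ψ). -/
lemma isShiftedInverse_form {M : H ≃L[ℂ] H} {Vop : H →L[ℂ] H} {c : ℝ}
    (hM : ∀ a b : H, ⟪M a, M b⟫_ℂ = ⟪a, Vop b + (c : ℂ) • b⟫_ℂ) {D : Submodule ℂ (H × L)}
    {A : Submodule ℂ (H × H)}
    (hA : ∀ ψ f, (ψ, f) ∈ A ↔
      ∃ F : L, (ψ, F) ∈ D.topologicalClosure ∧ ∀ q ∈ D.topologicalClosure,
        ⟪q.2, F⟫_ℂ = ⟪q.1, f - Vop ψ⟫_ℂ) :
    IsShiftedInverse A (formEmbedding M D.topologicalClosure ∘L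
      (formEmbedding M D.topologicalClosure).adjoint) c := by
  set J := formEmbedding M D.topologicalClosure with hJ
  refine ⟨ContinuousLinearMap.isPositive_self_comp_adjoint J, fun ψ f => ?_⟩
  rw [hA]
  change _ ↔ J (J.adjoint (f + (c : ℂ) • ψ)) = ψ
  have hinner : ∀ p q : formSpace M D.topologicalClosure,
      ⟪p, q⟫_ℂ = ⟪(p : WithLp 2 (H × L)).fst, (q : WithLp 2 (H × L)).fst⟫_ℂ +
        ⟪(p : WithLp 2 (H × L)).snd, (q : WithLp 2 (H × L)).snd⟫_ℂ := fun p q =>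
    WithLp.prod_inner_apply _ _
  constructor
  · rintro ⟨F, hF, hq⟩
    set p : formSpace M D.topologicalClosure :=
      ⟨WithLp.toLp 2 (M ψ, F), by rw [mem_formSpace]; simpa using hF⟩ with hp
    have : J.adjoint (f + (c : ℂ) • ψ) = p := by
      refine ext_inner_left ℂ fun q => ?_
      rw [ContinuousLinearMap.adjoint_inner_right, hinner, hJ, formEmbedding_apply]
      have h1 : ⟪(q : WithLp 2 (H × L)).snd, F⟫_ℂ =
          ⟪M.symm (q : WithLp 2 (H × L)).fst, f - Vop ψ⟫_ℂ := hq _ (mem_formSpace.1 q.2)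
      have h2 := hM (M.symm (q : WithLp 2 (H × L)).fst) ψ
      rw [ContinuousLinearEquiv.apply_symm_apply] at h2
      change _ = ⟪(q : WithLp 2 (H × L)).fst, M ψ⟫_ℂ + ⟪(q : WithLp 2 (H × L)).snd, F⟫_ℂ
      rw [h1, h2, ← inner_add_right]
      congr 1
      abel
    rw [this, hJ, formEmbedding_apply]
    simp [hp]
  · intro h
    set p := J.adjoint (f + (c : ℂ) • ψ) with hp
    have hψ : (p : WithLp 2 (H × L)).fst = M ψ := by
      rw [← h, hJ, formEmbedding_apply, ContinuousLinearEquiv.apply_symm_apply]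
    refine ⟨(p : WithLp 2 (H × L)).snd, ?_, fun q hq => ?_⟩
    · have := mem_formSpace.1 p.2
      rwa [hψ, ContinuousLinearEquiv.symm_apply_apply] at this
    · set q' : formSpace M D.topologicalClosure :=
        ⟨WithLp.toLp 2 (M q.1, q.2), by rw [mem_formSpace]; simpa using hq⟩ with hq'
      have h1 : ⟪q', p⟫_ℂ = ⟪J q', f + (c : ℂ) • ψ⟫_ℂ := by
        rw [hp, ContinuousLinearMap.adjoint_inner_right]
      rw [hinner, hψ, hJ, formEmbedding_apply] at h1
      change ⟪M q.1, M ψ⟫_ℂ + ⟪q.2, (p : WithLp 2 (H × L)).snd⟫_ℂ =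
        ⟪M.symm (M q.1), f + (c : ℂ) • ψ⟫_ℂ at h1
      rw [hM, ContinuousLinearEquiv.symm_apply_apply, inner_add_right, inner_add_right] at h1
      rw [inner_sub_right]
      linear_combination h1

/-- Min-max, upper bound, for the operator of the form `‖∇ψ‖² + ⟪ψ, Vψ⟫`. -/
theorem spectralNumber_le_of_form {M : H ≃L[ℂ] H} {Vop : H →L[ℂ] H} {c : ℝ}
    (hM : ∀ a b : H, ⟪M a, M b⟫_ℂ = ⟪a, Vop b + (c : ℂ) • b⟫_ℂ) {D : Submodule ℂ (H × L)}
    {A : Submodule ℂ (H × H)}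
    (hA : ∀ ψ f, (ψ, f) ∈ A ↔
      ∃ F : L, (ψ, F) ∈ D.topologicalClosure ∧ ∀ q ∈ D.topologicalClosure,
        ⟪q.2, F⟫_ℂ = ⟪q.1, f - Vop ψ⟫_ℂ)
    {n : ℕ} (hn : 1 ≤ n) {E : ℝ} (B : (Fin n → ℂ) →ₗ[ℂ] H × L) (hBD : ∀ x, B x ∈ D)
    (hB : ∀ x, x ≠ 0 → (B x).1 ≠ 0 ∧
      ‖(B x).2‖ ^ 2 + ‖M (B x).1‖ ^ 2 ≤ (E + c) * ‖(B x).1‖ ^ 2) :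
    spectralNumber A n ≤ (E : EReal) := by
  have hBs : ∀ x, (formEquiv L M).symm (B x) ∈ formSpace M D.topologicalClosure := by
    intro x
    change formEquiv L M ((formEquiv L M).symm (B x)) ∈ D.topologicalClosure
    rw [ContinuousLinearEquiv.apply_symm_apply]
    exact D.le_topologicalClosure (hBD x)
  refine (isShiftedInverse_form hM hA).spectralNumber_le hn
    (LinearMap.codRestrict _ (((formEquiv L M).symm : H × L →L[ℂ] WithLp 2 (H × L)).toLinearMap ∘ₗ B)
      hBs) fun x hx => ?_
  obtain ⟨h1, h2⟩ := hB x hx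
  have e1 : ∀ q : formSpace M D.topologicalClosure, (q : WithLp 2 (H × L)) =
      (formEquiv L M).symm (B x) → formEmbedding M D.topologicalClosure q = (B x).1 := by
    intro q hq
    rw [formEmbedding_apply, hq]
    exact congrArg Prod.fst ((formEquiv L M).apply_symm_apply (B x))
  have e2 : ∀ q : formSpace M D.topologicalClosure, (q : WithLp 2 (H × L)) =
      (formEquiv L M).symm (B x) → ‖q‖ ^ 2 = ‖(B x).2‖ ^ 2 + ‖M (B x).1‖ ^ 2 := by
    intro q hq
    have h3 := (formEquiv L M).apply_symm_apply (B x)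
    rw [← hq, formEquiv_apply] at h3
    rw [← h3, ContinuousLinearEquiv.apply_symm_apply, add_comm]
    exact WithLp.prod_norm_sq_eq_of_L2 _
  rw [e1 _ rfl, e2 _ rfl]
  exact ⟨h1, h2⟩

/-- Min-max, lower bound, for the operator of the form `‖∇ψ‖² + ⟪ψ, Vψ⟫`. -/
theorem exists_trial_of_form {M : H ≃L[ℂ] H} {Vop : H →L[ℂ] H} {c : ℝ}
    (hM : ∀ a b : H, ⟪M a, M b⟫_ℂ = ⟪a, Vop b + (c : ℂ) • b⟫_ℂ) {D : Submodule ℂ (H × L)}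
    {A : Submodule ℂ (H × H)}
    (hA : ∀ ψ f, (ψ, f) ∈ A ↔
      ∃ F : L, (ψ, F) ∈ D.topologicalClosure ∧ ∀ q ∈ D.topologicalClosure,
        ⟪q.2, F⟫_ℂ = ⟪q.1, f - Vop ψ⟫_ℂ)
    {n : ℕ} (hn : 1 ≤ n) {E : ℝ} (hlt : spectralNumber A n < (E : EReal)) :
    ∃ B : (Fin n → ℂ) →ₗ[ℂ] H × L, (∀ x, B x ∈ D) ∧ ∀ x, x ≠ 0 → (B x).1 ≠ 0 ∧
      ‖(B x).2‖ ^ 2 + ‖M (B x).1‖ ^ 2 ≤ (E + c) * ‖(B x).1‖ ^ 2 := by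
  -- Trial vectors are wanted in D itself and not only in its closure; D is a form core because
  -- `formEquiv` is a homeomorphism.
  set X₀ : Submodule ℂ (formSpace M D.topologicalClosure) :=
    (formSpace M D).comap (formSpace M D.topologicalClosure).subtype with hX₀
  have hd : Dense (X₀ : Set (formSpace M D.topologicalClosure)) := by
    rw [Subtype.dense_iff]
    have e : (formEquiv L M).toHomeomorph ⁻¹' (D : Set (H × L)) ⊆
        Subtype.val '' (X₀ : Set (formSpace M D.topologicalClosure)) := fun p hp =>
      ⟨⟨p, D.le_topologicalClosure hp⟩, hp, rfl⟩
    refine Subset.trans ?_ (closure_mono e)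
    rw [← (formEquiv L M).toHomeomorph.preimage_closure (D : Set (H × L))]
    intro p hp
    exact hp
  obtain ⟨B, hB1, hB2⟩ := (isShiftedInverse_form hM hA).exists_trial hd hn hlt
  refine ⟨((formEquiv L M : WithLp 2 (H × L) →L[ℂ] H × L).toLinearMap ∘ₗ
    (formSpace M D.topologicalClosure).subtype) ∘ₗ B, fun x => hB1 x, fun x hx => ?_⟩
  obtain ⟨h1, h2⟩ := hB2 x hx
  refine ⟨h1, ?_⟩
  change ‖(B x : WithLp 2 (H × L)).snd‖ ^ 2 + ‖M (M.symm (B x : WithLp 2 (H × L)).fst)‖ ^ 2 ≤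
    (E + c) * ‖formEmbedding M D.topologicalClosure (B x)‖ ^ 2
  rw [ContinuousLinearEquiv.apply_symm_apply, add_comm]
  refine le_trans (le_of_eq ?_) h2
  exact (WithLp.prod_norm_sq_eq_of_L2 _).symm

end FormSpace

/-! ### Bounded potentials -/

section Multiplication

open scoped ENNReal

variable {Ω : Type*} [MeasurableSpace Ω] {μ : Measure Ω}

/-- Multiplication by an essentially bounded real function. -/
def mulOp (m : Ω → ℝ) (hm : MemLp (fun x => (m x : ℂ)) ∞ μ) : Lp ℂ 2 μ →L[ℂ] Lp ℂ 2 μ :=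
  (ContinuousLinearMap.mul ℂ ℂ).holderL μ ∞ 2 2 (hm.toLp _)

lemma coeFn_mulOp (m : Ω → ℝ) (hm : MemLp (fun x => (m x : ℂ)) ∞ μ) (f : Lp ℂ 2 μ) :
    mulOp m hm f =ᵐ[μ] fun x => (m x : ℂ) * f x := by
  have h1 := (ContinuousLinearMap.mul ℂ ℂ).coeFn_holder (r := 2) (hm.toLp _) f
  filter_upwards [h1, hm.coeFn_toLp] with x hx hx2
  change ((ContinuousLinearMap.mul ℂ ℂ).holder 2 (hm.toLp _) f) x = _
  rw [hx, hx2]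
  rfl

lemma inner_mulOp_left (m : Ω → ℝ) (hm : MemLp (fun x => (m x : ℂ)) ∞ μ) (f g : Lp ℂ 2 μ) :
    ⟪mulOp m hm f, g⟫_ℂ = ⟪f, mulOp m hm g⟫_ℂ := by
  rw [L2.inner_def, L2.inner_def]
  apply integral_congr_ae
  filter_upwards [coeFn_mulOp m hm f, coeFn_mulOp m hm g] with x h1 h2
  rw [h1, h2]
  simp only [RCLike.inner_apply, map_mul, Complex.conj_ofReal]
  ring

lemma norm_sq_eq_integral {E : Type*} [NormedAddCommGroup E] [InnerProductSpace ℂ E]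
    (f : Lp E 2 μ) : ‖f‖ ^ 2 = ∫ x, ‖f x‖ ^ 2 ∂μ := by
  have h := @inner_self_eq_norm_sq ℂ _ _ _ _ f
  rw [← h, L2.inner_def]
  have : ∀ x, ⟪f x, f x⟫_ℂ = ((‖f x‖ ^ 2 : ℝ) : ℂ) := by
    intro x
    rw [inner_self_eq_norm_sq_to_K]
    push_cast
    rfl
  simp_rw [this]
  rw [integral_complex_ofReal]
  exact Complex.ofReal_re _

lemma integrable_norm_sq {E : Type*} [NormedAddCommGroup E] (f : Lp E 2 μ) :
    Integrable (fun x => ‖f x‖ ^ 2) μ :=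
  (memLp_two_iff_integrable_sq_norm (Lp.memLp f).1).1 (Lp.memLp f)

/-- A bounded potential, shifted to be positive, as the square of an invertible operator. -/
lemma exists_sqrt_potential {V : Ω → ℝ} (hV : AEStronglyMeasurable V μ) {b : ℝ}
    (hb : ∀ᵐ x ∂μ, |V x| ≤ b) (hVm : MemLp (fun x => (V x : ℂ)) ∞ μ) :
    ∃ M : Lp ℂ 2 μ ≃L[ℂ] Lp ℂ 2 μ,
      (∀ f g, ⟪M f, M g⟫_ℂ = ⟪f, mulOp V hVm g + ((b + 1 : ℝ) : ℂ) • g⟫_ℂ) ∧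
      ∀ f, ‖M f‖ ^ 2 = ∫ x, V x * ‖f x‖ ^ 2 ∂μ + (b + 1) * ‖f‖ ^ 2 := by
  -- The shift b + 1, rather than b, makes V + b + 1 ≥ 1, so that the square root has a bounded
  -- inverse.
  set m : Ω → ℝ := fun x => √(V x + (b + 1)) with hmdef
  have hmm : AEStronglyMeasurable m μ :=
    Real.continuous_sqrt.comp_aestronglyMeasurable (hV.add aestronglyMeasurable_const)
  have hm1 : ∀ᵐ x ∂μ, 1 ≤ m x := by
    filter_upwards [hb] with x hx
    rw [hmdef, Real.one_le_sqrt]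
    have := (abs_le.1 hx).1
    linarith
  have hm2 : ∀ᵐ x ∂μ, m x * m x = V x + (b + 1) := by
    filter_upwards [hb] with x hx
    refine Real.mul_self_sqrt ?_
    have := (abs_le.1 hx).1
    linarith
  have hmL : MemLp (fun x => (m x : ℂ)) ∞ μ := by
    refine memLp_top_of_bound (Complex.continuous_ofReal.comp_aestronglyMeasurable hmm)
      (2 * b + 1) ?_
    filter_upwards [hm1, hm2, hb] with x h1 h2 h3
    rw [Complex.norm_real, Real.norm_of_nonneg (by linarith)]
    have := (abs_le.1 h3).2
    nlinarith
  have hiL : MemLp (fun x => (((m x)⁻¹ : ℝ) : ℂ)) ∞ μ := by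
    refine memLp_top_of_bound (Complex.continuous_ofReal.comp_aestronglyMeasurable
      hmm.aemeasurable.inv.aestronglyMeasurable) 1 ?_
    filter_upwards [hm1] with x h1
    rw [Complex.norm_real, Real.norm_of_nonneg (by positivity)]
    exact inv_le_one_of_one_le₀ h1
  have hcancel : ∀ f, mulOp _ hiL (mulOp m hmL f) = f := by
    intro f
    apply Lp.ext
    filter_upwards [coeFn_mulOp _ hiL (mulOp m hmL f), coeFn_mulOp m hmL f, hm1] with x h1 h2 h3
    have : (m x : ℂ) ≠ 0 := by
      have : m x ≠ 0 := by linarith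
      exact_mod_cast this
    rw [h1, h2, Complex.ofReal_inv, inv_mul_cancel_left₀ this]
  have hcancel' : ∀ f, mulOp m hmL (mulOp _ hiL f) = f := by
    intro f
    apply Lp.ext
    filter_upwards [coeFn_mulOp m hmL (mulOp _ hiL f), coeFn_mulOp _ hiL f, hm1] with x h1 h2 h3
    have : (m x : ℂ) ≠ 0 := by
      have : m x ≠ 0 := by linarith
      exact_mod_cast this
    rw [h1, h2, Complex.ofReal_inv, mul_inv_cancel_left₀ this]
  have hsq : ∀ g, mulOp m hmL (mulOp m hmL g) = mulOp V hVm g + ((b + 1 : ℝ) : ℂ) • g := by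
    intro g
    apply Lp.ext
    filter_upwards [coeFn_mulOp m hmL (mulOp m hmL g), coeFn_mulOp m hmL g, hm2,
      coeFn_mulOp V hVm g, Lp.coeFn_add (mulOp V hVm g) (((b + 1 : ℝ) : ℂ) • g),
      Lp.coeFn_smul ((b + 1 : ℝ) : ℂ) g] with x h1 h2 h3 h4 h5 h6
    rw [h1, h2, h5, Pi.add_apply, h4, h6, Pi.smul_apply, smul_eq_mul, ← mul_assoc, ← add_mul,
      ← Complex.ofReal_mul, h3, Complex.ofReal_add]
  refine ⟨ContinuousLinearEquiv.equivOfInverse (mulOp m hmL) (mulOp _ hiL) hcancel hcancel',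
    fun f g => ?_, fun f => ?_⟩
  · change ⟪mulOp m hmL f, mulOp m hmL g⟫_ℂ = _
    rw [inner_mulOp_left, hsq]
  · change ‖mulOp m hmL f‖ ^ 2 = _
    rw [norm_sq_eq_integral, norm_sq_eq_integral, ← integral_const_mul, ← integral_add]
    · apply integral_congr_ae
      filter_upwards [coeFn_mulOp m hmL f, hm2] with x h1 h2
      rw [h1, norm_mul, mul_pow, Complex.norm_real, Real.norm_eq_abs, sq_abs, sq, h2]
      ring
    · exact (integrable_norm_sq f).bdd_mul hV hb
    · exact (integrable_norm_sq f).const_mul _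

variable {L : Type*} [NormedAddCommGroup L] [InnerProductSpace ℂ L] [CompleteSpace L]

/-- A bounded potential does not change the domain: the intermediate value g is forced to be f - V
ψ. -/
lemma mem_addPotential_iff {V : Ω → ℝ} (hVm : MemLp (fun x => (V x : ℂ)) ∞ μ)
    {D : Submodule ℂ (Lp ℂ 2 μ × L)} (ψ f : Lp ℂ 2 μ) :
    (ψ, f) ∈ addPotential (ofGradient D) V ↔
      ∃ F : L, (ψ, F) ∈ D ∧ ∀ q ∈ D, ⟪q.2, F⟫_ℂ = ⟪q.1, f - mulOp V hVm ψ⟫_ℂ := by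
  change (∃ g : Lp ℂ 2 μ, (∃ F : L, (ψ, F) ∈ D ∧ ∀ q ∈ D, ⟪q.2, F⟫_ℂ = ⟪q.1, g⟫_ℂ) ∧
    f =ᵐ[μ] fun x => g x + (V x : ℂ) * ψ x) ↔ _
  have key : ∀ g : Lp ℂ 2 μ, (f =ᵐ[μ] fun x => g x + (V x : ℂ) * ψ x) ↔
      g = f - mulOp V hVm ψ := by
    intro g
    rw [eq_sub_iff_add_eq, eq_comm (b := f)]
    constructor
    · intro h
      apply Lp.ext
      filter_upwards [h, Lp.coeFn_add g (mulOp V hVm ψ), coeFn_mulOp V hVm ψ] with x h1 h2 h3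
      rw [h1, h2, Pi.add_apply, h3]
    · intro h
      rw [h]
      filter_upwards [Lp.coeFn_add g (mulOp V hVm ψ), coeFn_mulOp V hVm ψ] with x h2 h3
      rw [h2, Pi.add_apply, h3]
  simp_rw [key]
  constructor
  · rintro ⟨g, h, rfl⟩
    exact h
  · intro h
    exact ⟨_, h, rfl⟩

/-- Min-max, upper bound, for `∇* ∇ + V`. -/
theorem spectralNumber_addPotential_le {V : Ω → ℝ} (hV : AEStronglyMeasurable V μ) {b : ℝ}
    (hb : ∀ᵐ x ∂μ, |V x| ≤ b) (D : Submodule ℂ (Lp ℂ 2 μ × L)) {n : ℕ} (hn : 1 ≤ n) {E : ℝ}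
    (B : (Fin n → ℂ) →ₗ[ℂ] Lp ℂ 2 μ × L) (hBD : ∀ x, B x ∈ D)
    (hB : ∀ x, x ≠ 0 → (B x).1 ≠ 0 ∧
      ‖(B x).2‖ ^ 2 + ∫ y, V y * ‖(B x).1 y‖ ^ 2 ∂μ ≤ E * ‖(B x).1‖ ^ 2) :
    spectralNumber (addPotential (ofGradient D.topologicalClosure) V) n ≤ (E : EReal) := by
  have hVm : MemLp (fun x => (V x : ℂ)) ∞ μ := by
    refine memLp_top_of_bound (Complex.continuous_ofReal.comp_aestronglyMeasurable hV) b ?_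
    filter_upwards [hb] with x hx
    rwa [Complex.norm_real, Real.norm_eq_abs]
  obtain ⟨M, hM1, hM2⟩ := exists_sqrt_potential hV hb hVm
  refine spectralNumber_le_of_form hM1 (mem_addPotential_iff hVm) hn B hBD fun x hx => ?_
  obtain ⟨h1, h2⟩ := hB x hx
  refine ⟨h1, ?_⟩
  rw [hM2, add_mul]
  linarith

/-- Min-max, lower bound, for `∇* ∇ + V`. -/
theorem exists_trial_of_spectralNumber_lt {V : Ω → ℝ} (hV : AEStronglyMeasurable V μ) {b : ℝ}
    (hb : ∀ᵐ x ∂μ, |V x| ≤ b) (D : Submodule ℂ (Lp ℂ 2 μ × L)) {n : ℕ} (hn : 1 ≤ n) {E : ℝ}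
    (hlt : spectralNumber (addPotential (ofGradient D.topologicalClosure) V) n < (E : EReal)) :
    ∃ B : (Fin n → ℂ) →ₗ[ℂ] Lp ℂ 2 μ × L, (∀ x, B x ∈ D) ∧ ∀ x, x ≠ 0 → (B x).1 ≠ 0 ∧
      ‖(B x).2‖ ^ 2 + ∫ y, V y * ‖(B x).1 y‖ ^ 2 ∂μ ≤ E * ‖(B x).1‖ ^ 2 := by
  have hVm : MemLp (fun x => (V x : ℂ)) ∞ μ := by
    refine memLp_top_of_bound (Complex.continuous_ofReal.comp_aestronglyMeasurable hV) b ?_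
    filter_upwards [hb] with x hx
    rwa [Complex.norm_real, Real.norm_eq_abs]
  obtain ⟨M, hM1, hM2⟩ := exists_sqrt_potential hV hb hVm
  obtain ⟨B, hB1, hB2⟩ := exists_trial_of_form hM1 (mem_addPotential_iff hVm) hn hlt
  refine ⟨B, hB1, fun x hx => ?_⟩
  obtain ⟨h1, h2⟩ := hB2 x hx
  refine ⟨h1, ?_⟩
  rw [hM2, add_mul] at h2
  linarith

/-- With this the Dirichlet-Neumann Laplacian is the case V = 0 of the results with a potential. -/
lemma addPotential_zero (A : Submodule ℂ (Lp ℂ 2 μ × Lp ℂ 2 μ)) :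
    addPotential A (fun _ => 0) = A := by
  ext ⟨ψ, f⟩
  change (∃ g : Lp ℂ 2 μ, (ψ, g) ∈ A ∧ f =ᵐ[μ] fun x => g x + ((0 : ℝ) : ℂ) * ψ x) ↔ _
  simp only [Complex.ofReal_zero, zero_mul, add_zero]
  constructor
  · rintro ⟨g, hg, h⟩
    rwa [Lp.ext h]
  · intro h
    exact ⟨f, h, Filter.EventuallyEq.rfl⟩

end Multiplication

end OperatorGraph

/-! ### The transverse Dirichlet-Neumann problem on the unit interval -/

namespace Transverse

open intervalIntegral

/-- The normalized first eigenfunction of the Dirichlet-Neumann Laplacian on `(0, 1)`. -/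
def chi (t : ℝ) : ℝ := √2 * Real.sin (Real.pi / 2 * t)

/-- The derivative of `chi`. -/
def dchi (t : ℝ) : ℝ := √2 * (Real.pi / 2 * Real.cos (Real.pi / 2 * t))

lemma hasDerivAt_chi (t : ℝ) : HasDerivAt chi (dchi t) t := by
  have h := ((hasDerivAt_id t).const_mul (Real.pi / 2)).sin.const_mul √2
  refine h.congr_deriv ?_
  simp only [dchi, id]
  ring

lemma hasDerivAt_dchi (t : ℝ) : HasDerivAt dchi (-((Real.pi / 2) ^ 2 * chi t)) t := by
  have h := (((hasDerivAt_id t).const_mul (Real.pi / 2)).cos.const_mul (Real.pi / 2)).const_mul √2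
  refine h.congr_deriv ?_
  simp only [chi, id]
  ring

lemma continuous_chi : Continuous chi := by unfold chi; fun_prop

lemma continuous_dchi : Continuous dchi := by unfold dchi; fun_prop

lemma chi_zero : chi 0 = 0 := by simp [chi]

lemma dchi_one : dchi 1 = 0 := by simp [dchi]

lemma chi_one_sq : chi 1 ^ 2 = 2 := by simp [chi]

/-- Jordan's inequality. It says that the weight χ² degenerates at the Dirichlet end no faster than
2 t², which drives the weighted Poincaré inequality. -/
lemma le_chi {t : ℝ} (ht0 : 0 ≤ t) (ht1 : t ≤ 1) : √2 * t ≤ chi t := by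
  unfold chi
  gcongr
  have h := Real.mul_le_sin (x := Real.pi / 2 * t) (by positivity) (by nlinarith [Real.pi_pos])
  have : 2 / Real.pi * (Real.pi / 2 * t) = t := by field_simp
  linarith

lemma chi_pos {t : ℝ} (ht0 : 0 < t) (ht1 : t ≤ 1) : 0 < chi t :=
  lt_of_lt_of_le (by positivity) (le_chi ht0.le ht1)

lemma chi_nonneg {t : ℝ} (ht : t ∈ Icc (0 : ℝ) 1) : 0 ≤ chi t :=
  le_trans (by have := ht.1; positivity) (le_chi ht.1 ht.2)

lemma dchi_nonneg {t : ℝ} (ht : t ∈ Icc (0 : ℝ) 1) : 0 ≤ dchi t := by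
  unfold dchi
  have : 0 ≤ Real.cos (Real.pi / 2 * t) :=
    Real.cos_nonneg_of_mem_Icc ⟨by nlinarith [ht.1, Real.pi_pos], by nlinarith [ht.2, Real.pi_pos]⟩
  positivity

lemma chi_le {t : ℝ} (ht0 : 0 ≤ t) : chi t ≤ √2 * (Real.pi / 2) * t := by
  unfold chi
  rw [mul_assoc]
  gcongr
  exact Real.sin_le (by positivity)

lemma chi_mul_dchi_le {t : ℝ} (ht : t ∈ Icc (0 : ℝ) 1) : chi t * dchi t ≤ 5 * t := by
  have h1 := chi_le ht.1
  have h2 : dchi t ≤ √2 * (Real.pi / 2) := by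
    unfold dchi
    have := Real.cos_le_one (Real.pi / 2 * t)
    gcongr
    nlinarith [Real.pi_pos]
  calc chi t * dchi t ≤ (√2 * (Real.pi / 2) * t) * (√2 * (Real.pi / 2)) :=
        mul_le_mul h1 h2 (dchi_nonneg ht) (by have := ht.1; positivity)
    _ = (√2 * √2) * (Real.pi ^ 2 / 4) * t := by ring
    _ = 2 * (Real.pi ^ 2 / 4) * t := by rw [Real.mul_self_sqrt (by norm_num)]
    _ ≤ 5 * t := by
        have h3 : Real.pi ^ 2 ≤ 10 := by nlinarith [Real.pi_lt_d2, Real.pi_pos]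
        have := ht.1
        nlinarith

lemma chi_sq_le {t : ℝ} (ht : t ∈ Icc (0 : ℝ) 1) : chi t ^ 2 ≤ 5 * t ^ 2 := by
  have h1 := chi_le ht.1
  calc chi t ^ 2 ≤ (√2 * (Real.pi / 2) * t) ^ 2 := by
        have := chi_nonneg ht; gcongr
    _ = (√2 ^ 2) * (Real.pi ^ 2 / 4) * t ^ 2 := by ring
    _ = 2 * (Real.pi ^ 2 / 4) * t ^ 2 := by rw [Real.sq_sqrt (by norm_num)]
    _ ≤ 5 * t ^ 2 := by
        have h3 : Real.pi ^ 2 ≤ 10 := by nlinarith [Real.pi_lt_d2, Real.pi_pos]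
        nlinarith [sq_nonneg t]

lemma chi_sq_le' {t : ℝ} (ht : t ∈ Icc (0 : ℝ) 1) : chi t ^ 2 ≤ 5 * t := by
  have h1 := chi_sq_le ht
  nlinarith [ht.1, ht.2]

/-- The integrand is the derivative of χ²/2. The value one is the reason why the effective potential
is κ/ε with coefficient one. -/
lemma integral_chi_mul_dchi : ∫ t in (0 : ℝ)..1, chi t * dchi t = 1 := by
  have h : ∀ t ∈ uIcc (0 : ℝ) 1, HasDerivAt (fun t => chi t ^ 2 / 2) (chi t * dchi t) t := by
    intro t _
    refine (((hasDerivAt_chi t).pow 2).div_const 2).congr_deriv ?_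
    simp
    ring
  rw [integral_eq_sub_of_hasDerivAt h
    ((continuous_chi.mul continuous_dchi).intervalIntegrable _ _), chi_one_sq, chi_zero]
  norm_num

lemma dchi_sq_add (t : ℝ) : (Real.pi / 2) ^ 2 * chi t ^ 2 + dchi t ^ 2 = 2 * (Real.pi / 2) ^ 2 := by
  have h : √2 ^ 2 = 2 := Real.sq_sqrt (by norm_num)
  unfold chi dchi
  calc _ = √2 ^ 2 * (Real.pi / 2) ^ 2 *
        (Real.sin (Real.pi / 2 * t) ^ 2 + Real.cos (Real.pi / 2 * t) ^ 2) := by ring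
    _ = _ := by rw [Real.sin_sq_add_cos_sq, h]; ring

/-- The primitive comes from (χ χ')' = χ'² - (π/2)² χ² together with the conservation law
`dchi_sq_add`. -/
lemma integral_chi_sq : ∫ t in (0 : ℝ)..1, chi t ^ 2 = 1 := by
  have h : ∀ t ∈ uIcc (0 : ℝ) 1, HasDerivAt
      (fun t => t - chi t * dchi t / (2 * (Real.pi / 2) ^ 2)) (chi t ^ 2) t := by
    intro t _
    refine ((hasDerivAt_id t).sub
      (((hasDerivAt_chi t).mul (hasDerivAt_dchi t)).div_const _)).congr_deriv ?_
    have h1 := dchi_sq_add t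
    have hpi : (Real.pi / 2) ^ 2 ≠ 0 := by positivity
    have h2 : dchi t * dchi t + chi t * -((Real.pi / 2) ^ 2 * chi t) =
      2 * (Real.pi / 2) ^ 2 - 2 * (Real.pi / 2) ^ 2 * chi t ^ 2 := by nlinarith
    rw [h2]
    field_simp
    ring
  rw [integral_eq_sub_of_hasDerivAt h ((continuous_chi.pow 2).intervalIntegrable _ _), chi_zero,
    dchi_one]
  norm_num

/-- For x > 0 and A > 0 the choice l = x / (2A) turns the hypothesis into x/2 ≤ 2AB/x. This recovers
the Cauchy-Schwarz inequality for integrals from Young's inequality for the integrands. The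
degenerate cases are separate because the sign of B is not given. -/
lemma le_of_forall_young {x A B : ℝ} (hx : 0 ≤ x) (hA : 0 ≤ A)
    (h : ∀ l : ℝ, 0 < l → x ≤ l * A + B / l) : x ^ 2 ≤ 4 * A * B := by
  rcases hx.eq_or_lt with rfl | hx
  · have h1 := h 1 one_pos
    rcases hA.eq_or_lt with rfl | hA
    · simp
    · by_contra hneg
      push Not at hneg
      have hB : B < 0 := by nlinarith
      have h2 := h (√(-B / (2 * A))) (by apply Real.sqrt_pos.2; apply div_pos <;> linarith)
      set l := √(-B / (2 * A)) with hl
      have hl0 : 0 < l := by rw [hl]; apply Real.sqrt_pos.2; apply div_pos <;> linarith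
      have hl2 : l ^ 2 = -B / (2 * A) := Real.sq_sqrt (by apply div_nonneg <;> linarith)
      have h3 : 0 ≤ (l * A + B / l) * l := mul_nonneg h2 hl0.le
      have h4 : (l * A + B / l) * l = l ^ 2 * A + B := by field_simp
      rw [h4, hl2] at h3
      have h5 : -B / (2 * A) * A = -B / 2 := by field_simp
      linarith
  · rcases hA.eq_or_lt with rfl | hA
    · have h2 := h ((2 * |B| + 1) / x) (by positivity)
      have h3 : B / ((2 * |B| + 1) / x) < x := by
        rw [div_div_eq_mul_div, div_lt_iff₀ (by positivity)]
        nlinarith [le_abs_self B, abs_nonneg B]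
      linarith
    · have h2 := h (x / (2 * A)) (by positivity)
      have h3 : x / (2 * A) * A = x / 2 := by field_simp
      have h4 : B / (x / (2 * A)) = 2 * A * B / x := by field_simp
      rw [h3, h4] at h2
      have h5 : x / 2 ≤ 2 * A * B / x := by linarith
      rw [le_div_iff₀ hx] at h5
      nlinarith

/-! ### A weighted Poincaré inequality -/

section Poincare

variable {f f' : ℝ → ℂ}

/-- Pointwise oscillation bound by the weighted energy. -/
lemma norm_sub_sq_le (hf : ∀ t ∈ Icc (0 : ℝ) 1, HasDerivAt f (f' t) t)
    (hf' : ContinuousOn f' (Icc 0 1)) {s t : ℝ} (hs : 0 < s) (hst : s ≤ t) (ht : t ≤ 1) :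
    ‖f t - f s‖ ^ 2 ≤ (∫ r in (0 : ℝ)..1, chi r ^ 2 * ‖f' r‖ ^ 2) / s := by
  set D := ∫ r in (0 : ℝ)..1, chi r ^ 2 * ‖f' r‖ ^ 2 with hD
  have hcont : ContinuousOn (fun r => chi r ^ 2 * ‖f' r‖ ^ 2) (Icc 0 1) :=
    (continuous_chi.pow 2).continuousOn.mul (hf'.norm.pow 2)
  have hD0 : 0 ≤ D := integral_nonneg zero_le_one fun r _ => by positivity
  have hsub : Icc s t ⊆ Icc 0 1 := Icc_subset_Icc hs.le ht
  have hint : ∀ {F : ℝ → ℂ}, ContinuousOn F (Icc 0 1) → IntervalIntegrable F volume s t :=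
    fun hF => (hF.mono hsub).intervalIntegrable_of_Icc hst
  have hintr : ∀ {F : ℝ → ℝ}, ContinuousOn F (Icc s t) → IntervalIntegrable F volume s t :=
    fun hF => hF.intervalIntegrable_of_Icc hst
  have hDst : ∫ r in s..t, chi r ^ 2 * ‖f' r‖ ^ 2 ≤ D := by
    rw [hD]
    exact integral_mono_interval hs.le hst ht (Filter.Eventually.of_forall fun r => by
      change 0 ≤ chi r ^ 2 * ‖f' r‖ ^ 2; positivity)
      (hcont.intervalIntegrable_of_Icc zero_le_one)
  have hinv : ContinuousOn (fun r : ℝ => (r ^ 2)⁻¹) (Icc s t) :=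
    (continuousOn_id.pow 2).inv₀ fun r hr => by
      have : 0 < r := hs.trans_le hr.1
      exact pow_ne_zero 2 this.ne'
  have hint2 : ∫ r in s..t, (r ^ 2)⁻¹ ≤ s⁻¹ := by
    have h : ∀ r ∈ uIcc s t, HasDerivAt (fun r : ℝ => -r⁻¹) ((r ^ 2)⁻¹) r := by
      intro r hr
      rw [uIcc_of_le hst] at hr
      have : r ≠ 0 := (hs.trans_le hr.1).ne'
      exact ((hasDerivAt_inv this).neg).congr_deriv (by simp)
    rw [integral_eq_sub_of_hasDerivAt h (hintr hinv)]
    have : 0 < t⁻¹ := inv_pos.2 (hs.trans_le hst)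
    linarith
  -- Young's inequality ‖f'‖ ≤ l r² ‖f'‖² + 1/(4 l r²), then 2 r² ≤ χ² in the first term and ∫ r⁻² ≤
  -- 1/s in the second.
  have hmain : ∀ l : ℝ, 0 < l → ‖f t - f s‖ ≤ l * (D / 2) + (s⁻¹ / 4) / l := by
    intro l hl
    have h1 : ∫ r in s..t, f' r = f t - f s :=
      integral_eq_sub_of_hasDerivAt (fun r hr => hf r (hsub (by rwa [uIcc_of_le hst] at hr)))
        (hint hf')
    rw [← h1]
    calc ‖∫ r in s..t, f' r‖ ≤ ∫ r in s..t, ‖f' r‖ := norm_integral_le_integral_norm hst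
      _ ≤ ∫ r in s..t, (l / 2 * (chi r ^ 2 * ‖f' r‖ ^ 2) + 1 / (4 * l) * (r ^ 2)⁻¹) := by
          refine integral_mono_on hst (hintr (hf'.mono hsub).norm)
            ((hintr ((hcont.mono hsub).const_mul _)).add (hintr (hinv.const_mul _))) ?_
          intro r hr
          have hr0 : 0 < r := hs.trans_le hr.1
          have h2 : 2 * r ^ 2 ≤ chi r ^ 2 := by
            have h3 := le_chi hr0.le (hr.2.trans ht)
            calc 2 * r ^ 2 = (√2 * r) ^ 2 := by rw [mul_pow, Real.sq_sqrt (by norm_num)]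
              _ ≤ _ := by gcongr
          have h4 : l * r ^ 2 * ‖f' r‖ ^ 2 + 1 / (4 * l) * (r ^ 2)⁻¹ - ‖f' r‖ =
              (1 / (l * r ^ 2)) * (l * r ^ 2 * ‖f' r‖ - 1 / 2) ^ 2 := by
            field_simp
            ring
          have h5 : 0 ≤ (1 / (l * r ^ 2)) * (l * r ^ 2 * ‖f' r‖ - 1 / 2) ^ 2 := by positivity
          have h6 : l / 2 * (2 * r ^ 2 * ‖f' r‖ ^ 2) ≤ l / 2 * (chi r ^ 2 * ‖f' r‖ ^ 2) := by
            gcongr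
          nlinarith
      _ = l / 2 * (∫ r in s..t, chi r ^ 2 * ‖f' r‖ ^ 2) + 1 / (4 * l) * ∫ r in s..t, (r ^ 2)⁻¹ := by
          rw [intervalIntegral.integral_add (hintr ((hcont.mono hsub).const_mul _))
            (hintr (hinv.const_mul _)), intervalIntegral.integral_const_mul,
            intervalIntegral.integral_const_mul]
      _ ≤ l / 2 * D + 1 / (4 * l) * s⁻¹ := by gcongr
      _ = _ := by field_simp
  have := le_of_forall_young (norm_nonneg _) (by positivity) hmain
  calc ‖f t - f s‖ ^ 2 ≤ 4 * (D / 2) * (s⁻¹ / 4) := this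
    _ = D / 2 / s := by field_simp
    _ ≤ D / s := by gcongr; linarith

/-- Pointwise Poincaré inequality with weight. -/
lemma mul_norm_sub_mean_sq_le (hf : ∀ t ∈ Icc (0 : ℝ) 1, HasDerivAt f (f' t) t)
    (hf' : ContinuousOn f' (Icc 0 1)) {t : ℝ} (ht : t ∈ Icc (0 : ℝ) 1) :
    t * ‖f t - ∫ r in (0 : ℝ)..1, (chi r ^ 2 : ℂ) * f r‖ ^ 2 ≤
      100 * ∫ r in (0 : ℝ)..1, chi r ^ 2 * ‖f' r‖ ^ 2 := by
  set D := ∫ r in (0 : ℝ)..1, chi r ^ 2 * ‖f' r‖ ^ 2 with hD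
  have hD0 : 0 ≤ D := integral_nonneg zero_le_one fun r _ => by positivity
  rcases ht.1.eq_or_lt with rfl | ht0
  · simp only [zero_mul]; positivity
  have hfc : ContinuousOn f (Icc 0 1) := fun r hr => (hf r hr).continuousAt.continuousWithinAt
  have hchi : Continuous fun r : ℝ => ((chi r : ℂ) ^ 2) := by
    have := continuous_chi; fun_prop
  -- χ² has mass one, so the deviation from the mean is an average of f(t) - f(r). The weight
  -- satisfies χ(r)² ≤ 5 r², which outweighs the growth of the oscillation bound as r tends to 0.
  have hmean : f t - ∫ r in (0 : ℝ)..1, (chi r ^ 2 : ℂ) * f r =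
      ∫ r in (0 : ℝ)..1, (chi r ^ 2 : ℂ) * (f t - f r) := by
    have h1 : (∫ r in (0 : ℝ)..1, ((chi r : ℂ) ^ 2)) = 1 := by
      have : (fun r : ℝ => ((chi r : ℂ) ^ 2)) = fun r => ((chi r ^ 2 : ℝ) : ℂ) := by
        ext r; push_cast; rfl
      rw [this, intervalIntegral.integral_ofReal, integral_chi_sq]
      simp
    have hI1 : IntervalIntegrable (fun r : ℝ => (chi r : ℂ) ^ 2 * f t) volume 0 1 :=
      (hchi.mul continuous_const).intervalIntegrable _ _
    have hI2 : IntervalIntegrable (fun r : ℝ => (chi r : ℂ) ^ 2 * f r) volume 0 1 :=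
      (hchi.continuousOn.mul hfc).intervalIntegrable_of_Icc zero_le_one
    simp_rw [mul_sub]
    rw [intervalIntegral.integral_sub hI1 hI2, intervalIntegral.integral_mul_const, h1, one_mul]
  have hbound : ‖f t - ∫ r in (0 : ℝ)..1, (chi r ^ 2 : ℂ) * f r‖ ≤ 10 * √(D / t) := by
    rw [hmean]
    have := intervalIntegral.norm_integral_le_of_norm_le_const (a := 0) (b := 1)
      (f := fun r : ℝ => (chi r ^ 2 : ℂ) * (f t - f r)) (C := 10 * √(D / t)) ?_
    · simpa using this
    intro r hr
    rw [uIoc_of_le zero_le_one] at hr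
    have hr' : r ∈ Icc (0 : ℝ) 1 := ⟨hr.1.le, hr.2⟩
    rw [norm_mul, norm_pow, Complex.norm_real, Real.norm_of_nonneg (chi_nonneg hr')]
    have h1 := chi_sq_le hr'
    have h2 : r * ‖f t - f r‖ ≤ √(D / t) := by
      apply Real.le_sqrt_of_sq_le
      rw [mul_pow]
      rcases le_total r t with h | h
      · have h3 := norm_sub_sq_le hf hf' hr.1 h ht.2
        rw [← hD] at h3
        calc r ^ 2 * ‖f t - f r‖ ^ 2 ≤ r ^ 2 * (D / r) := by gcongr
          _ = r * D := by have := hr.1.ne'; field_simp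
          _ ≤ 1 * D := by gcongr; exact hr.2
          _ ≤ D / t := by rw [one_mul, le_div_iff₀ ht0]; nlinarith [ht.2]
      · have h3 := norm_sub_sq_le hf hf' ht0 h hr.2
        rw [← hD, norm_sub_rev] at h3
        calc r ^ 2 * ‖f t - f r‖ ^ 2 ≤ 1 ^ 2 * (D / t) := by
              gcongr
              exacts [hr.1.le, hr.2]
          _ = _ := by ring
    calc chi r ^ 2 * ‖f t - f r‖ ≤ 5 * r ^ 2 * ‖f t - f r‖ := by gcongr
      _ = 5 * r * (r * ‖f t - f r‖) := by ring
      _ ≤ 5 * 1 * √(D / t) := by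
          gcongr
          exacts [by have := hr.1.le; positivity, hr.2]
      _ ≤ 10 * √(D / t) := by gcongr; norm_num
  calc t * ‖f t - ∫ r in (0 : ℝ)..1, (chi r ^ 2 : ℂ) * f r‖ ^ 2
      ≤ t * (10 * √(D / t)) ^ 2 := by gcongr
    _ = 100 * (t * (√(D / t)) ^ 2) := by ring
    _ = 100 * D := by
        rw [Real.sq_sqrt (by positivity)]
        field_simp

end Poincare

/-- The ground state representation of the transverse energy. -/
lemma integral_energy {f f' : ℝ → ℂ} (hf : ∀ t ∈ Icc (0 : ℝ) 1, HasDerivAt f (f' t) t)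
    (hf' : ContinuousOn f' (Icc 0 1)) {ρ ρ' : ℝ → ℝ}
    (hρ : ∀ t ∈ Icc (0 : ℝ) 1, HasDerivAt ρ (ρ' t) t) (hρ' : ContinuousOn ρ' (Icc 0 1)) :
    ∫ t in (0 : ℝ)..1, (‖(dchi t : ℂ) * f t + chi t * f' t‖ ^ 2 -
        (Real.pi / 2) ^ 2 * ‖(chi t : ℂ) * f t‖ ^ 2) * ρ t =
      (∫ t in (0 : ℝ)..1, chi t ^ 2 * ‖f' t‖ ^ 2 * ρ t) -
        ∫ t in (0 : ℝ)..1, chi t * dchi t * ρ' t * ‖f t‖ ^ 2 := by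
  have hfc : ContinuousOn f (Icc 0 1) := fun r hr => (hf r hr).continuousAt.continuousWithinAt
  have hρc : ContinuousOn ρ (Icc 0 1) := fun r hr => (hρ r hr).continuousAt.continuousWithinAt
  have hc := continuous_chi.continuousOn (s := Icc (0 : ℝ) 1)
  have hdc := continuous_dchi.continuousOn (s := Icc (0 : ℝ) 1)
  -- F vanishes at both ends since χ(0) = 0 and χ'(1) = 0, so F' integrates to zero. The integrands
  -- on the two sides differ by exactly F'.
  set F : ℝ → ℝ := fun t => chi t * dchi t * ρ t * ‖f t‖ ^ 2 with hF
  set F' : ℝ → ℝ := fun t => (dchi t * dchi t + chi t * -((Real.pi / 2) ^ 2 * chi t)) * ρ t *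
    ‖f t‖ ^ 2 + chi t * dchi t * ρ' t * ‖f t‖ ^ 2 +
    chi t * dchi t * ρ t * (2 * ⟪f t, f' t⟫_ℝ) with hF'
  have hder : ∀ t ∈ uIcc (0 : ℝ) 1, HasDerivAt F (F' t) t := by
    intro t ht
    rw [uIcc_of_le zero_le_one] at ht
    have h1 := ((hasDerivAt_chi t).mul (hasDerivAt_dchi t)).mul (hρ t ht)
    have h2 := (hf t ht).norm_sq
    refine (h1.mul h2).congr_deriv ?_
    simp only [hF', Pi.mul_apply]
    ring
  have hF'c : ContinuousOn F' (Icc 0 1) := by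
    have hi : ContinuousOn (fun t => ⟪f t, f' t⟫_ℝ) (Icc 0 1) :=
      ContinuousOn.inner hfc hf'
    simp only [hF']
    fun_prop
  have h0 : ∫ t in (0 : ℝ)..1, F' t = 0 := by
    rw [integral_eq_sub_of_hasDerivAt hder (hF'c.intervalIntegrable_of_Icc zero_le_one)]
    simp [hF, chi_zero, dchi_one]
  have hi1 : IntervalIntegrable (fun t => chi t ^ 2 * ‖f' t‖ ^ 2 * ρ t) volume 0 1 :=
    ContinuousOn.intervalIntegrable_of_Icc zero_le_one (by fun_prop)
  have hi2 : IntervalIntegrable (fun t => chi t * dchi t * ρ' t * ‖f t‖ ^ 2) volume 0 1 :=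
    ContinuousOn.intervalIntegrable_of_Icc zero_le_one (by fun_prop)
  have hi3 : IntervalIntegrable F' volume 0 1 := hF'c.intervalIntegrable_of_Icc zero_le_one
  refine Eq.trans ?_ (add_zero _)
  rw [← intervalIntegral.integral_sub hi1 hi2]
  refine Eq.trans ?_ (congrArg _ h0)
  rw [← intervalIntegral.integral_add (hi1.sub hi2) hi3]
  refine integral_congr fun t _ => ?_
  have e1 : ‖(dchi t : ℂ) * f t + chi t * f' t‖ ^ 2 = dchi t ^ 2 * ‖f t‖ ^ 2 +
      2 * (dchi t * chi t * ⟪f t, f' t⟫_ℝ) + chi t ^ 2 * ‖f' t‖ ^ 2 := by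
    rw [← Complex.real_smul, ← Complex.real_smul, norm_add_sq_real, norm_smul, norm_smul,
      real_inner_smul_left, real_inner_smul_right, mul_pow, mul_pow, Real.norm_eq_abs,
      Real.norm_eq_abs, sq_abs, sq_abs]
    ring
  have e2 : ‖(chi t : ℂ) * f t‖ ^ 2 = chi t ^ 2 * ‖f t‖ ^ 2 := by
    rw [norm_mul, mul_pow, Complex.norm_real, Real.norm_eq_abs, sq_abs]
  simp only [hF', e1, e2]
  ring

set_option maxHeartbeats 1000000 in
/-- Lower bound for the transverse energy, uniformly for weights `ρ = 1 - εκt + O(ε²)`. -/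
theorem exists_energy_lower_bound (a b : ℝ) (ha : 0 ≤ a) (hb : 0 ≤ b) :
    ∃ C : ℝ, 0 ≤ C ∧ ∃ ε₀ : ℝ, 0 < ε₀ ∧ ∀ (ε κ m : ℝ) (ρ ρ' : ℝ → ℝ) (ψ ψ' : ℝ → ℂ),
      0 < ε → ε ≤ ε₀ → |κ| ≤ a → |m| ≤ b / ε →
      (∀ t ∈ Icc (0 : ℝ) 1, HasDerivAt ρ (ρ' t) t) → ContinuousOn ρ' (Icc 0 1) →
      (∀ t ∈ Icc (0 : ℝ) 1, |ρ t - 1| ≤ a * ε) →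
      (∀ t ∈ Icc (0 : ℝ) 1, |ρ' t + ε * κ| ≤ a * ε ^ 2) →
      (∀ t ∈ Icc (0 : ℝ) 1, HasDerivAt ψ (ψ' t) t) → ContinuousOn ψ' (Icc 0 1) →
      (∃ δ > 0, ∀ t < δ, ψ t = 0) →
      (κ / ε - m - C) * ‖∫ t in (0 : ℝ)..1, (chi t : ℂ) * ψ t‖ ^ 2 ≤
        ∫ t in (0 : ℝ)..1, (ε⁻¹ ^ 2 * (‖ψ' t‖ ^ 2 - (Real.pi / 2) ^ 2 * ‖ψ t‖ ^ 2) -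
          m * ‖ψ t‖ ^ 2) * ρ t := by
  -- The total coefficient of the oscillation terms: a + b from τ and a + a b from T ≤ τ.
  set c := 2 * a + b + a * b with hc
  have hc0 : 0 ≤ c := by positivity
  -- The term (100 c)² ‖φ‖² is left over when 100 c ‖φ‖ d is absorbed into d²/4; a and a b multiply
  -- ‖φ‖² directly. The bounds on ε ensure ρ ≥ 1/2, ε ≤ 1, and 500 c ε d² ≤ d²/4.
  refine ⟨(100 * c) ^ 2 + a + a * b, by positivity, min 1 (min (1 / (2 * a + 1)) (1 / (2000 * c + 1))),
    by positivity, ?_⟩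
  intro ε κ m ρ ρ' ψ ψ' hε hε₀ hκ hm hρ hρ'c hρ1 hρ2 hψ hψ'c ⟨δ, hδ, hδψ⟩
  have hε1 : ε ≤ 1 := hε₀.trans (min_le_left _ _)
  have hε2 : a * ε ≤ 1 / 2 := by
    have h1 : ε ≤ 1 / (2 * a + 1) := hε₀.trans ((min_le_right _ _).trans (min_le_left _ _))
    rw [le_div_iff₀ (by positivity)] at h1
    nlinarith
  have hε3 : 2000 * c * ε ≤ 1 := by
    have h1 : ε ≤ 1 / (2000 * c + 1) := hε₀.trans ((min_le_right _ _).trans (min_le_right _ _))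
    rw [le_div_iff₀ (by positivity)] at h1
    nlinarith
  -- factor out the ground state
  set f : ℝ → ℂ := fun t => ψ t / chi t with hf
  -- χ vanishes at 0, so the quotient rule is used only for t ≥ δ/2. For smaller t both ψ and f
  -- vanish near t.
  set f' : ℝ → ℂ := fun t => if t < δ / 2 then 0 else
    (ψ' t * chi t - ψ t * dchi t) / (chi t : ℂ) ^ 2 with hf'
  have hchiC : ∀ t, HasDerivAt (fun t => (chi t : ℂ)) (dchi t : ℂ) t := fun t =>
    (hasDerivAt_chi t).ofReal_comp
  have hne : ∀ t : ℝ, 0 < t → t ≤ 1 → (chi t : ℂ) ≠ 0 := fun t h0 h1 => by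
    exact_mod_cast (chi_pos h0 h1).ne'
  have hfd : ∀ t ∈ Icc (0 : ℝ) 1, HasDerivAt f (f' t) t := by
    intro t ht
    by_cases hlt : t < δ / 2
    · have h0 : f =ᶠ[nhds t] fun _ => 0 := by
        filter_upwards [Iio_mem_nhds (by linarith : t < δ)] with r hr
        simp [hf, hδψ r hr]
      simp only [hf', if_pos hlt]
      exact (hasDerivAt_const t (0 : ℂ)).congr_of_eventuallyEq h0
    · have ht0 : 0 < t := by linarith
      simp only [hf', if_neg hlt]
      exact (hψ t ht).fun_div (hchiC t) (hne t ht0 ht.2)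
  have hψ0 : ∀ t ∈ Icc (0 : ℝ) 1, ψ t = chi t * f t := by
    intro t ht
    rcases ht.1.eq_or_lt with rfl | h0
    · simp [hδψ 0 hδ, chi_zero]
    · simp only [hf]
      rw [mul_div_cancel₀ _ (hne t h0 ht.2)]
  have hψ'0 : ∀ t ∈ Icc (0 : ℝ) 1, ψ' t = dchi t * f t + chi t * f' t := by
    intro t ht
    by_cases hlt : t < δ / 2
    · have h0 : ψ =ᶠ[nhds t] fun _ => 0 := by
        filter_upwards [Iio_mem_nhds (by linarith : t < δ)] with r hr
        simp [hδψ r hr]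
      have h1 : ψ' t = 0 :=
        (hψ t ht).unique ((hasDerivAt_const t (0 : ℂ)).congr_of_eventuallyEq h0)
      simp [h1, hf', hlt, hf, hδψ t (by linarith)]
    · have ht0 : 0 < t := by linarith
      have := hne t ht0 ht.2
      simp only [hf', if_neg hlt, hf]
      field_simp
      ring
  have hf'c : ContinuousOn f' (Icc 0 1) := by
    intro t ht
    by_cases hlt : t < δ / 2
    · have h0 : f' =ᶠ[nhds t] fun _ => 0 := by
        filter_upwards [Iio_mem_nhds hlt] with r hr
        simp only [hf', if_pos (show r < δ / 2 from hr)]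
      exact (continuousAt_const.congr h0.symm).continuousWithinAt
    · have ht0 : 0 < t := by linarith
      have h1 : ContinuousWithinAt (fun t => (ψ' t * chi t - ψ t * dchi t) / (chi t : ℂ) ^ 2)
          (Icc 0 1) t := by
        have e1 : ContinuousWithinAt (fun t : ℝ => (chi t : ℂ)) (Icc 0 1) t :=
          (Complex.continuous_ofReal.comp continuous_chi).continuousWithinAt
        have e2 : ContinuousWithinAt (fun t : ℝ => (dchi t : ℂ)) (Icc 0 1) t :=
          (Complex.continuous_ofReal.comp continuous_dchi).continuousWithinAt
        refine (((hψ'c t ht).mul e1).sub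
          ((hψ t ht).continuousAt.continuousWithinAt.mul e2)).div (e1.pow 2) ?_
        exact pow_ne_zero 2 (hne t ht0 ht.2)
      refine h1.congr_of_eventuallyEq ?_ (by simp only [hf', if_neg hlt])
      filter_upwards [self_mem_nhdsWithin, mem_nhdsWithin_of_mem_nhds (Ioi_mem_nhds ht0)]
        with r hr hr0
      by_cases hlr : r < δ / 2
      · have h0 : ψ =ᶠ[nhds r] fun _ => 0 := by
          filter_upwards [Iio_mem_nhds (by linarith : r < δ)] with r hr
          simp [hδψ r hr]
        have h1 : ψ' r = 0 :=
          (hψ r hr).unique ((hasDerivAt_const r (0 : ℂ)).congr_of_eventuallyEq h0)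
        simp [hf', hlr, h1, hδψ r (by linarith)]
      · simp only [hf', if_neg hlr]
  have hfc : ContinuousOn f (Icc 0 1) := fun r hr => (hfd r hr).continuousAt.continuousWithinAt
  have hρc : ContinuousOn ρ (Icc 0 1) := fun r hr => (hρ r hr).continuousAt.continuousWithinAt
  have hcc := continuous_chi.continuousOn (s := Icc (0 : ℝ) 1)
  have hdc := continuous_dchi.continuousOn (s := Icc (0 : ℝ) 1)
  have hii : ∀ {F : ℝ → ℝ}, ContinuousOn F (Icc 0 1) → IntervalIntegrable F volume 0 1 :=
    fun hF => hF.intervalIntegrable_of_Icc zero_le_one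
  have hφ : ∫ t in (0 : ℝ)..1, (chi t : ℂ) * ψ t = ∫ t in (0 : ℝ)..1, (chi t ^ 2 : ℂ) * f t := by
    refine integral_congr fun t ht => ?_
    rw [uIcc_of_le zero_le_one] at ht
    simp only [hψ0 t ht]
    ring
  rw [hφ]
  set φ := ∫ t in (0 : ℝ)..1, (chi t ^ 2 : ℂ) * f t with hφdef
  set D := ∫ r in (0 : ℝ)..1, chi r ^ 2 * ‖f' r‖ ^ 2 with hD
  have hD0 : 0 ≤ D := integral_nonneg zero_le_one fun r _ => by positivity
  -- From |f|² - |φ|² = 2 ⟪φ, f - φ⟫ + |f - φ|² with t |f - φ| ≤ 10 √D and t |f - φ|² ≤ 100 D. The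
  -- factor 5 t, which dominates both weights χ χ' and χ², accounts for the constants.
  set T := 100 * ‖φ‖ * √D + 500 * D with hT
  have hT0 : 0 ≤ T := by positivity
  have hosc : ∀ t ∈ Icc (0 : ℝ) 1, 5 * t * |‖f t‖ ^ 2 - ‖φ‖ ^ 2| ≤ T := by
    intro t ht
    have h1 := mul_norm_sub_mean_sq_le hfd hf'c ht
    rw [← hφdef, ← hD] at h1
    have h2 : t * ‖f t - φ‖ ≤ 10 * √D := by
      refine (sq_le_sq₀ (mul_nonneg ht.1 (norm_nonneg _)) (by positivity)).1 ?_
      rw [mul_pow, mul_pow, Real.sq_sqrt hD0]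
      have : t * (t * ‖f t - φ‖ ^ 2) ≤ 1 * (100 * D) :=
        mul_le_mul ht.2 h1 (by have := ht.1; positivity) zero_le_one
      nlinarith
    have h3 : ‖f t‖ ^ 2 - ‖φ‖ ^ 2 = 2 * ⟪φ, f t - φ⟫_ℝ + ‖f t - φ‖ ^ 2 := by
      have := norm_add_sq_real φ (f t - φ)
      rw [add_sub_cancel] at this
      linarith
    have h4 : |‖f t‖ ^ 2 - ‖φ‖ ^ 2| ≤ 2 * (‖φ‖ * ‖f t - φ‖) + ‖f t - φ‖ ^ 2 := by
      rw [h3]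
      refine (abs_add_le _ _).trans ?_
      rw [abs_mul, abs_of_nonneg (sq_nonneg ‖f t - φ‖), abs_of_pos (two_pos)]
      gcongr
      exact abs_real_inner_le_norm _ _
    calc 5 * t * |‖f t‖ ^ 2 - ‖φ‖ ^ 2|
        ≤ 5 * t * (2 * (‖φ‖ * ‖f t - φ‖) + ‖f t - φ‖ ^ 2) := by
          have := ht.1
          gcongr
      _ = 10 * ‖φ‖ * (t * ‖f t - φ‖) + 5 * (t * ‖f t - φ‖ ^ 2) := by ring
      _ ≤ 10 * ‖φ‖ * (10 * √D) + 5 * (100 * D) := by gcongr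
      _ = T := by rw [hT]; ring
  -- averages with the two weights of mass one
  have havg : ∀ w : ℝ → ℝ, ContinuousOn w (Icc 0 1) → (∀ t ∈ Icc (0 : ℝ) 1, 0 ≤ w t ∧ w t ≤ 5 * t) →
      ∫ t in (0 : ℝ)..1, w t = 1 → |(∫ t in (0 : ℝ)..1, w t * ‖f t‖ ^ 2) - ‖φ‖ ^ 2| ≤ T := by
    intro w hw hw5 hw1
    have e1 : (∫ t in (0 : ℝ)..1, w t * ‖f t‖ ^ 2) - ‖φ‖ ^ 2 =
        ∫ t in (0 : ℝ)..1, w t * (‖f t‖ ^ 2 - ‖φ‖ ^ 2) := by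
      simp_rw [mul_sub]
      rw [intervalIntegral.integral_sub (hii (by fun_prop)) (hii (by fun_prop)),
        intervalIntegral.integral_mul_const, hw1, one_mul]
    rw [e1]
    have := intervalIntegral.norm_integral_le_of_norm_le_const (a := 0) (b := 1)
      (f := fun t => w t * (‖f t‖ ^ 2 - ‖φ‖ ^ 2)) (C := T) ?_
    · simpa using this
    intro t ht
    rw [uIoc_of_le zero_le_one] at ht
    have ht' : t ∈ Icc (0 : ℝ) 1 := ⟨ht.1.le, ht.2⟩
    rw [Real.norm_eq_abs, abs_mul, abs_of_nonneg (hw5 t ht').1]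
    exact (mul_le_mul_of_nonneg_right (hw5 t ht').2 (abs_nonneg _)).trans (hosc t ht')
  have h1 := havg (fun t => chi t * dchi t) (hcc.mul hdc)
    (fun t ht => ⟨mul_nonneg (chi_nonneg ht) (dchi_nonneg ht), chi_mul_dchi_le ht⟩)
    integral_chi_mul_dchi
  have h2 := havg (fun t => chi t ^ 2) (hcc.pow 2) (fun t ht => ⟨sq_nonneg _, chi_sq_le' ht⟩)
    integral_chi_sq
  set I₁ := ∫ t in (0 : ℝ)..1, chi t * dchi t * ‖f t‖ ^ 2 with hI₁
  set I₂ := ∫ t in (0 : ℝ)..1, chi t ^ 2 * ‖f t‖ ^ 2 with hI₂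
  -- the energy
  have hen : ∫ t in (0 : ℝ)..1, (‖ψ' t‖ ^ 2 - (Real.pi / 2) ^ 2 * ‖ψ t‖ ^ 2) * ρ t =
      (∫ t in (0 : ℝ)..1, chi t ^ 2 * ‖f' t‖ ^ 2 * ρ t) -
        ∫ t in (0 : ℝ)..1, chi t * dchi t * ρ' t * ‖f t‖ ^ 2 := by
    rw [← integral_energy hfd hf'c hρ hρ'c]
    refine integral_congr fun t ht => ?_
    rw [uIcc_of_le zero_le_one] at ht
    simp only [hψ0 t ht, hψ'0 t ht]
  have hk : D / 2 ≤ ∫ t in (0 : ℝ)..1, chi t ^ 2 * ‖f' t‖ ^ 2 * ρ t := by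
    rw [hD, ← intervalIntegral.integral_div]
    refine integral_mono_on zero_le_one (hii (by fun_prop)) (hii (by fun_prop)) fun t ht => ?_
    have h3 := (abs_le.1 (hρ1 t ht)).1
    have h4 : 1 / 2 ≤ ρ t := by linarith
    rw [div_eq_mul_one_div]
    gcongr
  have hp : ε * κ * I₁ - a * ε ^ 2 * I₁ ≤
      -∫ t in (0 : ℝ)..1, chi t * dchi t * ρ' t * ‖f t‖ ^ 2 := by
    rw [hI₁, ← intervalIntegral.integral_const_mul, ← intervalIntegral.integral_const_mul,
      ← intervalIntegral.integral_neg, ← intervalIntegral.integral_sub (hii (by fun_prop))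
        (hii (by fun_prop))]
    refine integral_mono_on zero_le_one (hii (by fun_prop)) (hii (by fun_prop)) fun t ht => ?_
    have h3 := (abs_le.1 (hρ2 t ht)).2
    have h4 : 0 ≤ chi t * dchi t * ‖f t‖ ^ 2 :=
      mul_nonneg (mul_nonneg (chi_nonneg ht) (dchi_nonneg ht)) (sq_nonneg _)
    nlinarith
  have hn : |(∫ t in (0 : ℝ)..1, ‖ψ t‖ ^ 2 * ρ t) - I₂| ≤ a * ε * I₂ := by
    have e1 : (∫ t in (0 : ℝ)..1, ‖ψ t‖ ^ 2 * ρ t) - I₂ =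
        ∫ t in (0 : ℝ)..1, chi t ^ 2 * ‖f t‖ ^ 2 * (ρ t - 1) := by
      have e2 : ∫ t in (0 : ℝ)..1, ‖ψ t‖ ^ 2 * ρ t =
          ∫ t in (0 : ℝ)..1, chi t ^ 2 * ‖f t‖ ^ 2 * ρ t := by
        refine integral_congr fun t ht => ?_
        rw [uIcc_of_le zero_le_one] at ht
        simp only [hψ0 t ht]
        rw [norm_mul, mul_pow, Complex.norm_real, Real.norm_eq_abs, sq_abs]
      rw [e2, hI₂, ← intervalIntegral.integral_sub (hii (by fun_prop)) (hii (by fun_prop))]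
      exact integral_congr fun t _ => by ring
    rw [e1, hI₂, ← intervalIntegral.integral_const_mul]
    refine (abs_integral_le_integral_abs zero_le_one).trans
      (integral_mono_on zero_le_one (hii (by fun_prop)) (hii (by fun_prop)) fun t ht => ?_)
    rw [abs_mul, abs_of_nonneg (by positivity), mul_comm]
    gcongr
    exact hρ1 t ht
  have hψc : ContinuousOn ψ (Icc 0 1) := fun r hr => (hψ r hr).continuousAt.continuousWithinAt
  have hsplit : ∫ t in (0 : ℝ)..1, (ε⁻¹ ^ 2 * (‖ψ' t‖ ^ 2 - (Real.pi / 2) ^ 2 * ‖ψ t‖ ^ 2) -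
          m * ‖ψ t‖ ^ 2) * ρ t =
      ε⁻¹ ^ 2 * (∫ t in (0 : ℝ)..1, (‖ψ' t‖ ^ 2 - (Real.pi / 2) ^ 2 * ‖ψ t‖ ^ 2) * ρ t) -
        m * ∫ t in (0 : ℝ)..1, ‖ψ t‖ ^ 2 * ρ t := by
    rw [← intervalIntegral.integral_const_mul, ← intervalIntegral.integral_const_mul,
      ← intervalIntegral.integral_sub (hii (by fun_prop)) (hii (by fun_prop))]
    exact integral_congr fun t _ => by ring
  rw [hsplit, hen]
  set E₁ := ∫ t in (0 : ℝ)..1, chi t ^ 2 * ‖f' t‖ ^ 2 * ρ t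
  set E₂ := ∫ t in (0 : ℝ)..1, chi t * dchi t * ρ' t * ‖f t‖ ^ 2
  set P := ∫ t in (0 : ℝ)..1, ‖ψ t‖ ^ 2 * ρ t
  set Φ := ‖φ‖ ^ 2 with hΦ
  have hΦ0 : 0 ≤ Φ := sq_nonneg _
  have hE : D / 2 + ε * κ * Φ - a * ε * T - a * ε ^ 2 * (Φ + T) ≤ E₁ - E₂ := by
    have h3 := abs_le.1 h1
    have h4 : |ε * κ * (I₁ - Φ)| ≤ a * ε * T := by
      rw [abs_mul, abs_mul, abs_of_pos hε]
      calc ε * |κ| * |I₁ - Φ| ≤ ε * a * T := by gcongr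
        _ = _ := by ring
    have h5 : a * ε ^ 2 * I₁ ≤ a * ε ^ 2 * (Φ + T) := by gcongr; linarith
    have h6 := (abs_le.1 h4).1
    have h7 : ε * κ * I₁ = ε * κ * Φ + ε * κ * (I₁ - Φ) := by ring
    linarith
  have hP : |P - Φ| ≤ T + a * ε * (Φ + T) := by
    have h3 := abs_le.1 h2
    have h4 : a * ε * I₂ ≤ a * ε * (Φ + T) := by gcongr; linarith
    calc |P - Φ| = |(P - I₂) + (I₂ - Φ)| := by ring_nf
      _ ≤ _ := abs_add_le _ _
      _ ≤ _ := by linarith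
  have hmP : m * P ≤ m * Φ + b / ε * (T + a * ε * (Φ + T)) := by
    have h3 : |m * (P - Φ)| ≤ b / ε * (T + a * ε * (Φ + T)) := by
      rw [abs_mul]
      exact mul_le_mul hm hP (abs_nonneg _) (by positivity)
    have h4 := (abs_le.1 h3).2
    linarith
  -- absorb the error terms
  have hs : √D ^ 2 = D := Real.sq_sqrt hD0
  -- In terms of d the kinetic energy divided by ε² is at least d²/2, while the oscillation errors
  -- are bounded by multiples of ‖φ‖ d and ε d². Both fit into d²/2 at the cost of a constant times
  -- ‖φ‖².
  set d := √D / ε with hd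
  have hsd : √D = d * ε := by rw [hd]; field_simp
  have hDd : D = d ^ 2 * ε ^ 2 := by rw [← hs, hsd]; ring
  set τ := 100 * ‖φ‖ * d + 500 * ε * d ^ 2 with hτ
  have hd0 : 0 ≤ d := by positivity
  have hτ0 : 0 ≤ τ := by positivity
  have hTd : T = τ * ε := by rw [hT, hsd, hDd]; ring
  have g1 : ε⁻¹ ^ 2 * (D / 2 + ε * κ * Φ - a * ε * T - a * ε ^ 2 * (Φ + T)) =
      d ^ 2 / 2 + κ / ε * Φ - a * τ - a * (Φ + T) := by
    rw [hTd, hDd]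
    field_simp
  have g2 : b / ε * (T + a * ε * (Φ + T)) = b * τ + a * b * (Φ + T) := by
    rw [hTd]
    field_simp
  have g3 : ε⁻¹ ^ 2 * (D / 2 + ε * κ * Φ - a * ε * T - a * ε ^ 2 * (Φ + T)) ≤
      ε⁻¹ ^ 2 * (E₁ - E₂) := by gcongr
  rw [g1] at g3
  rw [g2] at hmP
  have g4 : T ≤ τ := by rw [hTd]; nlinarith
  have g5 : c * τ ≤ d ^ 2 / 2 + (100 * c) ^ 2 * Φ := by
    have e1 : c * τ = (100 * c * ‖φ‖) * d + (2000 * c * ε) * (d ^ 2 / 4) := by rw [hτ]; ring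
    have e2 : (2000 * c * ε) * (d ^ 2 / 4) ≤ 1 * (d ^ 2 / 4) := by gcongr
    have e3 : (100 * c * ‖φ‖) * d ≤ d ^ 2 / 4 + (100 * c) ^ 2 * Φ := by
      have := sq_nonneg (d / 2 - 100 * c * ‖φ‖)
      rw [hΦ]
      nlinarith
    linarith
  have g6 : (a + a * b) * T ≤ (a + a * b) * τ := by gcongr
  have g7 : c * τ = (a + b) * τ + (a + a * b) * τ := by rw [hc]; ring
  have g8 : (κ / ε - m - ((100 * c) ^ 2 + a + a * b)) * Φ =
      κ / ε * Φ - m * Φ - (100 * c) ^ 2 * Φ - a * Φ - a * b * Φ := by ring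
  rw [g8]
  linarith

/-- A smooth step from `0` to `1` between `δ` and `2δ`. -/
lemma exists_step : ∃ M : ℝ, 0 ≤ M ∧ ∀ δ : ℝ, 0 < δ → ∃ f f' : ℝ → ℝ, ContDiff ℝ 1 f ∧
    (∀ t, HasDerivAt f (f' t) t) ∧ Continuous f' ∧ (∀ t, 0 ≤ f t ∧ f t ≤ 1) ∧
    (∀ t ≤ δ, f t = 0) ∧ (∀ t, 2 * δ ≤ t → f t = 1) ∧ (∀ t, 0 ≤ f' t ∧ f' t ≤ M / δ) ∧
    ∀ t, 2 * δ < t → f' t = 0 := by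
  set S := Real.smoothTransition with hS
  have hSc : ContDiff ℝ 1 S := Real.smoothTransition.contDiff
  have hdc : Continuous (deriv S) := hSc.continuous_deriv le_rfl
  have hmono : Monotone S := Real.smoothTransition.monotone
  obtain ⟨M, hM⟩ := (isCompact_Icc (a := (0 : ℝ)) (b := 1)).exists_bound_of_continuousOn
    hdc.continuousOn
  have hder1 : ∀ t, 1 < t → deriv S t = 0 := by
    intro t ht
    have : S =ᶠ[nhds t] fun _ => 1 := by
      filter_upwards [Ioi_mem_nhds ht] with r hr
      exact Real.smoothTransition.one_of_one_le (le_of_lt hr)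
    rw [this.deriv_eq, deriv_const]
  have hder0 : ∀ t, t < 0 → deriv S t = 0 := by
    intro t ht
    have : S =ᶠ[nhds t] fun _ => 0 := by
      filter_upwards [Iio_mem_nhds ht] with r hr
      exact Real.smoothTransition.zero_of_nonpos (le_of_lt hr)
    rw [this.deriv_eq, deriv_const]
  have hM0 : 0 ≤ M := (norm_nonneg _).trans (hM 0 ⟨le_rfl, zero_le_one⟩)
  have hMall : ∀ t, deriv S t ≤ M := by
    intro t
    rcases lt_or_ge t 0 with h | h
    · rw [hder0 t h]; exact hM0
    rcases lt_or_ge 1 t with h' | h'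
    · rw [hder1 t h']; exact hM0
    · exact (le_abs_self _).trans (hM t ⟨h, h'⟩)
  refine ⟨M, hM0, fun δ hδ => ⟨fun t => S (t / δ - 1), fun t => deriv S (t / δ - 1) * (1 / δ),
    hSc.comp (by fun_prop), fun t => ?_, by fun_prop, fun t => ⟨Real.smoothTransition.nonneg _,
    Real.smoothTransition.le_one _⟩, fun t ht => ?_, fun t ht => ?_, fun t => ⟨?_, ?_⟩,
    fun t ht => ?_⟩⟩
  · have h1 : HasDerivAt (fun t => t / δ - 1) (1 / δ) t :=
      ((hasDerivAt_id t).div_const δ).sub_const 1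
    exact ((hSc.differentiable one_ne_zero _).hasDerivAt).comp t h1
  · apply Real.smoothTransition.zero_of_nonpos
    have : t / δ ≤ 1 := by rwa [div_le_one hδ]
    linarith
  · apply Real.smoothTransition.one_of_one_le
    have : 2 ≤ t / δ := by rwa [le_div_iff₀ hδ]
    linarith
  · exact mul_nonneg hmono.deriv_nonneg (by positivity)
  · change deriv S (t / δ - 1) * (1 / δ) ≤ M / δ
    rw [div_eq_mul_one_div M]
    gcongr
    exact hMall _
  · change deriv S (t / δ - 1) * (1 / δ) = 0
    rw [hder1, zero_mul]
    have : 2 < t / δ := by rwa [lt_div_iff₀ hδ]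
    linarith

set_option maxHeartbeats 1000000 in
/-- Transverse trial functions, vanishing near `0`, and the corresponding upper bound for the
transverse energy. -/
theorem exists_trial_profile (a : ℝ) (ha : 0 ≤ a) :
    ∃ C : ℝ, 0 ≤ C ∧ ∀ ε : ℝ, 0 < ε → ε ≤ 1 → a * ε ≤ 1 / 2 → ∃ g : ℝ → ℝ, ContDiff ℝ 1 g ∧
      (∃ δ > 0, ∀ t < δ, g t = 0) ∧ (∀ t, 2 ≤ t → g t = 0) ∧
      ∀ (κ : ℝ) (ρ ρ' : ℝ → ℝ), |κ| ≤ a →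
      (∀ t ∈ Icc (0 : ℝ) 1, HasDerivAt ρ (ρ' t) t) → ContinuousOn ρ' (Icc 0 1) →
      (∀ t ∈ Icc (0 : ℝ) 1, |ρ t - 1| ≤ a * ε) →
      (∀ t ∈ Icc (0 : ℝ) 1, |ρ' t + ε * κ| ≤ a * ε ^ 2) →
      ∫ t in (0 : ℝ)..1, ε⁻¹ ^ 2 * (deriv g t ^ 2 - (Real.pi / 2) ^ 2 * g t ^ 2) * ρ t ≤
          κ / ε + C ∧
        1 - C * ε ≤ ∫ t in (0 : ℝ)..1, g t ^ 2 * ρ t ∧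
        ∫ t in (0 : ℝ)..1, g t ^ 2 * ρ t ≤ 1 + C * ε := by
  obtain ⟨M, hM0, hM⟩ := exists_step
  refine ⟨8 * M + 4 * a + 3, by positivity, fun ε hε hε1 hε2 => ?_⟩
  -- The cut-off acts at scale ε². As χ = O(t) there, its energy is O(δ), which is O(1) after
  -- division by ε², and the loss in the weighted integrals is O(ε²).
  set δ := ε ^ 2 / 4 with hδdef
  have hδ : 0 < δ := by positivity
  have hδ1 : 2 * δ ≤ 1 := by rw [hδdef]; nlinarith
  obtain ⟨f, f', hfc, hfd, hf'c, hf01, hf0, hf1, hf'b, hf'0⟩ := hM δ hδ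
  -- A second cut-off, between 5/4 and 7/4, does not affect [0, 1] and makes g vanish for t ≥ 2, so
  -- that the trial functions have compact support beyond the Neumann side.
  set cut : ℝ → ℝ := fun t => 1 - Real.smoothTransition (2 * t - 5 / 2) with hcut
  have hcut1 : ∀ t, t ≤ 5 / 4 → cut t = 1 := fun t ht => by
    simp [hcut, Real.smoothTransition.zero_of_nonpos (show 2 * t - 5 / 2 ≤ 0 by linarith)]
  have hcutc : ContDiff ℝ 1 cut :=
    contDiff_const.sub (Real.smoothTransition.contDiff.comp (by fun_prop))
  have hchic : ContDiff ℝ 1 chi := by unfold chi; fun_prop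
  refine ⟨fun t => chi t * f t * cut t, (hchic.mul hfc).mul hcutc, ⟨δ, hδ, fun t ht => by
    simp [hf0 t ht.le]⟩, fun t ht => by
    simp [hcut, Real.smoothTransition.one_of_one_le (show 1 ≤ 2 * t - 5 / 2 by linarith)], ?_⟩
  intro κ ρ ρ' hκ hρ hρ'c hρ1 hρ2
  have hfcc : ContinuousOn f (Icc 0 1) := hfc.continuous.continuousOn
  have hf'cc : ContinuousOn f' (Icc 0 1) := hf'c.continuousOn
  have hρc : ContinuousOn ρ (Icc 0 1) := fun r hr => (hρ r hr).continuousAt.continuousWithinAt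
  have hcc := continuous_chi.continuousOn (s := Icc (0 : ℝ) 1)
  have hdc := continuous_dchi.continuousOn (s := Icc (0 : ℝ) 1)
  have hii : ∀ {F : ℝ → ℝ}, ContinuousOn F (Icc 0 1) → IntervalIntegrable F volume 0 1 :=
    fun hF => hF.intervalIntegrable_of_Icc zero_le_one
  have hg : ∀ t ∈ Icc (0 : ℝ) 1, chi t * f t * cut t = chi t * f t := fun t ht => by
    rw [hcut1 t (by linarith [ht.2]), mul_one]
  have hg' : ∀ t ∈ Icc (0 : ℝ) 1, deriv (fun t => chi t * f t * cut t) t =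
      dchi t * f t + chi t * f' t := by
    intro t ht
    have e1 : (fun t => chi t * f t * cut t) =ᶠ[nhds t] fun t => chi t * f t := by
      filter_upwards [Iio_mem_nhds (show t < 5 / 4 by linarith [ht.2])] with r hr
      rw [hcut1 r (le_of_lt hr), mul_one]
    rw [e1.deriv_eq]
    exact ((hasDerivAt_chi t).mul (hfd t)).deriv
  have hρle : ∀ t ∈ Icc (0 : ℝ) 1, 1 / 2 ≤ ρ t ∧ ρ t ≤ 3 / 2 := fun t ht => by
    have := abs_le.1 (hρ1 t ht)
    constructor <;> linarith
  have hen : ∫ t in (0 : ℝ)..1, (deriv (fun t => chi t * f t * cut t) t ^ 2 -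
      (Real.pi / 2) ^ 2 * (chi t * f t * cut t) ^ 2) * ρ t =
      (∫ t in (0 : ℝ)..1, chi t ^ 2 * f' t ^ 2 * ρ t) -
        ∫ t in (0 : ℝ)..1, chi t * dchi t * ρ' t * f t ^ 2 := by
    have h := integral_energy (f := fun t => (f t : ℂ)) (f' := fun t => (f' t : ℂ))
      (fun t _ => (hfd t).ofReal_comp) (Complex.continuous_ofReal.comp hf'c).continuousOn hρ hρ'c
    simp only [← Complex.ofReal_mul, ← Complex.ofReal_add, Complex.norm_real, Real.norm_eq_abs,
      sq_abs] at h
    rw [← h]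
    refine integral_congr fun t ht => ?_
    rw [uIcc_of_le zero_le_one] at ht
    simp only [hg t ht, hg' t ht]
  have hint1 : ∫ t in (0 : ℝ)..1, f' t ≤ 1 := by
    rw [integral_eq_sub_of_hasDerivAt (fun t _ => hfd t) (hii hf'cc)]
    linarith [(hf01 1).2, (hf01 0).1]
  -- Only one factor f' is bounded by M/δ; the other integrates to at most one. With χ² ≤ 20 δ² for
  -- t ≤ 2δ and ρ ≤ 3/2 this gives 30 δ M = 7.5 M ε².
  have hA : ∫ t in (0 : ℝ)..1, chi t ^ 2 * f' t ^ 2 * ρ t ≤ 8 * M * ε ^ 2 := by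
    calc ∫ t in (0 : ℝ)..1, chi t ^ 2 * f' t ^ 2 * ρ t
        ≤ ∫ t in (0 : ℝ)..1, 8 * M * ε ^ 2 * f' t := by
          refine integral_mono_on zero_le_one (hii (by fun_prop)) (hii (by fun_prop))
            fun t ht => ?_
          rcases lt_or_ge (2 * δ) t with h | h
          · simp [hf'0 t h]
          · have h1 := chi_sq_le ht
            have h2 : chi t ^ 2 ≤ 20 * δ ^ 2 := by nlinarith [ht.1]
            have h3 := hf'b t
            calc chi t ^ 2 * f' t ^ 2 * ρ t ≤ 20 * δ ^ 2 * (f' t * (M / δ)) * (3 / 2) := by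
                  have e1 : f' t ^ 2 ≤ f' t * (M / δ) := by
                    rw [sq]; exact mul_le_mul_of_nonneg_left h3.2 h3.1
                  have e2 : 0 ≤ f' t * (M / δ) := mul_nonneg h3.1 (by positivity)
                  exact mul_le_mul (mul_le_mul h2 e1 (sq_nonneg _) (by positivity))
                    (hρle t ht).2 (by linarith [(hρle t ht).1]) (by positivity)
              _ = 30 * δ * M * f' t := by field_simp; ring
              _ ≤ 8 * M * ε ^ 2 * f' t := by
                  rw [hδdef]
                  have := mul_nonneg (mul_nonneg hM0 (sq_nonneg ε)) h3.1
                  nlinarith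
      _ = 8 * M * ε ^ 2 * ∫ t in (0 : ℝ)..1, f' t := intervalIntegral.integral_const_mul _ _
      _ ≤ 8 * M * ε ^ 2 * 1 := by gcongr
      _ = _ := mul_one _
  -- Where the cut-off is active, t ≤ 2δ and the weight is at most 10 δ = 2.5 ε².
  have hcut2 : ∀ w : ℝ → ℝ, ContinuousOn w (Icc 0 1) →
      (∀ t ∈ Icc (0 : ℝ) 1, 0 ≤ w t ∧ w t ≤ 5 * t) → ∫ t in (0 : ℝ)..1, w t = 1 →
      1 - 3 * ε ^ 2 ≤ ∫ t in (0 : ℝ)..1, w t * f t ^ 2 ∧ ∫ t in (0 : ℝ)..1, w t * f t ^ 2 ≤ 1 := by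
    intro w hw hw5 hw1
    constructor
    · have : ∫ t in (0 : ℝ)..1, (w t - 3 * ε ^ 2) ≤ ∫ t in (0 : ℝ)..1, w t * f t ^ 2 := by
        refine integral_mono_on zero_le_one (hii (by fun_prop)) (hii (by fun_prop))
            fun t ht => ?_
        obtain ⟨h0, h5⟩ := hw5 t ht
        rcases lt_or_ge (2 * δ) t with h | h
        · rw [hf1 t h.le]
          nlinarith [sq_nonneg ε]
        · have : w t ≤ 3 * ε ^ 2 := by rw [hδdef] at h; nlinarith
          nlinarith [mul_nonneg h0 (sq_nonneg (f t))]
      rw [intervalIntegral.integral_sub (hii hw) (hii continuousOn_const), hw1] at this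
      simpa using this
    · refine le_of_le_of_eq ?_ hw1
      refine integral_mono_on zero_le_one (hii (by fun_prop)) (hii (by fun_prop)) fun t ht => ?_
      have h1 : f t ^ 2 ≤ 1 := pow_le_one₀ (hf01 t).1 (hf01 t).2
      nlinarith [(hw5 t ht).1]
  obtain ⟨hB1, hB2⟩ := hcut2 (fun t => chi t * dchi t) (hcc.mul hdc)
    (fun t ht => ⟨mul_nonneg (chi_nonneg ht) (dchi_nonneg ht), chi_mul_dchi_le ht⟩)
    integral_chi_mul_dchi
  obtain ⟨hN1, hN2⟩ := hcut2 (fun t => chi t ^ 2) (hcc.pow 2)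
    (fun t ht => ⟨sq_nonneg _, chi_sq_le' ht⟩) integral_chi_sq
  set I₁ := ∫ t in (0 : ℝ)..1, chi t * dchi t * f t ^ 2 with hI₁
  set I₂ := ∫ t in (0 : ℝ)..1, chi t ^ 2 * f t ^ 2 with hI₂
  have hB : -∫ t in (0 : ℝ)..1, chi t * dchi t * ρ' t * f t ^ 2 ≤
      ε * κ * I₁ + a * ε ^ 2 * I₁ := by
    rw [hI₁, ← intervalIntegral.integral_const_mul, ← intervalIntegral.integral_const_mul,
      ← intervalIntegral.integral_neg, ← intervalIntegral.integral_add (hii (by fun_prop))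
        (hii (by fun_prop))]
    refine integral_mono_on zero_le_one (hii (by fun_prop)) (hii (by fun_prop)) fun t ht => ?_
    have h3 := (abs_le.1 (hρ2 t ht)).1
    have h4 : 0 ≤ chi t * dchi t * f t ^ 2 :=
      mul_nonneg (mul_nonneg (chi_nonneg ht) (dchi_nonneg ht)) (sq_nonneg _)
    nlinarith
  have hmass : ∫ t in (0 : ℝ)..1, (chi t * f t * cut t) ^ 2 * ρ t =
      ∫ t in (0 : ℝ)..1, chi t ^ 2 * f t ^ 2 * ρ t := by
    refine integral_congr fun t ht => ?_
    rw [uIcc_of_le zero_le_one] at ht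
    simp only [hg t ht]
    ring
  refine ⟨?_, ?_, ?_⟩
  · simp_rw [mul_assoc (ε⁻¹ ^ 2)]
    rw [intervalIntegral.integral_const_mul, hen]
    have h1 : ε * κ * I₁ ≤ ε * κ + 3 * a * ε ^ 2 := by
      have e1 : ε * κ * I₁ = ε * κ + ε * (-κ) * (1 - I₁) := by ring
      have e2 : ε * (-κ) * (1 - I₁) ≤ 1 * a * (3 * ε ^ 2) := by
        have := (abs_le.1 hκ).1
        have e3 : 0 ≤ 1 - I₁ := by linarith
        calc ε * (-κ) * (1 - I₁) ≤ ε * a * (1 - I₁) := by gcongr; linarith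
          _ ≤ 1 * a * (3 * ε ^ 2) := by gcongr; linarith
      linarith
    have h2 : a * ε ^ 2 * I₁ ≤ a * ε ^ 2 * 1 := by gcongr
    rw [inv_pow, inv_mul_le_iff₀ (by positivity)]
    have e4 : ε ^ 2 * (κ / ε + (8 * M + 4 * a + 3)) =
      ε * κ + 8 * M * ε ^ 2 + 4 * a * ε ^ 2 + 3 * ε ^ 2 := by
      field_simp
      ring
    rw [e4]
    have := sq_nonneg ε
    linarith
  · rw [hmass]
    have h1 : (1 - a * ε) * I₂ ≤ ∫ t in (0 : ℝ)..1, chi t ^ 2 * f t ^ 2 * ρ t := by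
      rw [hI₂, ← intervalIntegral.integral_const_mul]
      refine integral_mono_on zero_le_one (hii (by fun_prop)) (hii (by fun_prop)) fun t ht => ?_
      have h3 := (abs_le.1 (hρ1 t ht)).1
      have : 0 ≤ chi t ^ 2 * f t ^ 2 := by positivity
      nlinarith
    have h2 : (1 - a * ε) * (1 - 3 * ε ^ 2) ≤ (1 - a * ε) * I₂ := by
      gcongr
      linarith
    have h4 : 0 ≤ a * ε * (3 * ε ^ 2) := by positivity
    have h5 : 0 ≤ M * ε := by positivity
    have h6 : 0 ≤ a * ε := by positivity
    have h7 : ε ^ 2 ≤ ε := by rw [sq]; exact mul_le_of_le_one_left hε.le hε1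
    have h8 : (1 - a * ε) * (1 - 3 * ε ^ 2) =
      1 - a * ε - 3 * ε ^ 2 + a * ε * (3 * ε ^ 2) := by ring
    have h9 : (8 * M + 4 * a + 3) * ε = 8 * (M * ε) + 4 * (a * ε) + 3 * ε := by ring
    linarith
  · rw [hmass]
    have h1 : ∫ t in (0 : ℝ)..1, chi t ^ 2 * f t ^ 2 * ρ t ≤ (1 + a * ε) * I₂ := by
      rw [hI₂, ← intervalIntegral.integral_const_mul]
      refine integral_mono_on zero_le_one (hii (by fun_prop)) (hii (by fun_prop)) fun t ht => ?_
      have h3 := (abs_le.1 (hρ1 t ht)).2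
      have : 0 ≤ chi t ^ 2 * f t ^ 2 := by positivity
      nlinarith
    have h2 : (1 + a * ε) * I₂ ≤ (1 + a * ε) * 1 := by gcongr
    have h5 : 0 ≤ M * ε := by positivity
    have h6 : 0 ≤ a * ε := by positivity
    have h9 : (8 * M + 4 * a + 3) * ε = 8 * (M * ε) + 4 * (a * ε) + 3 * ε := by ring
    linarith

end Transverse

/-! ### Level sets -/

section LevelSet

open Filter Topology

variable {E : Type*} [NormedAddCommGroup E] [InnerProductSpace ℝ E] [FiniteDimensional ℝ E]

/-- The kernel of the derivative of a defining function is tangent to its level set. -/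
lemma mem_tangentConeAt_of_fderiv_eq_zero {S U : Set E} {f : E → ℝ} {f' : E →L[ℝ] ℝ} {x v : E}
    (hU : U ∈ 𝓝 x) (hf : HasStrictFDerivAt f f' x) (hf' : f' ≠ 0) (hfx : f x = 0)
    (hS : ∀ y ∈ U, f y = 0 → y ∈ S) (hv : f' v = 0) : v ∈ tangentConeAt ℝ S x := by
  have hr : f'.range = ⊤ := by
    refine LinearMap.range_eq_top.2 fun c => ?_
    obtain ⟨w, hw⟩ : ∃ w, f' w ≠ 0 := by
      by_contra! h
      exact hf' (ContinuousLinearMap.ext h)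
    refine ⟨(c / f' w) • w, ?_⟩
    simp [hw]
  -- The implicit function parametrizes the level set by the kernel of f', with derivative the
  -- inclusion at 0. Tangent cones are mapped forward, and near 0 the parameter set is a
  -- neighbourhood.
  set g : f'.ker → E := hf.implicitFunction f f' hr (f x) with hg
  have hgd : HasStrictFDerivAt g f'.ker.subtypeL 0 := hf.to_implicitFunction hr
  have hg0 : g 0 = x := by
    simp [hg]
  have hev : ∀ᶠ w in 𝓝 (0 : f'.ker), g w ∈ S := by
    have h1 : ∀ᶠ w in 𝓝 (0 : f'.ker), f (g w) = f x := by
      have := hf.map_implicitFunction_eq hr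
      have hc : Tendsto (fun w : f'.ker => (f x, w)) (𝓝 0) (𝓝 (f x, 0)) :=
        (continuous_const.prodMk continuous_id).tendsto' _ _ rfl
      exact hc.eventually this
    have h2 : ∀ᶠ w in 𝓝 (0 : f'.ker), g w ∈ U := by
      have := hgd.hasFDerivAt.continuousAt
      exact this (by rwa [hg0])
    filter_upwards [h1, h2] with w h1 h2 using hS _ h2 (by rw [h1, hfx])
  have := hgd.hasFDerivAt.hasFDerivWithinAt (s := {w | g w ∈ S})
  have h3 := this.mapsTo_tangent_cone (show (⟨v, hv⟩ : f'.ker) ∈ _ by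
    rw [tangentConeAt_of_mem_nhds hev]; trivial)
  rw [hg0] at h3
  exact tangentConeAt_mono (by rintro _ ⟨w, hw, rfl⟩; exact hw) h3

lemma fderiv_eq_inner_gradient (f : E → ℝ) (x v : E) : fderiv ℝ f x v = ⟪gradient f x, v⟫_ℝ := by
  simp [gradient]

/-- A vector that is orthogonal to all vectors orthogonal to `a` is a multiple of `a`. -/
lemma eq_smul_of_forall_orthogonal {E : Type*} [NormedAddCommGroup E] [InnerProductSpace ℝ E]
    {a n : E} (ha : a ≠ 0)
    (h : ∀ v, ⟪a, v⟫_ℝ = 0 → ⟪v, n⟫_ℝ = 0) : n = (⟪a, n⟫_ℝ / ‖a‖ ^ 2) • a := by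
  have ha' : ‖a‖ ^ 2 ≠ 0 := by positivity
  set c := ⟪a, n⟫_ℝ / ‖a‖ ^ 2
  have h1 : ⟪a, n - c • a⟫_ℝ = 0 := by
    rw [inner_sub_right, inner_smul_right, real_inner_self_eq_norm_sq]
    simp only [c]
    field_simp
    ring
  have h2 := h _ h1
  have h3 : ⟪n - c • a, n - c • a⟫_ℝ = 0 := by
    rw [inner_sub_right, h2, inner_smul_right, real_inner_comm, h1]; simp
  exact sub_eq_zero.1 (inner_self_eq_zero.1 h3)

end LevelSet

/-! ### Defining functions and the unit normal -/

namespace Tube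

open Filter Topology

variable {d : ℕ} {S : Set (EuclideanSpace ℝ (Fin d))}
  {N : EuclideanSpace ℝ (Fin d) → EuclideanSpace ℝ (Fin d)}

/-- The normalized gradient. -/
def unitGradient (f : EuclideanSpace ℝ (Fin d) → ℝ) (y : EuclideanSpace ℝ (Fin d)) :
    EuclideanSpace ℝ (Fin d) :=
  ‖gradient f y‖⁻¹ • gradient f y

/-- `f` is a defining function of `S` on the open set `U`, and `N` is its normalized gradient. -/
structure IsDefiningFunction (S : Set (EuclideanSpace ℝ (Fin d)))
    (N : EuclideanSpace ℝ (Fin d) → EuclideanSpace ℝ (Fin d))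
    (U : Set (EuclideanSpace ℝ (Fin d))) (f : EuclideanSpace ℝ (Fin d) → ℝ) : Prop where
  isOpen : IsOpen U
  contDiffOn : ContDiffOn ℝ 2 f U
  gradient_ne_zero : ∀ y ∈ U, gradient f y ≠ 0
  mem_iff : ∀ y ∈ U, y ∈ S ↔ f y = 0
  eq_unitGradient : ∀ y ∈ S ∩ U, N y = unitGradient f y

lemma norm_unitGradient {f : EuclideanSpace ℝ (Fin d) → ℝ} {y : EuclideanSpace ℝ (Fin d)}
    (h : gradient f y ≠ 0) : ‖unitGradient f y‖ = 1 := by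
  rw [unitGradient, norm_smul, norm_inv, norm_norm, inv_mul_cancel₀ (norm_ne_zero_iff.2 h)]

lemma unitGradient_neg (f : EuclideanSpace ℝ (Fin d) → ℝ) (y : EuclideanSpace ℝ (Fin d)) :
    unitGradient (fun z => -f z) y = -unitGradient f y := by
  have : gradient (fun z => -f z) y = -gradient f y := by
    simp [gradient, fderiv_fun_neg]
  rw [unitGradient, unitGradient, this, norm_neg, smul_neg]

lemma contDiffOn_gradient {U : Set (EuclideanSpace ℝ (Fin d))} (hU : IsOpen U)
    {f : EuclideanSpace ℝ (Fin d) → ℝ} (hf : ContDiffOn ℝ 2 f U) :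
    ContDiffOn ℝ 1 (gradient f) U := by
  have h := hf.fderiv_of_isOpen hU (m := 1) (by norm_num)
  exact (InnerProductSpace.toDual ℝ
    (EuclideanSpace ℝ (Fin d))).symm.toContinuousLinearEquiv.contDiff.comp_contDiffOn h

lemma contDiffOn_unitGradient {U : Set (EuclideanSpace ℝ (Fin d))} (hU : IsOpen U)
    {f : EuclideanSpace ℝ (Fin d) → ℝ} (hf : ContDiffOn ℝ 2 f U)
    (h : ∀ y ∈ U, gradient f y ≠ 0) : ContDiffOn ℝ 1 (unitGradient f) U := by
  have h1 := contDiffOn_gradient hU hf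
  exact (((h1.norm ℝ h).inv fun y hy => norm_ne_zero_iff.2 (h y hy))).smul h1

/-- Near each of its points an oriented hypersurface has a defining function whose normalized
gradient is the given normal. -/
lemma exists_isDefiningFunction (hS : IsC2Hypersurface S) (hN : IsUnitNormalField S N)
    {x : EuclideanSpace ℝ (Fin d)} (hx : x ∈ S) :
    ∃ U f, IsDefiningFunction S N U f ∧ x ∈ U := by
  obtain ⟨U, f, hU, hxU, hf, hf0, hSU⟩ := hS x hx
  have hmem : ∀ y ∈ U, y ∈ S ↔ f y = 0 := fun y hy =>
    ⟨fun h => (hSU.subset ⟨h, hy⟩).2, fun h => (hSU.symm.subset ⟨hy, h⟩).1⟩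
  have hg0 : ∀ y ∈ U, gradient f y ≠ 0 := fun y hy h => hf0 y hy (by
    ext v; rw [fderiv_eq_inner_gradient, h]; simp)
  -- The tangent cone contains the kernel of the derivative of f, so a normal vector must be
  -- parallel to the gradient.
  have hpar : ∀ y ∈ S ∩ U, N y = ⟪unitGradient f y, N y⟫_ℝ • unitGradient f y := by
    intro y ⟨hyS, hyU⟩
    have hk := eq_smul_of_forall_orthogonal (hg0 y hyU) (n := N y) fun v hv => by
      refine hN.2.2 y hyS v ?_
      refine mem_tangentConeAt_of_fderiv_eq_zero (hU.mem_nhds hyU)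
        ((hf.contDiffAt (hU.mem_nhds hyU)).hasStrictFDerivAt (by norm_num)) (hf0 y hyU)
        ((hmem y hyU).1 hyS) (fun z hz hz0 => (hmem z hz).2 hz0) ?_
      rw [fderiv_eq_inner_gradient, hv]
    have hne : ‖gradient f y‖ ≠ 0 := norm_ne_zero_iff.2 (hg0 y hyU)
    conv_lhs => rw [hk]
    rw [unitGradient, smul_smul, real_inner_smul_left]
    congr 1
    field_simp
  have hsq : ∀ y ∈ S ∩ U, ⟪unitGradient f y, N y⟫_ℝ ^ 2 = 1 := by
    intro y hy
    have h1 := congrArg norm (hpar y hy)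
    rw [hN.2.1 y hy.1, norm_smul, norm_unitGradient (hg0 y hy.2), mul_one, Real.norm_eq_abs] at h1
    rw [← sq_abs, ← h1, one_pow]
  have hcont : ContinuousOn (fun y => ⟪unitGradient f y, N y⟫_ℝ) (S ∩ U) :=
    ((contDiffOn_unitGradient hU hf hg0).continuousOn.mono inter_subset_right).inner
      (hN.1.mono (inter_subset_left.trans subset_closure))
  -- the sign of `⟪∇f, N⟫` is locally constant on `S`
  have key : ∀ σ : ℝ, σ ^ 2 = 1 → ⟪unitGradient f x, N x⟫_ℝ = σ →
      ∃ V, IsOpen V ∧ x ∈ V ∧ V ⊆ U ∧ ∀ y ∈ S ∩ V, N y = σ • unitGradient f y := by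
    intro σ hσ hxσ
    have h1 : ∀ᶠ y in 𝓝[S ∩ U] x, ⟪unitGradient f y, N y⟫_ℝ * σ > 0 := by
      have := (hcont x ⟨hx, hxU⟩).mul_const σ
      refine this.eventually (lt_mem_nhds ?_)
      simp only [hxσ, ← sq, hσ]; norm_num
    obtain ⟨W, hW, hxW, hWsub⟩ := mem_nhdsWithin.1 h1
    refine ⟨W ∩ U, hW.inter hU, ⟨hxW, hxU⟩, inter_subset_right, fun y hy => ?_⟩
    have hyU : y ∈ S ∩ U := ⟨hy.1, hy.2.2⟩
    have h2 : ⟪unitGradient f y, N y⟫_ℝ * σ > 0 := hWsub ⟨hy.2.1, hyU⟩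
    have h3 : ⟪unitGradient f y, N y⟫_ℝ = σ := by
      have h4 := hsq y hyU
      rcases sq_eq_one_iff.1 h4 with h | h <;>
      rcases sq_eq_one_iff.1 hσ with h' | h' <;>
      first
      | exact h.trans h'.symm
      | (rw [h, h'] at h2; norm_num at h2)
    rw [hpar y hyU, h3]
  have hsx := hsq x ⟨hx, hxU⟩
  obtain ⟨V, hV, hxV, hVU, hVN⟩ := key _ hsx rfl
  rcases sq_eq_one_iff.1 hsx with h | h
  · refine ⟨V, f, ⟨hV, hf.mono hVU, fun y hy => hg0 y (hVU hy), fun y hy => hmem y (hVU hy),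
      fun y hy => ?_⟩, hxV⟩
    rw [hVN y hy, h, one_smul]
  · refine ⟨V, fun y => -f y, ⟨hV, (hf.mono hVU).neg, fun y hy h0 => hg0 y (hVU hy) ?_,
      fun y hy => ?_, fun y hy => ?_⟩, hxV⟩
    · have : gradient (fun z => -f z) y = -gradient f y := by simp [gradient, fderiv_fun_neg]
      rwa [this, neg_eq_zero] at h0
    · rw [neg_eq_zero]; exact hmem y (hVU hy)
    · rw [hVN y hy, h, unitGradient_neg, neg_one_smul]

namespace IsDefiningFunction

variable {U : Set (EuclideanSpace ℝ (Fin d))} {f : EuclideanSpace ℝ (Fin d) → ℝ}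
  {x : EuclideanSpace ℝ (Fin d)}

lemma contDiffAt (h : IsDefiningFunction S N U f) (hx : x ∈ U) : ContDiffAt ℝ 2 f x :=
  h.contDiffOn.contDiffAt (h.isOpen.mem_nhds hx)

lemma contDiffOn_unitGradient (h : IsDefiningFunction S N U f) :
    ContDiffOn ℝ 1 (unitGradient f) U :=
  Tube.contDiffOn_unitGradient h.isOpen h.contDiffOn h.gradient_ne_zero

lemma contDiffAt_unitGradient (h : IsDefiningFunction S N U f) (hx : x ∈ U) :
    ContDiffAt ℝ 1 (unitGradient f) x :=
  h.contDiffOn_unitGradient.contDiffAt (h.isOpen.mem_nhds hx)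

lemma differentiableAt_unitGradient (h : IsDefiningFunction S N U f) (hx : x ∈ U) :
    DifferentiableAt ℝ (unitGradient f) x :=
  (h.contDiffAt_unitGradient hx).differentiableAt (by norm_num)

lemma gradient_eq (h : IsDefiningFunction S N U f) (hx : x ∈ S ∩ U) :
    gradient f x = ‖gradient f x‖ • N x := by
  rw [h.eq_unitGradient x hx, unitGradient, smul_smul,
    mul_inv_cancel₀ (norm_ne_zero_iff.2 (h.gradient_ne_zero x hx.2)), one_smul]

lemma mem_tangentConeAt (h : IsDefiningFunction S N U f) (hx : x ∈ S ∩ U)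
    {v : EuclideanSpace ℝ (Fin d)} (hv : ⟪N x, v⟫_ℝ = 0) : v ∈ tangentConeAt ℝ S x := by
  refine mem_tangentConeAt_of_fderiv_eq_zero (h.isOpen.mem_nhds hx.2)
    ((h.contDiffAt hx.2).hasStrictFDerivAt (by norm_num)) (fun h0 => ?_)
    ((h.mem_iff x hx.2).1 hx.1) (fun z hz hz0 => (h.mem_iff z hz).2 hz0) ?_
  · refine h.gradient_ne_zero x hx.2 ?_
    simp [gradient, h0]
  · rw [fderiv_eq_inner_gradient, h.gradient_eq hx, real_inner_smul_left, hv, mul_zero]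

/-- The normalized gradient has constant length on U; differentiate its square. -/
lemma inner_fderiv_unitGradient (h : IsDefiningFunction S N U f) (hx : x ∈ S ∩ U)
    (v : EuclideanSpace ℝ (Fin d)) : ⟪N x, fderiv ℝ (unitGradient f) x v⟫_ℝ = 0 := by
  have h1 := (h.differentiableAt_unitGradient hx.2).hasFDerivAt
  have h2 := h1.inner ℝ h1
  have h3 : (fun y => ⟪unitGradient f y, unitGradient f y⟫_ℝ) =ᶠ[𝓝 x] fun _ => 1 := by
    filter_upwards [h.isOpen.mem_nhds hx.2] with y hy
    rw [real_inner_self_eq_norm_sq, norm_unitGradient (h.gradient_ne_zero y hy), one_pow]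
  have h4 := h2.unique ((hasFDerivAt_const (1 : ℝ) x).congr_of_eventuallyEq h3)
  have h5 := congrArg (fun L => L v) h4
  simp [fderivInnerCLM_apply] at h5
  rw [real_inner_comm] at h5
  rw [h.eq_unitGradient x hx]
  rw [real_inner_comm] at h5 ⊢
  linarith [real_inner_comm (unitGradient f x) (fderiv ℝ (unitGradient f) x v)]

/-- A derivative within S is determined only on the span of the tangent cone. Tangent vectors lie in
the cone, so there any differentiable extension of N gives the same value. -/
lemma fderivWithin_eq (h : IsDefiningFunction S N U f) (hx : x ∈ S ∩ U)
    {M : EuclideanSpace ℝ (Fin d) → EuclideanSpace ℝ (Fin d)} (hM : DifferentiableAt ℝ M x)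
    (hMN : M =ᶠ[𝓝[S] x] N) {v : EuclideanSpace ℝ (Fin d)} (hv : ⟪N x, v⟫_ℝ = 0) :
    fderivWithin ℝ N S x v = fderiv ℝ M x v := by
  have h1 : HasFDerivWithinAt N (fderiv ℝ M x) S x :=
    hM.hasFDerivAt.hasFDerivWithinAt.congr_of_eventuallyEq hMN.symm
      (hMN.self_of_nhdsWithin hx.1).symm
  exact h1.differentiableWithinAt.hasFDerivWithinAt.unique_on h1 (h.mem_tangentConeAt hx hv)

lemma unitGradient_eventuallyEq (h : IsDefiningFunction S N U f) (hx : x ∈ U) :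
    unitGradient f =ᶠ[𝓝[S] x] N := by
  filter_upwards [self_mem_nhdsWithin, mem_nhdsWithin_of_mem_nhds (h.isOpen.mem_nhds hx)]
    with y hy hyU using (h.eq_unitGradient y ⟨hy, hyU⟩).symm

/-- Tested on tangent vectors, the derivative of the normalized gradient is the Hessian of f divided
by the length of the gradient. Differentiating the normalizing factor only contributes a normal
vector. -/
lemma inner_fderiv_unitGradient_comm (h : IsDefiningFunction S N U f) (hx : x ∈ S ∩ U)
    {v w : EuclideanSpace ℝ (Fin d)} (hv : ⟪N x, v⟫_ℝ = 0) (hw : ⟪N x, w⟫_ℝ = 0) :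
    ⟪fderiv ℝ (unitGradient f) x v, w⟫_ℝ = ⟪fderiv ℝ (unitGradient f) x w, v⟫_ℝ := by
  have hg : DifferentiableAt ℝ (gradient f) x :=
    ((contDiffOn_gradient h.isOpen h.contDiffOn).contDiffAt
      (h.isOpen.mem_nhds hx.2)).differentiableAt (by norm_num)
  have hn : DifferentiableAt ℝ (fun y => ‖gradient f y‖⁻¹) x :=
    (hg.norm ℝ (h.gradient_ne_zero x hx.2)).inv (norm_ne_zero_iff.2 (h.gradient_ne_zero x hx.2))
  have key : ∀ v w : EuclideanSpace ℝ (Fin d), ⟪N x, w⟫_ℝ = 0 →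
      ⟪fderiv ℝ (unitGradient f) x v, w⟫_ℝ =
        ‖gradient f x‖⁻¹ * fderiv ℝ (fderiv ℝ f) x v w := by
    intro v w hw
    have h1 : fderiv ℝ (unitGradient f) x = _ := (hn.hasFDerivAt.smul hg.hasFDerivAt).fderiv
    have h2 : fderiv ℝ (gradient f) x v =
        (InnerProductSpace.toDual ℝ (EuclideanSpace ℝ (Fin d))).symm
          (fderiv ℝ (fderiv ℝ f) x v) := by
      have := (InnerProductSpace.toDual ℝ
        (EuclideanSpace ℝ (Fin d))).symm.toContinuousLinearEquiv.comp_fderiv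
          (f := fderiv ℝ f) (x := x)
      exact congrArg (fun L => L v) this
    rw [h1]
    simp only [add_apply, smul_apply,
      ContinuousLinearMap.smulRight_apply, inner_add_left, real_inner_smul_left, h2]
    rw [InnerProductSpace.toDual_symm_apply]
    have h3 : ⟪gradient f x, w⟫_ℝ = 0 := by
      rw [h.gradient_eq hx, real_inner_smul_left, hw, mul_zero]
    rw [h3, mul_zero, add_zero]
  rw [key v w hw, key w v hv]
  congr 1
  exact ((h.contDiffAt hx.2).isSymmSndFDerivAt (by simp)) v w

end IsDefiningFunction

end Tube

/-! ### Shape operator, principal curvatures and the Jacobian -/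

namespace Tube

open Filter Topology

variable {d : ℕ} {S : Set (EuclideanSpace ℝ (Fin d))}
  {N : EuclideanSpace ℝ (Fin d) → EuclideanSpace ℝ (Fin d)} {x : EuclideanSpace ℝ (Fin d)}

/-- The Weingarten map, extended by zero to the normal direction. -/
def shapeOperator (S : Set (EuclideanSpace ℝ (Fin d)))
    (N : EuclideanSpace ℝ (Fin d) → EuclideanSpace ℝ (Fin d)) (x : EuclideanSpace ℝ (Fin d)) :
    EuclideanSpace ℝ (Fin d) →L[ℝ] EuclideanSpace ℝ (Fin d) :=
  LinearMap.toContinuousLinearMap ((tangentSpace N x).subtype ∘ₗ weingarten S N x ∘ₗ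
    (tangentSpace N x).orthogonalProjectionOnto.toLinearMap)

lemma mem_tangentSpace {v : EuclideanSpace ℝ (Fin d)} :
    v ∈ tangentSpace N x ↔ ⟪N x, v⟫_ℝ = 0 :=
  Submodule.mem_orthogonal_singleton_iff_inner_right

lemma starProjection_tangentSpace (hx : ‖N x‖ = 1) (v : EuclideanSpace ℝ (Fin d)) :
    (tangentSpace N x).starProjection v = v - ⟪N x, v⟫_ℝ • N x := by
  rw [tangentSpace, Submodule.starProjection_orthogonal', sub_apply,
    Submodule.starProjection_unit_singleton ℝ hx]
  rfl

lemma inner_starProjection_tangentSpace (v : EuclideanSpace ℝ (Fin d)) :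
    ⟪N x, (tangentSpace N x).starProjection v⟫_ℝ = 0 :=
  mem_tangentSpace.1 (Submodule.starProjection_apply_mem _ _)

lemma inner_shapeOperator (v : EuclideanSpace ℝ (Fin d)) :
    ⟪N x, shapeOperator S N x v⟫_ℝ = 0 :=
  mem_tangentSpace.1 (Submodule.coe_mem _)

lemma shapeOperator_starProjection (v : EuclideanSpace ℝ (Fin d)) :
    shapeOperator S N x ((tangentSpace N x).starProjection v) = shapeOperator S N x v := by
  have : (tangentSpace N x).orthogonalProjectionOnto ((tangentSpace N x).starProjection v) =
      (tangentSpace N x).orthogonalProjectionOnto v :=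
    Submodule.orthogonalProjectionOnto_mem_subspace_eq_self
      ((tangentSpace N x).orthogonalProjectionOnto v)
  simp [shapeOperator, this]

lemma shapeOperator_normal : shapeOperator S N x (N x) = 0 := by
  have : (tangentSpace N x).orthogonalProjectionOnto (N x) = 0 := by
    rw [Submodule.orthogonalProjectionOnto_eq_zero_iff]
    exact Submodule.le_orthogonal_orthogonal _ (Submodule.mem_span_singleton_self _)
  simp [shapeOperator, this]

lemma shapeOperator_apply_of_mem {v : EuclideanSpace ℝ (Fin d)} (hv : v ∈ tangentSpace N x) :
    shapeOperator S N x v = weingarten S N x ⟨v, hv⟩ := by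
  have : (tangentSpace N x).orthogonalProjectionOnto v = ⟨v, hv⟩ :=
    Submodule.orthogonalProjectionOnto_mem_subspace_eq_self (⟨v, hv⟩ : tangentSpace N x)
  simp [shapeOperator, this]

namespace IsDefiningFunction

variable {U : Set (EuclideanSpace ℝ (Fin d))} {f : EuclideanSpace ℝ (Fin d) → ℝ}

/-- The projection in the Weingarten map can be dropped, since the derivative of the unit normal is
already tangent. -/
lemma shapeOperator_eq (h : IsDefiningFunction S N U f) (hx : x ∈ S ∩ U)
    {v : EuclideanSpace ℝ (Fin d)} (hv : ⟪N x, v⟫_ℝ = 0) :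
    shapeOperator S N x v = -fderiv ℝ (unitGradient f) x v := by
  rw [shapeOperator_apply_of_mem (mem_tangentSpace.2 hv), weingarten]
  simp only [LinearMap.neg_apply, LinearMap.comp_apply, Submodule.subtype_apply,
    ContinuousLinearMap.coe_coe, Submodule.coe_neg]
  rw [h.fderivWithin_eq hx (h.differentiableAt_unitGradient hx.2)
    (h.unitGradient_eventuallyEq hx.2) hv]
  congr 1
  exact Submodule.starProjection_eq_self_iff.2
    (mem_tangentSpace.2 (h.inner_fderiv_unitGradient hx v))

lemma shapeOperator_eq_comp (h : IsDefiningFunction S N U f) (hx : x ∈ S ∩ U) :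
    shapeOperator S N x =
      -(fderiv ℝ (unitGradient f) x ∘L (tangentSpace N x).starProjection) := by
  ext1 v
  rw [← shapeOperator_starProjection, h.shapeOperator_eq hx (inner_starProjection_tangentSpace v)]
  rfl

lemma norm_normal (h : IsDefiningFunction S N U f) (hx : x ∈ S ∩ U) : ‖N x‖ = 1 := by
  rw [h.eq_unitGradient x hx, norm_unitGradient (h.gradient_ne_zero x hx.2)]

lemma isSymmetric_shapeOperator (h : IsDefiningFunction S N U f) (hx : x ∈ S ∩ U) :
    (shapeOperator S N x).toLinearMap.IsSymmetric := by
  intro v w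
  set P := (tangentSpace N x).starProjection
  have hmem : ∀ u, shapeOperator S N x u ∈ tangentSpace N x := fun u =>
    mem_tangentSpace.2 (inner_shapeOperator u)
  have key : ∀ u w, ⟪shapeOperator S N x u, w⟫_ℝ =
      -⟪fderiv ℝ (unitGradient f) x (P u), P w⟫_ℝ := by
    intro u w
    have h1 : ⟪shapeOperator S N x u, w⟫_ℝ = ⟪shapeOperator S N x u, P w⟫_ℝ := by
      rw [← Submodule.starProjection_eq_self_iff.2 (hmem u), Submodule.inner_starProjection_left_eq_right,
        Submodule.starProjection_eq_self_iff.2 (hmem u)]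
    rw [h1, h.shapeOperator_eq_comp hx]
    simp [P]
  simp only [ContinuousLinearMap.coe_coe]
  rw [real_inner_comm (shapeOperator S N x w) v, key, key,
    h.inner_fderiv_unitGradient_comm hx (inner_starProjection_tangentSpace v)
      (inner_starProjection_tangentSpace w)]

end IsDefiningFunction

/-- In the splitting into tangent space and normal line the shape operator is the Weingarten map
plus zero. The additional eigenvalue 0 affects neither the sum of the eigenvalues nor the product of
the factors 1 - s k. -/
lemma charpoly_shapeOperator (hx : ‖N x‖ = 1) : (shapeOperator S N x).toLinearMap.charpoly =
    Polynomial.X * (weingarten S N x).charpoly := by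
  let T := tangentSpace N x
  have hN0 : N x ≠ 0 := by intro h; simp [h] at hx
  have hc : IsCompl T (ℝ ∙ N x) := (Submodule.isCompl_orthogonal _).symm
  set e := Submodule.prodEquivOfIsCompl _ _ hc
  have h1 : (shapeOperator S N x).toLinearMap =
      e.conj ((weingarten S N x).prodMap (0 : (ℝ ∙ N x) →ₗ[ℝ] (ℝ ∙ N x))) := by
    ext1 v
    obtain ⟨⟨a, b⟩, rfl⟩ := e.surjective v
    rw [LinearEquiv.conj_apply_apply, LinearEquiv.symm_apply_apply]
    obtain ⟨c, hc'⟩ := Submodule.mem_span_singleton.1 b.2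
    have hb : shapeOperator S N x (b : EuclideanSpace ℝ (Fin d)) = 0 := by
      rw [← hc', map_smul, shapeOperator_normal, smul_zero]
    simp only [e, Submodule.coe_prodEquivOfIsCompl', LinearMap.prodMap_apply, LinearMap.zero_apply,
      ContinuousLinearMap.coe_coe, map_add, hb, Submodule.coe_zero]
    rw [shapeOperator_apply_of_mem a.2]
  rw [h1, LinearEquiv.charpoly_conj, LinearMap.charpoly_prodMap, mul_comm]
  congr 1
  rw [LinearMap.charpoly_zero, finrank_span_singleton hN0, pow_one]

lemma isSymmetric_shapeOperator (hS : IsC2Hypersurface S) (hN : IsUnitNormalField S N)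
    (hx : x ∈ S) : (shapeOperator S N x).toLinearMap.IsSymmetric := by
  obtain ⟨U, f, h, hxU⟩ := exists_isDefiningFunction hS hN hx
  exact h.isSymmetric_shapeOperator ⟨hx, hxU⟩

lemma finrank_tangentSpace (hx : ‖N x‖ = 1) (hd : 2 ≤ d) :
    Module.finrank ℝ (tangentSpace N x) = d - 1 := by
  have hN0 : N x ≠ 0 := by intro h; simp [h] at hx
  have : Fact (Module.finrank ℝ (EuclideanSpace ℝ (Fin d)) = (d - 1) + 1) :=
    ⟨by simp; omega⟩
  exact Submodule.finrank_orthogonal_span_singleton hN0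

lemma roots_charpoly_shapeOperator (hx : ‖N x‖ = 1) :
    (shapeOperator S N x).toLinearMap.charpoly.roots = 0 ::ₘ principalCurvatures S N x := by
  rw [charpoly_shapeOperator hx, Polynomial.roots_mul
    (mul_ne_zero Polynomial.X_ne_zero (LinearMap.charpoly_monic _).ne_zero), Polynomial.roots_X]
  rfl

/-- By symmetry the characteristic polynomial splits over ℝ, so no eigenvalue is missing among its
roots. The trace form yields continuity of the curvature. -/
lemma totalCurvature_eq_trace (hS : IsC2Hypersurface S) (hN : IsUnitNormalField S N)
    (hx : x ∈ S) : totalCurvature S N x = LinearMap.trace ℝ _ (shapeOperator S N x).toLinearMap := by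
  have h := isSymmetric_shapeOperator hS hN hx
  rw [Module.End.trace_eq_sum_roots_charpoly_of_splits h.splits_charpoly,
    roots_charpoly_shapeOperator (hN.2.1 x hx), Multiset.sum_cons, zero_add]
  rfl

/-- The Jacobian determinant of `(x, s) ↦ x + s N(x)`. -/
def tubeJacobian (S : Set (EuclideanSpace ℝ (Fin d)))
    (N : EuclideanSpace ℝ (Fin d) → EuclideanSpace ℝ (Fin d)) (x : EuclideanSpace ℝ (Fin d))
    (s : ℝ) : ℝ :=
  (ContinuousLinearMap.id ℝ (EuclideanSpace ℝ (Fin d)) - s • shapeOperator S N x).det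

/-- The eigenvalues of the shape operator, their sum, and the Jacobian of the tube map. -/
lemma exists_eigenvalues_shapeOperator (hS : IsC2Hypersurface S) (hN : IsUnitNormalField S N)
    (hx : x ∈ S) {K : ℝ} (hK0 : 0 ≤ K) (hK : ∀ k ∈ principalCurvatures S N x, |k| ≤ K) :
    ∃ k : Fin d → ℝ, (∀ i, |k i| ≤ K) ∧ totalCurvature S N x = ∑ i, k i ∧
      (∀ s, tubeJacobian S N x s = ∏ i, (1 - s * k i)) ∧
      ∀ v, ‖shapeOperator S N x v‖ ≤ K * ‖v‖ := by
  have h := isSymmetric_shapeOperator hS hN hx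
  have hfr : Module.finrank ℝ (EuclideanSpace ℝ (Fin d)) = d := finrank_euclideanSpace_fin
  set b := h.eigenvectorBasis hfr
  set k := h.eigenvalues hfr
  have hb : ∀ i, shapeOperator S N x (b i) = k i • b i := fun i => h.apply_eigenvectorBasis hfr i
  have hroots := h.roots_charpoly_eq_eigenvalues hfr
  have hkK : ∀ i, |k i| ≤ K := by
    intro i
    have : k i ∈ (shapeOperator S N x).toLinearMap.charpoly.roots := by
      rw [hroots]
      exact Multiset.mem_map.2 ⟨i, Finset.mem_univ i, rfl⟩
    rw [roots_charpoly_shapeOperator (hN.2.1 x hx), Multiset.mem_cons] at this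
    -- The eigenvalue 0 of the normal direction is where 0 ≤ K is needed.
    rcases this with h0 | h0
    · rw [h0, abs_zero]; exact hK0
    · exact hK _ h0
  refine ⟨k, hkK, ?_, fun s => ?_, fun v => ?_⟩
  · have h1 : totalCurvature S N x = (shapeOperator S N x).toLinearMap.charpoly.roots.sum := by
      rw [roots_charpoly_shapeOperator (hN.2.1 x hx), Multiset.sum_cons, zero_add]; rfl
    rw [h1, hroots]
    rfl
  · rw [tubeJacobian, ContinuousLinearMap.det, ← LinearMap.det_toMatrix b.toBasis]
    have : LinearMap.toMatrix b.toBasis b.toBasis (ContinuousLinearMap.id ℝ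
        (EuclideanSpace ℝ (Fin d)) - s • shapeOperator S N x).toLinearMap =
        Matrix.diagonal fun i => 1 - s * k i := by
      ext i j
      rw [LinearMap.toMatrix_apply]
      simp only [OrthonormalBasis.coe_toBasis, ContinuousLinearMap.coe_coe, sub_apply,
        smul_apply, hb, ContinuousLinearMap.id_apply]
      have : b j - s • k j • b j = (1 - s * k j) • b j := by
        rw [sub_smul, one_smul, mul_smul]
      rw [this, map_smul, ← OrthonormalBasis.coe_toBasis, Module.Basis.repr_self,
        Finsupp.smul_apply, Finsupp.single_apply, Matrix.diagonal_apply]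
      by_cases hij : i = j
      · simp [hij]
      · simp [hij, Ne.symm hij]
    rw [this, Matrix.det_diagonal]
  · have h1 : ‖shapeOperator S N x v‖ ^ 2 ≤ (K * ‖v‖) ^ 2 := by
      rw [mul_pow, ← b.sum_sq_norm_inner_right, ← b.sum_sq_norm_inner_right v, Finset.mul_sum]
      refine Finset.sum_le_sum fun i _ => ?_
      have : ⟪b i, shapeOperator S N x v⟫_ℝ = k i * ⟪b i, v⟫_ℝ := by
        have := h (b i) v
        simp only [ContinuousLinearMap.coe_coe] at this
        rw [← this, hb, real_inner_smul_left]
      rw [this, norm_mul, mul_pow, Real.norm_eq_abs]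
      gcongr
      exact hkK i
    exact (sq_le_sq₀ (norm_nonneg _) (by positivity)).1 h1

/-- At each point there are d - 1 ≥ 1 principal curvatures, so the curvature bound is not vacuous.
-/
lemma curvature_bound_nonneg (hS : IsC2Hypersurface S) (hN : IsUnitNormalField S N)
    (hd : 2 ≤ d) (hx : x ∈ S) {K : ℝ} (hK : ∀ k ∈ principalCurvatures S N x, |k| ≤ K) : 0 ≤ K := by
  have h := isSymmetric_shapeOperator hS hN hx
  have h1 : (shapeOperator S N x).toLinearMap.charpoly.roots.card = d := by
    rw [h.roots_charpoly_eq_eigenvalues finrank_euclideanSpace_fin]; simp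
  rw [roots_charpoly_shapeOperator (hN.2.1 x hx), Multiset.card_cons] at h1
  obtain ⟨k, hk⟩ := Multiset.card_pos_iff_exists_mem.1
    (show 0 < (principalCurvatures S N x).card by omega)
  exact (abs_nonneg k).trans (hK k hk)

/-- Locally the shape operator is minus the derivative of a C¹ field composed with the projection 1
- ⟪N, ·⟫ N, and both depend continuously on the point. -/
lemma continuousOn_shapeOperator (hS : IsC2Hypersurface S) (hN : IsUnitNormalField S N) :
    ContinuousOn (shapeOperator S N) S := by
  intro x hx
  obtain ⟨U, f, h, hxU⟩ := exists_isDefiningFunction hS hN hx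
  have hNx : ContinuousWithinAt N S x := (hN.1 x (subset_closure hx)).mono subset_closure
  have h1 : ContinuousWithinAt (fun y => -(fderiv ℝ (unitGradient f) y ∘L
      (ContinuousLinearMap.id ℝ _ - (innerSL ℝ (N y)).smulRight (N y)))) S x := by
    refine (ContinuousWithinAt.clm_comp ?_ ?_).neg
    · exact ((h.contDiffOn_unitGradient.continuousOn_fderiv_of_isOpen h.isOpen
        (le_refl _)).continuousAt (h.isOpen.mem_nhds hxU)).continuousWithinAt
    · refine continuousWithinAt_const.sub ?_
      have h2 : ContinuousWithinAt (fun y => innerSL ℝ (N y)) S x :=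
        (innerSL ℝ).continuous.continuousAt.comp_continuousWithinAt hNx
      exact ((ContinuousLinearMap.smulRightL ℝ (EuclideanSpace ℝ (Fin d))
        (EuclideanSpace ℝ (Fin d))).continuous.continuousAt.comp_continuousWithinAt h2).clm_apply hNx
  refine h1.congr_of_eventuallyEq_of_mem ?_ hx
  filter_upwards [self_mem_nhdsWithin, mem_nhdsWithin_of_mem_nhds (h.isOpen.mem_nhds hxU)]
    with y hy hyU
  rw [h.shapeOperator_eq_comp ⟨hy, hyU⟩]
  congr 2
  ext1 v
  rw [starProjection_tangentSpace (hN.2.1 y hy)]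
  simp

lemma continuousOn_totalCurvature (hS : IsC2Hypersurface S) (hN : IsUnitNormalField S N) :
    ContinuousOn (totalCurvature S N) S := by
  have h1 : Continuous fun A : EuclideanSpace ℝ (Fin d) →L[ℝ] EuclideanSpace ℝ (Fin d) =>
      LinearMap.trace ℝ _ A.toLinearMap :=
    LinearMap.continuous_of_finiteDimensional (LinearMap.trace ℝ (EuclideanSpace ℝ (Fin d)) ∘ₗ
      (ContinuousLinearMap.coeLM ℝ : (EuclideanSpace ℝ (Fin d) →L[ℝ] EuclideanSpace ℝ (Fin d)) →ₗ[ℝ]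
        (EuclideanSpace ℝ (Fin d) →ₗ[ℝ] EuclideanSpace ℝ (Fin d))))
  exact (h1.comp_continuousOn (continuousOn_shapeOperator hS hN)).congr
    fun x hx => totalCurvature_eq_trace hS hN hx

lemma continuousOn_tubeJacobian (hS : IsC2Hypersurface S) (hN : IsUnitNormalField S N) :
    ContinuousOn (fun p : EuclideanSpace ℝ (Fin d) × ℝ => tubeJacobian S N p.1 p.2)
      (S ×ˢ univ) := by
  refine ContinuousLinearMap.continuous_det.comp_continuousOn ?_
  refine continuousOn_const.sub (continuousOn_snd.smul ?_)
  exact (continuousOn_shapeOperator hS hN).comp continuousOn_fst fun p hp => hp.1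

/-- Near a point of the hypersurface, secants are almost tangent, and the normal is almost
linear. -/
lemma eventually_secant (hS : IsC2Hypersurface S) (hN : IsUnitNormalField S N) (hx : x ∈ S)
    {η : ℝ} (hη : 0 < η) : ∀ᶠ p in 𝓝 (x, x), p.1 ∈ S → p.2 ∈ S →
      |⟪N x, p.1 - p.2⟫_ℝ| ≤ η * ‖p.1 - p.2‖ ∧
      ‖N p.1 - N p.2 + shapeOperator S N x (p.1 - p.2)‖ ≤ η * ‖p.1 - p.2‖ := by
  obtain ⟨U, f, h, hxU⟩ := exists_isDefiningFunction hS hN hx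
  have hg : 0 < ‖gradient f x‖ := norm_pos_iff.2 (h.gradient_ne_zero x hxU)
  set D := fderiv ℝ (unitGradient f) x
  -- The second condition controls the error made when the derivative of the normal field is
  -- replaced by the shape operator, which ignores the normal component of the secant.
  obtain ⟨η', hη', hη1, hη2⟩ : ∃ η' > 0, η' ≤ η ∧ η' * ‖D (N x)‖ ≤ η / 2 := by
    refine ⟨min η (η / 2 / (‖D (N x)‖ + 1)), by positivity, min_le_left _ _, ?_⟩
    calc _ ≤ η / 2 / (‖D (N x)‖ + 1) * ‖D (N x)‖ := by gcongr; exact min_le_right _ _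
      _ ≤ η / 2 / (‖D (N x)‖ + 1) * (‖D (N x)‖ + 1) := by gcongr; linarith
      _ = η / 2 := by field_simp
  -- Strict differentiability makes the estimates uniform in both endpoints of the secant. For f the
  -- difference of values is zero, so the linear term itself must be small.
  have h1 := ((h.contDiffAt hxU).hasStrictFDerivAt (by norm_num)).isLittleO.bound
    (show 0 < ‖gradient f x‖ * η' by positivity)
  have h2 := ((h.contDiffAt_unitGradient hxU).hasStrictFDerivAt (by norm_num)).isLittleO.bound
    (half_pos hη)
  have hU : ∀ᶠ p in 𝓝 (x, x), p.1 ∈ U ∧ p.2 ∈ U :=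
    (h.isOpen.prod h.isOpen).mem_nhds ⟨hxU, hxU⟩
  filter_upwards [h1, h2, hU] with p h1 h2 hU hp1 hp2
  set w := p.1 - p.2
  have h3 : |⟪N x, w⟫_ℝ| ≤ η' * ‖w‖ := by
    rw [(h.mem_iff _ hU.1).1 hp1, (h.mem_iff _ hU.2).1 hp2, fderiv_eq_inner_gradient,
      h.gradient_eq ⟨hx, hxU⟩, real_inner_smul_left, sub_self, zero_sub, norm_neg, norm_mul,
      norm_norm, Real.norm_eq_abs, mul_assoc, norm_smul, norm_norm, hN.2.1 x hx, mul_one] at h1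
    exact le_of_mul_le_mul_left h1 hg
  refine ⟨h3.trans (by gcongr), ?_⟩
  rw [h.eq_unitGradient _ ⟨hp1, hU.1⟩, h.eq_unitGradient _ ⟨hp2, hU.2⟩]
  have h4 : shapeOperator S N x w = -D w + ⟪N x, w⟫_ℝ • D (N x) := by
    rw [h.shapeOperator_eq_comp ⟨hx, hxU⟩]
    simp only [neg_apply, ContinuousLinearMap.comp_apply]
    rw [starProjection_tangentSpace (hN.2.1 x hx), map_sub, map_smul]
    simp only [D]; abel
  rw [h4]
  calc _ = ‖(unitGradient f p.1 - unitGradient f p.2 - D w) + ⟪N x, w⟫_ℝ • D (N x)‖ := by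
        congr 1; abel
    _ ≤ η / 2 * ‖w‖ + η' * ‖w‖ * ‖D (N x)‖ := by
        refine (norm_add_le _ _).trans (add_le_add h2 ?_)
        rw [norm_smul, Real.norm_eq_abs]
        gcongr
    _ ≤ η * ‖w‖ := by nlinarith [norm_nonneg w]

end Tube

/-! ### Lipschitz maps, Hausdorff measure and local comparison of measures -/

section HausdorffMeasure

open scoped NNReal ENNReal

variable {X Y : Type*} [MetricSpace X] [MeasurableSpace X] [BorelSpace X]
  [MetricSpace Y] [MeasurableSpace Y] [BorelSpace Y]

lemma LipschitzOnWith.euclideanHausdorffMeasure_image_le {f : X → Y} {s : Set X} {K : ℝ≥0}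
    (h : LipschitzOnWith K f s) (n : ℕ) :
    Measure.euclideanHausdorffMeasure n (f '' s) ≤
      (K : ℝ≥0∞) ^ n * Measure.euclideanHausdorffMeasure n s := by
  simp only [Measure.euclideanHausdorffMeasure_def, Measure.smul_apply]
  have := h.hausdorffMeasure_image_le (d := n) (by positivity)
  rw [ENNReal.rpow_natCast] at this
  calc _ ≤ _ • ((K : ℝ≥0∞) ^ n * Measure.hausdorffMeasure (n : ℝ) s) := by gcongr
    _ = _ := by rw [mul_smul_comm]

/-- A map that does not increase distances, and decreases them at most by a factor `c`. -/
lemma euclideanHausdorffMeasure_le_image {f : X → Y} {s : Set X} {c : ℝ≥0}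
    (h : ∀ x ∈ s, ∀ y ∈ s, dist x y ≤ c * dist (f x) (f y)) (n : ℕ) :
    Measure.euclideanHausdorffMeasure n s ≤
      (c : ℝ≥0∞) ^ n * Measure.euclideanHausdorffMeasure n (f '' s) := by
  rcases s.eq_empty_or_nonempty with rfl | ⟨x₀, hx₀⟩
  · simp
  have : Nonempty X := ⟨x₀⟩
  have hinj : InjOn f s := fun x hx y hy hxy => by
    have := h x hx y hy
    rw [hxy, dist_self, mul_zero] at this
    exact dist_le_zero.1 this
  set g := Function.invFunOn f s
  have hg : ∀ x ∈ s, g (f x) = x := fun x hx => hinj.leftInvOn_invFunOn hx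
  have hL : LipschitzOnWith c g (f '' s) := by
    refine LipschitzOnWith.of_dist_le_mul ?_
    rintro _ ⟨x, hx, rfl⟩ _ ⟨y, hy, rfl⟩
    rw [hg x hx, hg y hy]
    exact h x hx y hy
  have := hL.euclideanHausdorffMeasure_image_le n
  rwa [image_image, (image_congr hg : _ = (fun x => x) '' s), image_id'] at this

end HausdorffMeasure

/-- Two set functions that compare locally compare globally. -/
lemma measure_image_le_of_locally {X Y : Type*} [TopologicalSpace X] [SecondCountableTopology X]
    [MeasurableSpace X] [BorelSpace X] [MeasurableSpace Y]
    {f : X → Y} {Z : Set X} {μ : Measure X} {τ : Measure Y}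
    (h : ∀ p ∈ Z, ∃ W ∈ nhds p, ∀ B ⊆ Z ∩ W, MeasurableSet B → τ (f '' B) ≤ μ B)
    {B : Set X} (hBZ : B ⊆ Z) (hB : MeasurableSet B) : τ (f '' B) ≤ μ B := by
  rcases Z.eq_empty_or_nonempty with rfl | hZ
  · simp [subset_empty_iff.1 hBZ]
  choose! W hW hWB using h
  obtain ⟨t, htZ, htc, ht⟩ := TopologicalSpace.countable_cover_nhdsWithin
    (f := fun p => interior (W p)) (s := Z)
    fun p hp => mem_nhdsWithin_of_mem_nhds (interior_mem_nhds.2 (hW p hp))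
  have htn : t.Nonempty := by
    obtain ⟨z, hz⟩ := hZ
    obtain ⟨i, hi, -⟩ := mem_iUnion₂.1 (ht hz)
    exact ⟨i, hi⟩
  obtain ⟨e, rfl⟩ := htc.exists_eq_range htn
  -- By the Lindelöf property countably many neighbourhoods suffice; making them disjoint lets the
  -- local inequalities be summed.
  set A : ℕ → Set X := fun n => B ∩ interior (W (e n))
  have hA : ∀ n, MeasurableSet (disjointed A n) :=
    MeasurableSet.disjointed fun n => hB.inter isOpen_interior.measurableSet
  have hBA : B = ⋃ n, disjointed A n := by
    rw [iUnion_disjointed, ← inter_iUnion]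
    refine (inter_eq_self_of_subset_left fun p hp => ?_).symm
    simpa using ht (hBZ hp)
  have hsub : ∀ n, disjointed A n ⊆ Z ∩ W (e n) := fun n =>
    (disjointed_subset A n).trans (inter_subset_inter hBZ interior_subset)
  calc τ (f '' B) = τ (⋃ n, f '' disjointed A n) := by rw [← image_iUnion, ← hBA]
    _ ≤ ∑' n, τ (f '' disjointed A n) := measure_iUnion_le _
    _ ≤ ∑' n, μ (disjointed A n) :=
        ENNReal.tsum_le_tsum fun n => hWB _ (htZ ⟨n, rfl⟩) _ (hsub n) (hA n)
    _ = μ B := by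
        rw [← measure_iUnion (disjoint_disjointed A) hA, ← hBA]

/-- In this direction the images of the disjoint pieces must themselves be disjoint and measurable,
which is why injectivity is required. The opposite comparison uses subadditivity only. -/
lemma measure_le_image_of_locally {X Y : Type*} [TopologicalSpace X] [SecondCountableTopology X]
    [MeasurableSpace X] [BorelSpace X] [MeasurableSpace Y]
    {f : X → Y} {Z : Set X} {μ : Measure X} {τ : Measure Y} (hf : InjOn f Z)
    (hm : ∀ B ⊆ Z, MeasurableSet B → MeasurableSet (f '' B))
    (h : ∀ p ∈ Z, ∃ W ∈ nhds p, ∀ B ⊆ Z ∩ W, MeasurableSet B → μ B ≤ τ (f '' B))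
    {B : Set X} (hBZ : B ⊆ Z) (hB : MeasurableSet B) : μ B ≤ τ (f '' B) := by
  rcases Z.eq_empty_or_nonempty with rfl | hZ
  · simp [subset_empty_iff.1 hBZ]
  choose! W hW hWB using h
  obtain ⟨t, htZ, htc, ht⟩ := TopologicalSpace.countable_cover_nhdsWithin
    (f := fun p => interior (W p)) (s := Z)
    fun p hp => mem_nhdsWithin_of_mem_nhds (interior_mem_nhds.2 (hW p hp))
  have htn : t.Nonempty := by
    obtain ⟨z, hz⟩ := hZ
    obtain ⟨i, hi, -⟩ := mem_iUnion₂.1 (ht hz)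
    exact ⟨i, hi⟩
  obtain ⟨e, rfl⟩ := htc.exists_eq_range htn
  set A : ℕ → Set X := fun n => B ∩ interior (W (e n))
  have hA : ∀ n, MeasurableSet (disjointed A n) :=
    MeasurableSet.disjointed fun n => hB.inter isOpen_interior.measurableSet
  have hBA : B = ⋃ n, disjointed A n := by
    rw [iUnion_disjointed, ← inter_iUnion]
    refine (inter_eq_self_of_subset_left fun p hp => ?_).symm
    simpa using ht (hBZ hp)
  have hsub : ∀ n, disjointed A n ⊆ Z ∩ W (e n) := fun n =>
    (disjointed_subset A n).trans (inter_subset_inter hBZ interior_subset)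
  calc μ B = ∑' n, μ (disjointed A n) := by
        rw [← measure_iUnion (disjoint_disjointed A) hA, ← hBA]
    _ ≤ ∑' n, τ (f '' disjointed A n) :=
        ENNReal.tsum_le_tsum fun n => hWB _ (htZ ⟨n, rfl⟩) _ (hsub n) (hA n)
    _ = τ (⋃ n, f '' disjointed A n) := by
        refine (measure_iUnion (fun i j hij => ?_) fun n =>
          hm _ ((hsub n).trans inter_subset_left) (hA n)).symm
        exact (disjoint_disjointed A hij).image hf ((hsub i).trans inter_subset_left)
          ((hsub j).trans inter_subset_left)
    _ = τ (f '' B) := by rw [← image_iUnion, ← hBA]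

/-! ### The surface measure -/

namespace Tube

open Filter Topology
open scoped ENNReal

variable {d : ℕ} {S : Set (EuclideanSpace ℝ (Fin d))}
  {N : EuclideanSpace ℝ (Fin d) → EuclideanSpace ℝ (Fin d)} {x : EuclideanSpace ℝ (Fin d)}

/-- A hypersurface is locally closed: a limit of points of S that lies in a chart domain satisfies f
= 0 by continuity. Measurability of S and closedness of its boundary follow. -/
lemma exists_isOpen_eq_closure_inter (hS : IsC2Hypersurface S) :
    ∃ O, IsOpen O ∧ S = closure S ∩ O := by
  choose! U f hU hxU hf hf0 hSU using hS
  refine ⟨⋃ x ∈ S, U x, isOpen_biUnion hU, subset_antisymm (fun x hx =>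
    ⟨subset_closure hx, mem_biUnion hx (hxU x hx)⟩) fun y ⟨hy, hyO⟩ => ?_⟩
  obtain ⟨x, hx, hyx⟩ := mem_iUnion₂.1 hyO
  have h1 : f x y = 0 := by
    have hc : ContinuousAt (f x) y :=
      (hf x hx).continuousOn.continuousAt ((hU x hx).mem_nhds hyx)
    have hm : y ∈ closure (U x ∩ S) := mem_closure_iff_nhds.2 fun V hV => by
      obtain ⟨z, hz1, hz2⟩ := mem_closure_iff_nhds.1 hy _ (inter_mem hV ((hU x hx).mem_nhds hyx))
      exact ⟨z, hz1.1, hz1.2, hz2⟩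
    have hm2 := mem_closure_iff_nhdsWithin_neBot.1 hm
    have h2 : Tendsto (f x) (𝓝[U x ∩ S] y) (𝓝 0) := by
      refine tendsto_const_nhds.congr' ?_
      filter_upwards [self_mem_nhdsWithin] with z hz
      exact ((hSU x hx).subset ⟨hz.2, hz.1⟩).2.symm
    exact tendsto_nhds_unique (hc.tendsto.mono_left nhdsWithin_le_nhds) h2
  exact ((hSU x hx).symm.subset ⟨hyx, h1⟩).1

lemma measurableSet (hS : IsC2Hypersurface S) : MeasurableSet S := by
  obtain ⟨O, hO, h⟩ := exists_isOpen_eq_closure_inter hS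
  rw [h]
  exact isClosed_closure.measurableSet.inter hO.measurableSet

lemma isClosed_boundary (hS : IsC2Hypersurface S) : IsClosed (closure S \ S) := by
  obtain ⟨O, hO, h⟩ := exists_isOpen_eq_closure_inter hS
  have : closure S \ S = closure S ∩ Oᶜ := by
    ext y
    constructor
    · rintro ⟨h1, h2⟩
      exact ⟨h1, fun h3 => h2 (h ▸ ⟨h1, h3⟩)⟩
    · rintro ⟨h1, h2⟩
      exact ⟨h1, fun h3 => h2 (h.subset h3).2⟩
  rw [this]
  exact isClosed_closure.inter hO.isClosed_compl

lemma norm_sq_eq_tangent_add_normal (hx : ‖N x‖ = 1) (v : EuclideanSpace ℝ (Fin d)) :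
    ‖v‖ ^ 2 = ‖(tangentSpace N x).orthogonalProjectionOnto v‖ ^ 2 + ⟪N x, v⟫_ℝ ^ 2 := by
  have h1 := (tangentSpace N x).norm_sq_eq_add_norm_sq_projection v
  have h2 : ‖(tangentSpace N x)ᗮ.orthogonalProjectionOnto v‖ ^ 2 = ⟪N x, v⟫_ℝ ^ 2 := by
    have h3 : ((tangentSpace N x)ᗮ.orthogonalProjectionOnto v : EuclideanSpace ℝ (Fin d)) =
        ⟪N x, v⟫_ℝ • N x := by
      have := Submodule.starProjection_orthogonal_val (K := tangentSpace N x) v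
      change (tangentSpace N x)ᗮ.starProjection v = _
      rw [this, starProjection_tangentSpace hx]
      abel
    change ‖((tangentSpace N x)ᗮ.orthogonalProjectionOnto v : EuclideanSpace ℝ (Fin d))‖ ^ 2 = _
    rw [h3, norm_smul, hx, mul_one, Real.norm_eq_abs, sq_abs]
  rw [h1, h2]

lemma euclideanHausdorffMeasure_tangentSpace (hx : ‖N x‖ = 1) (hd : 2 ≤ d) :
    (Measure.euclideanHausdorffMeasure (d - 1) : Measure (tangentSpace N x)) = volume := by
  rw [← InnerProductSpace.euclideanHausdorffMeasure_eq_volume, finrank_tangentSpace hx hd]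

lemma volume_image_orthogonalProjection_le (hx : ‖N x‖ = 1) (hd : 2 ≤ d)
    (X : Set (EuclideanSpace ℝ (Fin d))) :
    volume ((tangentSpace N x).orthogonalProjectionOnto '' X) ≤
      Measure.euclideanHausdorffMeasure (d - 1) X := by
  have h : LipschitzOnWith 1 (tangentSpace N x).orthogonalProjectionOnto X :=
    (LipschitzWith.of_dist_le_mul fun a b => by
      rw [dist_eq_norm, dist_eq_norm, ← map_sub, NNReal.coe_one, one_mul]
      exact Submodule.norm_orthogonalProjectionOnto_apply_le _ _).lipschitzOnWith
  have := h.euclideanHausdorffMeasure_image_le (d - 1)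
  rwa [euclideanHausdorffMeasure_tangentSpace hx hd, ENNReal.coe_one, one_pow, one_mul] at this

/-- The isometry `ℝ × T_x → ℝ^d`, `(s, z) ↦ s N(x) + z`. -/
lemma measurePreserving_normalCoordinates (hx : ‖N x‖ = 1) :
    MeasurePreserving (fun p : ℝ × tangentSpace N x => p.1 • N x + (p.2 : EuclideanSpace ℝ (Fin d)))
      (volume.prod volume) volume := by
  have h1 := ((ℝ ∙ N x).measurePreserving_measurableEquivProd (0 : EuclideanSpace ℝ (Fin d))).symm
  rw [InnerProductSpace.euclideanHausdorffMeasure_eq_volume] at h1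
  have h2 := (LinearIsometryEquiv.toSpanUnitSingleton (𝕜 := ℝ) (N x) hx).measurePreserving
  have h3 := h2.prod (MeasurePreserving.id (volume : Measure (tangentSpace N x)))
  have h4 := h1.comp h3
  convert! h4 using 1
  ext1 p
  change _ = ((ℝ ∙ N x).measurableEquivProd (0 : EuclideanSpace ℝ (Fin d))).symm
    (LinearIsometryEquiv.toSpanUnitSingleton (𝕜 := ℝ) (N x) hx p.1, p.2)
  rw [Submodule.measurableEquivProd_symm_apply, LinearIsometryEquiv.toSpanUnitSingleton_apply,
    vadd_eq_add, add_zero]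

/-- The tangential part of small secants controls the secants. -/
lemma norm_le_mul_norm_orthogonalProjection (hx : ‖N x‖ = 1) {q η : ℝ} (hq : 1 < q)
    (hη : η ^ 2 ≤ 1 - (q ^ 2)⁻¹) {w : EuclideanSpace ℝ (Fin d)}
    (hw : |⟪N x, w⟫_ℝ| ≤ η * ‖w‖) : ‖w‖ ≤ q * ‖(tangentSpace N x).orthogonalProjectionOnto w‖ := by
  have h1 := norm_sq_eq_tangent_add_normal hx w
  have h2 : ⟪N x, w⟫_ℝ ^ 2 ≤ η ^ 2 * ‖w‖ ^ 2 := by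
    rw [← sq_abs, ← mul_pow]; gcongr
  have h3 : (q ^ 2)⁻¹ * ‖w‖ ^ 2 ≤ ‖(tangentSpace N x).orthogonalProjectionOnto w‖ ^ 2 := by
    nlinarith [sq_nonneg ‖w‖]
  have h4 : ‖w‖ ^ 2 ≤ (q * ‖(tangentSpace N x).orthogonalProjectionOnto w‖) ^ 2 := by
    rw [mul_pow]
    calc ‖w‖ ^ 2 = q ^ 2 * ((q ^ 2)⁻¹ * ‖w‖ ^ 2) := by field_simp
      _ ≤ _ := by gcongr
  exact (sq_le_sq₀ (norm_nonneg _) (by positivity)).1 h4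

/-- Close to a point the surface measure is finite. -/
lemma exists_nhds_surfaceMeasure_lt_top (hS : IsC2Hypersurface S) (hN : IsUnitNormalField S N)
    (hd : 2 ≤ d) (hx : x ∈ S) : ∃ A ∈ 𝓝 x, surfaceMeasure S A < ∞ := by
  have h := eventually_secant hS hN hx (η := 1 / 2) (by norm_num)
  rw [nhds_prod_eq, eventually_prod_self_iff'] at h
  obtain ⟨A, hA, h⟩ := h
  refine ⟨A ∩ Metric.ball x 1, inter_mem hA (Metric.ball_mem_nhds x one_pos), ?_⟩
  rw [surfaceMeasure, Measure.restrict_apply' (measurableSet hS)]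
  set X := A ∩ Metric.ball x 1 ∩ S
  -- Secants near x are so nearly tangent that the projection to the tangent space is bi-Lipschitz
  -- on this piece, and its image is bounded in a space of dimension d - 1.
  have h1 : Measure.euclideanHausdorffMeasure (d - 1) X ≤ ((2 : NNReal) : ℝ≥0∞) ^ (d - 1) *
      Measure.euclideanHausdorffMeasure (d - 1)
        ((tangentSpace N x).orthogonalProjectionOnto '' X) := by
    refine euclideanHausdorffMeasure_le_image (fun y hy z hz => ?_) _
    rw [dist_eq_norm, dist_eq_norm, ← map_sub]
    exact norm_le_mul_norm_orthogonalProjection (hN.2.1 x hx) (by norm_num) (by norm_num)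
      (h _ hy.1.1 _ hz.1.1 hy.2 hz.2).1
  refine h1.trans_lt (ENNReal.mul_lt_top (by simp) ?_)
  rw [euclideanHausdorffMeasure_tangentSpace (hN.2.1 x hx) hd]
  refine Bornology.IsBounded.measure_lt_top ?_
  refine ((tangentSpace N x).orthogonalProjectionOnto.lipschitz.isBounded_image
    (Metric.isBounded_ball (x := x) (r := 1))).subset (image_mono ?_)
  exact fun y hy => hy.1.2

/-- Countably many of the neighbourhoods of finite measure cover S. The product measure and Fubini's
theorem depend on this. -/
lemma sigmaFinite_surfaceMeasure (hS : IsC2Hypersurface S) (hN : IsUnitNormalField S N)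
    (hd : 2 ≤ d) : SigmaFinite (surfaceMeasure S) := by
  have h : ∀ x ∈ S, ∃ A ∈ 𝓝 x, surfaceMeasure S A < ∞ :=
    fun x hx => exists_nhds_surfaceMeasure_lt_top hS hN hd hx
  choose! A hA hA' using h
  obtain ⟨t, htS, htc, ht⟩ := TopologicalSpace.countable_cover_nhdsWithin (f := A) (s := S)
    fun p hp => mem_nhdsWithin_of_mem_nhds (hA p hp)
  refine Measure.sigmaFinite_of_countable (S := insert Sᶜ (A '' t)) ((htc.image A).insert _) ?_ ?_
  · rintro s (rfl | ⟨p, hp, rfl⟩)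
    · rw [surfaceMeasure, Measure.restrict_apply' (measurableSet hS)]; simp
    · exact hA' p (htS hp)
  · refine eq_univ_of_forall fun y => ?_
    by_cases hy : y ∈ S
    · obtain ⟨i, hi, hyi⟩ := mem_iUnion₂.1 (ht hy)
      exact ⟨A i, Or.inr ⟨i, hi, rfl⟩, hyi⟩
    · exact ⟨Sᶜ, Or.inl rfl, hy⟩

lemma surfaceMeasure_lt_top_of_isCompact (hS : IsC2Hypersurface S) (hN : IsUnitNormalField S N)
    (hd : 2 ≤ d) {K : Set (EuclideanSpace ℝ (Fin d))} (hK : IsCompact K) (hKS : K ⊆ S) :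
    surfaceMeasure S K < ∞ :=
  hK.measure_lt_top_of_nhdsWithin fun x hx => by
    obtain ⟨A, hA, h⟩ := exists_nhds_surfaceMeasure_lt_top hS hN hd (hKS hx)
    exact ⟨A, mem_nhdsWithin_of_mem_nhds hA, h⟩

end Tube

/-! ### The volume formula for the normal map -/

namespace Tube

open Filter Topology
open scoped ENNReal NNReal

variable {d : ℕ} {S : Set (EuclideanSpace ℝ (Fin d))}
  {N : EuclideanSpace ℝ (Fin d) → EuclideanSpace ℝ (Fin d)} {x : EuclideanSpace ℝ (Fin d)}

/-- The map `(x, s) ↦ x + s N(x)`. -/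
def normalMap (N : EuclideanSpace ℝ (Fin d) → EuclideanSpace ℝ (Fin d))
    (p : EuclideanSpace ℝ (Fin d) × ℝ) : EuclideanSpace ℝ (Fin d) :=
  p.1 + p.2 • N p.1

lemma continuousOn_normalMap (hN : IsUnitNormalField S N) :
    ContinuousOn (normalMap N) (closure S ×ˢ univ) :=
  continuousOn_fst.add (continuousOn_snd.smul (hN.1.comp continuousOn_fst fun _ hp => hp.1))

/-- The tangential projection of the first component together with the height. -/
def flatMap (N : EuclideanSpace ℝ (Fin d) → EuclideanSpace ℝ (Fin d))
    (x : EuclideanSpace ℝ (Fin d)) (p : EuclideanSpace ℝ (Fin d) × ℝ) : EuclideanSpace ℝ (Fin d) :=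
  p.2 • N x + (tangentSpace N x).starProjection p.1

lemma continuous_flatMap : Continuous (flatMap N x) := by
  unfold flatMap; fun_prop

lemma flatMap_sub (p p' : EuclideanSpace ℝ (Fin d) × ℝ) :
    flatMap N x p - flatMap N x p' = flatMap N x (p - p') := by
  simp only [flatMap, Prod.fst_sub, Prod.snd_sub, map_sub, sub_smul]; abel

lemma norm_orthogonalProjection_le_flatMap (hx : ‖N x‖ = 1) (p : EuclideanSpace ℝ (Fin d) × ℝ) :
    ‖(tangentSpace N x).orthogonalProjectionOnto p.1‖ ≤ ‖flatMap N x p‖ ∧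
      |p.2| ≤ ‖flatMap N x p‖ := by
  have h := norm_sq_eq_tangent_add_normal hx (flatMap N x p)
  have h1 : ⟪N x, flatMap N x p⟫_ℝ = p.2 := by
    rw [flatMap, inner_add_right, inner_starProjection_tangentSpace, inner_smul_right,
      real_inner_self_eq_norm_sq, hx]; simp
  have h2 : (tangentSpace N x).orthogonalProjectionOnto (flatMap N x p) =
      (tangentSpace N x).orthogonalProjectionOnto p.1 := by
    have h3 : (tangentSpace N x).orthogonalProjectionOnto (N x) = 0 := by
      rw [Submodule.orthogonalProjectionOnto_eq_zero_iff]
      exact Submodule.le_orthogonal_orthogonal _ (Submodule.mem_span_singleton_self _)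
    have h4 : (tangentSpace N x).orthogonalProjectionOnto
        ((tangentSpace N x).starProjection p.1) =
        (tangentSpace N x).orthogonalProjectionOnto p.1 :=
      Submodule.orthogonalProjectionOnto_mem_subspace_eq_self
        ((tangentSpace N x).orthogonalProjectionOnto p.1)
    rw [flatMap, map_add, map_smul, h3, h4, smul_zero, zero_add]
  rw [h1, h2] at h
  constructor
  · exact (sq_le_sq₀ (norm_nonneg _) (norm_nonneg _)).1 (by nlinarith [sq_nonneg p.2])
  · refine (sq_le_sq₀ (abs_nonneg _) (norm_nonneg _)).1 ?_
    rw [sq_abs]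
    nlinarith [sq_nonneg ‖(tangentSpace N x).orthogonalProjectionOnto p.1‖]

/-- In orthonormal coordinates (s, z) the slice at height s of the flattened set is the tangential
projection of the slice of B; then Fubini. The secant condition makes the flattening injective,
which is needed for measurability of the image. -/
lemma volume_flatMap_image_eq (hx1 : ‖N x‖ = 1) {q : ℝ≥0}
    {B : Set (EuclideanSpace ℝ (Fin d) × ℝ)} (hB : MeasurableSet B)
    (hq : ∀ p ∈ B, ∀ p' ∈ B,
      ‖p.1 - p'.1‖ ≤ q * ‖(tangentSpace N x).orthogonalProjectionOnto (p.1 - p'.1)‖) :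
    volume (flatMap N x '' B) =
      ∫⁻ s, volume ((tangentSpace N x).orthogonalProjectionOnto '' {y | (y, s) ∈ B}) := by
  let P := (tangentSpace N x).orthogonalProjectionOnto
  let b : EuclideanSpace ℝ (Fin d) × ℝ → ℝ × tangentSpace N x := fun p => (p.2, P p.1)
  have hbc : Continuous b := continuous_snd.prodMk (P.continuous.comp continuous_fst)
  have hbinj : InjOn b B := fun p hp p' hp' h => by
    have h1 : P (p.1 - p'.1) = 0 := by
      rw [map_sub]; exact sub_eq_zero.2 (Prod.ext_iff.1 h).2
    have h2 := hq p hp p' hp'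
    change _ ≤ _ * ‖P _‖ at h2
    rw [h1, norm_zero, mul_zero] at h2
    exact Prod.ext (sub_eq_zero.1 (norm_le_zero_iff.1 h2)) (Prod.ext_iff.1 h).1
  have hbm : MeasurableSet (b '' B) := hB.image_of_continuousOn_injOn hbc.continuousOn hbinj
  have hfinj : InjOn (flatMap N x) B := fun p hp p' hp' h => by
    have h1 := norm_orthogonalProjection_le_flatMap hx1 (p - p')
    rw [← flatMap_sub, h, sub_self, norm_zero] at h1
    exact hbinj hp hp' (Prod.ext (sub_eq_zero.1 (abs_nonpos_iff.1 h1.2))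
      (sub_eq_zero.1 ((map_sub P p.1 p'.1).symm.trans (norm_le_zero_iff.1 h1.1))))
  have hfm : MeasurableSet (flatMap N x '' B) :=
    hB.image_of_continuousOn_injOn continuous_flatMap.continuousOn hfinj
  have hj := measurePreserving_normalCoordinates hx1
  rw [← hj.measure_preimage hfm.nullMeasurableSet]
  have : (fun p : ℝ × tangentSpace N x => p.1 • N x + (p.2 : EuclideanSpace ℝ (Fin d))) ⁻¹'
      (flatMap N x '' B) = b '' B := by
    ext ⟨s, z⟩
    constructor
    · rintro ⟨p, hp, h⟩
      refine ⟨p, hp, ?_⟩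
      have h1 : flatMap N x (p - ((z : EuclideanSpace ℝ (Fin d)), s)) = 0 := by
        rw [← flatMap_sub, h, sub_eq_zero]
        simp [flatMap, Submodule.starProjection_eq_self_iff.2 z.2]
      have h2 := norm_orthogonalProjection_le_flatMap hx1 (p - ((z : EuclideanSpace ℝ (Fin d)), s))
      rw [h1, norm_zero] at h2
      have h3 : P (p.1 - z) = 0 := norm_le_zero_iff.1 h2.1
      have h4 : P z = z := Submodule.orthogonalProjectionOnto_mem_subspace_eq_self z
      rw [map_sub, h4, sub_eq_zero] at h3
      exact Prod.ext (sub_eq_zero.1 (abs_nonpos_iff.1 h2.2)) h3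
    · rintro ⟨p, hp, h⟩
      exact ⟨p, hp, by rw [← h]; rfl⟩
  rw [this, Measure.prod_apply hbm]
  refine lintegral_congr fun s => ?_
  congr 1
  ext z
  constructor
  · rintro ⟨p, hp, h⟩
    obtain ⟨rfl, rfl⟩ := Prod.ext_iff.1 h
    exact ⟨p.1, hp, rfl⟩
  · rintro ⟨y, hy, rfl⟩
    exact ⟨(y, s), hy, rfl⟩

/-- Volumes of flattened sets are comparable to the product of surface measure and length. -/
lemma volume_flatMap_image (hS : IsC2Hypersurface S) (hN : IsUnitNormalField S N)
    (hd : 2 ≤ d) (hx : x ∈ S) {q : ℝ≥0} {B : Set (EuclideanSpace ℝ (Fin d) × ℝ)}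
    (hB : MeasurableSet B) (hBS : B ⊆ S ×ˢ univ)
    (hq : ∀ p ∈ B, ∀ p' ∈ B,
      ‖p.1 - p'.1‖ ≤ q * ‖(tangentSpace N x).orthogonalProjectionOnto (p.1 - p'.1)‖) :
    volume (flatMap N x '' B) ≤ (surfaceMeasure S).prod volume B ∧
    (surfaceMeasure S).prod volume B ≤ (q : ℝ≥0∞) ^ (d - 1) * volume (flatMap N x '' B) := by
  have hσ := sigmaFinite_surfaceMeasure hS hN hd
  have hx1 := hN.2.1 x hx
  have hsurf : (surfaceMeasure S).prod volume B =
      ∫⁻ s, Measure.euclideanHausdorffMeasure (d - 1) {y | (y, s) ∈ B} := by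
    rw [Measure.prod_apply_symm hB]
    refine lintegral_congr fun s => ?_
    exact Measure.restrict_eq_self _ fun y hy => (hBS hy).1
  rw [volume_flatMap_image_eq hx1 hB hq, hsurf]
  -- Slice by slice: projecting does not increase Hausdorff measure, and by the secant condition it
  -- loses at most a factor q for each of the d - 1 dimensions.
  refine ⟨lintegral_mono fun s => volume_image_orthogonalProjection_le hx1 hd _, ?_⟩
  rw [← lintegral_const_mul' _ _ (by simp)]
  refine lintegral_mono fun s => ?_
  simp only [← euclideanHausdorffMeasure_tangentSpace hx1 hd]
  refine euclideanHausdorffMeasure_le_image (fun y hy z hz => ?_) _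
  rw [dist_eq_norm, dist_eq_norm, ← map_sub]
  exact hq (y, s) hy (z, s) hz

/-- Near a point the normal map is close to a linear map in flat coordinates. -/
lemma eventually_normalMap_sub_le (hS : IsC2Hypersurface S) (hN : IsUnitNormalField S N)
    (hx : x ∈ S) (s : ℝ) {q : ℝ} (hq : 1 < q) {δ : ℝ} (hδ : 0 < δ) :
    ∃ W ∈ 𝓝 (x, s), ∀ p ∈ W, ∀ p' ∈ W, p.1 ∈ S → p'.1 ∈ S →
      ‖p.1 - p'.1‖ ≤ q * ‖(tangentSpace N x).orthogonalProjectionOnto (p.1 - p'.1)‖ ∧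
      ‖normalMap N p - normalMap N p' - (ContinuousLinearMap.id ℝ (EuclideanSpace ℝ (Fin d)) - s • shapeOperator S N x)
        (flatMap N x p - flatMap N x p')‖ ≤ δ * ‖flatMap N x p - flatMap N x p'‖ := by
  have hx1 := hN.2.1 x hx
  set A := shapeOperator S N x
  set M := q * (2 + |s| + ‖A‖) + 1
  have hM : 0 < M := by positivity
  have hq' : 0 < 1 - (q ^ 2)⁻¹ := by
    rw [sub_pos]; exact inv_lt_one_of_one_lt₀ (by nlinarith)
  obtain ⟨η, hη, hηδ, hηq⟩ : ∃ η > 0, η * M ≤ δ ∧ η ^ 2 ≤ 1 - (q ^ 2)⁻¹ := by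
    refine ⟨min (δ / M) (Real.sqrt (1 - (q ^ 2)⁻¹)), by positivity, ?_, ?_⟩
    · calc _ ≤ δ / M * M := by gcongr; exact min_le_left _ _
        _ = δ := by field_simp
    · calc _ ≤ Real.sqrt (1 - (q ^ 2)⁻¹) ^ 2 := by gcongr; exact min_le_right _ _
        _ = _ := Real.sq_sqrt hq'.le
  have h := eventually_secant hS hN hx hη
  rw [nhds_prod_eq, eventually_prod_self_iff'] at h
  obtain ⟨V, hV, h⟩ := h
  have hNx : ContinuousWithinAt N S x := (hN.1 x (subset_closure hx)).mono subset_closure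
  obtain ⟨V', hV', h'⟩ : ∃ V' ∈ 𝓝 x, ∀ y ∈ V', y ∈ S → ‖N y - N x‖ ≤ η := by
    have := hNx.eventually (Metric.closedBall_mem_nhds _ hη)
    rw [eventually_nhdsWithin_iff] at this
    exact ⟨_, this, fun y hy hyS => by simpa [dist_eq_norm] using hy hyS⟩
  refine ⟨(V ∩ V') ×ˢ Metric.ball s (min η 1), prod_mem_nhds (inter_mem hV hV')
    (Metric.ball_mem_nhds _ (by positivity)), fun p hp p' hp' hpS hpS' => ?_⟩
  obtain ⟨h1, h2⟩ := h _ hp.1.1 _ hp'.1.1 hpS hpS'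
  have h3 := h' _ hp.1.2 hpS
  have hs' : |p'.2 - s| < min η 1 := hp'.2
  have hs1 := hs'.trans_le (min_le_left _ _)
  have hs2 := hs'.trans_le (min_le_right _ _)
  simp only at h1 h2
  set w := p.1 - p'.1 with hw
  have h4 := norm_le_mul_norm_orthogonalProjection hx1 hq hηq h1
  refine ⟨h4, ?_⟩
  rw [flatMap_sub]
  obtain ⟨h5, h6⟩ := norm_orthogonalProjection_le_flatMap hx1 (p - p')
  set Δ := flatMap N x (p - p') with hΔ
  have h7 : ‖w‖ ≤ q * ‖Δ‖ := h4.trans (by gcongr; exact h5)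
  -- The remainder splits exactly into the normal part of the secant, the variation of N times the
  -- difference of heights, the nonlinearity of N, and the change of s in the linear map. Each is at
  -- most η times ‖w‖ or ‖Δ‖; M collects the coefficients.
  have e1 : normalMap N p - normalMap N p' - (ContinuousLinearMap.id ℝ (EuclideanSpace ℝ (Fin d)) - s • A) Δ =
      ⟪N x, w⟫_ℝ • N x + (p.2 - p'.2) • (N p.1 - N x) + p'.2 • (N p.1 - N p'.1 + A w) +
        (s - p'.2) • A w := by
    have e2 : A Δ = A w := by
      rw [hΔ, flatMap, map_add, map_smul, shapeOperator_normal, shapeOperator_starProjection,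
        smul_zero, zero_add]
      rfl
    rw [sub_apply, smul_apply, e2, ContinuousLinearMap.id_apply, hΔ, flatMap,
      starProjection_tangentSpace hx1]
    simp only [normalMap, Prod.fst_sub, Prod.snd_sub, ← hw]
    rw [hw]
    module
  rw [e1]
  have hp's : |p'.2| ≤ |s| + 1 := by
    have := abs_sub_abs_le_abs_sub p'.2 s
    linarith
  have hAw : ‖A w‖ ≤ ‖A‖ * ‖w‖ := A.le_opNorm w
  calc _ ≤ |⟪N x, w⟫_ℝ| + |p.2 - p'.2| * ‖N p.1 - N x‖ + |p'.2| * ‖N p.1 - N p'.1 + A w‖ +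
        |s - p'.2| * ‖A w‖ := by
        refine (norm_add_le _ _).trans (add_le_add ((norm_add_le _ _).trans (add_le_add
          ((norm_add_le _ _).trans (add_le_add ?_ ?_)) ?_)) ?_) <;>
        rw [norm_smul, Real.norm_eq_abs]
        rw [hx1, mul_one]
    _ ≤ η * ‖w‖ + ‖Δ‖ * η + (|s| + 1) * (η * ‖w‖) + η * (‖A‖ * ‖w‖) := by
        gcongr
        · exact h6
        · rw [abs_sub_comm]; exact hs1.le
    _ = η * ((2 + |s| + ‖A‖) * ‖w‖ + ‖Δ‖) := by ring
    _ ≤ η * ((2 + |s| + ‖A‖) * (q * ‖Δ‖) + ‖Δ‖) := by gcongr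
    _ = η * M * ‖Δ‖ := by simp only [M]; ring
    _ ≤ δ * ‖Δ‖ := by gcongr

/-- Near a point the volume of an image under the normal map is comparable to the integral of the
Jacobian. -/
lemma exists_nhds_volume_normalMap_image (hS : IsC2Hypersurface S) (hN : IsUnitNormalField S N)
    (hd : 2 ≤ d) (hx : x ∈ S) {s : ℝ} (hJ : 0 < tubeJacobian S N x s) {q : ℝ≥0} (hq : 1 < q) :
    ∃ W ∈ 𝓝 (x, s), ∀ B ⊆ (S ×ˢ univ) ∩ W, MeasurableSet B →
      volume (normalMap N '' B) ≤ (q : ℝ≥0∞) ^ (d + 1) *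
        ∫⁻ p in B, ENNReal.ofReal (tubeJacobian S N p.1 p.2) ∂((surfaceMeasure S).prod volume) ∧
      ∫⁻ p in B, ENNReal.ofReal (tubeJacobian S N p.1 p.2) ∂((surfaceMeasure S).prod volume) ≤
        (q : ℝ≥0∞) ^ (d + 1) * volume (normalMap N '' B) := by
  set J := (tubeJacobian S N x s).toNNReal with hJdef
  have hJ0 : 0 < J := Real.toNNReal_pos.2 hJ
  set A := ContinuousLinearMap.id ℝ (EuclideanSpace ℝ (Fin d)) - s • shapeOperator S N x with hA
  have hdet : ENNReal.ofReal |A.det| = J := by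
    rw [show A.det = tubeJacobian S N x s from rfl, abs_of_pos hJ]; rfl
  have hm1 : ENNReal.ofReal |A.det| < (q * J : ℝ≥0) := by
    rw [hdet]; exact_mod_cast lt_mul_of_one_lt_left hJ0 hq
  have hm2 : ((q⁻¹ * J : ℝ≥0) : ℝ≥0∞) < ENNReal.ofReal |A.det| := by
    rw [hdet]; exact_mod_cast mul_lt_of_lt_one_left hJ0 (inv_lt_one_of_one_lt₀ hq)
  -- A map that is δ-close to the linear map A distorts volumes by nearly the determinant of A,
  -- which is the Jacobian at the base point.
  obtain ⟨δ, ⟨hδ1, hδ2⟩, hδ⟩ := (((addHaar_image_le_mul_of_det_lt volume A hm1).and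
    (mul_le_addHaar_image_of_lt_det volume A hm2)).and self_mem_nhdsWithin).exists
  obtain ⟨W, hW, hWp⟩ := eventually_normalMap_sub_le hS hN hx s (q := q) (by exact_mod_cast hq)
    (δ := δ) (by exact_mod_cast hδ)
  have hJc : ∃ W' ∈ 𝓝 (x, s), ∀ p ∈ W', p.1 ∈ S →
      (q⁻¹ * J : ℝ≥0) ≤ ENNReal.ofReal (tubeJacobian S N p.1 p.2) ∧
      ENNReal.ofReal (tubeJacobian S N p.1 p.2) ≤ (q * J : ℝ≥0) := by
    have h1 : ContinuousWithinAt (fun p : EuclideanSpace ℝ (Fin d) × ℝ =>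
        ENNReal.ofReal (tubeJacobian S N p.1 p.2)) (S ×ˢ univ) (x, s) :=
      ENNReal.continuous_ofReal.continuousAt.comp_continuousWithinAt
        (continuousOn_tubeJacobian hS hN (x, s) ⟨hx, mem_univ _⟩)
    have h2 : ENNReal.ofReal (tubeJacobian S N x s) = J := rfl
    have h3 := h1.eventually (Icc_mem_nhds (a := ((q⁻¹ * J : ℝ≥0) : ℝ≥0∞))
      (b := ((q * J : ℝ≥0) : ℝ≥0∞)) (by rw [← hdet] at h2; simp only [h2]; exact hm2)
      (by rw [← hdet] at h2; simp only [h2]; exact hm1))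
    rw [eventually_nhdsWithin_iff] at h3
    exact ⟨_, h3, fun p hp hpS => hp ⟨hpS, mem_univ _⟩⟩
  obtain ⟨W', hW', hWJ⟩ := hJc
  refine ⟨W ∩ W', inter_mem hW hW', fun B hBW hB => ?_⟩
  have hBS : B ⊆ S ×ˢ univ := fun p hp => (hBW hp).1
  have hsec := fun p (hp : p ∈ B) p' (hp' : p' ∈ B) =>
    hWp p (hBW hp).2.1 p' (hBW hp').2.1 (hBS hp).1 (hBS hp').1
  obtain ⟨hv1, hv2⟩ := volume_flatMap_image hS hN hd hx (q := q) hB hBS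
    fun p hp p' hp' => (hsec p hp p' hp').1
  set ν := (surfaceMeasure S).prod (volume : Measure ℝ)
  -- the normal map in flat coordinates
  have happ : ∃ g, ApproximatesLinearOn g A (flatMap N x '' B) δ ∧
      g '' (flatMap N x '' B) = normalMap N '' B := by
    have hinj : ∀ p ∈ B, ∀ p' ∈ B, flatMap N x p = flatMap N x p' → normalMap N p = normalMap N p' := by
      intro p hp p' hp' h
      have := (hsec p hp p' hp').2
      rw [h, sub_self, norm_zero, mul_zero, map_zero, sub_zero] at this
      exact sub_eq_zero.1 (norm_le_zero_iff.1 this)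
    let r := Function.invFunOn (flatMap N x) B
    have hr : ∀ p ∈ B, r (flatMap N x p) ∈ B ∧ flatMap N x (r (flatMap N x p)) = flatMap N x p :=
      fun p hp => Function.invFunOn_pos ⟨p, hp, rfl⟩
    have hg : ∀ p ∈ B, normalMap N (r (flatMap N x p)) = normalMap N p := fun p hp =>
      hinj _ (hr p hp).1 _ hp (hr p hp).2
    refine ⟨fun z => normalMap N (r z), ?_, ?_⟩
    · rintro _ ⟨p, hp, rfl⟩ _ ⟨p', hp', rfl⟩
      simp only [hg p hp, hg p' hp']
      exact (hsec p hp p' hp').2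
    · rw [image_image]
      exact image_congr hg
  obtain ⟨g, hg1, hg2⟩ := happ
  have h1 := hδ1 _ g hg1
  have h2 := hδ2 _ g hg1
  rw [hg2] at h1 h2
  have hq0 : q ≠ 0 := (zero_lt_one.trans hq).ne'
  have hqJ : (q : ℝ≥0∞) * (q⁻¹ * J : ℝ≥0) = J := by
    rw [← ENNReal.coe_mul, ← mul_assoc, mul_inv_cancel₀ hq0, one_mul]
  have hI1 : ((q⁻¹ * J : ℝ≥0) : ℝ≥0∞) * ν B ≤
      ∫⁻ p in B, ENNReal.ofReal (tubeJacobian S N p.1 p.2) ∂ν := by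
    rw [← setLIntegral_const]
    exact setLIntegral_mono' hB fun p hp => (hWJ p (hBW hp).2.2 (hBS hp).1).1
  have hI2 : ∫⁻ p in B, ENNReal.ofReal (tubeJacobian S N p.1 p.2) ∂ν ≤
      ((q * J : ℝ≥0) : ℝ≥0∞) * ν B := by
    rw [← setLIntegral_const]
    exact setLIntegral_mono' hB fun p hp => (hWJ p (hBW hp).2.2 (hBS hp).1).2
  have hq1 : (1 : ℝ≥0∞) ≤ q := by exact_mod_cast hq.le
  -- Two factors q come from the linear approximation and from comparing the Jacobian with its value
  -- at the base point. The second inequality needs d - 1 further ones for the projection.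
  constructor
  · calc volume (normalMap N '' B) ≤ ((q * J : ℝ≥0) : ℝ≥0∞) * ν B := h1.trans (by gcongr)
      _ = (q : ℝ≥0∞) ^ 2 * (((q⁻¹ * J : ℝ≥0) : ℝ≥0∞) * ν B) := by
        rw [ENNReal.coe_mul, ← hqJ]; ring
      _ ≤ (q : ℝ≥0∞) ^ (d + 1) * ∫⁻ p in B, ENNReal.ofReal (tubeJacobian S N p.1 p.2) ∂ν := by
        gcongr
        omega
  · calc _ ≤ ((q * J : ℝ≥0) : ℝ≥0∞) * ν B := hI2
      _ ≤ ((q * J : ℝ≥0) : ℝ≥0∞) * ((q : ℝ≥0∞) ^ (d - 1) * volume (flatMap N x '' B)) := by gcongr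
      _ = (q : ℝ≥0∞) ^ (d - 1 + 2) *
          (((q⁻¹ * J : ℝ≥0) : ℝ≥0∞) * volume (flatMap N x '' B)) := by
        rw [ENNReal.coe_mul, ← hqJ]; ring
      _ ≤ _ := by
        rw [show d - 1 + 2 = d + 1 by omega]
        gcongr

/-- The volume formula in tubular coordinates. -/
lemma volume_normalMap_image (hS : IsC2Hypersurface S) (hN : IsUnitNormalField S N)
    (hd : 2 ≤ d) {I : Set ℝ} (hinj : InjOn (normalMap N) (S ×ˢ I))
    (hJ : ∀ x ∈ S, ∀ s ∈ I, 0 < tubeJacobian S N x s)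
    {B : Set (EuclideanSpace ℝ (Fin d) × ℝ)} (hB : MeasurableSet B) (hBS : B ⊆ S ×ˢ I) :
    volume (normalMap N '' B) =
      ∫⁻ p in B, ENNReal.ofReal (tubeJacobian S N p.1 p.2) ∂((surfaceMeasure S).prod volume) := by
  set ν := ((surfaceMeasure S).prod volume).withDensity
    fun p : EuclideanSpace ℝ (Fin d) × ℝ => ENNReal.ofReal (tubeJacobian S N p.1 p.2)
  have hν : ∀ B, MeasurableSet B → ν B =
      ∫⁻ p in B, ENNReal.ofReal (tubeJacobian S N p.1 p.2) ∂((surfaceMeasure S).prod volume) :=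
    fun B hB => withDensity_apply _ hB
  -- For each q > 1 the local comparison holds around every point with the same factor, so it holds
  -- globally; afterwards q decreases to 1.
  have hle : ∀ q : ℝ≥0, 1 < q → volume (normalMap N '' B) ≤ (q : ℝ≥0∞) ^ (d + 1) * ν B ∧
      ν B ≤ (q : ℝ≥0∞) ^ (d + 1) * volume (normalMap N '' B) := by
    intro q hq
    have hloc := fun (p : EuclideanSpace ℝ (Fin d) × ℝ) (hp : p ∈ S ×ˢ I) =>
      exists_nhds_volume_normalMap_image hS hN hd hp.1 (hJ _ hp.1 _ hp.2) hq
    have hsub : S ×ˢ I ⊆ S ×ˢ univ := prod_mono_right (subset_univ _)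
    constructor
    · have := measure_image_le_of_locally (f := normalMap N) (Z := S ×ˢ I)
        (μ := (q : ℝ≥0∞) ^ (d + 1) • ν) (τ := volume) (fun p hp => by
          obtain ⟨W, hW, h⟩ := hloc p hp
          refine ⟨W, hW, fun B hBW hBm => ?_⟩
          rw [Measure.smul_apply, smul_eq_mul, hν B hBm]
          exact (h B (hBW.trans (inter_subset_inter_left _ hsub)) hBm).1) hBS hB
      rwa [Measure.smul_apply, smul_eq_mul] at this
    · have := measure_le_image_of_locally (f := normalMap N) (Z := S ×ˢ I)
        (μ := ν) (τ := (q : ℝ≥0∞) ^ (d + 1) • volume) hinj (fun B hBZ hBm =>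
          hBm.image_of_continuousOn_injOn ((continuousOn_normalMap hN).mono
            (hBZ.trans (prod_mono subset_closure (subset_univ _)))) (hinj.mono hBZ)) (fun p hp => by
          obtain ⟨W, hW, h⟩ := hloc p hp
          refine ⟨W, hW, fun B hBW hBm => ?_⟩
          rw [Measure.smul_apply, smul_eq_mul, hν B hBm]
          exact (h B (hBW.trans (inter_subset_inter_left _ hsub)) hBm).2) hBS hB
      rwa [Measure.smul_apply, smul_eq_mul] at this
  rw [← hν B hB]
  have hlim : ∀ a : ℝ≥0∞, Tendsto (fun q : ℝ≥0 => (q : ℝ≥0∞) ^ (d + 1) * a) (𝓝[>] 1) (𝓝 a) := by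
    intro a
    have h1 : Tendsto (fun q : ℝ≥0 => (q : ℝ≥0∞) ^ (d + 1)) (𝓝 1) (𝓝 ((1 : ℝ≥0) : ℝ≥0∞)) := by
      have : Tendsto (fun q : ℝ≥0 => ((q ^ (d + 1) : ℝ≥0) : ℝ≥0∞)) (𝓝 1) (𝓝 ((1 : ℝ≥0) : ℝ≥0∞)) :=
        ENNReal.tendsto_coe.2 (by simpa using (continuous_pow (d + 1)).tendsto (1 : ℝ≥0))
      simpa using this
    have h2 := ENNReal.Tendsto.mul_const (b := a) (h1.mono_left (nhdsWithin_le_nhds (s := Ioi 1)))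
      (Or.inl (by simp))
    simpa using h2
  refine le_antisymm ?_ ?_
  · refine ge_of_tendsto (hlim _) ?_
    filter_upwards [self_mem_nhdsWithin] with q hq using (hle q hq).1
  · refine ge_of_tendsto (hlim _) ?_
    filter_upwards [self_mem_nhdsWithin] with q hq using (hle q hq).2

end Tube

/-! ### Tubular coordinates and the Dirichlet part of the boundary -/

namespace Tube

open Filter Topology

variable {d : ℕ} {S : Set (EuclideanSpace ℝ (Fin d))}
  {N : EuclideanSpace ℝ (Fin d) → EuclideanSpace ℝ (Fin d)} {x : EuclideanSpace ℝ (Fin d)}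
  {K r : ℝ}

/-- `S` is an oriented hypersurface with curvatures bounded by `K`, and has a one-sided tubular
neighbourhood of width `r ≤ 1 / (2 K)`. -/
structure IsTube (S : Set (EuclideanSpace ℝ (Fin d)))
    (N : EuclideanSpace ℝ (Fin d) → EuclideanSpace ℝ (Fin d)) (K r : ℝ) : Prop where
  two_le : 2 ≤ d
  hypersurface : IsC2Hypersurface S
  normal : IsUnitNormalField S N
  nonneg : 0 ≤ K
  curvature_le : ∀ x ∈ S, ∀ k ∈ principalCurvatures S N x, |k| ≤ K
  pos : 0 < r
  mul_le : r * K ≤ 1 / 2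
  injOn : InjOn (normalMap N) (closure S ×ˢ Icc 0 r)

/-- The normal map has a local inverse that is `C¹` on an open subset of `ℝ^d`. -/
lemma IsDefiningFunction.exists_localInverse_normalMap {U : Set (EuclideanSpace ℝ (Fin d))}
    {f : EuclideanSpace ℝ (Fin d) → ℝ} (h : IsDefiningFunction S N U f) (hx : x ∈ S ∩ U) {s : ℝ}
    (hs : ∀ v, ‖s • shapeOperator S N x v‖ ≤ 1 / 2 * ‖v‖) :
    ∃ G : EuclideanSpace ℝ (Fin d) → EuclideanSpace ℝ (Fin d) × ℝ,
      ContDiffAt ℝ 1 G (normalMap N (x, s)) ∧ G (normalMap N (x, s)) = (x, s) ∧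
      (∀ᶠ z in 𝓝 (normalMap N (x, s)), (G z).1 ∈ S ∧ normalMap N (G z) = z) ∧
      ∀ v τ, ⟪N x, v⟫_ℝ = 0 → fderiv ℝ G (normalMap N (x, s))
        (v - s • shapeOperator S N x v + τ • N x) = (v, τ) := by
  set D := fderiv ℝ (unitGradient f) x
  -- The additional component f makes F a map between spaces of equal dimension d + 1, so the
  -- inverse function theorem applies without charts on S. Restricting its inverse to second
  -- component 0 forces the base point onto S.
  set F : EuclideanSpace ℝ (Fin d) × ℝ → EuclideanSpace ℝ (Fin d) × ℝ :=
    fun p => (p.1 + p.2 • unitGradient f p.1, f p.1) with hF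
  have hn1 : ContDiffAt ℝ 1 (fun p : EuclideanSpace ℝ (Fin d) × ℝ => unitGradient f p.1) (x, s) :=
    ContDiffAt.comp (g := unitGradient f) (x, s) (h.contDiffAt_unitGradient hx.2) contDiffAt_fst
  have hf1 : ContDiffAt ℝ 1 (fun p : EuclideanSpace ℝ (Fin d) × ℝ => f p.1) (x, s) :=
    ContDiffAt.comp (g := f) (x, s) ((h.contDiffAt hx.2).of_le (by norm_num)) contDiffAt_fst
  have hFc : ContDiffAt ℝ 1 F (x, s) := (contDiffAt_fst.add (contDiffAt_snd.smul hn1)).prodMk hf1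
  have hNx := h.eq_unitGradient x hx
  have hN1 := h.norm_normal hx
  have hFd : ∀ v τ, fderiv ℝ F (x, s) (v, τ) =
      (v + s • D v + τ • N x, ‖gradient f x‖ * ⟪N x, v⟫_ℝ) := by
    intro v τ
    have h1 : HasFDerivAt (fun p : EuclideanSpace ℝ (Fin d) × ℝ => unitGradient f p.1)
        (D ∘L ContinuousLinearMap.fst ℝ _ _) (x, s) :=
      HasFDerivAt.comp (g := unitGradient f) (x, s)
        (h.differentiableAt_unitGradient hx.2).hasFDerivAt hasFDerivAt_fst
    have h2 : HasFDerivAt (fun p : EuclideanSpace ℝ (Fin d) × ℝ => f p.1)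
        (fderiv ℝ f x ∘L ContinuousLinearMap.fst ℝ _ _) (x, s) :=
      HasFDerivAt.comp (g := f) (x, s)
        ((h.contDiffAt hx.2).differentiableAt (by norm_num)).hasFDerivAt hasFDerivAt_fst
    have h3 := (hasFDerivAt_fst.add (hasFDerivAt_snd.smul h1)).prodMk h2
    rw [show fderiv ℝ F (x, s) = _ from h3.fderiv]
    simp only [ContinuousLinearMap.prod_apply, add_apply, smul_apply,
      ContinuousLinearMap.smulRight_apply, ContinuousLinearMap.comp_apply,
      ContinuousLinearMap.coe_fst', ContinuousLinearMap.coe_snd', ← hNx]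
    rw [fderiv_eq_inner_gradient, h.gradient_eq hx, real_inner_smul_left, norm_smul, norm_norm,
      hN1, mul_one, add_assoc]
  -- In the kernel v is tangent, the normal component gives τ = 0, and v = s A v with ‖s A‖ ≤ 1/2
  -- forces v = 0.
  have hinj : Function.Injective (fderiv ℝ F (x, s)) := by
    rw [injective_iff_map_eq_zero]
    rintro ⟨v, τ⟩ h0
    rw [hFd, Prod.mk_eq_zero] at h0
    have hv : ⟪N x, v⟫_ℝ = 0 :=
      (mul_eq_zero.1 h0.2).resolve_left (norm_ne_zero_iff.2 (h.gradient_ne_zero x hx.2))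
    have hτ : τ = 0 := by
      have := congrArg (fun w => ⟪N x, w⟫_ℝ) h0.1
      simpa [inner_add_right, inner_smul_right, hv, D, h.inner_fderiv_unitGradient hx, hN1] using this
    have h1 : v = s • shapeOperator S N x v := by
      have := h0.1
      rw [hτ, zero_smul, add_zero] at this
      rw [h.shapeOperator_eq hx hv, smul_neg]
      exact eq_neg_of_add_eq_zero_left this
    have h2 := hs v
    rw [← h1] at h2
    have h3 : v = 0 := by
      rw [← norm_le_zero_iff]
      linarith
    rw [h3, hτ]; rfl
  set e : (EuclideanSpace ℝ (Fin d) × ℝ) ≃L[ℝ] (EuclideanSpace ℝ (Fin d) × ℝ) :=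
    (LinearEquiv.ofInjectiveEndo (fderiv ℝ F (x, s)).toLinearMap hinj).toContinuousLinearEquiv
  have he : (e : _ →L[ℝ] _) = fderiv ℝ F (x, s) := ContinuousLinearMap.ext fun v => rfl
  have hFe : HasFDerivAt F (e : _ →L[ℝ] _) (x, s) := by
    rw [he]; exact (hFc.differentiableAt (by norm_num)).hasFDerivAt
  have hFs : HasStrictFDerivAt F (e : _ →L[ℝ] _) (x, s) := hFc.hasStrictFDerivAt' hFe (by norm_num)
  set L := hFc.localInverse hFe (by norm_num)
  have hFx : F (x, s) = (normalMap N (x, s), 0) := by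
    simp only [hF, normalMap, hNx, (h.mem_iff x hx.2).1 hx.1]
  have hL0 : L (normalMap N (x, s), 0) = (x, s) := by
    rw [← hFx]; exact hFc.localInverse_apply_image hFe (by norm_num)
  have hLc : ContDiffAt ℝ 1 L (normalMap N (x, s), 0) := by
    rw [← hFx]; exact hFc.to_localInverse hFe (by norm_num)
  have hι : ContDiffAt ℝ 1 (fun z : EuclideanSpace ℝ (Fin d) => (z, (0 : ℝ)))
      (normalMap N (x, s)) := contDiffAt_id.prodMk contDiffAt_const
  have hGc : ContDiffAt ℝ 1 (fun z => L (z, 0)) (normalMap N (x, s)) :=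
    ContDiffAt.comp (g := L) (normalMap N (x, s)) hLc hι
  refine ⟨fun z => L (z, 0), hGc, hL0, ?_, fun v τ hv => ?_⟩
  · have h1 : ∀ᶠ z in 𝓝 (normalMap N (x, s)), F (L (z, 0)) = (z, 0) := by
      have := hFs.eventually_right_inverse
      rw [hFx] at this
      exact hι.continuousAt.eventually this
    have h2 : ∀ᶠ z in 𝓝 (normalMap N (x, s)), (L (z, 0)).1 ∈ U := by
      refine (continuous_fst.continuousAt.comp hGc.continuousAt).eventually_mem ?_
      rw [Function.comp_apply, hL0]
      exact h.isOpen.mem_nhds hx.2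
    filter_upwards [h1, h2] with z h1 h2
    have hzS := (h.mem_iff _ h2).2 (Prod.ext_iff.1 h1).2
    refine ⟨hzS, ?_⟩
    rw [normalMap, h.eq_unitGradient _ ⟨hzS, h2⟩]
    exact (Prod.ext_iff.1 h1).1
  · have h1 : HasFDerivAt L (e.symm : _ →L[ℝ] _) (normalMap N (x, s), 0) := by
      rw [← hFx]; exact hFs.to_localInverse.hasFDerivAt
    have h2 : HasFDerivAt (fun z => L (z, 0)) _ (normalMap N (x, s)) :=
      HasFDerivAt.comp (g := L) (normalMap N (x, s)) h1
        ((hasFDerivAt_id _).prodMk (hasFDerivAt_const (0 : ℝ) _))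
    rw [h2.fderiv]
    simp only [ContinuousLinearMap.comp_apply, ContinuousLinearMap.prod_apply,
      ContinuousLinearMap.id_apply, zero_apply, ContinuousLinearEquiv.coe_coe]
    rw [ContinuousLinearEquiv.symm_apply_eq]
    have h3 : e (v, τ) = fderiv ℝ F (x, s) (v, τ) := rfl
    rw [h3, hFd, hv, mul_zero, h.shapeOperator_eq hx hv, smul_neg, sub_neg_eq_add]

lemma tube_eq {ε : ℝ} (hε : 0 < ε) : tube S N ε = normalMap N '' (S ×ˢ Ioo 0 ε) := by
  ext z
  constructor
  · rintro ⟨⟨x, t⟩, ⟨hx, ht⟩, rfl⟩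
    exact ⟨(x, ε * t), ⟨hx, by have := ht.1; positivity, by nlinarith [ht.2]⟩, rfl⟩
  · rintro ⟨⟨x, s⟩, ⟨hx, hs⟩, rfl⟩
    refine ⟨(x, s / ε), ⟨hx, div_pos hs.1 hε, (div_lt_one hε).2 hs.2⟩, ?_⟩
    simp only [tubeMap, normalMap]
    rw [mul_div_cancel₀ _ hε.ne']

/-- The inverse of the normal map on the tubular neighbourhood. -/
def tubeCoord (S : Set (EuclideanSpace ℝ (Fin d)))
    (N : EuclideanSpace ℝ (Fin d) → EuclideanSpace ℝ (Fin d)) (r : ℝ) :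
    EuclideanSpace ℝ (Fin d) → EuclideanSpace ℝ (Fin d) × ℝ :=
  Function.invFunOn (normalMap N) (S ×ˢ Ioo 0 r)

namespace IsTube

lemma norm_eq_one (h : IsTube S N K r) (hx : x ∈ S) : ‖N x‖ = 1 := h.normal.2.1 x hx

lemma exists_eigenvalues (h : IsTube S N K r) (hx : x ∈ S) :
    ∃ k : Fin d → ℝ, (∀ i, |k i| ≤ K) ∧ totalCurvature S N x = ∑ i, k i ∧
      (∀ s, tubeJacobian S N x s = ∏ i, (1 - s * k i)) ∧
      ∀ v, ‖shapeOperator S N x v‖ ≤ K * ‖v‖ :=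
  exists_eigenvalues_shapeOperator h.hypersurface h.normal hx h.nonneg (h.curvature_le x hx)

lemma norm_shapeOperator_le (h : IsTube S N K r) (hx : x ∈ S) (v : EuclideanSpace ℝ (Fin d)) :
    ‖shapeOperator S N x v‖ ≤ K * ‖v‖ := by
  obtain ⟨-, -, -, -, h⟩ := h.exists_eigenvalues hx
  exact h v

lemma norm_smul_shapeOperator_le (h : IsTube S N K r) (hx : x ∈ S) {s : ℝ} (hs : |s| ≤ r)
    (v : EuclideanSpace ℝ (Fin d)) : ‖s • shapeOperator S N x v‖ ≤ 1 / 2 * ‖v‖ := by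
  rw [norm_smul, Real.norm_eq_abs]
  calc _ ≤ r * (K * ‖v‖) := by
        gcongr
        · exact h.pos.le
        · exact h.norm_shapeOperator_le hx v
    _ = r * K * ‖v‖ := by ring
    _ ≤ _ := by gcongr; exact h.mul_le

lemma tubeJacobian_pos (h : IsTube S N K r) (hx : x ∈ S) {s : ℝ} (hs : |s| ≤ r) :
    0 < tubeJacobian S N x s := by
  obtain ⟨k, hk, -, hJ, -⟩ := h.exists_eigenvalues hx
  rw [hJ]
  refine Finset.prod_pos fun i _ => ?_
  have h1 : |s * k i| ≤ r * K := by
    rw [abs_mul]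
    gcongr
    · exact h.pos.le
    · exact hk i
  have := (abs_le.1 (h1.trans h.mul_le)).2
  linarith

lemma exists_localInverse (h : IsTube S N K r) (hx : x ∈ S) {s : ℝ} (hs : |s| ≤ r) :
    ∃ G : EuclideanSpace ℝ (Fin d) → EuclideanSpace ℝ (Fin d) × ℝ,
      ContDiffAt ℝ 1 G (normalMap N (x, s)) ∧ G (normalMap N (x, s)) = (x, s) ∧
      (∀ᶠ z in 𝓝 (normalMap N (x, s)), (G z).1 ∈ S ∧ normalMap N (G z) = z) ∧
      ∀ v τ, ⟪N x, v⟫_ℝ = 0 → fderiv ℝ G (normalMap N (x, s))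
        (v - s • shapeOperator S N x v + τ • N x) = (v, τ) := by
  obtain ⟨U, f, hf, hxU⟩ := exists_isDefiningFunction h.hypersurface h.normal hx
  exact hf.exists_localInverse_normalMap ⟨hx, hxU⟩ fun v => h.norm_smul_shapeOperator_le hx hs v

/-- The local inverse exhibits all points near an image point as images, with base point in S and
nearby height. -/
lemma isOpen_image (h : IsTube S N K r) {s : ℝ} (hs : s ≤ r) :
    IsOpen (normalMap N '' (S ×ˢ Ioo 0 s)) := by
  rw [isOpen_iff_mem_nhds]
  rintro _ ⟨⟨x, t⟩, ⟨hx, ht⟩, rfl⟩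
  obtain ⟨G, hG, hG0, hev, -⟩ := h.exists_localInverse hx
    (abs_le.2 ⟨by linarith [ht.1, h.pos], ht.2.le.trans hs⟩ : |t| ≤ r)
  have h2 : ∀ᶠ z in 𝓝 (normalMap N (x, t)), (G z).2 ∈ Ioo 0 s := by
    refine (continuous_snd.continuousAt.comp hG.continuousAt).eventually_mem ?_
    rw [Function.comp_apply, hG0]
    exact isOpen_Ioo.mem_nhds ht
  filter_upwards [hev, h2] with z h1 h2
  exact ⟨G z, ⟨h1.1, h2⟩, h1.2⟩

lemma injOn_open (h : IsTube S N K r) : InjOn (normalMap N) (S ×ˢ Ioo 0 r) :=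
  h.injOn.mono (prod_mono subset_closure Ioo_subset_Icc_self)

lemma tubeCoord_normalMap (h : IsTube S N K r) {p : EuclideanSpace ℝ (Fin d) × ℝ}
    (hp : p ∈ S ×ˢ Ioo 0 r) : tubeCoord S N r (normalMap N p) = p :=
  h.injOn_open.leftInvOn_invFunOn hp

/-- Injectivity of the normal map forces its globally chosen inverse to agree with the local C¹
inverse. -/
lemma tubeCoord_eventuallyEq (h : IsTube S N K r) (hx : x ∈ S) {s : ℝ} (hs : s ∈ Ioo 0 r) :
    ∃ G : EuclideanSpace ℝ (Fin d) → EuclideanSpace ℝ (Fin d) × ℝ,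
      tubeCoord S N r =ᶠ[𝓝 (normalMap N (x, s))] G ∧
      ContDiffAt ℝ 1 G (normalMap N (x, s)) ∧
      ∀ v τ, ⟪N x, v⟫_ℝ = 0 → fderiv ℝ G (normalMap N (x, s))
        (v - s • shapeOperator S N x v + τ • N x) = (v, τ) := by
  obtain ⟨G, hG, hG0, hev, hd⟩ := h.exists_localInverse hx
    (abs_le.2 ⟨by linarith [hs.1, h.pos], hs.2.le⟩ : |s| ≤ r)
  refine ⟨G, ?_, hG, hd⟩
  have h2 : ∀ᶠ z in 𝓝 (normalMap N (x, s)), (G z).2 ∈ Ioo 0 r := by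
    refine (continuous_snd.continuousAt.comp hG.continuousAt).eventually_mem ?_
    rw [Function.comp_apply, hG0]
    exact isOpen_Ioo.mem_nhds hs
  filter_upwards [hev, h2] with z h1 h2
  conv_lhs => rw [← h1.2]
  exact h.tubeCoord_normalMap ⟨h1.1, h2⟩

lemma contDiffAt_tubeCoord (h : IsTube S N K r) (hx : x ∈ S) {s : ℝ} (hs : s ∈ Ioo 0 r) :
    ContDiffAt ℝ 1 (tubeCoord S N r) (normalMap N (x, s)) := by
  obtain ⟨G, hG, hG1, -⟩ := h.tubeCoord_eventuallyEq hx hs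
  exact hG1.congr_of_eventuallyEq hG

lemma fderiv_tubeCoord (h : IsTube S N K r) (hx : x ∈ S) {s : ℝ} (hs : s ∈ Ioo 0 r)
    {v : EuclideanSpace ℝ (Fin d)} (hv : ⟪N x, v⟫_ℝ = 0) (τ : ℝ) :
    fderiv ℝ (tubeCoord S N r) (normalMap N (x, s))
      (v - s • shapeOperator S N x v + τ • N x) = (v, τ) := by
  obtain ⟨G, hG, -, hd⟩ := h.tubeCoord_eventuallyEq hx hs
  rw [hG.fderiv_eq]
  exact hd v τ hv

/-- The point is a limit of points of the tube. By injectivity on the closed product it lies neither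
in the tube nor on the parallel surface. It is used to see that test functions on the tube vanish
near S and near the lateral boundary. -/
lemma mem_dirichlet (h : IsTube S N K r) {ε : ℝ} (hε : 0 < ε) (hεr : ε ≤ r)
    {p : EuclideanSpace ℝ (Fin d) × ℝ} (hp : p ∈ closure S ×ˢ Icc 0 ε) (hp' : p.1 ∉ S ∨ p.2 = 0) :
    normalMap N p ∈ frontier (tube S N ε) \ parallelSurface S N ε := by
  have hmem : ∀ q ∈ S ×ˢ Ioc 0 ε, normalMap N q ≠ normalMap N p := by
    intro q hq hqp
    have := h.injOn (show q ∈ closure S ×ˢ Icc 0 r from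
      ⟨subset_closure hq.1, hq.2.1.le, hq.2.2.trans hεr⟩)
      (show p ∈ closure S ×ˢ Icc 0 r from ⟨hp.1, hp.2.1, hp.2.2.trans hεr⟩) hqp
    rw [← this] at hp'
    rcases hp' with h1 | h1
    · exact h1 hq.1
    · exact hq.2.1.ne' h1
  rw [tube_eq hε]
  refine ⟨⟨?_, fun hi => ?_⟩, ?_⟩
  · have hcl : closure (S ×ˢ Ioo 0 ε) = closure S ×ˢ Icc 0 ε := by
      rw [closure_prod_eq, closure_Ioo hε.ne]
    refine ContinuousOn.image_closure ?_ ⟨p, by rwa [hcl], rfl⟩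
    rw [hcl]
    exact (continuousOn_normalMap h.normal).mono (prod_mono_right (subset_univ _))
  · obtain ⟨q, hq, hqp⟩ := interior_subset hi
    exact hmem q ⟨hq.1, Ioo_subset_Ioc_self hq.2⟩ hqp
  · rintro ⟨y, hy, hyp⟩
    exact hmem (y, ε) ⟨hy, hε, le_rfl⟩ hyp

/-- Since ‖N‖ = 1, points of the tube near z have base points in a fixed ball, so the relevant piece
of the closed product is compact and has a closed image. -/
lemma closure_tube_subset (h : IsTube S N K r) {ε : ℝ} (hε : 0 < ε) :
    closure (tube S N ε) ⊆ normalMap N '' (closure S ×ˢ Icc 0 ε) := by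
  intro z hz
  set C := (closure S ∩ Metric.closedBall z (1 + ε)) ×ˢ Icc 0 ε
  have hC : IsCompact C :=
    ((isCompact_closedBall z (1 + ε)).inter_left isClosed_closure).prod isCompact_Icc
  have hCi : IsClosed (normalMap N '' C) :=
    (hC.image_of_continuousOn ((continuousOn_normalMap h.normal).mono
      (prod_mono inter_subset_left (subset_univ _)))).isClosed
  have h1 := Metric.isOpen_ball.inter_closure (t := tube S N ε)
    ⟨Metric.mem_ball_self (x := z) one_pos, hz⟩
  have h2 : z ∈ normalMap N '' C := by
    refine closure_minimal ?_ hCi h1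
    rintro y ⟨hy, hyt⟩
    rw [tube_eq hε] at hyt
    obtain ⟨p, hp, rfl⟩ := hyt
    refine ⟨p, ⟨⟨subset_closure hp.1, ?_⟩, Ioo_subset_Icc_self hp.2⟩, rfl⟩
    rw [mem_closedBall_iff_norm]
    calc ‖p.1 - z‖ = ‖(normalMap N p - z) - p.2 • N p.1‖ := by
          congr 1; simp only [normalMap]; abel
      _ ≤ ‖normalMap N p - z‖ + ‖p.2 • N p.1‖ := norm_sub_le _ _
      _ ≤ 1 + ε := by
          refine add_le_add (mem_ball_iff_norm.1 hy).le ?_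
          rw [norm_smul, h.norm_eq_one hp.1, mul_one, Real.norm_eq_abs, abs_of_pos hp.2.1]
          exact hp.2.2.le
  exact image_mono (prod_mono_left inter_subset_left) h2

/-- Heights below ε give interior points, height ε gives the Neumann side, and heights above ε lie
outside the closure by injectivity. Trial functions may therefore be supported beyond the parallel
surface. -/
lemma notMem_dirichlet (h : IsTube S N K r) {ε : ℝ} (hε : 0 < ε) (hεr : ε ≤ r)
    {p : EuclideanSpace ℝ (Fin d) × ℝ} (hp : p ∈ S ×ˢ Ioc 0 r) :
    normalMap N p ∉ frontier (tube S N ε) \ parallelSurface S N ε := by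
  rintro ⟨⟨h1, h2⟩, h3⟩
  rcases lt_trichotomy p.2 ε with hlt | heq | hgt
  · refine h2 ?_
    rw [tube_eq hε, (h.isOpen_image hεr).interior_eq]
    exact ⟨p, ⟨hp.1, hp.2.1, hlt⟩, rfl⟩
  · exact h3 ⟨p.1, hp.1, by simp only [normalMap, heq]⟩
  · obtain ⟨q, hq, hqp⟩ := h.closure_tube_subset hε h1
    have := h.injOn (show q ∈ closure S ×ˢ Icc 0 r from ⟨hq.1, hq.2.1, hq.2.2.trans hεr⟩)
      (show p ∈ closure S ×ˢ Icc 0 r from ⟨subset_closure hp.1, hp.2.1.le, hp.2.2⟩) hqp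
    rw [← this] at hgt
    exact hgt.not_ge hq.2.2

end IsTube

end Tube

namespace Tube

open Filter Topology

variable {d : ℕ} {S : Set (EuclideanSpace ℝ (Fin d))}
  {N : EuclideanSpace ℝ (Fin d) → EuclideanSpace ℝ (Fin d)} {x : EuclideanSpace ℝ (Fin d)}
  {K r : ℝ}

/-! ### Covectors along a subspace -/

/-- The components of a complex covector, projected onto a subspace. -/
def covectorAlong (T : Submodule ℝ (EuclideanSpace ℝ (Fin d)))
    (l : EuclideanSpace ℝ (Fin d) →L[ℝ] ℂ) : EuclideanSpace ℂ (Fin d) :=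
  WithLp.toLp 2 fun i => l (T.starProjection (EuclideanSpace.single i 1))

lemma gradientAlong_eq (T : Submodule ℝ (EuclideanSpace ℝ (Fin d)))
    (u : EuclideanSpace ℝ (Fin d) → ℂ) (x : EuclideanSpace ℝ (Fin d)) :
    gradientAlong T u x = covectorAlong T (fderiv ℝ u x) := rfl

/-- A complex covector is given by its real and imaginary gradient vectors. -/
lemma exists_riesz (l : EuclideanSpace ℝ (Fin d) →L[ℝ] ℂ) :
    ∃ a b : EuclideanSpace ℝ (Fin d), ∀ v, l v = ⟪a, v⟫_ℝ + ⟪b, v⟫_ℝ * Complex.I := by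
  refine ⟨(InnerProductSpace.toDual ℝ _).symm (Complex.reCLM ∘L l),
    (InnerProductSpace.toDual ℝ _).symm (Complex.imCLM ∘L l), fun v => ?_⟩
  simp [InnerProductSpace.toDual_symm_apply]

lemma norm_sq_eq_of_riesz {l : EuclideanSpace ℝ (Fin d) →L[ℝ] ℂ} {a b : EuclideanSpace ℝ (Fin d)}
    (h : ∀ v, l v = ⟪a, v⟫_ℝ + ⟪b, v⟫_ℝ * Complex.I) (v : EuclideanSpace ℝ (Fin d)) :
    ‖l v‖ ^ 2 = ⟪a, v⟫_ℝ ^ 2 + ⟪b, v⟫_ℝ ^ 2 := by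
  rw [h, ← Complex.normSq_eq_norm_sq, Complex.normSq_add_mul_I]

lemma norm_covectorAlong_sq (T : Submodule ℝ (EuclideanSpace ℝ (Fin d)))
    {l : EuclideanSpace ℝ (Fin d) →L[ℝ] ℂ} {a b : EuclideanSpace ℝ (Fin d)}
    (h : ∀ v, l v = ⟪a, v⟫_ℝ + ⟪b, v⟫_ℝ * Complex.I) :
    ‖covectorAlong T l‖ ^ 2 = ‖T.starProjection a‖ ^ 2 + ‖T.starProjection b‖ ^ 2 := by
  have key : ∀ a : EuclideanSpace ℝ (Fin d), ∑ i,
      ⟪a, T.starProjection (EuclideanSpace.single i 1)⟫_ℝ ^ 2 = ‖T.starProjection a‖ ^ 2 := by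
    intro a
    rw [EuclideanSpace.norm_sq_eq]
    refine Finset.sum_congr rfl fun i _ => ?_
    rw [← Submodule.inner_starProjection_left_eq_right, EuclideanSpace.inner_single_right]
    simp
  rw [EuclideanSpace.norm_sq_eq]
  simp only [covectorAlong, norm_sq_eq_of_riesz h]
  rw [Finset.sum_add_distrib, key, key]

/-- The gradient splits into its tangential and its normal part. -/
lemma norm_covectorAlong_top_sq (hx : ‖N x‖ = 1) (l : EuclideanSpace ℝ (Fin d) →L[ℝ] ℂ) :
    ‖covectorAlong ⊤ l‖ ^ 2 = ‖covectorAlong (tangentSpace N x) l‖ ^ 2 + ‖l (N x)‖ ^ 2 := by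
  obtain ⟨a, b, h⟩ := exists_riesz l
  have key : ∀ a : EuclideanSpace ℝ (Fin d), ‖a‖ ^ 2 =
      ‖(tangentSpace N x).starProjection a‖ ^ 2 + ⟪a, N x⟫_ℝ ^ 2 := fun a => by
    rw [real_inner_comm]; exact norm_sq_eq_tangent_add_normal hx a
  rw [norm_covectorAlong_sq _ h, norm_covectorAlong_sq _ h, norm_sq_eq_of_riesz h,
    Submodule.starProjection_top]
  simp only [ContinuousLinearMap.id_apply]
  rw [key a, key b]
  ring

/-- The behaviour of the tangential gradient under the derivative of a parallel translation. -/
lemma IsTube.norm_covectorAlong_comp (h : IsTube S N K r) (hx : x ∈ S) {s : ℝ} (hs : |s| ≤ r)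
    {l l' : EuclideanSpace ℝ (Fin d) →L[ℝ] ℂ}
    (hl : ∀ v, ⟪N x, v⟫_ℝ = 0 → l' v = l (v - s • shapeOperator S N x v)) :
    (1 - |s| * K) * ‖covectorAlong (tangentSpace N x) l‖ ≤
        ‖covectorAlong (tangentSpace N x) l'‖ ∧
      ‖covectorAlong (tangentSpace N x) l'‖ ≤
        (1 + |s| * K) * ‖covectorAlong (tangentSpace N x) l‖ := by
  obtain ⟨a, b, hab⟩ := exists_riesz l
  obtain ⟨a', b', hab'⟩ := exists_riesz l'
  set P := (tangentSpace N x).starProjection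
  set A := shapeOperator S N x
  have hsK : |s| * K ≤ 1 / 2 := (mul_le_mul_of_nonneg_right hs h.nonneg).trans h.mul_le
  have hA : ∀ v, ‖s • A v‖ ≤ |s| * K * ‖v‖ := fun v => by
    rw [norm_smul, Real.norm_eq_abs, mul_assoc]
    gcongr
    exact h.norm_shapeOperator_le hx v
  have hmem : ∀ v, ⟪N x, v⟫_ℝ = 0 → P v = v := fun v hv =>
    Submodule.starProjection_eq_self_iff.2 (mem_tangentSpace.2 hv)
  have hNs : ∀ v, ⟪N x, v - s • A v⟫_ℝ = ⟪N x, v⟫_ℝ := fun v => by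
    rw [inner_sub_right, inner_smul_right, inner_shapeOperator, mul_zero, sub_zero]
  -- the real statement
  have key : ∀ a a' : EuclideanSpace ℝ (Fin d),
      (∀ v, ⟪N x, v⟫_ℝ = 0 → ⟪a', v⟫_ℝ = ⟪a, v - s • A v⟫_ℝ) →
      (1 - |s| * K) * ‖P a‖ ≤ ‖P a'‖ ∧ ‖P a'‖ ≤ (1 + |s| * K) * ‖P a‖ := by
    intro a a' haa
    have hPin : ∀ (a v : EuclideanSpace ℝ (Fin d)), ⟪N x, v⟫_ℝ = 0 → ⟪a, v⟫_ℝ = ⟪P a, v⟫_ℝ := by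
      intro a v hv
      rw [Submodule.inner_starProjection_left_eq_right]
      exact congrArg _ (hmem v hv).symm
    have hsq : ∀ a : EuclideanSpace ℝ (Fin d), ⟪a, P a⟫_ℝ = ‖P a‖ ^ 2 := fun a => by
      rw [hPin a _ (inner_starProjection_tangentSpace a), real_inner_self_eq_norm_sq]
    constructor
    -- For the lower bound, P a is written as (1 - s A) v with v tangent. This is possible because
    -- ‖s A‖ ≤ 1/2, and it bounds ‖v‖ by ‖P a‖ / (1 - |s| K).
    · have hinj : Function.Injective
          (ContinuousLinearMap.id ℝ (EuclideanSpace ℝ (Fin d)) - s • A) := by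
        rw [injective_iff_map_eq_zero]
        intro v hv
        have h1 : v = s • A v := sub_eq_zero.1 hv
        have h2 := h.norm_smul_shapeOperator_le hx hs v
        rw [← h1] at h2
        rw [← norm_le_zero_iff]; linarith
      obtain ⟨v, hv⟩ := (LinearMap.injective_iff_surjective
        (f := (ContinuousLinearMap.id ℝ (EuclideanSpace ℝ (Fin d)) - s • A).toLinearMap)).1 hinj (P a)
      have hv' : v - s • A v = P a := hv
      have hvN : ⟪N x, v⟫_ℝ = 0 := by
        rw [← hNs, hv']; exact inner_starProjection_tangentSpace a
      have h1 : ‖P a‖ ^ 2 ≤ ‖P a'‖ * ‖v‖ := by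
        rw [← hsq, ← hv', ← haa v hvN, hPin a' v hvN]
        exact real_inner_le_norm _ _
      have h2 : (1 - |s| * K) * ‖v‖ ≤ ‖P a‖ := by
        rw [← hv']
        have := norm_sub_norm_le v (s • A v)
        linarith [hA v]
      rcases (norm_nonneg (P a)).eq_or_lt with h0 | h0
      · rw [← h0, mul_zero]; exact norm_nonneg _
      · refine le_of_mul_le_mul_right ?_ h0
        calc (1 - |s| * K) * ‖P a‖ * ‖P a‖ = (1 - |s| * K) * ‖P a‖ ^ 2 := by ring
          _ ≤ (1 - |s| * K) * (‖P a'‖ * ‖v‖) := by gcongr; linarith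
          _ = ‖P a'‖ * ((1 - |s| * K) * ‖v‖) := by ring
          _ ≤ ‖P a'‖ * ‖P a‖ := by gcongr
    · have hN0 := inner_starProjection_tangentSpace (N := N) (x := x) a'
      have h1 : ‖P a'‖ ^ 2 ≤ ‖P a‖ * ((1 + |s| * K) * ‖P a'‖) := by
        rw [← hsq, haa _ hN0, hPin a _ ((hNs _).trans hN0)]
        refine (real_inner_le_norm _ _).trans ?_
        gcongr
        refine (norm_sub_le _ _).trans ?_
        linarith [hA (P a')]
      rcases (norm_nonneg (P a')).eq_or_lt with h0 | h0
      · rw [← h0]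
        have := h.nonneg
        positivity
      · refine le_of_mul_le_mul_right ?_ h0
        linarith
  have ha := key a a' fun v hv => by
    have := congrArg Complex.re (hl v hv)
    simpa [hab, hab'] using this
  have hb := key b b' fun v hv => by
    have := congrArg Complex.im (hl v hv)
    simpa [hab, hab'] using this
  have h0 : 0 ≤ 1 - |s| * K := by linarith
  have h0' : 0 ≤ 1 + |s| * K := by have := h.nonneg; positivity
  constructor
  · refine (sq_le_sq₀ (by positivity) (norm_nonneg _)).1 ?_
    rw [mul_pow, norm_covectorAlong_sq _ hab, norm_covectorAlong_sq _ hab', mul_add, ← mul_pow,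
      ← mul_pow]
    gcongr
    · exact ha.1
    · exact hb.1
  · refine (sq_le_sq₀ (norm_nonneg _) (by positivity)).1 ?_
    rw [mul_pow, norm_covectorAlong_sq _ hab, norm_covectorAlong_sq _ hab', mul_add, ← mul_pow,
      ← mul_pow]
    gcongr
    · exact ha.2
    · exact hb.2

/-! ### Trial functions on the tube -/

open Classical in
/-- The function `x + s N(x) ↦ φ(x) g(s / ε)` on the tubular neighbourhood. -/
def tubeTrial (S : Set (EuclideanSpace ℝ (Fin d)))
    (N : EuclideanSpace ℝ (Fin d) → EuclideanSpace ℝ (Fin d)) (r ε : ℝ) (g : ℝ → ℝ)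
    (φ : EuclideanSpace ℝ (Fin d) → ℂ) (z : EuclideanSpace ℝ (Fin d)) : ℂ :=
  if z ∈ normalMap N '' (S ×ˢ Ioo 0 r) then
    g ((tubeCoord S N r z).2 / ε) • φ (tubeCoord S N r z).1 else 0

namespace IsTube

lemma tubeTrial_apply (h : IsTube S N K r) {ε : ℝ} (g : ℝ → ℝ)
    (φ : EuclideanSpace ℝ (Fin d) → ℂ) {p : EuclideanSpace ℝ (Fin d) × ℝ} (hp : p ∈ S ×ˢ Ioo 0 r) :
    tubeTrial S N r ε g φ (normalMap N p) = g (p.2 / ε) • φ p.1 := by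
  rw [tubeTrial, if_pos ⟨p, hp, rfl⟩, h.tubeCoord_normalMap hp]

lemma tubeTrial_eventuallyEq (h : IsTube S N K r) {ε : ℝ} (g : ℝ → ℝ)
    (φ : EuclideanSpace ℝ (Fin d) → ℂ) {p : EuclideanSpace ℝ (Fin d) × ℝ} (hp : p ∈ S ×ˢ Ioo 0 r) :
    tubeTrial S N r ε g φ =ᶠ[𝓝 (normalMap N p)]
      fun z => g ((tubeCoord S N r z).2 / ε) • φ (tubeCoord S N r z).1 := by
  filter_upwards [(h.isOpen_image le_rfl).mem_nhds ⟨p, hp, rfl⟩] with z hz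
  rw [tubeTrial, if_pos hz]

/-- The vector is the image of (v, τ) under the derivative of the normal map, so the chain rule
reduces to differentiating g(s/ε) φ(x) in the direction (v, τ). -/
lemma fderiv_tubeTrial (h : IsTube S N K r) {ε : ℝ} {g : ℝ → ℝ} (hg : ContDiff ℝ 1 g)
    {φ : EuclideanSpace ℝ (Fin d) → ℂ} (hφ : ContDiff ℝ 1 φ) (hx : x ∈ S) {s : ℝ}
    (hs : s ∈ Ioo 0 r) {v : EuclideanSpace ℝ (Fin d)} (hv : ⟪N x, v⟫_ℝ = 0) (τ : ℝ) :
    fderiv ℝ (tubeTrial S N r ε g φ) (normalMap N (x, s))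
      (v - s • shapeOperator S N x v + τ • N x) =
      g (s / ε) • fderiv ℝ φ x v + (deriv g (s / ε) * (τ / ε)) • φ x := by
  rw [(h.tubeTrial_eventuallyEq g φ ⟨hx, hs⟩).fderiv_eq]
  have h0 : tubeCoord S N r (normalMap N (x, s)) = (x, s) := h.tubeCoord_normalMap ⟨hx, hs⟩
  have h1 : HasFDerivAt (tubeCoord S N r) _ (normalMap N (x, s)) :=
    ((h.contDiffAt_tubeCoord hx hs).differentiableAt (by norm_num)).hasFDerivAt
  have h2 : HasFDerivAt (fun z => g ((tubeCoord S N r z).2 / ε)) _ (normalMap N (x, s)) :=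
    HasDerivAt.comp_hasFDerivAt (h₂ := g) _
      (hg.differentiable (by norm_num) _).hasDerivAt
      ((hasFDerivAt_snd.comp _ h1).mul_const ε⁻¹)
  have h3 : HasFDerivAt (fun z => φ (tubeCoord S N r z).1) _ (normalMap N (x, s)) :=
    HasFDerivAt.comp (g := φ) _ (hφ.differentiable (by norm_num) _).hasFDerivAt
      (hasFDerivAt_fst.comp _ h1)
  rw [show fderiv ℝ (fun z => g ((tubeCoord S N r z).2 / ε) • φ (tubeCoord S N r z).1)
    (normalMap N (x, s)) = _ from (h2.smul h3).fderiv]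
  simp only [add_apply, smul_apply, ContinuousLinearMap.smulRight_apply,
    ContinuousLinearMap.comp_apply, ContinuousLinearMap.coe_fst', ContinuousLinearMap.coe_snd',
    h.fderiv_tubeCoord hx hs hv, h0, smul_eq_mul, div_eq_mul_inv]
  rw [mul_comm ε⁻¹ τ]

/-- The set of points of the tube at which the trial function does not vanish is relatively
compact. -/
lemma exists_isCompact_tubeTrial (h : IsTube S N K r) {ε : ℝ} (hε : 0 < ε) (hεr : 2 * ε < r)
    {g : ℝ → ℝ} {δ : ℝ} (hδ : 0 < δ) (hg0 : ∀ t < δ, g t = 0) (hg2 : ∀ t, 2 ≤ t → g t = 0)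
    {φ : EuclideanSpace ℝ (Fin d) → ℂ} (hφc : HasCompactSupport φ)
    (hφS : Disjoint (tsupport φ) (closure S \ S)) :
    ∃ Q, IsCompact Q ∧ Q ⊆ normalMap N '' (S ×ˢ Ioo 0 r) ∧
      ∀ z, z ∉ Q → tubeTrial S N r ε g φ z = 0 := by
  refine ⟨normalMap N '' ((tsupport φ ∩ closure S) ×ˢ Icc (ε * δ) (2 * ε)), ?_, ?_, fun z hz => ?_⟩
  · refine ((IsCompact.inter_right hφc isClosed_closure).prod isCompact_Icc).image_of_continuousOn ?_
    exact (continuousOn_normalMap h.normal).mono (prod_mono inter_subset_right (subset_univ _))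
  · refine image_mono (prod_mono (fun y hy => ?_) fun t ht => ⟨?_, ht.2.trans_lt hεr⟩)
    · by_contra hyS
      exact disjoint_left.1 hφS hy.1 ⟨hy.2, hyS⟩
    · exact (mul_pos hε hδ).trans_le ht.1
  · rw [tubeTrial]
    split_ifs with hzm
    · obtain ⟨p, hp, rfl⟩ := hzm
      rw [h.tubeCoord_normalMap hp]
      by_contra hne
      obtain ⟨h1, h2⟩ := smul_ne_zero_iff.1 hne
      refine hz ⟨p, ⟨⟨subset_tsupport _ h2, subset_closure hp.1⟩, ?_, ?_⟩, rfl⟩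
      · have : δ ≤ p.2 / ε := by
          by_contra hlt
          exact h1 (hg0 _ (not_le.1 hlt))
        rw [le_div_iff₀ hε] at this
        linarith
      · have : p.2 / ε < 2 := by
          by_contra hlt
          exact h1 (hg2 _ (not_lt.1 hlt))
        rw [div_lt_iff₀ hε] at this
        linarith
    · rfl

/-- The function lives on a compact subset Q of the open tube of width r: it is C¹ there through the
tubular coordinates and zero near every point outside Q. All heights in Q are positive and below r,
so Q misses the Dirichlet part. -/
lemma tubeTrial_isTest (h : IsTube S N K r) {ε : ℝ} (hε : 0 < ε) (hεr : 2 * ε < r)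
    {g : ℝ → ℝ} (hg : ContDiff ℝ 1 g) {δ : ℝ} (hδ : 0 < δ) (hg0 : ∀ t < δ, g t = 0)
    (hg2 : ∀ t, 2 ≤ t → g t = 0)
    {φ : EuclideanSpace ℝ (Fin d) → ℂ} (hφ : ContDiff ℝ 1 φ) (hφc : HasCompactSupport φ)
    (hφS : Disjoint (tsupport φ) (closure S \ S)) :
    ContDiff ℝ 1 (tubeTrial S N r ε g φ) ∧ HasCompactSupport (tubeTrial S N r ε g φ) ∧
      Disjoint (tsupport (tubeTrial S N r ε g φ))
        (frontier (tube S N ε) \ parallelSurface S N ε) := by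
  obtain ⟨Q, hQ, hQS, hQ0⟩ := h.exists_isCompact_tubeTrial hε hεr hδ hg0 hg2 hφc hφS
  have hts : tsupport (tubeTrial S N r ε g φ) ⊆ Q := by
    refine closure_minimal (fun z hz => ?_) hQ.isClosed
    by_contra hzQ
    exact hz (hQ0 z hzQ)
  refine ⟨contDiff_iff_contDiffAt.2 fun z => ?_, hQ.of_isClosed_subset (isClosed_tsupport _) hts,
    disjoint_left.2 fun z hz hz' => ?_⟩
  · by_cases hz : z ∈ Q
    · obtain ⟨⟨y, s⟩, hp, rfl⟩ := hQS hz
      refine ContDiffAt.congr_of_eventuallyEq ?_ (h.tubeTrial_eventuallyEq g φ hp)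
      have h1 := h.contDiffAt_tubeCoord hp.1 hp.2
      have h2 : ContDiffAt ℝ 1 (fun z => (tubeCoord S N r z).1) (normalMap N (y, s)) := h1.fst
      have h3 : ContDiffAt ℝ 1 (fun z => (tubeCoord S N r z).2 / ε) (normalMap N (y, s)) :=
        h1.snd.div_const ε
      exact (ContDiffAt.comp (g := g) _ hg.contDiffAt h3).smul
        (ContDiffAt.comp (g := φ) _ hφ.contDiffAt h2)
    · refine (contDiffAt_const (c := (0 : ℂ))).congr_of_eventuallyEq ?_
      filter_upwards [hQ.isClosed.isOpen_compl.mem_nhds hz] with w hw using hQ0 w hw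
  · obtain ⟨p, hp, rfl⟩ := hQS (hts hz)
    exact h.notMem_dirichlet hε (by linarith) ⟨hp.1, hp.2.1, hp.2.2.le⟩ hz'

end IsTube

end Tube

/-! ### Integrals depending on a parameter -/

section ParametricIntegral

open Filter Topology

variable {E G : Type*} [NormedAddCommGroup E] [NormedSpace ℝ E] [FiniteDimensional ℝ E]
  [NormedAddCommGroup G] [NormedSpace ℝ G]

/-- In finite dimension the partial derivative is bounded on the compact set of a closed ball times
the interval, which supplies the dominating constant. -/
lemma hasFDerivAt_intervalIntegral_of_contDiff {F : E × ℝ → G} (hF : ContDiff ℝ 1 F) (a b : ℝ)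
    (y : E) : HasFDerivAt (fun y => ∫ t in a..b, F (y, t))
      (∫ t in a..b, fderiv ℝ F (y, t) ∘L ContinuousLinearMap.inl ℝ E ℝ) y := by
  have hF' : Continuous fun p : E × ℝ => fderiv ℝ F p ∘L ContinuousLinearMap.inl ℝ E ℝ :=
    (hF.continuous_fderiv (by norm_num)).clm_comp continuous_const
  have hc : IsCompact (Metric.closedBall y 1 ×ˢ uIcc a b) :=
    (isCompact_closedBall y 1).prod isCompact_uIcc
  obtain ⟨C, hC⟩ := hc.exists_bound_of_continuousOn hF'.continuousOn
  refine intervalIntegral.hasFDerivAt_integral_of_dominated_of_fderiv_le (bound := fun _ => C)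
    (F' := fun y t => fderiv ℝ F (y, t) ∘L ContinuousLinearMap.inl ℝ E ℝ)
    (Metric.closedBall_mem_nhds y one_pos) ?_ ?_ ?_ ?_ ?_ ?_
  · exact Eventually.of_forall fun z =>
      (hF.continuous.comp (by fun_prop : Continuous fun t : ℝ => (z, t))).aestronglyMeasurable
  · exact (hF.continuous.comp (by fun_prop : Continuous fun t : ℝ => (y, t))).intervalIntegrable _ _
  · exact (hF'.comp (by fun_prop : Continuous fun t : ℝ => (y, t))).aestronglyMeasurable
  · exact Eventually.of_forall fun t ht z hz => hC (z, t) ⟨hz, uIoc_subset_uIcc ht⟩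
  · exact intervalIntegrable_const
  · refine Eventually.of_forall fun t _ z _ => ?_
    exact HasFDerivAt.comp (g := F) z (hF.differentiable (by norm_num) (z, t)).hasFDerivAt
      (hasFDerivAt_prodMk_left z t)

lemma contDiff_intervalIntegral {F : E × ℝ → G} (hF : ContDiff ℝ 1 F) (a b : ℝ) :
    ContDiff ℝ 1 fun y => ∫ t in a..b, F (y, t) := by
  rw [contDiff_one_iff_fderiv]
  refine ⟨fun y => (hasFDerivAt_intervalIntegral_of_contDiff hF a b y).differentiableAt, ?_⟩
  have : fderiv ℝ (fun y => ∫ t in a..b, F (y, t)) =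
      fun y => ∫ t in a..b, fderiv ℝ F (y, t) ∘L ContinuousLinearMap.inl ℝ E ℝ :=
    funext fun y => (hasFDerivAt_intervalIntegral_of_contDiff hF a b y).fderiv
  rw [this]
  refine intervalIntegral.continuous_parametric_intervalIntegral_of_continuous' ?_ a b
  exact (hF.continuous_fderiv (by norm_num)).clm_comp continuous_const

end ParametricIntegral

namespace Transverse

lemma contDiff_chi : ContDiff ℝ 1 chi := by unfold chi; fun_prop

end Transverse

/-! ### Transversal averages -/

namespace Tube

open Filter Topology Transverse
open scoped Manifold ContDiff

variable {d : ℕ} {S : Set (EuclideanSpace ℝ (Fin d))}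
  {N : EuclideanSpace ℝ (Fin d) → EuclideanSpace ℝ (Fin d)} {x : EuclideanSpace ℝ (Fin d)}
  {K r : ℝ}

/-- Away from the boundary, the normal field extends to a `C¹` vector field on the whole space. -/
lemma exists_contDiff_extension (hS : IsC2Hypersurface S) (hN : IsUnitNormalField S N)
    {F : Set (EuclideanSpace ℝ (Fin d))} (hF : IsClosed F) (hFd : Disjoint F (closure S \ S)) :
    ∃ M : EuclideanSpace ℝ (Fin d) → EuclideanSpace ℝ (Fin d),
      ContDiff ℝ 1 M ∧ ∀ y ∈ S ∩ F, M y = N y := by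
  have hcl : IsClosed (S ∩ F) := by
    have : S ∩ F = closure S ∩ F := by
      refine subset_antisymm (inter_subset_inter_left _ subset_closure) fun y hy => ⟨?_, hy.2⟩
      by_contra hyS
      exact disjoint_left.1 hFd hy.2 ⟨hy.1, hyS⟩
    rw [this]
    exact isClosed_closure.inter hF
  obtain ⟨M, hM⟩ := exists_contMDiffMap_forall_mem_convex_of_local
    (n := 1) 𝓘(ℝ, EuclideanSpace ℝ (Fin d))
    (t := fun y => {m : EuclideanSpace ℝ (Fin d) | y ∈ S ∩ F → m = N y}) (fun y => by
      by_cases hy : y ∈ S ∩ F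
      · simp only [hy, true_imp_iff]; exact convex_singleton _
      · simp only [hy, false_imp_iff]; exact convex_univ) (fun x => by
      by_cases hx : x ∈ S ∩ F
      · obtain ⟨U, f, hf, hxU⟩ := exists_isDefiningFunction hS hN hx.1
        exact ⟨U, hf.isOpen.mem_nhds hxU, unitGradient f, hf.contDiffOn_unitGradient.contMDiffOn,
          fun y hyU hy => (hf.eq_unitGradient y ⟨hy.1, hyU⟩).symm⟩
      · exact ⟨(S ∩ F)ᶜ, hcl.isOpen_compl.mem_nhds hx, fun _ => 0, contMDiffOn_const,
          fun y hy hy' => absurd hy' hy⟩)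
  exact ⟨M, M.contMDiff.contDiff, fun y hy => hM y hy⟩

/-- Tangential derivatives only see values on S, so a C¹ extension of N has the same ones as a local
unit gradient. -/
lemma shapeOperator_eq_of_eventuallyEq (hS : IsC2Hypersurface S) (hN : IsUnitNormalField S N)
    (hx : x ∈ S) {M : EuclideanSpace ℝ (Fin d) → EuclideanSpace ℝ (Fin d)}
    (hM : DifferentiableAt ℝ M x) (hMN : M =ᶠ[𝓝[S] x] N) {v : EuclideanSpace ℝ (Fin d)}
    (hv : ⟪N x, v⟫_ℝ = 0) : fderiv ℝ M x v = -shapeOperator S N x v := by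
  obtain ⟨U, f, hf, hxU⟩ := exists_isDefiningFunction hS hN hx
  rw [hf.shapeOperator_eq ⟨hx, hxU⟩ hv, neg_neg, ← hf.fderivWithin_eq ⟨hx, hxU⟩ hM hMN hv,
    ← hf.fderivWithin_eq ⟨hx, hxU⟩ (hf.differentiableAt_unitGradient hxU)
      (hf.unitGradient_eventuallyEq hxU) hv]

lemma norm_eq_one_of_mem_closure (hN : IsUnitNormalField S N) (hx : x ∈ closure S) : ‖N x‖ = 1 :=
  EqOn.of_subset_closure (s := S) (f := fun y => ‖N y‖) (g := fun _ => 1) hN.2.1 hN.1.norm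
    continuousOn_const subset_closure subset_rfl hx

namespace IsTube

/-- The base points of the support of a function. -/
def supportBase (S : Set (EuclideanSpace ℝ (Fin d)))
    (N : EuclideanSpace ℝ (Fin d) → EuclideanSpace ℝ (Fin d)) (ε : ℝ)
    (u : EuclideanSpace ℝ (Fin d) → ℂ) : Set (EuclideanSpace ℝ (Fin d)) :=
  Prod.fst '' {p ∈ closure S ×ˢ Icc 0 ε | normalMap N p ∈ tsupport u}

lemma isCompact_supportBase (h : IsTube S N K r) {ε : ℝ}
    {u : EuclideanSpace ℝ (Fin d) → ℂ} (hu : HasCompactSupport u) :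
    IsCompact (supportBase S N ε u) := by
  refine IsCompact.image ?_ continuous_fst
  obtain ⟨R, hR⟩ := (IsCompact.isBounded hu).subset_closedBall 0
  refine Metric.isCompact_of_isClosed_isBounded ?_ ?_
  · exact ((continuousOn_normalMap h.normal).mono
      (prod_mono_right (subset_univ _))).preimage_isClosed_of_isClosed
      (isClosed_closure.prod isClosed_Icc) (isClosed_tsupport u)
  · refine ((Metric.isBounded_closedBall (x := (0 : EuclideanSpace ℝ (Fin d)))
      (r := R + ε)).prod (Metric.isBounded_Icc 0 ε)).subset fun p hp => ⟨?_, hp.1.2⟩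
    rw [mem_closedBall_zero_iff]
    have h1 := mem_closedBall_zero_iff.1 (hR hp.2)
    calc ‖p.1‖ = ‖normalMap N p - p.2 • N p.1‖ := by simp [normalMap]
      _ ≤ ‖normalMap N p‖ + ‖p.2 • N p.1‖ := norm_sub_le _ _
      _ ≤ R + ε := by
        rw [norm_smul, norm_eq_one_of_mem_closure h.normal hp.1.1, mul_one, Real.norm_eq_abs,
          abs_of_nonneg hp.1.2.1]
        exact add_le_add h1 hp.1.2.2

/-- A base point on the boundary of S would place a point of the support on the Dirichlet part. -/
lemma supportBase_subset (h : IsTube S N K r) {ε : ℝ} (hε : 0 < ε) (hεr : ε ≤ r)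
    {u : EuclideanSpace ℝ (Fin d) → ℂ}
    (hu : Disjoint (tsupport u) (frontier (tube S N ε) \ parallelSurface S N ε)) :
    supportBase S N ε u ⊆ S := by
  rintro _ ⟨p, ⟨hp, hpu⟩, rfl⟩
  by_contra hpS
  exact disjoint_left.1 hu hpu (h.mem_dirichlet hε hεr hp (Or.inl hpS))

/-- The transversal average of a function that vanishes on the Dirichlet part of the boundary of
the tube is a test function on the hypersurface. -/
lemma exists_average (h : IsTube S N K r) {ε : ℝ} (hε : 0 < ε) (hεr : ε ≤ r)
    {u : EuclideanSpace ℝ (Fin d) → ℂ} (hu : ContDiff ℝ 1 u) (huc : HasCompactSupport u)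
    (huZ : Disjoint (tsupport u) (frontier (tube S N ε) \ parallelSurface S N ε)) :
    ∃ φ : EuclideanSpace ℝ (Fin d) → ℂ, ContDiff ℝ 1 φ ∧ HasCompactSupport φ ∧
      Disjoint (tsupport φ) (closure S \ S) ∧ ∀ x ∈ S,
        φ x = ∫ t in (0 : ℝ)..1, (chi t : ℂ) * u (normalMap N (x, ε * t)) ∧
        ∀ v, ⟪N x, v⟫_ℝ = 0 → fderiv ℝ φ x v = ∫ t in (0 : ℝ)..1,
          (chi t : ℂ) * fderiv ℝ u (normalMap N (x, ε * t))
            (v - (ε * t) • shapeOperator S N x v) := by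
  set A := supportBase S N ε u
  have hA : IsCompact A := h.isCompact_supportBase huc
  have hAS : A ⊆ S := h.supportBase_subset hε hεr huZ
  have hdc := isClosed_boundary h.hypersurface
  have hAd : A ⊆ (closure S \ S)ᶜ := fun y hy hy' => hy'.2 (hAS hy)
  -- The cut-off η is one near A and supported in L₁, while the extension M of the normal is exact
  -- on the larger set L₂. Hence M agrees with N on S near every point of L₁, and tangential
  -- derivatives can be compared there.
  obtain ⟨L₁, hL₁, hAL₁, hL₁d⟩ := exists_compact_between hA hdc.isOpen_compl hAd
  obtain ⟨L₂, hL₂, hL₁₂, hL₂d⟩ := exists_compact_between hL₁ hdc.isOpen_compl hL₁d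
  obtain ⟨M, hMc, hM⟩ := exists_contDiff_extension h.hypersurface h.normal hL₂.isClosed
    (disjoint_left.2 fun y hy => hL₂d hy)
  obtain ⟨η, hη1, hη0, -⟩ := exists_contMDiffMap_one_nhds_of_subset_interior (n := 1)
    𝓘(ℝ, EuclideanSpace ℝ (Fin d)) hA.isClosed hAL₁
  have hηc : ContDiff ℝ 1 η := η.contMDiff.contDiff
  set F : EuclideanSpace ℝ (Fin d) × ℝ → ℂ := fun p => (chi p.2 : ℂ) * u (p.1 + (ε * p.2) • M p.1)
  have hm : ContDiff ℝ 1 fun p : EuclideanSpace ℝ (Fin d) × ℝ => p.1 + (ε * p.2) • M p.1 :=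
    contDiff_fst.add ((contDiff_const.mul contDiff_snd).smul (hMc.comp contDiff_fst))
  have hF : ContDiff ℝ 1 F :=
    (Complex.ofRealCLM.contDiff.comp (contDiff_chi.comp contDiff_snd)).mul (hu.comp hm)
  set I : EuclideanSpace ℝ (Fin d) → ℂ := fun y => ∫ t in (0 : ℝ)..1, F (y, t)
  have hI : ContDiff ℝ 1 I := contDiff_intervalIntegral hF 0 1
  set φ : EuclideanSpace ℝ (Fin d) → ℂ := fun y => η y • I y
  have hφL₁ : tsupport φ ⊆ L₁ := by
    refine closure_minimal (fun y hy => ?_) hL₁.isClosed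
    by_contra hyL
    exact hy (by simp only [φ, hη0 y hyL, zero_smul])
  -- The normal segment over a point of S outside A misses the support of u, so both sides of the
  -- claimed identities vanish there and the choice of η does not matter.
  have hnA : ∀ x ∈ S, x ∉ A → ∀ t ∈ Icc (0 : ℝ) 1, normalMap N (x, ε * t) ∉ tsupport u := by
    intro x hx hxA t ht hmem
    exact hxA ⟨(x, ε * t), ⟨⟨subset_closure hx, by have := ht.1; positivity,
      by nlinarith [ht.2]⟩, hmem⟩, rfl⟩
  refine ⟨φ, hηc.smul hI, hL₁.of_isClosed_subset (isClosed_tsupport _) hφL₁,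
    disjoint_left.2 fun y hy => hL₁d (hφL₁ hy), fun x hx => ?_⟩
  have hMx : x ∈ L₁ → ∀ t, x + (ε * t) • M x = normalMap N (x, ε * t) := fun hxL t => by
    rw [normalMap, hM x ⟨hx, interior_subset (hL₁₂ hxL)⟩]
  have hIcc : ∀ t ∈ uIcc (0 : ℝ) 1, t ∈ Icc (0 : ℝ) 1 := fun t ht => by
    rwa [uIcc_of_le zero_le_one] at ht
  have hI0 : x ∈ L₁ → x ∉ A → I x = 0 := fun hxL hxA => by
    refine (intervalIntegral.integral_congr (g := fun _ => (0 : ℂ)) fun t ht => ?_).trans (by simp)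
    simp only [F, hMx hxL, image_eq_zero_of_notMem_tsupport (hnA x hx hxA t (hIcc t ht)), mul_zero]
  constructor
  · by_cases hxL : x ∈ L₁
    · have h1 : I x = ∫ t in (0 : ℝ)..1, (chi t : ℂ) * u (normalMap N (x, ε * t)) := by
        simp only [I, F, hMx hxL]
      rw [← h1]
      by_cases hxA : x ∈ A
      · simp only [φ, hη1.self_of_nhdsSet x hxA, one_smul]
      · simp only [φ, hI0 hxL hxA, smul_zero]
    · have hxA : x ∉ A := fun hxA => hxL (interior_subset (hAL₁ hxA))
      simp only [φ, hη0 x hxL, zero_smul]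
      refine (intervalIntegral.integral_congr (g := fun _ => (0 : ℂ)) fun t ht => ?_).trans
        (by simp) |>.symm
      simp only [image_eq_zero_of_notMem_tsupport (hnA x hx hxA t (hIcc t ht)), mul_zero]
  · intro v hv
    have hnD : ∀ t ∈ uIcc (0 : ℝ) 1, x ∉ A → fderiv ℝ u (normalMap N (x, ε * t)) = 0 :=
      fun t ht hxA => image_eq_zero_of_notMem_tsupport fun hmem =>
        hnA x hx hxA t (hIcc t ht) (tsupport_fderiv_subset ℝ hmem)
    by_cases hxL : x ∈ L₁
    · have hDM : fderiv ℝ M x v = -shapeOperator S N x v := by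
        refine shapeOperator_eq_of_eventuallyEq h.hypersurface h.normal hx
          (hMc.differentiable (by norm_num) x) ?_ hv
        filter_upwards [self_mem_nhdsWithin, mem_nhdsWithin_of_mem_nhds
          (mem_interior_iff_mem_nhds.1 (hL₁₂ hxL))] with y hy hyL using hM y ⟨hy, hyL⟩
      have hDF : ∀ t, fderiv ℝ F (x, t) (v, 0) = (chi t : ℂ) *
          fderiv ℝ u (normalMap N (x, ε * t)) (v - (ε * t) • shapeOperator S N x v) := by
        intro t
        have e1 : HasFDerivAt M (fderiv ℝ M x) x :=
          (hMc.differentiable (by norm_num) x).hasFDerivAt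
        have e2 : HasFDerivAt (fun y => y + (ε * t) • M y)
            (ContinuousLinearMap.id ℝ _ + (ε * t) • fderiv ℝ M x) x :=
          (hasFDerivAt_id x).add (e1.const_smul (ε * t))
        have e3 : HasFDerivAt (fun y => (chi t : ℂ) * u (y + (ε * t) • M y)) _ x :=
          (HasFDerivAt.comp (g := u) x (hu.differentiable (by norm_num) _).hasFDerivAt e2).const_mul
            (chi t : ℂ)
        have e4 : HasFDerivAt (fun y => F (y, t)) _ x :=
          HasFDerivAt.comp (g := F) x (hF.differentiable (by norm_num) (x, t)).hasFDerivAt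
            (hasFDerivAt_prodMk_left x t)
        have e5 := congrArg (fun l => l v) (e4.unique e3)
        simp only [ContinuousLinearMap.comp_apply, ContinuousLinearMap.inl_apply,
          smul_apply, add_apply, ContinuousLinearMap.id_apply, hDM, smul_neg, smul_eq_mul,
          hMx hxL] at e5
        rw [e5, sub_eq_add_neg]
      have hDI : fderiv ℝ I x v = ∫ t in (0 : ℝ)..1, (chi t : ℂ) *
          fderiv ℝ u (normalMap N (x, ε * t)) (v - (ε * t) • shapeOperator S N x v) := by
        rw [(hasFDerivAt_intervalIntegral_of_contDiff hF 0 1 x).fderiv,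
          ContinuousLinearMap.intervalIntegral_apply]
        · refine intervalIntegral.integral_congr fun t _ => ?_
          simp only [ContinuousLinearMap.comp_apply, ContinuousLinearMap.inl_apply, hDF]
        · refine Continuous.intervalIntegrable ?_ _ _
          exact ((hF.continuous_fderiv (by norm_num)).comp
            (by fun_prop : Continuous fun t : ℝ => (x, t))).clm_comp continuous_const
      have hprod : fderiv ℝ φ x v = η x • fderiv ℝ I x v + fderiv ℝ η x v • I x := by
        rw [show fderiv ℝ φ x = _ from ((hηc.differentiable (by norm_num) x).hasFDerivAt.smul
          (hI.differentiable (by norm_num) x).hasFDerivAt).fderiv]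
        simp
      rw [hprod, ← hDI]
      by_cases hxA : x ∈ A
      · have h1 : (η : EuclideanSpace ℝ (Fin d) → ℝ) =ᶠ[𝓝 x] fun _ => 1 :=
          (eventually_nhdsSet_iff_forall.1 hη1) x hxA
        rw [h1.fderiv_eq, hη1.self_of_nhdsSet x hxA]
        simp
      · rw [hI0 hxL hxA, smul_zero, add_zero, hDI]
        have : ∫ t in (0 : ℝ)..1, (chi t : ℂ) * fderiv ℝ u (normalMap N (x, ε * t))
            (v - (ε * t) • shapeOperator S N x v) = 0 := by
          refine (intervalIntegral.integral_congr (g := fun _ => (0 : ℂ)) fun t ht => ?_).trans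
            (by simp)
          simp only [hnD t ht hxA, zero_apply, mul_zero]
        rw [this, smul_zero]
    · have hxA : x ∉ A := fun hxA => hxL (interior_subset (hAL₁ hxA))
      have h0 : fderiv ℝ φ x = 0 := image_eq_zero_of_notMem_tsupport fun hmem =>
        hxL (hφL₁ (tsupport_fderiv_subset ℝ hmem))
      rw [h0, zero_apply]
      refine (intervalIntegral.integral_congr (g := fun _ => (0 : ℂ)) fun t ht => ?_).trans
        (by simp) |>.symm
      simp only [hnD t ht hxA, zero_apply, mul_zero]

end IsTube

end Tube

namespace Tube

open Filter Topology

variable {d : ℕ}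

/-! ### Test functions and spectral numbers -/

/-- The test functions: compactly supported `C¹` functions whose support does not meet `Z`. -/
structure IsTestFunction (Z : Set (EuclideanSpace ℝ (Fin d)))
    (u : EuclideanSpace ℝ (Fin d) → ℂ) : Prop where
  contDiff : ContDiff ℝ 1 u
  hasCompactSupport : HasCompactSupport u
  disjoint : Disjoint (tsupport u) Z

variable {Z : Set (EuclideanSpace ℝ (Fin d))} {μ : Measure (EuclideanSpace ℝ (Fin d))}
  {T : EuclideanSpace ℝ (Fin d) → Submodule ℝ (EuclideanSpace ℝ (Fin d))}
  {V : EuclideanSpace ℝ (Fin d) → ℝ} {n : ℕ}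

namespace IsTestFunction

lemma add {u v : EuclideanSpace ℝ (Fin d) → ℂ} (hu : IsTestFunction Z u)
    (hv : IsTestFunction Z v) : IsTestFunction Z (u + v) :=
  ⟨hu.contDiff.add hv.contDiff, hu.hasCompactSupport.add hv.hasCompactSupport,
    (disjoint_union_left.2 ⟨hu.disjoint, hv.disjoint⟩).mono_left (tsupport_add u v)⟩

lemma smul {u : EuclideanSpace ℝ (Fin d) → ℂ} (hu : IsTestFunction Z u) (c : ℂ) :
    IsTestFunction Z (c • u) := by
  have hs : tsupport (c • u) ⊆ tsupport u := closure_mono (Function.support_const_smul_subset c u)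
  exact ⟨hu.contDiff.const_smul c, hu.hasCompactSupport.mono' (subset_closure.trans hs),
    hu.disjoint.mono_left hs⟩

lemma zero : IsTestFunction Z (0 : EuclideanSpace ℝ (Fin d) → ℂ) :=
  ⟨contDiff_const, HasCompactSupport.zero, by simp [tsupport]⟩

lemma sum {ι : Type*} {s : Finset ι} {u : ι → EuclideanSpace ℝ (Fin d) → ℂ}
    (hu : ∀ i ∈ s, IsTestFunction Z (u i)) : IsTestFunction Z (∑ i ∈ s, u i) := by
  classical
  induction s using Finset.induction_on with
  | empty => simpa using zero
  | insert i s hi ih =>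
    rw [Finset.sum_insert hi]
    exact (hu i (Finset.mem_insert_self i s)).add
      (ih fun j hj => hu j (Finset.mem_insert_of_mem hj))

lemma sum_smul {u : Fin n → EuclideanSpace ℝ (Fin d) → ℂ} (hu : ∀ i, IsTestFunction Z (u i))
    (c : Fin n → ℂ) : IsTestFunction Z (∑ i, c i • u i) :=
  sum fun i _ => (hu i).smul (c i)

end IsTestFunction

lemma gradientAlong_sum_smul {T : Submodule ℝ (EuclideanSpace ℝ (Fin d))}
    {u : Fin n → EuclideanSpace ℝ (Fin d) → ℂ} (hu : ∀ i, ContDiff ℝ 1 (u i)) (c : Fin n → ℂ)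
    (x : EuclideanSpace ℝ (Fin d)) :
    gradientAlong T (∑ i, c i • u i) x = ∑ i, c i • gradientAlong T (u i) x := by
  have h1 : fderiv ℝ (∑ i, c i • u i) x = ∑ i, fderiv ℝ (c i • u i) x :=
    fderiv_sum fun i _ => ((hu i).const_smul (c i)).differentiable (by norm_num) x
  ext j
  simp only [gradientAlong, WithLp.ofLp_sum, WithLp.ofLp_smul, Finset.sum_apply, Pi.smul_apply]
  rw [h1]
  simp only [FunLike.coe_sum, Finset.sum_apply]
  refine Finset.sum_congr rfl fun i _ => ?_
  rw [fderiv_const_smul ((hu i).differentiable (by norm_num) x) (c i)]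
  rfl

lemma coeFn_sum_smul {F : Type*} [NormedAddCommGroup F] [NormedSpace ℂ F]
    {L : Fin n → Lp F 2 μ} {f : Fin n → EuclideanSpace ℝ (Fin d) → F} (hf : ∀ i, L i =ᵐ[μ] f i)
    (c : Fin n → ℂ) : ⇑(∑ i, c i • L i) =ᵐ[μ] fun x => ∑ i, c i • f i x := by
  have h1 : ∀ᵐ x ∂μ, ∀ i, (c i • L i : Lp F 2 μ) x = c i • f i x := by
    rw [ae_all_iff]
    intro i
    filter_upwards [Lp.coeFn_smul (c i) (L i), hf i] with x h1 h2
    rw [h1, Pi.smul_apply, h2]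
  filter_upwards [Lp.coeFn_finsetSum Finset.univ fun i => c i • L i, h1] with x h1 h2
  rw [h1, Finset.sum_apply]
  exact Finset.sum_congr rfl fun i _ => h2 i

/-- Strict positivity of the L² norm for every c ≠ 0 plays the role of linear independence in L². -/
theorem spectralNumber_le_of_testFunctions (hV : AEStronglyMeasurable V μ) {b : ℝ}
    (hb : ∀ᵐ x ∂μ, |V x| ≤ b) (hn : 1 ≤ n) {E : ℝ} {u : Fin n → EuclideanSpace ℝ (Fin d) → ℂ}
    (hu : ∀ i, IsTestFunction Z (u i)) (hu2 : ∀ i, MemLp (u i) 2 μ)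
    (hg2 : ∀ i, MemLp (fun x => gradientAlong (T x) (u i) x) 2 μ)
    (hE : ∀ c : Fin n → ℂ, c ≠ 0 → 0 < ∫ x, ‖(∑ i, c i • u i) x‖ ^ 2 ∂μ ∧
      ∫ x, ‖gradientAlong (T x) (∑ i, c i • u i) x‖ ^ 2 ∂μ +
        ∫ x, V x * ‖(∑ i, c i • u i) x‖ ^ 2 ∂μ ≤ E * ∫ x, ‖(∑ i, c i • u i) x‖ ^ 2 ∂μ) :
    OperatorGraph.spectralNumber
      (OperatorGraph.addPotential (OperatorGraph.ofGradient (sobolevGraph μ T Z)) V) n ≤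
      (E : EReal) := by
  have hmem : ∀ i, ((hu2 i).toLp (u i), (hg2 i).toLp (fun x => gradientAlong (T x) (u i) x)) ∈
      testGraph μ T Z := fun i =>
    ⟨u i, (hu i).contDiff, (hu i).hasCompactSupport, (hu i).disjoint,
      (hu2 i).coeFn_toLp, (hg2 i).coeFn_toLp⟩
  set B : (Fin n → ℂ) →ₗ[ℂ] Lp ℂ 2 μ × Lp (EuclideanSpace ℂ (Fin d)) 2 μ :=
    Fintype.linearCombination ℂ fun i =>
      ((hu2 i).toLp (u i), (hg2 i).toLp (fun x => gradientAlong (T x) (u i) x))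
  have hB : ∀ c, B c = (∑ i, c i • (hu2 i).toLp (u i),
      ∑ i, c i • (hg2 i).toLp (fun x => gradientAlong (T x) (u i) x)) := fun c => by
    simp only [B, Fintype.linearCombination_apply]
    ext1
    · simp [Prod.fst_sum]
    · simp [Prod.snd_sum]
  have h1 : ∀ c, (B c).1 =ᵐ[μ] ∑ i, c i • u i := fun c => by
    rw [hB]
    refine (coeFn_sum_smul (fun i => (hu2 i).coeFn_toLp) c).trans (Eventually.of_forall fun x => ?_)
    simp
  have h2 : ∀ c, (B c).2 =ᵐ[μ] fun x => gradientAlong (T x) (∑ i, c i • u i) x := fun c => by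
    rw [hB]
    refine (coeFn_sum_smul (fun i => (hg2 i).coeFn_toLp) c).trans (Eventually.of_forall fun x => ?_)
    simp only [gradientAlong_sum_smul fun i => (hu i).contDiff]
  refine OperatorGraph.spectralNumber_addPotential_le hV hb (testGraph μ T Z) hn B
    (fun c => ?_) fun c hc => ?_
  · simp only [B, Fintype.linearCombination_apply]
    exact Submodule.sum_mem _ fun i _ => Submodule.smul_mem _ _ (hmem i)
  · have e1 : ‖(B c).1‖ ^ 2 = ∫ x, ‖(∑ i, c i • u i) x‖ ^ 2 ∂μ := by
      rw [OperatorGraph.norm_sq_eq_integral]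
      exact integral_congr_ae ((h1 c).mono fun x hx => by simp only [hx])
    have e2 : ‖(B c).2‖ ^ 2 = ∫ x, ‖gradientAlong (T x) (∑ i, c i • u i) x‖ ^ 2 ∂μ := by
      rw [OperatorGraph.norm_sq_eq_integral]
      exact integral_congr_ae ((h2 c).mono fun x hx => by simp only [hx])
    have e3 : ∫ x, V x * ‖(B c).1 x‖ ^ 2 ∂μ = ∫ x, V x * ‖(∑ i, c i • u i) x‖ ^ 2 ∂μ :=
      integral_congr_ae ((h1 c).mono fun x hx => by simp only [hx])
    obtain ⟨hpos, hle⟩ := hE c hc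
    refine ⟨fun h0 => ?_, ?_⟩
    · rw [← e1, h0, norm_zero] at hpos
      norm_num at hpos
    · rw [e1, e2, e3]; exact hle

/-- Elements of the test graph are classes in L², so representatives are chosen for the n basis
vectors only and extended linearly. The combinations then agree almost everywhere. -/
theorem exists_testFunctions_of_spectralNumber_lt (hV : AEStronglyMeasurable V μ) {b : ℝ}
    (hb : ∀ᵐ x ∂μ, |V x| ≤ b) (hn : 1 ≤ n) {E : ℝ}
    (hlt : OperatorGraph.spectralNumber
      (OperatorGraph.addPotential (OperatorGraph.ofGradient (sobolevGraph μ T Z)) V) n <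
      (E : EReal)) :
    ∃ u : Fin n → EuclideanSpace ℝ (Fin d) → ℂ, (∀ i, IsTestFunction Z (u i)) ∧
      ∀ c : Fin n → ℂ, c ≠ 0 → 0 < ∫ x, ‖(∑ i, c i • u i) x‖ ^ 2 ∂μ ∧
        ∫ x, ‖gradientAlong (T x) (∑ i, c i • u i) x‖ ^ 2 ∂μ +
          ∫ x, V x * ‖(∑ i, c i • u i) x‖ ^ 2 ∂μ ≤ E * ∫ x, ‖(∑ i, c i • u i) x‖ ^ 2 ∂μ := by
  obtain ⟨B, hBD, hB⟩ := OperatorGraph.exists_trial_of_spectralNumber_lt hV hb (testGraph μ T Z)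
    hn hlt
  choose u hu1 hu2 hu3 hu4 hu5 using fun i : Fin n => hBD (Pi.single i 1)
  have hu : ∀ i, IsTestFunction Z (u i) := fun i => ⟨hu1 i, hu2 i, hu3 i⟩
  have hBc : ∀ c, B c = ∑ i, c i • B (Pi.single i 1) := fun c => by
    conv_lhs => rw [← Finset.univ_sum_single c]
    rw [map_sum]
    refine Finset.sum_congr rfl fun i _ => ?_
    rw [← map_smul]
    congr 1
    ext j
    by_cases hij : j = i
    · subst hij; simp
    · simp [hij]
  have h1 : ∀ c, (B c).1 =ᵐ[μ] ∑ i, c i • u i := fun c => by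
    rw [hBc, Prod.fst_sum]
    refine (coeFn_sum_smul hu4 c).trans (Eventually.of_forall fun x => ?_)
    simp
  have h2 : ∀ c, (B c).2 =ᵐ[μ] fun x => gradientAlong (T x) (∑ i, c i • u i) x := fun c => by
    rw [hBc, Prod.snd_sum]
    refine (coeFn_sum_smul hu5 c).trans (Eventually.of_forall fun x => ?_)
    simp only [gradientAlong_sum_smul fun i => (hu i).contDiff]
  refine ⟨u, hu, fun c hc => ?_⟩
  obtain ⟨h0, hle⟩ := hB c hc
  have e1 : ‖(B c).1‖ ^ 2 = ∫ x, ‖(∑ i, c i • u i) x‖ ^ 2 ∂μ := by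
    rw [OperatorGraph.norm_sq_eq_integral]
    exact integral_congr_ae ((h1 c).mono fun x hx => by simp only [hx])
  have e2 : ‖(B c).2‖ ^ 2 = ∫ x, ‖gradientAlong (T x) (∑ i, c i • u i) x‖ ^ 2 ∂μ := by
    rw [OperatorGraph.norm_sq_eq_integral]
    exact integral_congr_ae ((h2 c).mono fun x hx => by simp only [hx])
  have e3 : ∫ x, V x * ‖(B c).1 x‖ ^ 2 ∂μ = ∫ x, V x * ‖(∑ i, c i • u i) x‖ ^ 2 ∂μ :=
    integral_congr_ae ((h1 c).mono fun x hx => by simp only [hx])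
  rw [← e1, ← e2, ← e3]
  exact ⟨by have := norm_pos_iff.2 h0; positivity, hle⟩

end Tube

namespace Tube

open Filter Topology

variable {d : ℕ} {S : Set (EuclideanSpace ℝ (Fin d))}
  {N : EuclideanSpace ℝ (Fin d) → EuclideanSpace ℝ (Fin d)} {x : EuclideanSpace ℝ (Fin d)}
  {K r : ℝ}

/-! ### Integration over the tube -/

lemma measurableSet_inter_preimage {X Y : Type*} [TopologicalSpace X] [MeasurableSpace X]
    [BorelSpace X] [TopologicalSpace Y] [MeasurableSpace Y] [BorelSpace Y]
    {f : X → Y} {s : Set X} (hf : ContinuousOn f s) (hs : MeasurableSet s) {A : Set Y}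
    (hA : MeasurableSet A) : MeasurableSet (s ∩ f ⁻¹' A) := by
  have h1 := (continuousOn_iff_continuous_domRestrict.1 hf).measurable hA
  have h2 : MeasurableSet (Subtype.val '' (Subtype.val ⁻¹' (f ⁻¹' A) : Set s)) :=
    hs.subtype_image h1
  rwa [Subtype.image_preimage_coe] at h2

namespace IsTube

lemma restrict_surfaceMeasure_prod (h : IsTube S N K r) (ε : ℝ) :
    ((surfaceMeasure S).prod volume).restrict (S ×ˢ Ioo 0 ε) =
      (surfaceMeasure S).prod (volume.restrict (Ioo 0 ε)) := by
  have := sigmaFinite_surfaceMeasure h.hypersurface h.normal h.two_le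
  rw [← Measure.prod_restrict]
  congr 1
  rw [surfaceMeasure, Measure.restrict_restrict (measurableSet h.hypersurface), inter_self]

lemma measurableSet_prod (h : IsTube S N K r) (ε : ℝ) : MeasurableSet (S ×ˢ Ioo (0 : ℝ) ε) :=
  (measurableSet h.hypersurface).prod measurableSet_Ioo

lemma aemeasurable_tubeJacobian (h : IsTube S N K r) (ε : ℝ) :
    AEMeasurable (fun p : EuclideanSpace ℝ (Fin d) × ℝ => tubeJacobian S N p.1 p.2)
      (((surfaceMeasure S).prod volume).restrict (S ×ˢ Ioo 0 ε)) :=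
  ((continuousOn_tubeJacobian h.hypersurface h.normal).mono
    (prod_mono_right (subset_univ _))).aemeasurable (h.measurableSet_prod ε)

lemma aemeasurable_normalMap (h : IsTube S N K r) (ε : ℝ) : AEMeasurable (normalMap N)
      (((surfaceMeasure S).prod volume).restrict (S ×ˢ Ioo 0 ε)) :=
  ((continuousOn_normalMap h.normal).mono
    (prod_mono subset_closure (subset_univ _))).aemeasurable (h.measurableSet_prod ε)

/-- Lebesgue measure on the tube is the product of surface measure and length, with density
the Jacobian of the normal map. -/
lemma volume_restrict_tube (h : IsTube S N K r) {ε : ℝ} (hε : 0 < ε) (hεr : ε ≤ r) :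
    volume.restrict (tube S N ε) = ((((surfaceMeasure S).prod volume).restrict
      (S ×ˢ Ioo 0 ε)).withDensity fun p => ENNReal.ofReal (tubeJacobian S N p.1 p.2)).map
        (normalMap N) := by
  have := sigmaFinite_surfaceMeasure h.hypersurface h.normal h.two_le
  have hcont : ContinuousOn (normalMap N) (S ×ˢ Ioo 0 ε) :=
    (continuousOn_normalMap h.normal).mono (prod_mono subset_closure (subset_univ _))
  ext A hA
  rw [Measure.map_apply_of_aemeasurable
    ((h.aemeasurable_normalMap ε).mono_ac (withDensity_absolutelyContinuous _ _)) hA,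
    withDensity_apply', Measure.restrict_restrict' (h.measurableSet_prod ε),
    Measure.restrict_apply hA, inter_comm (normalMap N ⁻¹' A),
    ← volume_normalMap_image h.hypersurface h.normal h.two_le (I := Ioo 0 ε)
      (h.injOn_open.mono (prod_mono_right (Ioo_subset_Ioo_right hεr)))
      (fun x hx s hs => h.tubeJacobian_pos hx
        (by rw [abs_of_pos hs.1]; exact hs.2.le.trans hεr))
      (measurableSet_inter_preimage hcont (h.measurableSet_prod ε) hA) inter_subset_left,
    tube_eq hε, inter_comm, image_inter_preimage]

/-- Change of variables by the volume formula, Fubini, and s = ε t. -/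
theorem integral_tube (h : IsTube S N K r) {ε : ℝ} (hε : 0 < ε) (hεr : ε ≤ r)
    {F : EuclideanSpace ℝ (Fin d) → ℝ} (hF : Continuous F) (hFc : HasCompactSupport F) :
    Integrable (fun x => ∫ t in (0 : ℝ)..1, F (normalMap N (x, ε * t)) * tubeJacobian S N x (ε * t))
        (surfaceMeasure S) ∧
      ∫ z in tube S N ε, F z = ε * ∫ x, (∫ t in (0 : ℝ)..1,
        F (normalMap N (x, ε * t)) * tubeJacobian S N x (ε * t)) ∂surfaceMeasure S := by
  have := sigmaFinite_surfaceMeasure h.hypersurface h.normal h.two_le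
  set m := ((surfaceMeasure S).prod volume).restrict (S ×ˢ Ioo 0 ε) with hm
  have hJ : AEMeasurable (fun p : EuclideanSpace ℝ (Fin d) × ℝ =>
      ENNReal.ofReal (tubeJacobian S N p.1 p.2)) m := (h.aemeasurable_tubeJacobian ε).ennreal_ofReal
  have hΘ := (h.aemeasurable_normalMap ε).mono_ac (withDensity_absolutelyContinuous m
    fun p => ENNReal.ofReal (tubeJacobian S N p.1 p.2))
  have hint : Integrable F (volume.restrict (tube S N ε)) :=
    (hF.integrable_of_hasCompactSupport hFc).integrableOn
  have hJpos : ∀ᵐ p ∂m, (ENNReal.ofReal (tubeJacobian S N p.1 p.2)).toReal =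
      tubeJacobian S N p.1 p.2 := by
    filter_upwards [ae_restrict_mem (h.measurableSet_prod ε)] with p hp
    exact ENNReal.toReal_ofReal (h.tubeJacobian_pos hp.1
      (by rw [abs_of_pos hp.2.1]; exact hp.2.2.le.trans hεr)).le
  have hG : Integrable (fun p : EuclideanSpace ℝ (Fin d) × ℝ =>
      F (normalMap N p) * tubeJacobian S N p.1 p.2) m := by
    rw [h.volume_restrict_tube hε hεr, integrable_map_measure hF.aestronglyMeasurable hΘ,
      integrable_withDensity_iff_integrable_smul₀' hJ (by simp)] at hint
    refine hint.congr ?_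
    filter_upwards [hJpos] with p hp
    rw [hp, smul_eq_mul, mul_comm, Function.comp_apply]
  have hsub : ∀ x, ∫ s in Ioo 0 ε, F (normalMap N (x, s)) * tubeJacobian S N x s =
      ε * ∫ t in (0 : ℝ)..1, F (normalMap N (x, ε * t)) * tubeJacobian S N x (ε * t) := fun x => by
    rw [← integral_Ioc_eq_integral_Ioo, ← intervalIntegral.integral_of_le hε.le]
    have := intervalIntegral.smul_integral_comp_mul_left (a := 0) (b := 1)
      (fun s => F (normalMap N (x, s)) * tubeJacobian S N x s) ε
    rw [mul_zero, mul_one, smul_eq_mul] at this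
    exact this.symm
  have hG' := hG
  rw [hm, h.restrict_surfaceMeasure_prod] at hG'
  constructor
  · have := hG'.integral_prod_left
    simp only [hsub] at this
    exact (this.const_mul ε⁻¹).congr (Eventually.of_forall fun x =>
      by simp only; rw [inv_mul_cancel_left₀ hε.ne'])
  · rw [h.volume_restrict_tube hε hεr, integral_map hΘ hF.aestronglyMeasurable,
      integral_withDensity_eq_integral_toReal_smul₀ hJ (by simp)]
    have : ∫ p, (ENNReal.ofReal (tubeJacobian S N p.1 p.2)).toReal • F (normalMap N p) ∂m =
        ∫ p, F (normalMap N p) * tubeJacobian S N p.1 p.2 ∂m := by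
      refine integral_congr_ae ?_
      filter_upwards [hJpos] with p hp
      rw [hp, smul_eq_mul, mul_comm]
    rw [this, hm, h.restrict_surfaceMeasure_prod, integral_prod _ hG']
    simp only [hsub]
    rw [integral_const_mul]

end IsTube

/-! ### Estimates of the Jacobian -/

/-- The expansion of the product has 2^n - 1 nontrivial terms, each at most η because η ≤ 1. -/
lemma abs_prod_one_sub_le {ι : Type*} (s : Finset ι) {y : ι → ℝ} {η : ℝ}
    (hη1 : η ≤ 1) (hy : ∀ i ∈ s, |y i| ≤ η) (hη : 0 ≤ η) :
    |∏ i ∈ s, (1 - y i) - 1| ≤ (2 ^ s.card - 1) * η := by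
  classical
  induction s using Finset.induction_on with
  | empty => simp
  | insert i s hi ih =>
    have ih := ih fun j hj => hy j (Finset.mem_insert_of_mem hj)
    have hyi := hy i (Finset.mem_insert_self i s)
    rw [Finset.prod_insert hi, Finset.card_insert_of_notMem hi]
    set P := ∏ i ∈ s, (1 - y i)
    have h2 : (1 : ℝ) ≤ 2 ^ s.card := one_le_pow₀ (by norm_num)
    have hP : |P| ≤ 2 ^ s.card := by
      have : |P| ≤ |P - 1| + |1| := by simpa using abs_add_le (P - 1) 1
      rw [abs_one] at this
      nlinarith
    calc |(1 - y i) * P - 1| = |(P - 1) - y i * P| := by congr 1; ring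
      _ ≤ |P - 1| + |y i| * |P| := by rw [← abs_mul]; exact abs_sub _ _
      _ ≤ (2 ^ s.card - 1) * η + η * 2 ^ s.card := by gcongr
      _ = (2 ^ (s.card + 1) - 1) * η := by ring

/-- The Jacobian along a normal line. -/
lemma exists_jacobian_bounds (d : ℕ) {K : ℝ} (hK : 0 ≤ K) : ∃ a, 0 ≤ a ∧
    ∀ k : Fin d → ℝ, (∀ i, |k i| ≤ K) → |∑ i, k i| ≤ a ∧ ∀ ε, 0 < ε → ε * K ≤ 1 →
      ∃ ρ' : ℝ → ℝ, (∀ t, HasDerivAt (fun t => ∏ i, (1 - ε * t * k i)) (ρ' t) t) ∧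
        Continuous ρ' ∧ (∀ t ∈ Icc (0 : ℝ) 1, |∏ i, (1 - ε * t * k i) - 1| ≤ a * ε) ∧
        ∀ t ∈ Icc (0 : ℝ) 1, |ρ' t + ε * ∑ i, k i| ≤ a * ε ^ 2 := by
  classical
  -- One constant for the three bounds: d K for the curvature, 2^d K for ρ - 1, and d 2^d K² for ρ'
  -- + ε κ.
  refine ⟨d * K + 2 ^ d * K + d * (2 ^ d * K ^ 2), by positivity, fun k hk => ⟨?_, fun ε hε hεK => ?_⟩⟩
  · calc |∑ i, k i| ≤ ∑ i, |k i| := Finset.abs_sum_le_sum_abs _ _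
      _ ≤ ∑ _i : Fin d, K := Finset.sum_le_sum fun i _ => hk i
      _ = d * K := by simp
      _ ≤ _ := by
        have : 0 ≤ 2 ^ d * K + d * (2 ^ d * K ^ 2) := by positivity
        linarith
  have hy : ∀ t ∈ Icc (0 : ℝ) 1, ∀ i, |ε * t * k i| ≤ ε * K := fun t ht i => by
    rw [abs_mul, abs_of_nonneg (mul_nonneg hε.le ht.1)]
    calc ε * t * |k i| ≤ ε * 1 * K := by gcongr; exacts [ht.2, hk i]
      _ = ε * K := by ring
  have hb : ∀ t ∈ Icc (0 : ℝ) 1, ∀ s : Finset (Fin d),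
      |∏ i ∈ s, (1 - ε * t * k i) - 1| ≤ 2 ^ d * (ε * K) := fun t ht s => by
    refine (abs_prod_one_sub_le s hεK (fun i _ => hy t ht i) (by positivity)).trans ?_
    gcongr
    have : s.card ≤ d := by simpa using s.card_le_univ
    have : (2 : ℝ) ^ s.card ≤ 2 ^ d := pow_le_pow_right₀ (by norm_num) this
    linarith
  refine ⟨fun t => ∑ i, (∏ j ∈ Finset.univ.erase i, (1 - ε * t * k j)) • (-(ε * k i)),
    fun t => ?_, by fun_prop, fun t ht => ?_, fun t ht => ?_⟩
  · refine HasDerivAt.fun_finsetProd fun i _ => ?_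
    refine ((((hasDerivAt_id t).const_mul ε).mul_const (k i)).const_sub 1).congr_deriv ?_
    ring
  · refine (hb t ht _).trans ?_
    have : 0 ≤ (d * K + d * (2 ^ d * K ^ 2)) * ε := by positivity
    linarith
  · have e : (∑ i, (∏ j ∈ Finset.univ.erase i, (1 - ε * t * k j)) • (-(ε * k i))) +
        ε * ∑ i, k i =
        ∑ i, -(ε * k i) * (∏ j ∈ Finset.univ.erase i, (1 - ε * t * k j) - 1) := by
      rw [Finset.mul_sum, ← Finset.sum_add_distrib]
      refine Finset.sum_congr rfl fun i _ => ?_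
      rw [smul_eq_mul]; ring
    rw [e]
    calc _ ≤ ∑ i, |-(ε * k i) * (∏ j ∈ Finset.univ.erase i, (1 - ε * t * k j) - 1)| :=
          Finset.abs_sum_le_sum_abs _ _
      _ ≤ ∑ _i : Fin d, ε * K * (2 ^ d * (ε * K)) := by
          refine Finset.sum_le_sum fun i _ => ?_
          rw [abs_mul, abs_neg, abs_mul, abs_of_pos hε]
          gcongr
          · exact hk i
          · exact hb t ht _
      _ = d * (2 ^ d * K ^ 2) * ε ^ 2 := by simp; ring
      _ ≤ _ := by
        gcongr
        have : 0 ≤ d * K + 2 ^ d * K := by positivity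
        linarith

end Tube

namespace Tube

open Filter Topology

variable {d : ℕ} {S : Set (EuclideanSpace ℝ (Fin d))}
  {N : EuclideanSpace ℝ (Fin d) → EuclideanSpace ℝ (Fin d)} {x : EuclideanSpace ℝ (Fin d)}
  {K r : ℝ}

/-! ### Integrability -/

lemma IsTestFunction.continuous_gradientAlong {Z : Set (EuclideanSpace ℝ (Fin d))}
    {u : EuclideanSpace ℝ (Fin d) → ℂ} (hu : IsTestFunction Z u)
    (T : Submodule ℝ (EuclideanSpace ℝ (Fin d))) :
    Continuous (gradientAlong T u) ∧ HasCompactSupport (gradientAlong T u) := by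
  have h1 : Continuous (fderiv ℝ u) := hu.contDiff.continuous_fderiv (by norm_num)
  refine ⟨(PiLp.continuous_toLp 2 _).comp (continuous_pi fun i => h1.clm_apply continuous_const),
    (hu.hasCompactSupport.fderiv (𝕜 := ℝ)).comp_left (g := covectorAlong T) ?_⟩
  ext i
  simp [covectorAlong]

lemma IsTestFunction.memLp {Z : Set (EuclideanSpace ℝ (Fin d))}
    {u : EuclideanSpace ℝ (Fin d) → ℂ} (hu : IsTestFunction Z u)
    (T : Submodule ℝ (EuclideanSpace ℝ (Fin d))) (A : Set (EuclideanSpace ℝ (Fin d))) :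
    MemLp u 2 (volume.restrict A) ∧ MemLp (gradientAlong T u) 2 (volume.restrict A) :=
  ⟨(hu.contDiff.continuous.memLp_of_hasCompactSupport hu.hasCompactSupport).restrict A,
    ((hu.continuous_gradientAlong T).1.memLp_of_hasCompactSupport (hu.continuous_gradientAlong T).2).restrict A⟩

namespace IsTube

lemma memLp_surfaceMeasure (h : IsTube S N K r) {G : Type*} [NormedAddCommGroup G]
    [SecondCountableTopology G]
    {f : EuclideanSpace ℝ (Fin d) → G} (hf : ContinuousOn f S) {Q : Set (EuclideanSpace ℝ (Fin d))}
    (hQ : IsCompact Q) (hQS : Q ⊆ S) (h0 : ∀ x ∈ S, x ∉ Q → f x = 0) (p : ENNReal) :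
    MemLp f p (surfaceMeasure S) := by
  have hS := measurableSet h.hypersurface
  obtain ⟨M, hM⟩ := hQ.exists_bound_of_continuousOn (hf.mono hQS)
  have hfin := surfaceMeasure_lt_top_of_isCompact h.hypersurface h.normal h.two_le hQ hQS
  have h1 : AEStronglyMeasurable f (surfaceMeasure S) := hf.aestronglyMeasurable hS
  have h2 : MemLp f p ((surfaceMeasure S).restrict Q) := by
    have : IsFiniteMeasure ((surfaceMeasure S).restrict Q) := ⟨by simpa using hfin⟩
    refine MemLp.of_bound h1.restrict M ?_
    filter_upwards [ae_restrict_mem hQ.measurableSet] with y hy using hM y hy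
  refine ((memLp_indicator_iff_restrict hQ.measurableSet).2 h2).ae_eq ?_
  filter_upwards [ae_restrict_mem (μ := Measure.euclideanHausdorffMeasure (d - 1)) hS] with y hy
  by_cases hyQ : y ∈ Q
  · rw [indicator_of_mem hyQ]
  · rw [indicator_of_notMem hyQ, h0 y hy hyQ]

/-- The compact set outside of which a test function on the hypersurface vanishes. -/
lemma isCompact_tsupport_inter {φ : EuclideanSpace ℝ (Fin d) → ℂ}
    (hφ : IsTestFunction (closure S \ S) φ) :
    IsCompact (tsupport φ ∩ closure S) ∧ tsupport φ ∩ closure S ⊆ S := by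
  refine ⟨IsCompact.inter_right hφ.hasCompactSupport isClosed_closure, fun y hy => ?_⟩
  by_contra hyS
  exact disjoint_left.1 hφ.disjoint hy.1 ⟨hy.2, hyS⟩

lemma gradientAlong_eq_zero {T : Submodule ℝ (EuclideanSpace ℝ (Fin d))}
    {u : EuclideanSpace ℝ (Fin d) → ℂ} (hx : x ∉ tsupport u) : gradientAlong T u x = 0 := by
  have : fderiv ℝ u x = 0 := by
    by_contra hne
    exact hx (support_fderiv_subset ℝ hne)
  rw [gradientAlong_eq, this]
  ext i
  simp [covectorAlong]

lemma continuousOn_gradientAlong (h : IsTube S N K r) {φ : EuclideanSpace ℝ (Fin d) → ℂ}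
    (hφ : ContDiff ℝ 1 φ) : ContinuousOn (fun x => gradientAlong (tangentSpace N x) φ x) S := by
  have h1 : Continuous (fderiv ℝ φ) := hφ.continuous_fderiv (by norm_num)
  have hN : ContinuousOn N S := h.normal.1.mono subset_closure
  have : ContinuousOn (fun x => (WithLp.toLp 2 fun i => fderiv ℝ φ x (EuclideanSpace.single i 1 -
      ⟪N x, EuclideanSpace.single i 1⟫_ℝ • N x) : EuclideanSpace ℂ (Fin d))) S :=
    (PiLp.continuous_toLp 2 _).comp_continuousOn (continuousOn_pi.2 fun i =>
      h1.continuousOn.clm_apply (by fun_prop))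
  refine this.congr fun y hy => ?_
  simp only [gradientAlong, starProjection_tangentSpace (h.norm_eq_one hy)]

lemma memLp_testFunction (h : IsTube S N K r) {φ : EuclideanSpace ℝ (Fin d) → ℂ}
    (hφ : IsTestFunction (closure S \ S) φ) : MemLp φ 2 (surfaceMeasure S) ∧
      MemLp (fun x => gradientAlong (tangentSpace N x) φ x) 2 (surfaceMeasure S) := by
  obtain ⟨hQ, hQS⟩ := isCompact_tsupport_inter hφ
  refine ⟨h.memLp_surfaceMeasure hφ.contDiff.continuous.continuousOn hQ hQS
    (fun y hy hyQ => ?_) 2, h.memLp_surfaceMeasure (h.continuousOn_gradientAlong hφ.contDiff)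
    hQ hQS (fun y hy hyQ => ?_) 2⟩
  · exact image_eq_zero_of_notMem_tsupport fun hy' => hyQ ⟨hy', subset_closure hy⟩
  · exact gradientAlong_eq_zero fun hy' => hyQ ⟨hy', subset_closure hy⟩

lemma integrable_testFunction (h : IsTube S N K r) {φ : EuclideanSpace ℝ (Fin d) → ℂ}
    (hφ : IsTestFunction (closure S \ S) φ) :
    Integrable (fun x => ‖φ x‖ ^ 2) (surfaceMeasure S) ∧
    Integrable (fun x => ‖gradientAlong (tangentSpace N x) φ x‖ ^ 2) (surfaceMeasure S) ∧
    Integrable (fun x => totalCurvature S N x * ‖φ x‖ ^ 2) (surfaceMeasure S) := by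
  obtain ⟨h1, h2⟩ := h.memLp_testFunction hφ
  refine ⟨h1.integrable_norm_pow (by norm_num), h2.integrable_norm_pow (by norm_num), ?_⟩
  obtain ⟨hQ, hQS⟩ := isCompact_tsupport_inter hφ
  rw [← memLp_one_iff_integrable]
  refine h.memLp_surfaceMeasure ((continuousOn_totalCurvature h.hypersurface h.normal).mul
    (hφ.contDiff.continuous.norm.pow 2).continuousOn) hQ hQS (fun y hy hyQ => ?_) 1
  have : φ y = 0 := image_eq_zero_of_notMem_tsupport fun hy' => hyQ ⟨hy', subset_closure hy⟩
  simp [this]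

lemma ae_mem (h : IsTube S N K r) : ∀ᵐ x ∂surfaceMeasure S, x ∈ S :=
  ae_restrict_mem (measurableSet h.hypersurface)

lemma aestronglyMeasurable_totalCurvature (h : IsTube S N K r) (ε : ℝ) :
    AEStronglyMeasurable (fun x => totalCurvature S N x / ε) (surfaceMeasure S) :=
  ((continuousOn_totalCurvature h.hypersurface h.normal).div_const ε).aestronglyMeasurable
    (measurableSet h.hypersurface)

/-! ### Existence of trial functions on the hypersurface -/

/-- At an isolated point the tangent cone would be trivial, but it contains a space of dimension d -
1 ≥ 1. -/
lemma accPt (h : IsTube S N K r) (hx : x ∈ S) : AccPt x (𝓟 S) := by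
  obtain ⟨U, f, hf, hxU⟩ := exists_isDefiningFunction h.hypersurface h.normal hx
  by_contra hacc
  obtain ⟨v, hv, hv0⟩ : ∃ v ∈ tangentSpace N x, v ≠ 0 := by
    refine (Submodule.ne_bot_iff _).1 fun hbot => ?_
    have h1 := finrank_tangentSpace (N := N) (h.norm_eq_one hx) h.two_le
    rw [hbot, finrank_bot] at h1
    have := h.two_le
    omega
  exact hv0 (tangentConeAt_subset_zero hacc
    (hf.mem_tangentConeAt ⟨hx, hxU⟩ (mem_tangentSpace.1 hv)))

lemma infinite (h : IsTube S N K r) (hne : S.Nonempty) : S.Infinite := by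
  obtain ⟨x, hx⟩ := hne
  intro hfin
  have h1 := h.accPt hx
  rw [accPt_iff_frequently] at h1
  have h2 : ∀ᶠ y in 𝓝 x, y ∉ S \ {x} := (hfin.sdiff (t := {x})).isClosed.isOpen_compl.mem_nhds (by simp)
  exact h1 (h2.mono fun y hy hy' => hy ⟨hy'.2, hy'.1⟩)

/-- A piece of S of measure zero would, by the volume formula, carry a set of volume zero over it,
yet this set is a neighbourhood of a point. -/
lemma surfaceMeasure_pos (h : IsTube S N K r) (hx : x ∈ S) {A : Set (EuclideanSpace ℝ (Fin d))}
    (hA : A ∈ 𝓝 x) : 0 < surfaceMeasure S A := by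
  have := sigmaFinite_surfaceMeasure h.hypersurface h.normal h.two_le
  obtain ⟨O, hOA, hO, hxO⟩ := mem_nhds_iff.1 hA
  refine lt_of_lt_of_le ?_ (measure_mono hOA)
  rw [pos_iff_ne_zero]
  intro h0
  have hr : r / 2 ∈ Ioo 0 r := ⟨by linarith [h.pos], by linarith [h.pos]⟩
  have hB : MeasurableSet ((S ∩ O) ×ˢ Ioo (0 : ℝ) r) :=
    ((measurableSet h.hypersurface).inter hO.measurableSet).prod measurableSet_Ioo
  have hvol : volume (normalMap N '' ((S ∩ O) ×ˢ Ioo (0 : ℝ) r)) = 0 := by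
    rw [volume_normalMap_image h.hypersurface h.normal h.two_le h.injOn_open
      (fun x hx s hs => h.tubeJacobian_pos hx (by rw [abs_of_pos hs.1]; exact hs.2.le)) hB
      (prod_mono_left inter_subset_left)]
    refine setLIntegral_measure_zero _ _ ?_
    rw [Measure.prod_prod, measure_mono_null inter_subset_right h0, zero_mul]
  have hnhds : normalMap N '' ((S ∩ O) ×ˢ Ioo (0 : ℝ) r) ∈ 𝓝 (normalMap N (x, r / 2)) := by
    have h1 := (h.isOpen_image le_rfl).mem_nhds
      (show normalMap N (x, r / 2) ∈ normalMap N '' (S ×ˢ Ioo 0 r) from ⟨_, ⟨hx, hr⟩, rfl⟩)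
    have h2 : ∀ᶠ z in 𝓝 (normalMap N (x, r / 2)), (tubeCoord S N r z).1 ∈ O := by
      refine (h.contDiffAt_tubeCoord hx hr).continuousAt.fst.eventually_mem ?_
      rw [h.tubeCoord_normalMap (show (x, r / 2) ∈ S ×ˢ Ioo 0 r from ⟨hx, hr⟩)]
      exact hO.mem_nhds hxO
    filter_upwards [h1, h2] with z hz hz2
    obtain ⟨p, hp, rfl⟩ := hz
    rw [h.tubeCoord_normalMap hp] at hz2
    exact ⟨p, ⟨⟨hp.1, hz2⟩, hp.2⟩, rfl⟩
  exact (Measure.measure_pos_of_mem_nhds volume hnhds).ne' hvol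

end IsTube

lemma norm_sum_smul_sq {ι F : Type*} [Fintype ι] [NormedAddCommGroup F] [NormedSpace ℂ F]
    {v : ι → F} (hv : ∀ i j, i ≠ j → v i = 0 ∨ v j = 0) (c : ι → ℂ) :
    ‖∑ i, c i • v i‖ ^ 2 = ∑ i, ‖c i‖ ^ 2 * ‖v i‖ ^ 2 := by
  by_cases h0 : ∀ i, v i = 0
  · simp [h0]
  · push Not at h0
    obtain ⟨i, hi⟩ := h0
    have hz : ∀ j, j ≠ i → v j = 0 := fun j hj => (hv i j hj.symm).resolve_left hi
    rw [Finset.sum_eq_single i (fun j _ hj => by rw [hz j hj, smul_zero]) (by simp),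
      Finset.sum_eq_single i (fun j _ hj => by rw [hz j hj]; simp) (by simp), norm_smul, mul_pow]

/-- There are arbitrarily many test functions with disjoint supports on the hypersurface. -/
theorem IsTube.exists_bumps (h : IsTube S N K r) (hne : S.Nonempty) (n : ℕ) :
    ∃ (M : ℝ) (φ : Fin n → EuclideanSpace ℝ (Fin d) → ℂ),
      (∀ i, IsTestFunction (closure S \ S) (φ i)) ∧ ∀ c : Fin n → ℂ, c ≠ 0 →
        0 < ∫ x, ‖(∑ i, c i • φ i) x‖ ^ 2 ∂surfaceMeasure S ∧
        ∫ x, ‖gradientAlong (tangentSpace N x) (∑ i, c i • φ i) x‖ ^ 2 ∂surfaceMeasure S ≤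
          M * ∫ x, ‖(∑ i, c i • φ i) x‖ ^ 2 ∂surfaceMeasure S := by
  obtain ⟨y, hyS⟩ : ∃ y : Fin n ↪ EuclideanSpace ℝ (Fin d), ∀ i, y i ∈ S := by
    have := (h.infinite hne).to_subtype
    exact ⟨(Fin.valEmbedding.trans (Infinite.natEmbedding S)).trans (Function.Embedding.subtype _),
      fun i => Subtype.coe_prop _⟩
  have hopen : IsOpen (closure S \ S)ᶜ := (isClosed_boundary h.hypersurface).isOpen_compl
  obtain ⟨δ, hδ, hδS, hδd⟩ : ∃ δ > 0, (∀ i, Metric.closedBall (y i) δ ⊆ (closure S \ S)ᶜ) ∧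
      ∀ i j, i ≠ j → Disjoint (Metric.closedBall (y i) δ) (Metric.closedBall (y j) δ) := by
    have h1 : ∀ i, ∀ᶠ δ in 𝓝[>] (0 : ℝ), Metric.closedBall (y i) δ ⊆ (closure S \ S)ᶜ := by
      intro i
      obtain ⟨η, hη, hη'⟩ := Metric.nhds_basis_closedBall.mem_iff.1
        (hopen.mem_nhds (show y i ∈ (closure S \ S)ᶜ from fun hi => hi.2 (hyS i)))
      filter_upwards [Ioc_mem_nhdsGT hη] with δ hδ
      exact (Metric.closedBall_subset_closedBall hδ.2).trans hη'
    have h2 : ∀ i j, ∀ᶠ δ in 𝓝[>] (0 : ℝ), i ≠ j →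
        Disjoint (Metric.closedBall (y i) δ) (Metric.closedBall (y j) δ) := by
      intro i j
      by_cases hij : i = j
      · simp [hij]
      · have hpos : 0 < dist (y i) (y j) / 3 := by
          have := dist_pos.2 (y.injective.ne hij); positivity
        filter_upwards [Ioc_mem_nhdsGT hpos] with δ hδ _
        refine Metric.closedBall_disjoint_closedBall ?_
        have := hδ.2
        have := hδ.1
        linarith
    have h3 := (eventually_all.2 h1).and (eventually_all.2 fun i => eventually_all.2 (h2 i))
    obtain ⟨δ, ⟨h4, h5⟩, h6⟩ := (h3.and self_mem_nhdsWithin).exists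
    exact ⟨δ, h6, h4, h5⟩
  set f : ∀ i, ContDiffBump (y i) := fun i => ⟨δ / 2, δ, by positivity, by linarith⟩
  set φ : Fin n → EuclideanSpace ℝ (Fin d) → ℂ := fun i z => (f i z : ℂ) with hφdef
  have hts : ∀ i, tsupport (φ i) ⊆ Metric.closedBall (y i) δ := fun i => by
    rw [← (f i).tsupport_eq]
    exact closure_mono fun z hz hz' => hz (by simp only [hφdef, hz']; simp)
  have hφ : ∀ i, IsTestFunction (closure S \ S) (φ i) := fun i =>
    ⟨Complex.ofRealCLM.contDiff.comp (f i).contDiff,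
      (isCompact_closedBall (y i) δ).of_isClosed_subset (isClosed_tsupport _) (hts i),
      disjoint_left.2 fun z hz => hδS i (hts i hz)⟩
  have hdis : ∀ z i j, i ≠ j → z ∉ tsupport (φ i) ∨ z ∉ tsupport (φ j) := fun z i j hij => by
    by_contra! hc
    exact disjoint_left.1 (hδd i j hij) (hts i hc.1) (hts j hc.2)
  set A : Fin n → ℝ := fun i => ∫ x, ‖φ i x‖ ^ 2 ∂surfaceMeasure S
  set B : Fin n → ℝ := fun i => ∫ x, ‖gradientAlong (tangentSpace N x) (φ i) x‖ ^ 2 ∂surfaceMeasure S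
  have hA : ∀ i, 0 < A i := fun i => by
    refine (integral_pos_iff_support_of_nonneg (fun x => by positivity)
      (h.integrable_testFunction (hφ i)).1).2 ?_
    refine h.surfaceMeasure_pos (hyS i) ?_
    filter_upwards [Metric.closedBall_mem_nhds (y i) (show 0 < δ / 2 by positivity)] with z hz
    have h1 : f i z = 1 := (f i).one_of_mem_closedBall hz
    simp [hφdef, h1]
  have hB : ∀ i, 0 ≤ B i := fun i => integral_nonneg fun x => by positivity
  have e1 : ∀ c : Fin n → ℂ, ∫ x, ‖(∑ i, c i • φ i) x‖ ^ 2 ∂surfaceMeasure S =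
      ∑ i, ‖c i‖ ^ 2 * A i := fun c => by
    have : ∀ x, ‖(∑ i, c i • φ i) x‖ ^ 2 = ∑ i, ‖c i‖ ^ 2 * ‖φ i x‖ ^ 2 := fun x => by
      rw [← norm_sum_smul_sq (v := fun i => φ i x) (fun i j hij => ?_) c]
      · simp
      · exact (hdis x i j hij).imp image_eq_zero_of_notMem_tsupport image_eq_zero_of_notMem_tsupport
    simp only [this]
    rw [integral_finsetSum _ fun i _ => (h.integrable_testFunction (hφ i)).1.const_mul _]
    simp only [integral_const_mul, A]
  have e2 : ∀ c : Fin n → ℂ,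
      ∫ x, ‖gradientAlong (tangentSpace N x) (∑ i, c i • φ i) x‖ ^ 2 ∂surfaceMeasure S =
      ∑ i, ‖c i‖ ^ 2 * B i := fun c => by
    have : ∀ x, ‖gradientAlong (tangentSpace N x) (∑ i, c i • φ i) x‖ ^ 2 =
        ∑ i, ‖c i‖ ^ 2 * ‖gradientAlong (tangentSpace N x) (φ i) x‖ ^ 2 := fun x => by
      rw [gradientAlong_sum_smul fun i => (hφ i).contDiff]
      exact norm_sum_smul_sq (fun i j hij => (hdis x i j hij).imp gradientAlong_eq_zero
        gradientAlong_eq_zero) c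
    simp only [this]
    rw [integral_finsetSum _ fun i _ => (h.integrable_testFunction (hφ i)).2.1.const_mul _]
    simp only [integral_const_mul, B]
  -- Disjoint supports decouple numerator and denominator, so the sum of the individual quotients
  -- bounds the quotient of every combination.
  refine ⟨∑ i, B i / A i, φ, hφ, fun c hc => ?_⟩
  rw [e1, e2]
  obtain ⟨i, hi⟩ := Function.ne_iff.1 hc
  refine ⟨Finset.sum_pos' (fun j _ => mul_nonneg (by positivity) (hA j).le)
    ⟨i, Finset.mem_univ i, mul_pos (by have := norm_pos_iff.2 hi; positivity) (hA i)⟩, ?_⟩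
  rw [Finset.mul_sum]
  refine Finset.sum_le_sum fun j _ => ?_
  have h1 : B j / A j ≤ ∑ i, B i / A i :=
    Finset.single_le_sum (f := fun i => B i / A i) (fun i _ => div_nonneg (hB i) (hA i).le)
      (Finset.mem_univ j)
  calc ‖c j‖ ^ 2 * B j = B j / A j * (‖c j‖ ^ 2 * A j) := by field_simp [(hA j).ne']
    _ ≤ _ := by
      have := hA j
      gcongr

end Tube

/-! ### Energy of a test function along normal lines -/

namespace Transverse

/-- Bessel's inequality for the single function `chi`. -/
lemma integral_chi_mul_sq_le {G : ℝ → ℝ} (hG : Continuous G) :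
    (∫ t in (0 : ℝ)..1, chi t * G t) ^ 2 ≤ ∫ t in (0 : ℝ)..1, G t ^ 2 := by
  set c := ∫ t in (0 : ℝ)..1, chi t * G t with hc
  have hχ := continuous_chi
  have h0 : 0 ≤ ∫ t in (0 : ℝ)..1, (G t - c * chi t) ^ 2 :=
    intervalIntegral.integral_nonneg zero_le_one fun t _ => sq_nonneg _
  have e : ∀ t, (G t - c * chi t) ^ 2 = G t ^ 2 - 2 * c * (chi t * G t) + c ^ 2 * chi t ^ 2 :=
    fun t => by ring
  simp only [e] at h0
  rw [intervalIntegral.integral_add, intervalIntegral.integral_sub,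
    intervalIntegral.integral_const_mul, intervalIntegral.integral_const_mul, integral_chi_sq,
    ← hc] at h0
  · nlinarith
  all_goals exact Continuous.intervalIntegrable (by fun_prop) _ _

end Transverse

namespace Tube

open Filter Topology Transverse

variable {d : ℕ} {S : Set (EuclideanSpace ℝ (Fin d))}
  {N : EuclideanSpace ℝ (Fin d) → EuclideanSpace ℝ (Fin d)} {x : EuclideanSpace ℝ (Fin d)}
  {K r : ℝ}

/-- The Jacobian along a normal line of a hypersurface with bounded curvatures. -/
lemma exists_tubeJacobian_bounds (d : ℕ) {K : ℝ} (hK : 0 ≤ K) : ∃ a, 0 ≤ a ∧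
    ∀ {S : Set (EuclideanSpace ℝ (Fin d))}
      {N : EuclideanSpace ℝ (Fin d) → EuclideanSpace ℝ (Fin d)} {r : ℝ}, IsTube S N K r →
      ∀ x ∈ S, |totalCurvature S N x| ≤ a ∧ ∀ ε, 0 < ε → ε ≤ r →
      ∃ ρ' : ℝ → ℝ, (∀ t, HasDerivAt (fun t => tubeJacobian S N x (ε * t)) (ρ' t) t) ∧
        Continuous ρ' ∧ (∀ t ∈ Icc (0 : ℝ) 1, |tubeJacobian S N x (ε * t) - 1| ≤ a * ε) ∧
        ∀ t ∈ Icc (0 : ℝ) 1, |ρ' t + ε * totalCurvature S N x| ≤ a * ε ^ 2 := by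
  obtain ⟨a, ha, H⟩ := exists_jacobian_bounds d hK
  refine ⟨a, ha, fun h x hx => ?_⟩
  obtain ⟨k, hk, hκ, hJ, -⟩ := h.exists_eigenvalues hx
  simp only [hκ, hJ]
  refine ⟨(H k hk).1, fun ε hε hεr => (H k hk).2 ε hε ?_⟩
  have := mul_le_mul_of_nonneg_right hεr hK
  linarith [h.mul_le]

/-- `φ` is the average, with weight `chi`, of `u` over the normal lines. -/
def IsAverage (S : Set (EuclideanSpace ℝ (Fin d)))
    (N : EuclideanSpace ℝ (Fin d) → EuclideanSpace ℝ (Fin d)) (ε : ℝ)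
    (u φ : EuclideanSpace ℝ (Fin d) → ℂ) : Prop :=
  ∀ x ∈ S, φ x = ∫ t in (0 : ℝ)..1, (chi t : ℂ) * u (normalMap N (x, ε * t)) ∧
    ∀ v, ⟪N x, v⟫_ℝ = 0 → fderiv ℝ φ x v = ∫ t in (0 : ℝ)..1,
      (chi t : ℂ) * fderiv ℝ u (normalMap N (x, ε * t)) (v - (ε * t) • shapeOperator S N x v)

lemma continuous_normalLine (ε : ℝ) : Continuous fun t : ℝ => normalMap N (x, ε * t) := by
  change Continuous fun t : ℝ => x + (ε * t) • N x
  fun_prop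

/-- Linearity of the average, so that the same coefficients describe a combination on the tube and
its average on Σ. -/
lemma IsAverage.sum_smul {n : ℕ} {ε : ℝ} {u φ : Fin n → EuclideanSpace ℝ (Fin d) → ℂ}
    (h : ∀ i, IsAverage S N ε (u i) (φ i)) (hu : ∀ i, ContDiff ℝ 1 (u i))
    (hφ : ∀ i, ContDiff ℝ 1 (φ i)) (c : Fin n → ℂ) :
    IsAverage S N ε (∑ i, c i • u i) (∑ i, c i • φ i) := by
  have hfd : ∀ {w : Fin n → EuclideanSpace ℝ (Fin d) → ℂ}, (∀ i, ContDiff ℝ 1 (w i)) → ∀ y v,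
      fderiv ℝ (∑ i, c i • w i) y v = ∑ i, c i * fderiv ℝ (w i) y v := by
    intro w hw y v
    have h1 : fderiv ℝ (∑ i, c i • w i) y = ∑ i, fderiv ℝ (c i • w i) y :=
      fderiv_sum fun i _ => ((hw i).const_smul (c i)).differentiable (by norm_num) y
    rw [h1, FunLike.coe_sum, Finset.sum_apply]
    refine Finset.sum_congr rfl fun i _ => ?_
    rw [fderiv_const_smul ((hw i).differentiable (by norm_num) y) (c i)]
    rfl
  have hχ := continuous_chi
  intro x hx
  have hl := continuous_normalLine (N := N) (x := x) ε
  have hc : ∀ i, Continuous fun t : ℝ => u i (normalMap N (x, ε * t)) := fun i =>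
    (hu i).continuous.comp hl
  have hcd : ∀ i, Continuous fun t : ℝ => fderiv ℝ (u i) (normalMap N (x, ε * t)) := fun i =>
    ((hu i).continuous_fderiv (by norm_num)).comp hl
  constructor
  · simp only [Finset.sum_apply, Pi.smul_apply, smul_eq_mul, (h _ x hx).1, Finset.mul_sum]
    rw [intervalIntegral.integral_finsetSum]
    · refine Finset.sum_congr rfl fun i _ => ?_
      rw [← intervalIntegral.integral_const_mul]
      congr 1; ext t; ring
    · intro i _
      have := hc i
      exact Continuous.intervalIntegrable (by fun_prop) _ _
  · intro v hv
    simp only [hfd hu, hfd hφ, (h _ x hx).2 v hv, Finset.mul_sum]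
    rw [intervalIntegral.integral_finsetSum]
    · refine Finset.sum_congr rfl fun i _ => ?_
      rw [← intervalIntegral.integral_const_mul]
      congr 1; ext t; ring
    · intro i _
      have := hcd i
      exact Continuous.intervalIntegrable (by fun_prop) _ _

lemma continuous_covectorAlong (T : Submodule ℝ (EuclideanSpace ℝ (Fin d))) :
    Continuous (covectorAlong T) :=
  (PiLp.continuous_toLp 2 _).comp (continuous_pi fun _ => continuous_id.clm_apply continuous_const)

/-- The tangential gradient of the average. -/
lemma IsTube.norm_gradientAlong_average_sq_le (h : IsTube S N K r) {ε : ℝ} (hε : 0 < ε)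
    (hεr : ε ≤ r) {u φ : EuclideanSpace ℝ (Fin d) → ℂ} (hu : ContDiff ℝ 1 u)
    (hav : IsAverage S N ε u φ) (hx : x ∈ S) :
    ‖gradientAlong (tangentSpace N x) φ x‖ ^ 2 ≤ (1 + ε * K) ^ 2 * ∫ t in (0 : ℝ)..1,
      ‖gradientAlong (tangentSpace N x) u (normalMap N (x, ε * t))‖ ^ 2 := by
  set T := tangentSpace N x
  have hχ := continuous_chi
  have hl := continuous_normalLine (N := N) (x := x) ε
  have hcd : Continuous fun t : ℝ => fderiv ℝ u (normalMap N (x, ε * t)) :=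
    (hu.continuous_fderiv (by norm_num)).comp hl
  -- L t is the covector at height ε t pulled back to the base point. The tangential gradient of φ
  -- is its χ-average; Bessel's inequality removes the weight, and the pullback costs a factor 1 + ε
  -- K.
  set L : ℝ → EuclideanSpace ℝ (Fin d) →L[ℝ] ℂ := fun t => fderiv ℝ u (normalMap N (x, ε * t)) ∘L
    (ContinuousLinearMap.id ℝ _ - (ε * t) • shapeOperator S N x) with hL
  have hLc : Continuous L := hcd.clm_comp (by fun_prop)
  have hcov : Continuous fun t => covectorAlong T (L t) := (continuous_covectorAlong T).comp hLc
  have hcov' : Continuous fun t : ℝ => gradientAlong T u (normalMap N (x, ε * t)) := by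
    simp only [gradientAlong_eq]
    exact (continuous_covectorAlong T).comp hcd
  have hint : gradientAlong T φ x = ∫ t in (0 : ℝ)..1, chi t • covectorAlong T (L t) := by
    ext j
    have hi : IntervalIntegrable (fun t => chi t • covectorAlong T (L t)) volume 0 1 :=
      (hχ.smul hcov).intervalIntegrable _ _
    have := (EuclideanSpace.proj (𝕜 := ℂ) j).intervalIntegral_comp_comm hi
    simp only [PiLp.proj_apply, PiLp.smul_apply] at this
    rw [← this]
    have h2 := ((hav x hx).2 (T.starProjection (EuclideanSpace.single j 1))
      (inner_starProjection_tangentSpace _))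
    simp only [gradientAlong]
    rw [h2]
    refine intervalIntegral.integral_congr fun t _ => ?_
    simp [covectorAlong, hL]
  have h1 : ‖gradientAlong T φ x‖ ≤ ∫ t in (0 : ℝ)..1, chi t * ‖covectorAlong T (L t)‖ := by
    rw [hint]
    refine (intervalIntegral.norm_integral_le_integral_norm zero_le_one).trans_eq ?_
    refine intervalIntegral.integral_congr fun t ht => ?_
    rw [uIcc_of_le zero_le_one] at ht
    simp only [norm_smul, Real.norm_eq_abs, abs_of_nonneg (chi_nonneg ht)]
  calc ‖gradientAlong T φ x‖ ^ 2 ≤ (∫ t in (0 : ℝ)..1, chi t * ‖covectorAlong T (L t)‖) ^ 2 := by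
        gcongr
    _ ≤ ∫ t in (0 : ℝ)..1, ‖covectorAlong T (L t)‖ ^ 2 := integral_chi_mul_sq_le hcov.norm
    _ ≤ ∫ t in (0 : ℝ)..1, (1 + ε * K) ^ 2 * ‖gradientAlong T u (normalMap N (x, ε * t))‖ ^ 2 := by
        refine intervalIntegral.integral_mono_on zero_le_one
          ((hcov.norm.pow 2).intervalIntegrable _ _)
          ((continuous_const.mul (hcov'.norm.pow 2)).intervalIntegrable _ _) fun t ht => ?_
        have hεt : |ε * t| ≤ ε := by
          rw [abs_of_nonneg (mul_nonneg hε.le ht.1)]; nlinarith [ht.2]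
        have := (h.norm_covectorAlong_comp hx (hεt.trans hεr)
          (l := fderiv ℝ u (normalMap N (x, ε * t))) (l' := L t) fun v _ => rfl).2
        rw [← mul_pow]
        gcongr
        refine this.trans ?_
        rw [gradientAlong_eq]
        have := h.nonneg
        gcongr
    _ = _ := intervalIntegral.integral_const_mul _ _

/-- The energy of a test function along a normal line is bounded from below by the effective energy
of its average. -/
theorem exists_pointwise_lower_bound (d : ℕ) {K b : ℝ} (hK : 0 ≤ K) (hb : 0 ≤ b) :
    ∃ C, 0 ≤ C ∧ ∃ ε₀ > 0, ∀ {S : Set (EuclideanSpace ℝ (Fin d))}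
      {N : EuclideanSpace ℝ (Fin d) → EuclideanSpace ℝ (Fin d)} {r : ℝ}, IsTube S N K r →
      ∀ ε, 0 < ε → ε ≤ r → ε ≤ ε₀ → ∀ m, |m| ≤ b / ε → ∀ u φ : EuclideanSpace ℝ (Fin d) → ℂ,
      IsTestFunction (frontier (tube S N ε) \ parallelSurface S N ε) u → IsAverage S N ε u φ →
      ∀ x ∈ S, (1 - C * ε) * ‖gradientAlong (tangentSpace N x) φ x‖ ^ 2 +
        (totalCurvature S N x / ε - m - C) * ‖φ x‖ ^ 2 ≤
        ∫ t in (0 : ℝ)..1, (‖gradientAlong ⊤ u (normalMap N (x, ε * t))‖ ^ 2 -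
          ((Real.pi / (2 * ε)) ^ 2 + m) * ‖u (normalMap N (x, ε * t))‖ ^ 2) *
            tubeJacobian S N x (ε * t) := by
  obtain ⟨a, ha, H⟩ := exists_tubeJacobian_bounds d hK
  obtain ⟨C, hC, ε₀, hε₀, H1⟩ := exists_energy_lower_bound a b ha hb
  -- a + 2 K is what makes (1 - (a + 2K) ε) (1 + ε K)² ≤ 1 - a ε; the smallness of ε keeps 1 - a ε
  -- nonnegative.
  refine ⟨max C (a + 2 * K), le_max_of_le_left hC, min ε₀ (1 / (a + 1)), by positivity,
    fun {S N r} h ε hε hεr hεε m hm u φ hu hav x hx => ?_⟩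
  obtain ⟨hκ, H⟩ := H h x hx
  obtain ⟨ρ', hρ, hρ'c, hρ1, hρ2⟩ := H ε hε hεr
  have haε : a * ε ≤ 1 := by
    have h1 := hεε.trans (min_le_right _ _)
    rw [le_div_iff₀ (by positivity)] at h1
    nlinarith
  have hρc : Continuous fun t => tubeJacobian S N x (ε * t) :=
    continuous_iff_continuousAt.2 fun t => (hρ t).continuousAt
  have hρpos : ∀ t ∈ Icc (0 : ℝ) 1, 1 - a * ε ≤ tubeJacobian S N x (ε * t) := fun t ht => by
    linarith [(abs_le.1 (hρ1 t ht)).1]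
  have hl := continuous_normalLine (N := N) (x := x) ε
  have hN1 := h.norm_eq_one hx
  set w : ℝ → ℂ := fun t => u (normalMap N (x, ε * t))
  set w' : ℝ → ℂ := fun t => ε * fderiv ℝ u (normalMap N (x, ε * t)) (N x)
  have hcd : Continuous fun t : ℝ => fderiv ℝ u (normalMap N (x, ε * t)) :=
    (hu.contDiff.continuous_fderiv (by norm_num)).comp hl
  have hw : ∀ t, HasDerivAt w (w' t) t := fun t => by
    have h1 : HasDerivAt (fun t => normalMap N (x, ε * t)) (ε • N x) t := by
      have := (((hasDerivAt_id t).const_mul ε).smul_const (N x)).const_add x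
      simpa [normalMap] using this
    have h2 := (hu.contDiff.differentiable (by norm_num)
      (normalMap N (x, ε * t))).hasFDerivAt.comp_hasDerivAt t h1
    refine h2.congr_deriv ?_
    simp [w']
  have hwc : Continuous w := hu.contDiff.continuous.comp hl
  have hw'c : Continuous w' := by fun_prop
  -- vanishing near the bottom
  obtain ⟨δ, hδ, hwδ⟩ : ∃ δ > 0, ∀ t, |t| < δ → w t = 0 := by
    have h1 : x ∉ tsupport u := fun hxu => by
      have := h.mem_dirichlet hε hεr (p := (x, 0)) ⟨subset_closure hx, le_rfl, hε.le⟩ (Or.inr rfl)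
      rw [normalMap, zero_smul, add_zero] at this
      exact disjoint_left.1 hu.disjoint hxu this
    have h2 : ∀ᶠ t in 𝓝 (0 : ℝ), w t = 0 := by
      have h3 : ∀ᶠ z in 𝓝 (normalMap N (x, ε * 0)), u z = 0 := by
        rw [mul_zero, normalMap, zero_smul, add_zero]
        exact notMem_tsupport_iff_eventuallyEq.1 h1
      exact hl.continuousAt.eventually h3
    obtain ⟨δ, hδ, h3⟩ := Metric.eventually_nhds_iff.1 h2
    exact ⟨δ, hδ, fun t ht => h3 (by simpa using ht)⟩
  -- The one-dimensional estimate asks for vanishing on all t < δ, but u is known to vanish only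
  -- near t = 0. Cutting at t = 0 changes nothing on [0, 1].
  set ψ : ℝ → ℂ := fun t => if t < 0 then 0 else w t with hψdef
  have hψw : ∀ t, 0 ≤ t → ψ t = w t := fun t ht => if_neg (not_lt.2 ht)
  have hψ : ∀ t ∈ Icc (0 : ℝ) 1, HasDerivAt ψ (w' t) t := fun t ht => by
    refine (hw t).congr_of_eventuallyEq ?_
    filter_upwards [lt_mem_nhds (show t - δ < t by linarith)] with s hs
    by_cases hs0 : s < 0
    · simp only [hψdef, if_pos hs0]
      exact (hwδ s (by rw [abs_of_neg hs0]; linarith [ht.1])).symm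
    · exact hψw s (not_lt.1 hs0)
  have hψδ : ∀ t < δ, ψ t = 0 := fun t ht => by
    by_cases ht0 : t < 0
    · simp only [hψdef, if_pos ht0]
    · rw [hψw t (not_lt.1 ht0)]
      exact hwδ t (by rwa [abs_of_nonneg (not_lt.1 ht0)])
  have hE := H1 ε (totalCurvature S N x) m (fun t => tubeJacobian S N x (ε * t)) ρ' ψ w' hε
    (hεε.trans (min_le_left _ _)) hκ hm (fun t _ => hρ t) hρ'c.continuousOn hρ1 hρ2 hψ
    hw'c.continuousOn ⟨δ, hδ, hψδ⟩
  have e1 : ∫ t in (0 : ℝ)..1, (chi t : ℂ) * ψ t = φ x := by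
    rw [(hav x hx).1]
    refine intervalIntegral.integral_congr fun t ht => ?_
    rw [uIcc_of_le zero_le_one] at ht
    simp only [hψw t ht.1, w]
  have e2 : ∫ t in (0 : ℝ)..1, (ε⁻¹ ^ 2 * (‖w' t‖ ^ 2 - (Real.pi / 2) ^ 2 * ‖ψ t‖ ^ 2) -
      m * ‖ψ t‖ ^ 2) * tubeJacobian S N x (ε * t) =
      ∫ t in (0 : ℝ)..1, (‖fderiv ℝ u (normalMap N (x, ε * t)) (N x)‖ ^ 2 -
        ((Real.pi / (2 * ε)) ^ 2 + m) * ‖w t‖ ^ 2) * tubeJacobian S N x (ε * t) := by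
    refine intervalIntegral.integral_congr fun t ht => ?_
    rw [uIcc_of_le zero_le_one] at ht
    have : ‖w' t‖ = ε * ‖fderiv ℝ u (normalMap N (x, ε * t)) (N x)‖ := by
      simp [w', abs_of_pos hε]
    simp only [hψw t ht.1, this]
    field_simp
    ring
  rw [e1, e2] at hE
  -- the tangential part
  have hgc : Continuous fun t : ℝ =>
      gradientAlong (tangentSpace N x) u (normalMap N (x, ε * t)) := by
    simp only [gradientAlong_eq]
    exact (continuous_covectorAlong _).comp hcd
  set I := ∫ t in (0 : ℝ)..1, ‖gradientAlong (tangentSpace N x) u (normalMap N (x, ε * t))‖ ^ 2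
  have hgrad : (1 - (a + 2 * K) * ε) * ‖gradientAlong (tangentSpace N x) φ x‖ ^ 2 ≤
      ∫ t in (0 : ℝ)..1, ‖gradientAlong (tangentSpace N x) u (normalMap N (x, ε * t))‖ ^ 2 *
        tubeJacobian S N x (ε * t) := by
    have h1 := h.norm_gradientAlong_average_sq_le hε hεr hu.contDiff hav hx
    have hI : 0 ≤ I := intervalIntegral.integral_nonneg zero_le_one fun t _ => by positivity
    have h2 : (1 - a * ε) * I ≤ ∫ t in (0 : ℝ)..1,
        ‖gradientAlong (tangentSpace N x) u (normalMap N (x, ε * t))‖ ^ 2 *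
        tubeJacobian S N x (ε * t) := by
      rw [← intervalIntegral.integral_const_mul]
      refine intervalIntegral.integral_mono_on zero_le_one
        ((continuous_const.mul (hgc.norm.pow 2)).intervalIntegrable _ _)
        (((hgc.norm.pow 2).mul hρc).intervalIntegrable _ _) fun t ht => ?_
      rw [mul_comm]
      gcongr
      exact hρpos t ht
    refine le_trans ?_ h2
    rcases le_or_gt (1 - (a + 2 * K) * ε) 0 with hneg | hpos
    · exact (mul_nonpos_of_nonpos_of_nonneg hneg (sq_nonneg _)).trans
        (mul_nonneg (by linarith) hI)
    · have hy : 0 ≤ ε * K := by positivity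
      have h3 : (1 - (a + 2 * K) * ε) * (1 + ε * K) ^ 2 ≤ 1 - a * ε := by
        have h4 : 1 - (a + 2 * K) * ε ≤ (1 - a * ε) * (1 - 2 * (ε * K)) := by
          nlinarith [mul_nonneg ha (mul_nonneg hε.le hy)]
        have h5 : (1 - 2 * (ε * K)) * (1 + ε * K) ^ 2 ≤ 1 := by
          nlinarith [mul_nonneg hy (sq_nonneg (ε * K)), sq_nonneg (ε * K)]
        calc _ ≤ (1 - a * ε) * (1 - 2 * (ε * K)) * (1 + ε * K) ^ 2 := by gcongr
          _ = (1 - a * ε) * ((1 - 2 * (ε * K)) * (1 + ε * K) ^ 2) := by ring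
          _ ≤ (1 - a * ε) * 1 := by gcongr
          _ = _ := mul_one _
      calc _ ≤ (1 - (a + 2 * K) * ε) * ((1 + ε * K) ^ 2 * I) := by gcongr
        _ = ((1 - (a + 2 * K) * ε) * (1 + ε * K) ^ 2) * I := by ring
        _ ≤ _ := by gcongr
  have esum : ∫ t in (0 : ℝ)..1, (‖gradientAlong ⊤ u (normalMap N (x, ε * t))‖ ^ 2 -
        ((Real.pi / (2 * ε)) ^ 2 + m) * ‖u (normalMap N (x, ε * t))‖ ^ 2) *
          tubeJacobian S N x (ε * t) =
      (∫ t in (0 : ℝ)..1, ‖gradientAlong (tangentSpace N x) u (normalMap N (x, ε * t))‖ ^ 2 *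
        tubeJacobian S N x (ε * t)) + ∫ t in (0 : ℝ)..1,
        (‖fderiv ℝ u (normalMap N (x, ε * t)) (N x)‖ ^ 2 -
        ((Real.pi / (2 * ε)) ^ 2 + m) * ‖w t‖ ^ 2) * tubeJacobian S N x (ε * t) := by
    rw [← intervalIntegral.integral_add]
    · refine intervalIntegral.integral_congr fun t _ => ?_
      simp only [gradientAlong_eq, norm_covectorAlong_top_sq hN1, w]
      ring
    · exact ((hgc.norm.pow 2).mul hρc).intervalIntegrable _ _
    · exact Continuous.intervalIntegrable (by fun_prop) _ _
  rw [esum]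
  refine (add_le_add ?_ ?_).trans (add_le_add hgrad hE)
  · gcongr; exact le_max_right _ _
  · gcongr; exact le_max_left _ _

end Tube

namespace Tube

open Filter Topology Transverse

variable {d : ℕ} {S : Set (EuclideanSpace ℝ (Fin d))}
  {N : EuclideanSpace ℝ (Fin d) → EuclideanSpace ℝ (Fin d)} {x : EuclideanSpace ℝ (Fin d)}
  {K r : ℝ}

/-! ### Lower bound of the energy -/

/-- The energy of a test function on the tube is bounded from below by the effective energy of its
average. -/
theorem exists_energy_lower_bound (d : ℕ) {K b : ℝ} (hK : 0 ≤ K) (hb : 0 ≤ b) :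
    ∃ C, 0 ≤ C ∧ ∃ ε₀ > 0, ∀ {S : Set (EuclideanSpace ℝ (Fin d))}
      {N : EuclideanSpace ℝ (Fin d) → EuclideanSpace ℝ (Fin d)} {r : ℝ}, IsTube S N K r →
      ∀ ε, 0 < ε → ε ≤ r → ε ≤ ε₀ → ∀ m, |m| ≤ b / ε → ∀ u φ : EuclideanSpace ℝ (Fin d) → ℂ,
      IsTestFunction (frontier (tube S N ε) \ parallelSurface S N ε) u →
      IsTestFunction (closure S \ S) φ → IsAverage S N ε u φ →
      (1 - C * ε) * ∫ x, ‖gradientAlong (tangentSpace N x) φ x‖ ^ 2 ∂surfaceMeasure S +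
        ∫ x, totalCurvature S N x / ε * ‖φ x‖ ^ 2 ∂surfaceMeasure S -
        (m + C) * ∫ x, ‖φ x‖ ^ 2 ∂surfaceMeasure S ≤
      ε⁻¹ * ((∫ z in tube S N ε, ‖gradientAlong ⊤ u z‖ ^ 2) -
        ((Real.pi / (2 * ε)) ^ 2 + m) * ∫ z in tube S N ε, ‖u z‖ ^ 2) := by
  obtain ⟨C, hC, ε₀, hε₀, H⟩ := exists_pointwise_lower_bound d hK hb
  refine ⟨C, hC, ε₀, hε₀, fun {S N r} h ε hε hεr hεε m hm u φ hu hφ hav => ?_⟩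
  set e := (Real.pi / (2 * ε)) ^ 2 + m
  obtain ⟨hg1, hg2⟩ := hu.continuous_gradientAlong ⊤
  have hu1 := hu.contDiff.continuous
  have hu2 := hu.hasCompactSupport
  have hgi : Integrable (fun z => ‖gradientAlong ⊤ u z‖ ^ 2) (volume.restrict (tube S N ε)) :=
    (hu.memLp ⊤ _).2.integrable_norm_pow (by norm_num)
  have hui : Integrable (fun z => ‖u z‖ ^ 2) (volume.restrict (tube S N ε)) :=
    (hu.memLp ⊤ _).1.integrable_norm_pow (by norm_num)
  have hFc : HasCompactSupport fun z => ‖gradientAlong ⊤ u z‖ ^ 2 - e * ‖u z‖ ^ 2 := by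
    refine HasCompactSupport.intro hu2 fun z hz => ?_
    rw [IsTube.gradientAlong_eq_zero hz, image_eq_zero_of_notMem_tsupport hz]
    simp
  obtain ⟨hi, heq⟩ := h.integral_tube hε hεr
    (F := fun z => ‖gradientAlong ⊤ u z‖ ^ 2 - e * ‖u z‖ ^ 2) (by fun_prop) hFc
  rw [← integral_const_mul e, ← integral_sub hgi (hui.const_mul e), heq,
    inv_mul_cancel_left₀ hε.ne']
  obtain ⟨h1, h2, h3⟩ := h.integrable_testFunction hφ
  have h3' : Integrable (fun x => totalCurvature S N x / ε * ‖φ x‖ ^ 2) (surfaceMeasure S) :=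
    (h3.div_const ε).congr (Eventually.of_forall fun x => by simp only; ring)
  have hs : Integrable (fun x => (1 - C * ε) * ‖gradientAlong (tangentSpace N x) φ x‖ ^ 2 +
      totalCurvature S N x / ε * ‖φ x‖ ^ 2) (surfaceMeasure S) := (h2.const_mul _).add h3'
  rw [← integral_const_mul, ← integral_const_mul, ← integral_add (h2.const_mul _) h3',
    ← integral_sub hs (h1.const_mul _)]
  refine integral_mono_ae (hs.sub (h1.const_mul _)) hi ?_
  filter_upwards [h.ae_mem] with x hx
  refine le_trans (le_of_eq ?_) (H h ε hε hεr hεε m hm u φ hu hav x hx)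
  ring

/-! ### Upper bound of the energy of a trial function -/

lemma tubeTrial_sum_smul {n : ℕ} {ε : ℝ} {g : ℝ → ℝ} (φ : Fin n → EuclideanSpace ℝ (Fin d) → ℂ)
    (c : Fin n → ℂ) :
    tubeTrial S N r ε g (∑ i, c i • φ i) = ∑ i, c i • tubeTrial S N r ε g (φ i) := by
  ext z
  simp only [tubeTrial, Finset.sum_apply, Pi.smul_apply]
  split_ifs
  · rw [Finset.smul_sum]
    exact Finset.sum_congr rfl fun i _ => smul_comm _ _ _
  · simp

/-- The normal derivative is g'(t) φ / ε. The tangential part, composed with 1 - ε t A for the shape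
operator A, equals g dφ, so undoing this map costs at most (1 - ε K)⁻¹. -/
lemma IsTube.norm_gradientAlong_tubeTrial_sq_le (h : IsTube S N K r) {ε : ℝ} (hε : 0 < ε)
    (hεr : ε < r) {g : ℝ → ℝ} (hg : ContDiff ℝ 1 g) {φ : EuclideanSpace ℝ (Fin d) → ℂ}
    (hφ : ContDiff ℝ 1 φ) (hx : x ∈ S) {t : ℝ} (ht : t ∈ Ioc 0 1) :
    ‖gradientAlong ⊤ (tubeTrial S N r ε g φ) (normalMap N (x, ε * t))‖ ^ 2 ≤
      (1 - ε * K)⁻¹ ^ 2 * (g t ^ 2 * ‖gradientAlong (tangentSpace N x) φ x‖ ^ 2) +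
        ε⁻¹ ^ 2 * deriv g t ^ 2 * ‖φ x‖ ^ 2 := by
  have hεt : ε * t ∈ Ioo 0 r := ⟨mul_pos hε ht.1, by nlinarith [ht.2]⟩
  have hdiv : ε * t / ε = t := mul_div_cancel_left₀ t hε.ne'
  set l := fderiv ℝ (tubeTrial S N r ε g φ) (normalMap N (x, ε * t))
  have hlN : l (N x) = (deriv g t * ε⁻¹) • φ x := by
    have := h.fderiv_tubeTrial (ε := ε) hg hφ hx hεt (v := 0) (by simp) 1
    simpa [hdiv] using this
  have hεK : ε * K ≤ 1 / 2 := (mul_le_mul_of_nonneg_right hεr.le h.nonneg).trans h.mul_le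
  have hl := (h.norm_covectorAlong_comp hx (s := ε * t)
    (by rw [abs_of_pos hεt.1]; exact hεt.2.le) (l := l) (l' := g t • fderiv ℝ φ x)
    fun v hv => by
      have := h.fderiv_tubeTrial (ε := ε) hg hφ hx hεt hv 0
      simp only [hdiv, zero_smul, add_zero, zero_div, mul_zero] at this
      exact this.symm).1
  have hcov : ‖covectorAlong (tangentSpace N x) (g t • fderiv ℝ φ x)‖ =
      |g t| * ‖gradientAlong (tangentSpace N x) φ x‖ := by
    have : covectorAlong (tangentSpace N x) (g t • fderiv ℝ φ x) =
        (g t : ℂ) • gradientAlong (tangentSpace N x) φ x := by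
      ext i
      simp [covectorAlong, gradientAlong]
    rw [this, norm_smul, Complex.norm_real, Real.norm_eq_abs]
  rw [hcov, abs_of_pos hεt.1] at hl
  have hl2 : ‖covectorAlong (tangentSpace N x) l‖ ≤
      (1 - ε * K)⁻¹ * (|g t| * ‖gradientAlong (tangentSpace N x) φ x‖) := by
    rw [le_inv_mul_iff₀ (by linarith)]
    refine le_trans ?_ hl
    have : ε * t * K ≤ ε * K := by
      have := mul_nonneg hε.le h.nonneg
      nlinarith [ht.2]
    gcongr
  rw [gradientAlong_eq, norm_covectorAlong_top_sq (h.norm_eq_one hx), hlN]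
  refine add_le_add ?_ (le_of_eq ?_)
  · calc _ ≤ ((1 - ε * K)⁻¹ * (|g t| * ‖gradientAlong (tangentSpace N x) φ x‖)) ^ 2 := by gcongr
      _ = _ := by rw [mul_pow, mul_pow, sq_abs]
  · rw [norm_smul, mul_pow, Real.norm_eq_abs, sq_abs]
    ring

/-- The energy of the trial function over a test function on the hypersurface. -/
theorem exists_energy_upper_bound (d : ℕ) {K : ℝ} (hK : 0 ≤ K) :
    ∃ C, 0 ≤ C ∧ ∃ ε₀ > 0, ∀ ε, 0 < ε → ε ≤ ε₀ → ∃ g : ℝ → ℝ, ContDiff ℝ 1 g ∧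
      (∃ δ > 0, ∀ t < δ, g t = 0) ∧ (∀ t, 2 ≤ t → g t = 0) ∧
      ∀ {S : Set (EuclideanSpace ℝ (Fin d))}
      {N : EuclideanSpace ℝ (Fin d) → EuclideanSpace ℝ (Fin d)} {r : ℝ}, IsTube S N K r →
      2 * ε < r → ∀ φ : EuclideanSpace ℝ (Fin d) → ℂ, IsTestFunction (closure S \ S) φ →
      ε⁻¹ * ((∫ z in tube S N ε, ‖gradientAlong ⊤ (tubeTrial S N r ε g φ) z‖ ^ 2) -
        (Real.pi / (2 * ε)) ^ 2 * ∫ z in tube S N ε, ‖tubeTrial S N r ε g φ z‖ ^ 2) ≤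
      (1 + C * ε) * ∫ x, ‖gradientAlong (tangentSpace N x) φ x‖ ^ 2 ∂surfaceMeasure S +
        ∫ x, totalCurvature S N x / ε * ‖φ x‖ ^ 2 ∂surfaceMeasure S +
        C * ∫ x, ‖φ x‖ ^ 2 ∂surfaceMeasure S ∧
      (1 - C * ε) * ∫ x, ‖φ x‖ ^ 2 ∂surfaceMeasure S ≤
        ε⁻¹ * ∫ z in tube S N ε, ‖tubeTrial S N r ε g φ z‖ ^ 2 ∧
      ε⁻¹ * ∫ z in tube S N ε, ‖tubeTrial S N r ε g φ z‖ ^ 2 ≤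
        (1 + C * ε) * ∫ x, ‖φ x‖ ^ 2 ∂surfaceMeasure S := by
  obtain ⟨a, ha, H⟩ := exists_tubeJacobian_bounds d hK
  obtain ⟨C, hC, H1⟩ := exists_trial_profile a ha
  -- (1 - ε K)⁻² ≤ 1 + 6 ε K for ε K ≤ 1/2, and the cross term of (1 + 6 ε K) (1 + C ε) is then at
  -- most 3 C ε.
  refine ⟨4 * C + 6 * K, by positivity, min 1 (min (1 / (2 * (a + 1))) (1 / (2 * (K + 1)))),
    by positivity, fun ε hε hεε => ?_⟩
  have hε1 : ε ≤ 1 := hεε.trans (min_le_left _ _)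
  have hεa : a * ε ≤ 1 / 2 := by
    have h1 := hεε.trans ((min_le_right _ _).trans (min_le_left _ _))
    rw [le_div_iff₀ (by positivity)] at h1
    nlinarith
  have hεK : ε * K ≤ 1 / 2 := by
    have h1 := hεε.trans ((min_le_right _ _).trans (min_le_right _ _))
    rw [le_div_iff₀ (by positivity)] at h1
    nlinarith
  obtain ⟨g, hg, hg0, hg2, H1⟩ := H1 ε hε hε1 hεa
  refine ⟨g, hg, hg0, hg2, fun {S N r} h hεr φ hφ => ?_⟩
  obtain ⟨δ, hδ, hg0⟩ := hg0
  set w := tubeTrial S N r ε g φ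
  have hw : IsTestFunction (frontier (tube S N ε) \ parallelSurface S N ε) w := by
    obtain ⟨h1, h2, h3⟩ := h.tubeTrial_isTest hε hεr hg hδ hg0 hg2 hφ.contDiff
      hφ.hasCompactSupport hφ.disjoint
    exact ⟨h1, h2, h3⟩
  have hεr' : ε ≤ r := by linarith
  set e := (Real.pi / (2 * ε)) ^ 2 with he
  obtain ⟨hgr1, hgr2⟩ := hw.continuous_gradientAlong ⊤
  have hw1 := hw.contDiff.continuous
  have hw2 := hw.hasCompactSupport
  have hgi : Integrable (fun z => ‖gradientAlong ⊤ w z‖ ^ 2) (volume.restrict (tube S N ε)) :=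
    (hw.memLp ⊤ _).2.integrable_norm_pow (by norm_num)
  have hwi : Integrable (fun z => ‖w z‖ ^ 2) (volume.restrict (tube S N ε)) :=
    (hw.memLp ⊤ _).1.integrable_norm_pow (by norm_num)
  obtain ⟨h1, h2, h3⟩ := h.integrable_testFunction hφ
  have h3' : Integrable (fun x => totalCurvature S N x / ε * ‖φ x‖ ^ 2) (surfaceMeasure S) :=
    (h3.div_const ε).congr (Eventually.of_forall fun x => by simp only; ring)
  have hgc := hg.continuous
  have hg'c : Continuous (deriv g) := hg.continuous_deriv (by norm_num)
  have hwt : ∀ x ∈ S, ∀ t ∈ Ioc (0 : ℝ) 1, w (normalMap N (x, ε * t)) = g t • φ x :=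
    fun x hx t ht => by
      have := h.tubeTrial_apply (ε := ε) g φ (p := (x, ε * t))
        ⟨hx, mul_pos hε ht.1, by nlinarith [ht.2]⟩
      simpa [mul_div_cancel_left₀ t hε.ne'] using this
  have hmass : ∀ x ∈ S, ∫ t in (0 : ℝ)..1, ‖w (normalMap N (x, ε * t))‖ ^ 2 *
      tubeJacobian S N x (ε * t) =
      (∫ t in (0 : ℝ)..1, g t ^ 2 * tubeJacobian S N x (ε * t)) * ‖φ x‖ ^ 2 := fun x hx => by
    rw [← intervalIntegral.integral_mul_const]
    rw [intervalIntegral.integral_of_le zero_le_one, intervalIntegral.integral_of_le zero_le_one]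
    refine setIntegral_congr_fun measurableSet_Ioc fun t ht => ?_
    simp only [hwt x hx t ht, norm_smul, mul_pow, Real.norm_eq_abs, sq_abs]
    ring
  have hprof : ∀ x ∈ S, (Continuous fun t => tubeJacobian S N x (ε * t)) ∧
      ∫ t in (0 : ℝ)..1, ε⁻¹ ^ 2 * (deriv g t ^ 2 - (Real.pi / 2) ^ 2 * g t ^ 2) *
        tubeJacobian S N x (ε * t) ≤ totalCurvature S N x / ε + C ∧
      1 - C * ε ≤ ∫ t in (0 : ℝ)..1, g t ^ 2 * tubeJacobian S N x (ε * t) ∧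
      ∫ t in (0 : ℝ)..1, g t ^ 2 * tubeJacobian S N x (ε * t) ≤ 1 + C * ε := fun x hx => by
    obtain ⟨hκ, H⟩ := H h x hx
    obtain ⟨ρ', hρ, hρ'c, hρ1, hρ2⟩ := H ε hε hεr'
    have hc : Continuous fun t => tubeJacobian S N x (ε * t) :=
      continuous_iff_continuousAt.2 fun t => (hρ t).continuousAt
    exact ⟨hc, H1 (totalCurvature S N x) (fun t => tubeJacobian S N x (ε * t)) ρ' hκ
      (fun t _ => hρ t) hρ'c.continuousOn hρ1 hρ2⟩
  obtain ⟨hi, heq⟩ := h.integral_tube hε hεr' (F := fun z => ‖w z‖ ^ 2) (by fun_prop)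
    (HasCompactSupport.intro hw2 fun z hz => by
      rw [image_eq_zero_of_notMem_tsupport hz]; simp)
  refine ⟨?_, ?_, ?_⟩
  · obtain ⟨hi, heq⟩ := h.integral_tube hε hεr'
      (F := fun z => ‖gradientAlong ⊤ w z‖ ^ 2 - e * ‖w z‖ ^ 2) (by fun_prop)
      (HasCompactSupport.intro hw2 fun z hz => by
        rw [IsTube.gradientAlong_eq_zero hz, image_eq_zero_of_notMem_tsupport hz]
        simp)
    have hs : Integrable (fun x => (1 + (4 * C + 6 * K) * ε) *
        ‖gradientAlong (tangentSpace N x) φ x‖ ^ 2 + totalCurvature S N x / ε * ‖φ x‖ ^ 2)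
        (surfaceMeasure S) := (h2.const_mul _).add h3'
    rw [← integral_const_mul e, ← integral_sub hgi (hwi.const_mul e), heq,
      inv_mul_cancel_left₀ hε.ne', ← integral_const_mul, ← integral_const_mul,
      ← integral_add (h2.const_mul _) h3', ← integral_add hs (h1.const_mul _)]
    refine integral_mono_ae hi (hs.add (h1.const_mul _)) ?_
    filter_upwards [h.ae_mem] with x hx
    obtain ⟨hρc, hp1, hp2, hp3⟩ := hprof x hx
    have hl := continuous_normalLine (N := N) (x := x) ε
    set G := ‖gradientAlong (tangentSpace N x) φ x‖ ^ 2
    set M := ∫ t in (0 : ℝ)..1, g t ^ 2 * tubeJacobian S N x (ε * t)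
    set P := ∫ t in (0 : ℝ)..1, ε⁻¹ ^ 2 * (deriv g t ^ 2 - (Real.pi / 2) ^ 2 * g t ^ 2) *
      tubeJacobian S N x (ε * t)
    have hkey : ∫ t in (0 : ℝ)..1, (‖gradientAlong ⊤ w (normalMap N (x, ε * t))‖ ^ 2 -
        e * ‖w (normalMap N (x, ε * t))‖ ^ 2) * tubeJacobian S N x (ε * t) ≤
        (1 - ε * K)⁻¹ ^ 2 * M * G + P * ‖φ x‖ ^ 2 := by
      have : (1 - ε * K)⁻¹ ^ 2 * M * G + P * ‖φ x‖ ^ 2 = ∫ t in (0 : ℝ)..1,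
          ((1 - ε * K)⁻¹ ^ 2 * G * (g t ^ 2 * tubeJacobian S N x (ε * t)) +
          ‖φ x‖ ^ 2 * (ε⁻¹ ^ 2 * (deriv g t ^ 2 - (Real.pi / 2) ^ 2 * g t ^ 2) *
            tubeJacobian S N x (ε * t))) := by
        rw [intervalIntegral.integral_add, intervalIntegral.integral_const_mul,
          intervalIntegral.integral_const_mul]
        · ring
        all_goals exact Continuous.intervalIntegrable (by fun_prop) _ _
      rw [this]
      refine intervalIntegral.integral_mono_on_of_le_Ioo zero_le_one
        (Continuous.intervalIntegrable (by fun_prop) _ _)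
        (Continuous.intervalIntegrable (by fun_prop) _ _) fun t ht => ?_
      have hpos := h.tubeJacobian_pos hx (s := ε * t)
        (by rw [abs_of_pos (mul_pos hε ht.1)]; nlinarith [ht.2])
      have hb := h.norm_gradientAlong_tubeTrial_sq_le hε (by linarith) hg hφ.contDiff hx
        (t := t) ⟨ht.1, ht.2.le⟩
      rw [hwt x hx t ⟨ht.1, ht.2.le⟩, norm_smul, mul_pow, Real.norm_eq_abs, sq_abs]
      calc _ ≤ ((1 - ε * K)⁻¹ ^ 2 * (g t ^ 2 * G) + ε⁻¹ ^ 2 * deriv g t ^ 2 * ‖φ x‖ ^ 2 -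
            e * (g t ^ 2 * ‖φ x‖ ^ 2)) * tubeJacobian S N x (ε * t) := by gcongr
        _ = _ := by
          have : e = ε⁻¹ ^ 2 * (Real.pi / 2) ^ 2 := by rw [he]; field_simp
          rw [this]; ring
    refine hkey.trans ?_
    have hG : 0 ≤ G := by positivity
    have hcoef : (1 - ε * K)⁻¹ ^ 2 * M ≤ 1 + (4 * C + 6 * K) * ε := by
      have hy : 0 ≤ ε * K := by positivity
      have hinv : (1 - ε * K)⁻¹ ^ 2 ≤ 1 + 6 * (ε * K) := by
        rw [inv_pow, inv_le_iff_one_le_mul₀ (by nlinarith)]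
        nlinarith [mul_nonneg hy hy, mul_nonneg hy (mul_nonneg hy hy),
          mul_nonneg hy (sub_nonneg.2 hεK)]
      have hM0 : 0 ≤ 1 + C * ε := by positivity
      calc (1 - ε * K)⁻¹ ^ 2 * M ≤ (1 - ε * K)⁻¹ ^ 2 * (1 + C * ε) := by gcongr
        _ ≤ (1 + 6 * (ε * K)) * (1 + C * ε) := by gcongr
        _ = 1 + 6 * (ε * K) + C * ε + (ε * K) * (6 * (C * ε)) := by ring
        _ ≤ 1 + 6 * (ε * K) + C * ε + 1 / 2 * (6 * (C * ε)) := by gcongr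
        _ = _ := by ring
    have hP : P * ‖φ x‖ ^ 2 ≤ (totalCurvature S N x / ε + (4 * C + 6 * K)) * ‖φ x‖ ^ 2 := by
      gcongr
      refine hp1.trans ?_
      gcongr
      linarith
    have := mul_le_mul_of_nonneg_right hcoef hG
    linarith
  · rw [heq, inv_mul_cancel_left₀ hε.ne', ← integral_const_mul]
    refine integral_mono_ae (h1.const_mul _) hi ?_
    filter_upwards [h.ae_mem] with x hx
    simp only [hmass x hx]
    obtain ⟨-, -, hp2, -⟩ := hprof x hx
    gcongr
    refine le_trans ?_ hp2
    gcongr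
    linarith
  · rw [heq, inv_mul_cancel_left₀ hε.ne', ← integral_const_mul]
    refine integral_mono_ae hi (h1.const_mul _) ?_
    filter_upwards [h.ae_mem] with x hx
    simp only [hmass x hx]
    obtain ⟨-, -, -, hp3⟩ := hprof x hx
    gcongr
    refine hp3.trans ?_
    gcongr
    linarith

end Tube

namespace Tube

open Filter Topology Transverse

variable {d : ℕ} {S : Set (EuclideanSpace ℝ (Fin d))}
  {N : EuclideanSpace ℝ (Fin d) → EuclideanSpace ℝ (Fin d)} {x : EuclideanSpace ℝ (Fin d)}
  {K r a b : ℝ}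

/-! ### Comparison of the spectral numbers -/

lemma IsTube.abs_integral_curvature_le (h : IsTube S N K r)
    (ha : ∀ x ∈ S, |totalCurvature S N x| ≤ a) {ε : ℝ} (hε : 0 < ε)
    {φ : EuclideanSpace ℝ (Fin d) → ℂ} (hφ : IsTestFunction (closure S \ S) φ) :
    |∫ x, totalCurvature S N x / ε * ‖φ x‖ ^ 2 ∂surfaceMeasure S| ≤
      a / ε * ∫ x, ‖φ x‖ ^ 2 ∂surfaceMeasure S := by
  rw [← integral_const_mul, ← Real.norm_eq_abs]
  refine norm_integral_le_of_norm_le ((h.integrable_testFunction hφ).1.const_mul _) ?_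
  filter_upwards [h.ae_mem] with x hx
  rw [norm_mul, norm_div, Real.norm_eq_abs, Real.norm_eq_abs, abs_of_pos hε, norm_pow, norm_norm]
  gcongr
  exact ha x hx

lemma IsTube.ae_abs_le (h : IsTube S N K r)
    (ha : ∀ x ∈ S, |totalCurvature S N x| ≤ a) {ε : ℝ} (hε : 0 < ε) :
    ∀ᵐ x ∂surfaceMeasure S, |totalCurvature S N x / ε| ≤ a / ε := by
  filter_upwards [h.ae_mem] with x hx
  rw [abs_div, abs_of_pos hε]
  gcongr
  exact ha x hx

/-- A space of test functions on the tube with energy at most (π/(2ε))² + m is mapped to averages on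
Σ. The relative error C ε of the kinetic energy is harmless because the potential and m are O(1/ε),
so it changes the energy by O(1) only. -/
theorem exists_effective_le (d : ℕ) (hK : 0 ≤ K) (ha : 0 ≤ a) (hb : 0 ≤ b) :
    ∃ C, 0 ≤ C ∧ ∃ ε₀ > 0, ∀ {S : Set (EuclideanSpace ℝ (Fin d))}
      {N : EuclideanSpace ℝ (Fin d) → EuclideanSpace ℝ (Fin d)} {r : ℝ}, IsTube S N K r →
      (∀ x ∈ S, |totalCurvature S N x| ≤ a) →
      ∀ n : ℕ, 1 ≤ n → ∀ ε, 0 < ε → ε ≤ r → ε ≤ ε₀ → ∀ m : ℝ, |m| ≤ b / ε → |m + 1| ≤ b / ε →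
      OperatorGraph.spectralNumber (laplacianDN S N ε) n <
        (((Real.pi / (2 * ε)) ^ 2 + m : ℝ) : EReal) →
      OperatorGraph.spectralNumber (effectiveOperator S N ε) n ≤ ((m + C : ℝ) : EReal) := by
  obtain ⟨C, hC, ε₀, hε₀, H⟩ := exists_energy_lower_bound d hK hb
  refine ⟨2 * (1 + C + C * a + C * b), by positivity, min ε₀ (1 / (2 * (C + 1))), by positivity,
    fun {S N r} h haS n hn ε hε hεr hεε m hm hm1 hlt => ?_⟩
  have hCε : C * ε ≤ 1 / 2 := by
    have h1 := hεε.trans (min_le_right _ _)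
    rw [le_div_iff₀ (by positivity)] at h1
    nlinarith
  rw [laplacianDN, ← OperatorGraph.addPotential_zero (OperatorGraph.ofGradient _)] at hlt
  obtain ⟨u, hu, hE⟩ := exists_testFunctions_of_spectralNumber_lt
    (V := fun _ => 0) aestronglyMeasurable_const (b := 0) (by simp) hn hlt
  choose φ hφ1 hφ2 hφ3 hav using fun i => h.exists_average hε hεr (hu i).contDiff
    (hu i).hasCompactSupport (hu i).disjoint
  have hφ : ∀ i, IsTestFunction (closure S \ S) (φ i) := fun i => ⟨hφ1 i, hφ2 i, hφ3 i⟩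
  refine spectralNumber_le_of_testFunctions (h.aestronglyMeasurable_totalCurvature ε)
    (h.ae_abs_le haS hε) hn hφ (fun i => (h.memLp_testFunction (hφ i)).1)
    (fun i => (h.memLp_testFunction (hφ i)).2) fun c hc => ?_
  obtain ⟨hpos, hle⟩ := hE c hc
  have hφc := IsTestFunction.sum_smul hφ c
  -- The threshold m + 1 instead of m makes the right-hand side strictly negative, so the average of
  -- a nontrivial combination cannot vanish on Σ. Thus no dimension is lost.
  have hlow := H h ε hε hεr (hεε.trans (min_le_left _ _)) (m + 1) hm1 _ _
    (IsTestFunction.sum_smul hu c) hφc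
    (IsAverage.sum_smul (fun i => hav i) (fun i => (hu i).contDiff) hφ1 c)
  have hκ := abs_le.1 (h.abs_integral_curvature_le haS hε hφc)
  simp only [zero_mul, integral_zero, add_zero] at hle
  set U := ∫ z in tube S N ε, ‖(∑ i, c i • u i) z‖ ^ 2
  set Q := ∫ z in tube S N ε, ‖gradientAlong ⊤ (∑ i, c i • u i) z‖ ^ 2
  set P := ∫ x, ‖(∑ i, c i • φ i) x‖ ^ 2 ∂surfaceMeasure S
  set G := ∫ x, ‖gradientAlong (tangentSpace N x) (∑ i, c i • φ i) x‖ ^ 2 ∂surfaceMeasure S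
  set V := ∫ x, totalCurvature S N x / ε * ‖(∑ i, c i • φ i) x‖ ^ 2 ∂surfaceMeasure S
  have hP : 0 ≤ P := integral_nonneg fun x => by positivity
  have hG : 0 ≤ G := integral_nonneg fun x => by positivity
  have hneg : (1 - C * ε) * G + V - (m + 1 + C) * P < 0 := by
    refine hlow.trans_lt (mul_neg_of_pos_of_neg (by positivity) ?_)
    linarith
  have hP0 : 0 < P := by
    refine hP.lt_of_ne fun h0 => ?_
    rw [← h0] at hneg hκ
    have : 0 ≤ (1 - C * ε) * G := mul_nonneg (by linarith) hG
    linarith [hκ.1]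
  refine ⟨hP0, ?_⟩
  have hCV : C * ε * V ≤ C * ε * (a / ε * P) ∧ -(C * ε * (a / ε * P)) ≤ C * ε * V := by
    have : 0 ≤ C * ε := by positivity
    constructor
    · gcongr; exact hκ.2
    · rw [← mul_neg]; gcongr; exact hκ.1
  have e1 : C * ε * (a / ε * P) = C * a * P := by field_simp
  have hmb : C * ε * m ≤ C * b := by
    have h1 : m ≤ b / ε := (le_abs_self m).trans hm
    rw [le_div_iff₀ hε] at h1
    nlinarith
  rw [e1] at hCV
  by_contra! hgt
  have h1 : (1 - C * ε) * ((m + 2 * (1 + C + C * a + C * b)) * P) ≤ (1 - C * ε) * (G + V) :=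
    mul_le_mul_of_nonneg_left hgt.le (by linarith)
  have h2 : (1 - C * ε) * (G + V) < (m + 1 + C + C * a) * P := by linarith [hCV.2]
  -- Use C ε m ≤ C b for the first part and 1 - C ε ≥ 1/2 for the second, which explains the factor
  -- 2 in the constant.
  have h3 : (m + 1 + C + C * a) ≤ (1 - C * ε) * (m + 2 * (1 + C + C * a + C * b)) := by
    have : 0 ≤ 2 * (1 + C + C * a + C * b) := by positivity
    nlinarith
  nlinarith

/-- Trial functions on Σ are multiplied by the transverse profile. Two errors of relative size C ε
occur, in the kinetic energy and in the normalization. They multiply the kinetic energy and e, both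
O(1/ε), hence contribute O(1). The factor 2 in the constant passes from the norm on Σ to the norm on
the tube. -/
theorem exists_laplacianDN_le (d : ℕ) (hK : 0 ≤ K) (ha : 0 ≤ a) (hb : 0 ≤ b) :
    ∃ C, 0 ≤ C ∧ ∃ ε₀ > 0, ∀ {S : Set (EuclideanSpace ℝ (Fin d))}
      {N : EuclideanSpace ℝ (Fin d) → EuclideanSpace ℝ (Fin d)} {r : ℝ}, IsTube S N K r →
      (∀ x ∈ S, |totalCurvature S N x| ≤ a) →
      ∀ n : ℕ, 1 ≤ n → ∀ ε, 0 < ε → 2 * ε < r → ε ≤ ε₀ → ∀ e : ℝ, |e| ≤ b / ε →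
      OperatorGraph.spectralNumber (effectiveOperator S N ε) n < (e : EReal) →
      OperatorGraph.spectralNumber (laplacianDN S N ε) n ≤
        (((Real.pi / (2 * ε)) ^ 2 + e + C : ℝ) : EReal) := by
  obtain ⟨C, hC, ε₀, hε₀, H⟩ := exists_energy_upper_bound d hK
  refine ⟨2 * (C * (a + b) + C + b * C), by positivity, min ε₀ (1 / (2 * (C + 1))), by positivity,
    fun {S N r} h haS n hn ε hε hεr hεε e he hlt => ?_⟩
  have hCε : C * ε ≤ 1 / 2 := by
    have h1 := hεε.trans (min_le_right _ _)
    rw [le_div_iff₀ (by positivity)] at h1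
    nlinarith
  obtain ⟨g, hg, ⟨δ, hδ, hg0⟩, hg2, H⟩ := H ε hε (hεε.trans (min_le_left _ _))
  obtain ⟨φ, hφ, hE⟩ := exists_testFunctions_of_spectralNumber_lt
    (h.aestronglyMeasurable_totalCurvature ε) (h.ae_abs_le haS hε) hn hlt
  have hw : ∀ i, IsTestFunction (frontier (tube S N ε) \ parallelSurface S N ε)
      (tubeTrial S N r ε g (φ i)) := fun i => by
    obtain ⟨h1, h2, h3⟩ := h.tubeTrial_isTest hε hεr hg hδ hg0 hg2 (hφ i).contDiff
      (hφ i).hasCompactSupport (hφ i).disjoint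
    exact ⟨h1, h2, h3⟩
  rw [laplacianDN, ← OperatorGraph.addPotential_zero (OperatorGraph.ofGradient _)]
  refine spectralNumber_le_of_testFunctions (V := fun _ => 0) aestronglyMeasurable_const (b := 0)
    (by simp) hn hw (fun i => ((hw i).memLp ⊤ _).1) (fun i => ((hw i).memLp ⊤ _).2) fun c hc => ?_
  obtain ⟨hpos, hle⟩ := hE c hc
  have hφc := IsTestFunction.sum_smul hφ c
  obtain ⟨hu1, hu2, hu3⟩ := H h hεr _ hφc
  have hκ := abs_le.1 (h.abs_integral_curvature_le haS hε hφc)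
  simp only [zero_mul, integral_zero, add_zero]
  rw [← tubeTrial_sum_smul]
  set U := ∫ z in tube S N ε, ‖tubeTrial S N r ε g (∑ i, c i • φ i) z‖ ^ 2
  set Q := ∫ z in tube S N ε, ‖gradientAlong ⊤ (tubeTrial S N r ε g (∑ i, c i • φ i)) z‖ ^ 2
  set P := ∫ x, ‖(∑ i, c i • φ i) x‖ ^ 2 ∂surfaceMeasure S
  set G := ∫ x, ‖gradientAlong (tangentSpace N x) (∑ i, c i • φ i) x‖ ^ 2 ∂surfaceMeasure S
  set V := ∫ x, totalCurvature S N x / ε * ‖(∑ i, c i • φ i) x‖ ^ 2 ∂surfaceMeasure S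
  set R := ε⁻¹ * U with hR
  have hRP : 1 / 2 * P ≤ R := le_trans (by gcongr; linarith) hu2
  have hU : U = ε * R := by rw [hR, mul_inv_cancel_left₀ hε.ne']
  refine ⟨by rw [hU]; exact mul_pos hε (by linarith), ?_⟩
  have hb' := abs_le.1 he
  have hGb : C * ε * G ≤ C * (a + b) * P := by
    have h1 : G ≤ (b / ε + a / ε) * P := by
      have : e * P ≤ b / ε * P := by gcongr; exact hb'.2
      linarith [hκ.1]
    calc C * ε * G ≤ C * ε * ((b / ε + a / ε) * P) := by gcongr
      _ = C * (a + b) * P := by field_simp; ring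
  have heR : e * P - b * C * P ≤ e * R := by
    have h1 : |e * (R - P)| ≤ b / ε * (C * ε * P) := by
      rw [abs_mul]
      gcongr
      rw [abs_le]
      constructor <;> linarith
    have h2 : b / ε * (C * ε * P) = b * C * P := by field_simp
    rw [h2] at h1
    linarith [(abs_le.1 h1).1]
  have hD : 0 ≤ C * (a + b) + C + b * C := by positivity
  have h1 : ε⁻¹ * (Q - (Real.pi / (2 * ε)) ^ 2 * U) ≤ (e + 2 * (C * (a + b) + C + b * C)) * R := by
    have h2 := mul_le_mul_of_nonneg_left hRP hD
    linarith
  rw [inv_mul_le_iff₀ hε] at h1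
  have h3 : ε * ((e + 2 * (C * (a + b) + C + b * C)) * R) =
      (e + 2 * (C * (a + b) + C + b * C)) * U := by rw [hU]; ring
  linarith

/-- A priori bounds that place μ_n in the window of size O(1/ε) where the comparison theorems apply,
and that make it finite. M depends on Σ and n, but is dominated by 1/ε for small ε. -/
theorem IsTube.effective_bounds (h : IsTube S N K r) (hne : S.Nonempty)
    (haS : ∀ x ∈ S, |totalCurvature S N x| ≤ a) {n : ℕ} (hn : 1 ≤ n) :
    ∃ M : ℝ, ∀ ε, 0 < ε →
      OperatorGraph.spectralNumber (effectiveOperator S N ε) n ≤ ((M + a / ε : ℝ) : EReal) ∧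
      ((-(a / ε) - 1 : ℝ) : EReal) ≤ OperatorGraph.spectralNumber (effectiveOperator S N ε) n := by
  obtain ⟨M, φ, hφ, hM⟩ := h.exists_bumps hne n
  refine ⟨M, fun ε hε => ⟨?_, ?_⟩⟩
  · refine spectralNumber_le_of_testFunctions (h.aestronglyMeasurable_totalCurvature ε)
      (h.ae_abs_le haS hε) hn hφ (fun i => (h.memLp_testFunction (hφ i)).1)
      (fun i => (h.memLp_testFunction (hφ i)).2) fun c hc => ?_
    obtain ⟨hpos, hle⟩ := hM c hc
    refine ⟨hpos, ?_⟩
    have := (abs_le.1 (h.abs_integral_curvature_le haS hε (IsTestFunction.sum_smul hφ c))).2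
    linarith
  · by_contra! hlt
    obtain ⟨u, hu, hE⟩ := exists_testFunctions_of_spectralNumber_lt
      (h.aestronglyMeasurable_totalCurvature ε) (h.ae_abs_le haS hε) hn hlt
    obtain ⟨hpos, hle⟩ := hE (fun _ => 1) fun h0 => one_ne_zero (congrFun h0 ⟨0, hn⟩)
    have h1 := (abs_le.1 (h.abs_integral_curvature_le haS hε
      (IsTestFunction.sum_smul hu fun _ => 1))).1
    have h2 : 0 ≤ ∫ x, ‖gradientAlong (tangentSpace N x) (∑ i, (1 : ℂ) • u i) x‖ ^ 2
      ∂surfaceMeasure S := integral_nonneg fun x => by positivity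
    linarith

/-- Injectivity of the tube map for one ε₀ gives it for all smaller widths; the width is then
reduced until r K ≤ 1/2. -/
lemma exists_isTube (hd : 2 ≤ d) (hS : IsC2Hypersurface S) (hne : S.Nonempty)
    (hN : IsUnitNormalField S N)
    (hinj : ∃ ε₀ : ℝ, 0 < ε₀ ∧ InjOn (tubeMap N ε₀) (closure S ×ˢ Icc 0 1))
    (hK : ∀ x ∈ S, ∀ k ∈ principalCurvatures S N x, |k| ≤ K) : ∃ r, IsTube S N K r := by
  obtain ⟨ε₀, hε₀, hinj⟩ := hinj
  obtain ⟨x, hx⟩ := hne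
  have hK0 := curvature_bound_nonneg hS hN hd hx (hK x hx)
  refine ⟨min ε₀ (1 / (2 * (K + 1))), hd, hS, hN, hK0, hK, by positivity, ?_, ?_⟩
  · calc min ε₀ (1 / (2 * (K + 1))) * K ≤ 1 / (2 * (K + 1)) * (K + 1) := by
          gcongr
          · exact min_le_right _ _
          · linarith
      _ = 1 / 2 := by field_simp
  · have hmem : ∀ p ∈ closure S ×ˢ Icc (0 : ℝ) (min ε₀ (1 / (2 * (K + 1)))),
        (p.1, p.2 / ε₀) ∈ closure S ×ˢ Icc (0 : ℝ) 1 ∧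
        tubeMap N ε₀ (p.1, p.2 / ε₀) = normalMap N p := fun p hp => by
      refine ⟨⟨hp.1, div_nonneg hp.2.1 hε₀.le, ?_⟩, ?_⟩
      · exact div_le_one_of_le₀ (hp.2.2.trans (min_le_left _ _)) hε₀.le
      · simp only [tubeMap, normalMap, mul_div_cancel₀ p.2 hε₀.ne']
    intro p hp q hq hpq
    have h1 := hinj (hmem p hp).1 (hmem q hq).1 (by rw [(hmem p hp).2, (hmem q hq).2, hpq])
    rw [Prod.mk.injEq, div_left_inj' hε₀.ne'] at h1
    exact Prod.ext h1.1 h1.2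

end Tube

end

/-! ### The asymptotic expansion -/

theorem theorem1p1 (d : ℕ) (hd : 2 ≤ d) (K : ℝ) :
    ∃ C : ℝ, ∀ (S : Set (EuclideanSpace ℝ (Fin d)))
      (N : EuclideanSpace ℝ (Fin d) → EuclideanSpace ℝ (Fin d)),
      Tube.IsC2Hypersurface S → IsConnected S → Tube.IsUnitNormalField S N →
      (∃ ε₀ : ℝ, 0 < ε₀ ∧ Set.InjOn (Tube.tubeMap N ε₀) (closure S ×ˢ Set.Icc 0 1)) →
      (∀ x ∈ S, ∀ k ∈ Tube.principalCurvatures S N x, |k| ≤ K) →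
      ∀ n : ℕ, 1 ≤ n → ∃ ε₁ : ℝ, 0 < ε₁ ∧ ∀ ε ∈ Set.Ioo 0 ε₁, ∃ l m : ℝ,
        OperatorGraph.spectralNumber (Tube.laplacianDN S N ε) n = (l : EReal) ∧
        OperatorGraph.spectralNumber (Tube.effectiveOperator S N ε) n = (m : EReal) ∧
        |l - ((Real.pi / (2 * ε)) ^ 2 + m)| ≤ C := by
  rcases lt_or_ge K 0 with hK | hK
  · refine ⟨0, fun S N hS hSc hN hinj hKS => ?_⟩
    obtain ⟨x, hx⟩ := hSc.nonempty
    exact absurd (Tube.curvature_bound_nonneg hS hN hd hx (hKS x hx)) (not_le.2 hK)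
  obtain ⟨a, ha, Ha⟩ := Tube.exists_tubeJacobian_bounds d hK
  -- The window b = a + 2 leaves 2/ε of room beyond the bound a/ε of the potential, for M and for
  -- the shifts by constants.
  have hb : 0 ≤ a + 2 := by positivity
  obtain ⟨C₁, hC₁, ε₁, hε₁, H1⟩ := Tube.exists_effective_le d hK ha hb
  obtain ⟨C₂, hC₂, ε₂, hε₂, H2⟩ := Tube.exists_laplacianDN_le d hK ha hb
  refine ⟨C₁ + C₂ + 1, fun S N hS hSc hN hinj hKS n hn => ?_⟩
  obtain ⟨r, h⟩ := Tube.exists_isTube hd hS hSc.nonempty hN hinj hKS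
  have haS : ∀ x ∈ S, |Tube.totalCurvature S N x| ≤ a := fun x hx => (Ha h x hx).1
  obtain ⟨M, hM⟩ := h.effective_bounds hSc.nonempty haS hn
  have hr := h.pos
  -- r/2 because the trial functions reach height 2 ε; the last entry gives |M| + C₁ + 2 ≤ 1/ε,
  -- which keeps all energies used below in the window. Only this dependence on Σ and n remains.
  refine ⟨min (r / 2) (min (min ε₁ ε₂) (1 / (|M| + C₁ + 2))), by positivity, fun ε hε => ?_⟩
  obtain ⟨hε, hεlt⟩ := hε
  obtain ⟨hεr, hεlt⟩ := lt_min_iff.1 hεlt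
  obtain ⟨hε12, hεM⟩ := lt_min_iff.1 hεlt
  obtain ⟨hεε₁, hεε₂⟩ := lt_min_iff.1 hε12
  rw [lt_div_iff₀ (by positivity)] at hεM
  obtain ⟨hup, hlow⟩ := hM ε hε
  have hsmall : |M| + C₁ + 2 ≤ 1 / ε := by rw [le_div_iff₀ hε]; linarith
  have hdiv : ∀ c : ℝ, (a + c) / ε = a / ε + c * (1 / ε) := fun c => by ring
  have haε : 0 ≤ a / ε := by positivity
  obtain ⟨m, hm⟩ : ∃ m : ℝ, OperatorGraph.spectralNumber (Tube.effectiveOperator S N ε) n =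
      (m : EReal) := ⟨_, (EReal.coe_toReal (hup.trans_lt (EReal.coe_lt_top _)).ne
        ((EReal.bot_lt_coe _).trans_le hlow).ne').symm⟩
  rw [hm] at hup hlow
  have hup := EReal.coe_le_coe_iff.1 hup
  have hlow := EReal.coe_le_coe_iff.1 hlow
  have hMabs := le_abs_self M
  have hMpos := abs_nonneg M
  have hle := H2 h haS n hn ε hε (by linarith) hεε₂.le (m + 1)
    (by rw [abs_le, hdiv]; constructor <;> linarith)
    (by rw [hm]; exact EReal.coe_lt_coe_iff.2 (by linarith))
  -- If this failed, the comparison at m - C₁ - 1 would give μ_n ≤ m - 1, although μ_n = m.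
  have hge : (((Real.pi / (2 * ε)) ^ 2 + (m - C₁ - 1) : ℝ) : EReal) ≤
      OperatorGraph.spectralNumber (Tube.laplacianDN S N ε) n := by
    by_contra! hlt
    have := H1 h haS n hn ε hε (by linarith) hεε₁.le (m - C₁ - 1)
      (by rw [abs_le, hdiv]; constructor <;> linarith)
      (by rw [abs_le, hdiv]; constructor <;> linarith) hlt
    rw [hm] at this
    have := EReal.coe_le_coe_iff.1 this
    linarith
  obtain ⟨l, hl⟩ : ∃ l : ℝ, OperatorGraph.spectralNumber (Tube.laplacianDN S N ε) n =
      (l : EReal) := ⟨_, (EReal.coe_toReal (hle.trans_lt (EReal.coe_lt_top _)).ne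
        ((EReal.bot_lt_coe _).trans_le hge).ne').symm⟩
  rw [hl] at hle hge
  have hle := EReal.coe_le_coe_iff.1 hle
  have hge := EReal.coe_le_coe_iff.1 hge
  refine ⟨l, m, hl, hm, ?_⟩
  rw [abs_le]
  constructor <;> linarith
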